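/- **Theorem (OMv lower bound, partially dynamic).** Algorithms are programs of a random access machine with logarithmic cost (equivalently, up to polylogarithmic factors, a word RAM with words of logarithmic length) that may use random bits. *OMv conjecture.* In the online Boolean matrix-vector problem one is given $n \ge 1$ and a Boolean $n\times n$ matrix $M$, and then Boolean vectors $v_1,\dots,v_n$ of length $n$ one at a time; the Boolean product $Mv_t$ must be output before $v_{t+1}$ is seen. The conjecture states that for no constant $\varepsilon>0$ is there an algorithm that solves this problem in total time $O(n^{3-\varepsilon})$ (including the processing of $M$) such that, for every input, all outputs are correct with probability at least $2/3$. *Dynamic problem.* A simple digraph $G$ on $n$ vertices is given for preprocessing (together with the number $m$ defined below) and then undergoes a sequence of edge insertions (incremental case) or of edge deletions (decremental case), interleaved with queries of the form "are $u$ and $v$ strongly connected in $G\setminus e$?", where $u,v$ are vertices and $e$ is an edge of the current graph $G$. Each operation has to be processed before the next one is seen. Let $m$ be the number of edges of the graph after all insertions (incremental case) or of the initial graph (decremental case). Let $\delta\in(0,1/2]$ and let $0<c_1<c_2$ be constants, where $c_1<1$ if $\delta=1/2$. Assume the OMv conjecture. Then neither in the incremental nor in the decremental case are there a constant $\varepsilon>0$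 and an algorithm with the following property: on all instances with $$c_1\, n^{1/(1-\delta)}\le m\le c_2\, n^{1/(1-\delta)}$$ it uses preprocessing time polynomial in $n$, total update time $O((mn)^{1-\varepsilon})$ and time $O(m^{\delta-\varepsilon})$ for each query, and, for every sequence of operations fixed in advance, it answers each query correctly with probability at least $2/3$. (The constants in the $O$-bounds and the degree of the polynomial may depend on everything but the instance.) In particular, no deterministic algorithm has this property. -/

import Mathlib

/-! ### Random access machines with logarithmic cost

Programs are structured (while-) programs over registers and arrays of natural numbers.
Every instruction costs one plus the binary lengths of the addresses and values it handles, so up to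
polylogarithmic factors this is the word RAM with words of logarithmic length. Randomness is
an infinite string of fair random bits that is read by position. -/

namespace RAM

/-- The arithmetic operations; `minus` is truncated at zero, `quot` rounds down. -/
inductive BinOp where
  | plus | minus | times | quot

def BinOp.eval : BinOp → ℕ → ℕ → ℕ
  | .plus, a, b => a + b
  | .minus, a, b => a - b
  | .times, a, b => a * b
  | .quot, a, b => a / b

/-- Programs. Registers and arrays are named by natural numbers that are fixed in the program, so a
program uses finitely many of them; positions inside an array are computed at run time. -/
inductive Program where
  /-- do nothing -/
  | skip
  /-- `r x := c` -/
  | const (x c : ℕ)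
  /-- `r x := r y ∘ r z` -/
  | arith (o : BinOp) (x y z : ℕ)
  /-- `r x := A b [r y]` -/
  | load (b x y : ℕ)
  /-- `A b [r x] := r y` -/
  | store (b x y : ℕ)
  /-- `r x :=` the random bit at position `r y` -/
  | random (x y : ℕ)
  /-- first `p`, then `q` -/
  | seq (p q : Program)
  /-- if `r x ≠ 0` then `p` else `q` -/
  | cond (x : ℕ) (p q : Program)
  /-- while `r x ≠ 0` do `p` -/
  | loop (x : ℕ) (p : Program)

/-- The contents of the registers and of the arrays. -/
@[ext]
structure State where
  reg : ℕ → ℕ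
  arr : ℕ → ℕ → ℕ

/-- All registers and array entries are initially zero. -/
def State.blank : State := ⟨fun _ => 0, fun _ _ => 0⟩

def State.setReg (σ : State) (x v : ℕ) : State :=
  { σ with reg := Function.update σ.reg x v }

def State.setArr (σ : State) (b i v : ℕ) : State :=
  { σ with arr := Function.update σ.arr b (Function.update (σ.arr b) i v) }

/-- Array `0` is the input array: it is overwritten with the input of a call. -/
def State.withInput (σ : State) (inp : ℕ → ℕ) : State :=
  { σ with arr := Function.update σ.arr 0 inp }

/-- Array `1` is the output array. -/
def State.output (σ : State) : ℕ → ℕ := σ.arr 1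

/-- `Exec ω p σ t σ'`: with random bits `ω`, the program `p` started in `σ` halts in `σ'`, and
the computation costs `t`. (`Nat.size` is the binary length.) -/
inductive Exec (ω : ℕ → Bool) : Program → State → ℕ → State → Prop where
  | skip (σ : State) : Exec ω .skip σ 1 σ
  | const (σ : State) (x c : ℕ) :
      Exec ω (.const x c) σ (1 + c.size) (σ.setReg x c)
  | arith (σ : State) (o : BinOp) (x y z : ℕ) :
      Exec ω (.arith o x y z) σ (1 + (σ.reg y).size + (σ.reg z).size)
        (σ.setReg x (o.eval (σ.reg y) (σ.reg z)))
  | load (σ : State) (b x y : ℕ) :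
      Exec ω (.load b x y) σ (1 + (σ.reg y).size + (σ.arr b (σ.reg y)).size)
        (σ.setReg x (σ.arr b (σ.reg y)))
  | store (σ : State) (b x y : ℕ) :
      Exec ω (.store b x y) σ (1 + (σ.reg x).size + (σ.reg y).size)
        (σ.setArr b (σ.reg x) (σ.reg y))
  | random (σ : State) (x y : ℕ) :
      Exec ω (.random x y) σ (1 + (σ.reg y).size) (σ.setReg x (ω (σ.reg y)).toNat)
  | seq {p q : Program} {σ σ' σ'' : State} {s t : ℕ} :
      Exec ω p σ s σ' → Exec ω q σ' t σ'' → Exec ω (.seq p q) σ (s + t) σ''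
  | cond_pos {p q : Program} {σ σ' : State} {x t : ℕ} :
      σ.reg x ≠ 0 → Exec ω p σ t σ' →
        Exec ω (.cond x p q) σ (1 + (σ.reg x).size + t) σ'
  | cond_zero {p q : Program} {σ σ' : State} {x t : ℕ} :
      σ.reg x = 0 → Exec ω q σ t σ' → Exec ω (.cond x p q) σ (1 + t) σ'
  | loop_pos {p : Program} {σ σ' σ'' : State} {x s t : ℕ} :
      σ.reg x ≠ 0 → Exec ω p σ s σ' → Exec ω (.loop x p) σ' t σ'' →
        Exec ω (.loop x p) σ (1 + (σ.reg x).size + s + t) σ''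
  | loop_zero {p : Program} {σ : State} {x : ℕ} :
      σ.reg x = 0 → Exec ω (.loop x p) σ 1 σ

/-- What is observed of a call of a program: its cost and the output array at its end. -/
structure Result where
  time : ℕ
  out : ℕ → ℕ

/-- `Session ω σ calls res`: with random bits `ω` and starting in state `σ`, the listed programs are
called one after the other, each on its own input and on the registers and arrays that the
previous calls left behind; all calls halt, and `res` lists their results. The result of a call
is thus fixed before the input of the next call is seen. -/
inductive Session (ω : ℕ → Bool) : State → List (Program × (ℕ → ℕ)) → List Result → Prop where
  | nil (σ : State) : Session ω σ [] []
  | cons {σ σ' : State} {p : Program} {inp : ℕ → ℕ} {t : ℕ}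
      {calls : List (Program × (ℕ → ℕ))} {res : List Result} :
      Exec ω p (σ.withInput inp) t σ' → Session ω σ' calls res →
        Session ω σ ((p, inp) :: calls) (⟨t, σ'.output⟩ :: res)

/-- Independent fair bits. -/
noncomputable def coin : MeasureTheory.Measure (ℕ → Bool) :=
  MeasureTheory.Measure.infinitePi fun _ : ℕ => (PMF.uniformOfFintype Bool).toMeasure

/-- A finite list as the content of an array, continued by zeros. -/
def ofList (l : List ℕ) : ℕ → ℕ := fun k => l.getD k 0

/-- The entries of a Boolean `n × n` matrix as numbers `0` and `1`, row by row. -/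
def rows {n : ℕ} (M : Fin n → Fin n → Bool) : List ℕ :=
  (List.finRange n).flatMap fun i => (List.finRange n).map fun j => (M i j).toNat

end RAM

/-! ### Online Boolean matrix-vector multiplication -/

namespace OMv

open RAM

/-- The Boolean product of a matrix and a vector. -/
def boolMulVec {n : ℕ} (M : Fin n → Fin n → Bool) (v : Fin n → Bool) (i : Fin n) : Bool :=
  decide (∃ j, M i j = true ∧ v j = true)

/-- An online algorithm: one program for the matrix and one for each vector. -/
structure Algorithm where
  preprocess : Program
  multiply : Program

/-- The calls for the matrix `M` and the vectors `v 0, …, v (n-1)`, in this order. The first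
input is `n` followed by the entries of `M`. -/
def Algorithm.calls (A : Algorithm) {n : ℕ} (M : Fin n → Fin n → Bool)
    (v : Fin n → Fin n → Bool) : List (Program × (ℕ → ℕ)) :=
  (A.preprocess, ofList (n :: rows M)) ::
    (List.finRange n).map fun t =>
      (A.multiply, ofList ((List.finRange n).map fun j => (v t j).toNat))

/-- The result of the `t`-th multiplication (which is call number `t + 1`) is `M v_t`, for all
`t`. -/
def Correct {n : ℕ} (M : Fin n → Fin n → Bool) (v : Fin n → Fin n → Bool)
    (res : List Result) : Prop :=
  ∀ t : Fin n, ∃ r, res[t.val + 1]? = some r ∧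
    ∀ i : Fin n, r.out i = (boolMulVec M (v t) i).toNat

/-- The algorithm solves the problem in total time `T n`, preprocessing included, with error
probability at most `1/3`. -/
def Algorithm.SolvesIn (A : Algorithm) (T : ℕ → ℝ) : Prop :=
  ∀ n : ℕ, 1 ≤ n → ∀ M v : Fin n → Fin n → Bool,
    (∀ ω, ∃ res, Session ω State.blank (A.calls M v) res ∧
      ((res.map Result.time).sum : ℝ) ≤ T n) ∧
    2 / 3 ≤ coin {ω | ∃ res, Session ω State.blank (A.calls M v) res ∧ Correct M v res}

/-- The OMv conjecture: for no `ε > 0` can the problem be solved in time `O(n ^ (3 - ε))` with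
error probability at most `1/3`. -/
def Conjecture : Prop :=
  ∀ ε : ℝ, 0 < ε →
    ¬ ∃ (A : Algorithm) (C : ℝ), A.SolvesIn fun n => C * (n : ℝ) ^ (3 - ε)

end OMv

/-! ### Partially dynamic strong connectivity under the failure of one edge -/

namespace DynSC

open RAM

/-- The edge set of a digraph on the vertices `0, …, n-1`. -/
abbrev Edges (n : ℕ) := Finset (Fin n × Fin n)

/-- There is a directed path from `u` to `v`. -/
def Reaches {n : ℕ} (E : Edges n) (u v : Fin n) : Prop :=
  Relation.ReflTransGen (fun x y => (x, y) ∈ E) u v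

def StronglyConnected {n : ℕ} (E : Edges n) (u v : Fin n) : Prop :=
  Reaches E u v ∧ Reaches E v u

inductive Mode where
  | incremental | decremental

/-- `update a b` inserts or deletes the edge `(a, b)`; `query u v a b` asks whether `u` and `v` are
strongly connected after removal of the edge `(a, b)`. -/
inductive Operation (n : ℕ) where
  | update (a b : Fin n)
  | query (u v a b : Fin n)

/-- The edge set after an operation. -/
def apply {n : ℕ} : Mode → Edges n → Operation n → Edges n
  | .incremental, E, .update a b => insert (a, b) E
  | .decremental, E, .update a b => E.erase (a, b)
  | _, E, .query _ _ _ _ => E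

/-- The edge set after a sequence of operations. -/
def applyAll {n : ℕ} (mode : Mode) (E : Edges n) (ops : List (Operation n)) : Edges n :=
  ops.foldl (apply mode) E

/-- Only absent edges that are no loops are inserted, only present edges are deleted, and only
present edges are queried. -/
def Admissible {n : ℕ} : Mode → Edges n → Operation n → Prop
  | .incremental, E, .update a b => a ≠ b ∧ (a, b) ∉ E
  | .decremental, E, .update a b => (a, b) ∈ E
  | _, E, .query _ _ a b => (a, b) ∈ E

/-- An instance: a loopless initial digraph and a sequence of operations on it. -/
structure Instance (mode : Mode) (n : ℕ) where
  start : Edges n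
  loopless : ∀ a, (a, a) ∉ start
  ops : List (Operation n)
  admissible : ∀ i op, ops[i]? = some op → Admissible mode (applyAll mode start (ops.take i)) op

/-- The number of edges: after all insertions, or before all deletions. -/
def Instance.numEdges {n : ℕ} : {mode : Mode} → Instance mode n → ℕ
  | .incremental, I => (applyAll .incremental I.start I.ops).card
  | .decremental, I => I.start.card

/-- A data structure: one program for the initial digraph, one for each update, one for each
query. -/
structure DataStructure where
  preprocess : Program
  update : Program
  query : Program

def DataStructure.call (D : DataStructure) {n : ℕ} : Operation n → Program × (ℕ → ℕ)
  | .update a b => (D.update, ofList [a, b])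
  | .query u v a b => (D.query, ofList [u, v, a, b])

/-- The calls of an instance. The first input consists of `n`, the number `m` of edges, and the
adjacency matrix of the initial digraph. -/
def DataStructure.calls (D : DataStructure) {mode : Mode} {n : ℕ} (I : Instance mode n) :
    List (Program × (ℕ → ℕ)) :=
  (D.preprocess, ofList (n :: I.numEdges :: rows fun a b => decide ((a, b) ∈ I.start))) ::
    I.ops.map D.call

/-- The total cost of the updates, where `rs` lists the results of the operations `ops`. -/
def updateTime {n : ℕ} (ops : List (Operation n)) (rs : List Result) : ℕ :=
  (List.zipWith (fun (op : Operation n) (r : Result) => match op with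
    | .update _ _ => r.time
    | .query _ _ _ _ => 0) ops rs).sum

/-- The time bounds hold for all outcomes of the random bits: preprocessing costs at most `P`, all
updates together cost at most `U`, and each query costs at most `Q`. -/
def DataStructure.RunsWithin (D : DataStructure) {mode : Mode} {n : ℕ} (I : Instance mode n)
    (P U Q : ℝ) : Prop :=
  ∀ ω, ∃ r₀ rs, Session ω State.blank (D.calls I) (r₀ :: rs) ∧
    (r₀.time : ℝ) ≤ P ∧
    (updateTime I.ops rs : ℝ) ≤ U ∧
    ∀ (i : ℕ) (u v a b : Fin n) (r : Result), I.ops[i]? = some (.query u v a b) →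
      rs[i]? = some r → (r.time : ℝ) ≤ Q

/-- Each query is answered correctly (`1` for yes, `0` for no) with probability at least `2/3`. -/
def DataStructure.Correct (D : DataStructure) {mode : Mode} {n : ℕ} (I : Instance mode n) :
    Prop :=
  ∀ (i : ℕ) (u v a b : Fin n), I.ops[i]? = some (.query u v a b) →
    2 / 3 ≤ coin {ω | ∃ r₀ rs r, Session ω State.blank (D.calls I) (r₀ :: rs) ∧
      rs[i]? = some r ∧
      ((StronglyConnected ((applyAll mode I.start (I.ops.take i)).erase (a, b)) u v ∧
          r.out 0 = 1) ∨
        (¬ StronglyConnected ((applyAll mode I.start (I.ops.take i)).erase (a, b)) u v ∧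
          r.out 0 = 0))}

/-- On all instances with `c₁ n ^ (1 / (1 - δ)) ≤ m ≤ c₂ n ^ (1 / (1 - δ))`, the data structure is
correct and has polynomial preprocessing time, total update time `O((m n) ^ (1 - ε))` and query
time `O(m ^ (δ - ε))`. -/
def DataStructure.Achieves (D : DataStructure) (mode : Mode) (δ c₁ c₂ ε : ℝ) : Prop :=
  ∃ (C : ℝ) (k : ℕ), ∀ (n : ℕ) (I : Instance mode n),
    c₁ * (n : ℝ) ^ (1 / (1 - δ)) ≤ I.numEdges →
    (I.numEdges : ℝ) ≤ c₂ * (n : ℝ) ^ (1 / (1 - δ)) →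
    D.Correct I ∧
    D.RunsWithin I (C * ((n : ℝ) + 1) ^ k)
      (C * ((I.numEdges : ℝ) * n) ^ (1 - ε))
      (C * (I.numEdges : ℝ) ^ (δ - ε))

end DynSC

/-! Suppose that such a data structure exists. The matrix is cut into blocks with `a` rows and `b`
columns. The digraph of a block consists of a path 0 → … → a, a vertex for each column and each row,
an edge from column to row for every 1 of the block, and an edge from every row to 0. A vector is
encoded by edges from one path vertex k to the columns. If the path edge (k, k+1) fails and no
earlier path vertex has edges to columns, then everything that 0 reaches outside the path is reached
through k, so 0 and row i are strongly connected exactly if row i meets the vector (`reach_gadget`).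
With k = a-1, …, 0 and insertions, or k = 0, …, a-1 and deletions, one sequence of operations (a
run) serves `a` vectors. Every entry of a vector is updated in its phase, before or after the
queries according to its value; hence the number of edges does not depend on the vectors
(`Block.query_iff`, `Block.numEdges_toInstance`). For the next `a` vectors the data structure is put
back to its state after preprocessing.

All parameters are powers of g, which is about n^(1/K): a = g^s, there are nG = g^(s+1) vertices,
and b = g^r is nG^(δ/(1-δ)) up to a bounded power of g. With m of order nG^(1/(1-δ)), both m * nG
(updates) and a² * m^δ (queries) agree with a²b, the trivial cost of a run, up to bounded powers of
g. For s large the exponent ε gains g^50, so a run costs less than g^(2s+r-18)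
(`DataStructure.Achieves.exists_suitable`). This pays for all overheads below and leaves a total of
order n^3/g, that is n^(3-1/K).

Four difficulties remain. First, m must lie in a prescribed window, but δ, c₁, c₂ are arbitrary
reals and no program can compute the right amount of padding. So all γ < g^3 are tried as sizes of
the padding, in units of b, one of which is right (`exists_guess`). For a wrong guess the data
structure may err, be slow or not halt. It is therefore run by an interpreter with fuel, whose cost
is bounded whatever it interprets (`paid_simulate`) and which is faithful while fuel lasts
(`rep_simulate`). A positive majority answer is verified by scanning the b entries in question:
either a new entry of the product is found, or the guess is refuted for good, so there are few scans
(`Par.opens_verdict`). Thus outputs are sound unconditionally, and complete because of the right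
guess, which is never refuted if its majorities are correct (`Par.Verified.step`).

Second, going back to the state after preprocessing must be cheap: the virtual memory has layers, a
run writes to a fresh layer and reads the base layer where it has not written. Third, errors of the
data structure: each machine exists in g copies with independent random bits, the majority fails
with probability at most exp(-g/18) (`coin_majority`), and a union bound over polynomially many
queries follows (`Par.coin_reliable`). Fourth, the estimates need g large; for the finitely many
smaller n all possible entries are verified, without regard to the answers. -/

variable {ω : ℕ → Bool} {σ σ' : RAM.State} {Q : RAM.State → ℕ → Prop} {A : ℕ → ℕ} {p : RAM.Program}
  {D : DynSC.DataStructure} {vec : ℕ → ℕ → ℕ} {T κ id z z' k e q t s n x y i j : ℕ}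
namespace RAM

/-! ### Deterministic execution and frames -/

infixr:60 " ;; " => Program.seq

/-- The random bits are fixed, so at most one rule applies to a state. Because of this, cost, safety
and correctness of the same call can be proved separately and conjoined afterwards (`wp_and`,
`wp_and_all`). -/
theorem Exec.det {σ₁ : State} {t₁ : ℕ} (h : Exec ω p σ t₁ σ₁) :
    ∀ {t₂ : ℕ} {σ₂ : State}, Exec ω p σ t₂ σ₂ → t₁ = t₂ ∧ σ₁ = σ₂ := by
  induction h with
  | skip | const | arith | load | store | random => intro _ _ h; cases h; exact ⟨rfl, rfl⟩
  | seq _ _ ih₁ ih₂ =>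
    intro _ _ h
    cases h with
    | seq h₁ h₂ =>
      obtain ⟨rfl, rfl⟩ := ih₁ h₁; obtain ⟨rfl, rfl⟩ := ih₂ h₂; exact ⟨rfl, rfl⟩
  | cond_pos hx _ ih =>
    intro _ _ h
    cases h with
    | cond_pos _ h => obtain ⟨rfl, rfl⟩ := ih h; exact ⟨rfl, rfl⟩
    | cond_zero h0 _ => exact absurd h0 hx
  | cond_zero hx _ ih =>
    intro _ _ h
    cases h with
    | cond_pos h0 _ => exact absurd hx h0
    | cond_zero _ h => obtain ⟨rfl, rfl⟩ := ih h; exact ⟨rfl, rfl⟩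
  | loop_pos hx _ _ ih₁ ih₂ =>
    intro _ _ h
    cases h with
    | loop_pos _ h₁ h₂ =>
      obtain ⟨rfl, rfl⟩ := ih₁ h₁; obtain ⟨rfl, rfl⟩ := ih₂ h₂; exact ⟨rfl, rfl⟩
    | loop_zero h0 => exact absurd h0 hx
  | loop_zero hx =>
    intro _ _ h
    cases h with
    | loop_pos h0 _ _ => exact absurd hx h0
    | loop_zero _ => exact ⟨rfl, rfl⟩

@[simp] theorem State.reg_setReg (σ : State) (x v y : ℕ) :
    (σ.setReg x v).reg y = if y = x then v else σ.reg y := by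
  simp [State.setReg, Function.update_apply]

@[simp] theorem State.arr_setReg (σ : State) (x v : ℕ) : (σ.setReg x v).arr = σ.arr := rfl

@[simp] theorem State.reg_setArr (σ : State) (b i v : ℕ) : (σ.setArr b i v).reg = σ.reg := rfl

theorem State.arr_setArr (σ : State) (b i v c : ℕ) :
    (σ.setArr b i v).arr c = if c = b then Function.update (σ.arr b) i v else σ.arr c := by
  simp only [State.setArr, Function.update_apply]

theorem State.arr_setArr_apply (σ : State) (b i v c j : ℕ) :
    (σ.setArr b i v).arr c j = if c = b ∧ j = i then v else σ.arr c j := by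
  rw [State.arr_setArr]
  by_cases h : c = b
  · subst h; by_cases h' : j = i <;> simp [h']
  · simp [h]

/-- The registers a program may change. -/
def Program.writes : Program → Finset ℕ
  | .skip => ∅
  | .const x _ => {x}
  | .arith _ x _ _ => {x}
  | .load _ x _ => {x}
  | .store _ _ _ => ∅
  | .random x _ => {x}
  | .seq p q => p.writes ∪ q.writes
  | .cond _ p q => p.writes ∪ q.writes
  | .loop _ p => p.writes

/-- The arrays a program may change. -/
def Program.stores : Program → Finset ℕ
  | .skip => ∅
  | .const _ _ => ∅
  | .arith _ _ _ _ => ∅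
  | .load _ _ _ => ∅
  | .store b _ _ => {b}
  | .random _ _ => ∅
  | .seq p q => p.stores ∪ q.stores
  | .cond _ p q => p.stores ∪ q.stores
  | .loop _ p => p.stores

/-- `σ'` differs from `σ` at most where `p` may have written. -/
def Framed (p : Program) (σ σ' : State) : Prop :=
  (∀ x, x ∉ p.writes → σ'.reg x = σ.reg x) ∧ ∀ b, b ∉ p.stores → σ'.arr b = σ.arr b

theorem Exec.framed (h : Exec ω p σ t σ') : Framed p σ σ' := by
  induction h with
  | skip => exact ⟨fun _ _ => rfl, fun _ _ => rfl⟩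
  | const σ x c =>
    refine ⟨fun y hy => ?_, fun _ _ => rfl⟩; simp [Program.writes] at hy; simp [hy]
  | arith σ o x y z =>
    refine ⟨fun y hy => ?_, fun _ _ => rfl⟩; simp [Program.writes] at hy; simp [hy]
  | load σ b x y =>
    refine ⟨fun y hy => ?_, fun _ _ => rfl⟩; simp [Program.writes] at hy; simp [hy]
  | store σ b x y =>
    refine ⟨fun y _ => rfl, fun c hc => ?_⟩; simp [Program.stores] at hc; simp [State.arr_setArr, hc]
  | random σ x y =>
    refine ⟨fun y hy => ?_, fun _ _ => rfl⟩; simp [Program.writes] at hy; simp [hy]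
  | seq _ _ ih₁ ih₂ =>
    refine ⟨fun y hy => ?_, fun c hc => ?_⟩
    · simp [Program.writes] at hy; rw [ih₂.1 _ hy.2, ih₁.1 _ hy.1]
    · simp [Program.stores] at hc; rw [ih₂.2 _ hc.2, ih₁.2 _ hc.1]
  | cond_pos _ _ ih =>
    refine ⟨fun y hy => ?_, fun c hc => ?_⟩
    · simp [Program.writes] at hy; rw [ih.1 _ hy.1]
    · simp [Program.stores] at hc; rw [ih.2 _ hc.1]
  | cond_zero _ _ ih =>
    refine ⟨fun y hy => ?_, fun c hc => ?_⟩
    · simp [Program.writes] at hy; rw [ih.1 _ hy.2]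
    · simp [Program.stores] at hc; rw [ih.2 _ hc.2]
  | loop_pos _ _ _ ih₁ ih₂ =>
    refine ⟨fun y hy => ?_, fun c hc => ?_⟩
    · rw [ih₂.1 _ hy, ih₁.1 _ hy]
    · rw [ih₂.2 _ hc, ih₁.2 _ hc]
  | loop_zero => exact ⟨fun _ _ => rfl, fun _ _ => rfl⟩

/-! ### A weakest precondition with an upper bound on the elapsed time -/

/-- Total correctness. `T` is the time spent before; `Q` sees only some upper bound `T'` for the
time spent afterwards, so costs may be rounded up at any point. -/
def wp (ω : ℕ → Bool) (p : Program) (Q : State → ℕ → Prop) (σ : State) (T : ℕ) : Prop :=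
  ∃ σ' t T', Exec ω p σ t σ' ∧ T + t ≤ T' ∧ Q σ' T'

theorem wp_mono {R : State → ℕ → Prop}
    (h : wp ω p Q σ T) (hQR : ∀ σ' T', Framed p σ σ' → Q σ' T' → R σ' T') : wp ω p R σ T := by
  obtain ⟨σ', t, T', h, hT, hQ⟩ := h; exact ⟨σ', t, T', h, hT, hQR _ _ h.framed hQ⟩

theorem wp_time {T₂ : ℕ} (h : wp ω p Q σ T) (hT : T₂ ≤ T) : wp ω p Q σ T₂ := by
  obtain ⟨σ', t, T', h, hT, hQ⟩ := h; exact ⟨σ', t, T', h, by omega, hQ⟩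

theorem wp_slack (h : wp ω p (fun σ' T' => ∃ T₂, T' ≤ T₂ ∧ Q σ' T₂) σ T) : wp ω p Q σ T := by
  obtain ⟨σ', t, T', h, hT, T₂, hT₂, hQ⟩ := h; exact ⟨σ', t, T₂, h, by omega, hQ⟩

theorem wp_seq {q : Program} (h : wp ω p (fun σ' T' => wp ω q Q σ' T') σ T) : wp ω (p ;; q) Q σ T := by
  obtain ⟨σ₁, t₁, T₁, h₁, hT₁, σ₂, t₂, T₂, h₂, hT₂, hQ⟩ := h
  exact ⟨σ₂, t₁ + t₂, T₂, .seq h₁ h₂, by omega, hQ⟩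

/-- Needed for simulated loops: the simulation is `testReg ;; loop (body ;; testReg)`, so after one
body the regrouped rest is the simulation of the loop again. -/
theorem wp_seq_assoc' {q r : Program} (h : wp ω p (fun σ' T' => wp ω (q ;; r) Q σ' T') σ T) :
    wp ω (p ;; q) (fun σ' T' => wp ω r Q σ' T') σ T := by
  obtain ⟨σ₁, t₁, T₁, h₁, hT₁, σ₂, t₂, T₂, h₂, hT₂, hQ⟩ := h
  cases h₂ with
  | seq ha hb => exact ⟨_, _, _, .seq h₁ ha, le_rfl, _, _, T₂, hb, by omega, hQ⟩

theorem wp_skip (h : Q σ (T + 1)) : wp ω .skip Q σ T := ⟨_, _, _, .skip σ, le_rfl, h⟩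

theorem wp_const {c : ℕ} (h : Q (σ.setReg x c) (T + (1 + c.size))) : wp ω (.const x c) Q σ T :=
  ⟨_, _, _, .const σ x c, le_rfl, h⟩

theorem wp_arith {o : BinOp} (h : Q (σ.setReg x (o.eval (σ.reg y) (σ.reg z)))
      (T + (1 + (σ.reg y).size + (σ.reg z).size))) : wp ω (.arith o x y z) Q σ T :=
  ⟨_, _, _, .arith σ o x y z, le_rfl, h⟩

theorem wp_load {b : ℕ} (h : Q (σ.setReg x (σ.arr b (σ.reg y)))
      (T + (1 + (σ.reg y).size + (σ.arr b (σ.reg y)).size))) : wp ω (.load b x y) Q σ T :=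
  ⟨_, _, _, .load σ b x y, le_rfl, h⟩

theorem wp_store {b : ℕ} (h : Q (σ.setArr b (σ.reg x) (σ.reg y))
      (T + (1 + (σ.reg x).size + (σ.reg y).size))) : wp ω (.store b x y) Q σ T :=
  ⟨_, _, _, .store σ b x y, le_rfl, h⟩

theorem wp_random (h : Q (σ.setReg x (ω (σ.reg y)).toNat) (T + (1 + (σ.reg y).size))) :
    wp ω (.random x y) Q σ T :=
  ⟨_, _, _, .random σ x y, le_rfl, h⟩

theorem wp_cond {q : Program} (hp : σ.reg x ≠ 0 → wp ω p Q σ (T + (1 + (σ.reg x).size)))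
    (hq : σ.reg x = 0 → wp ω q Q σ (T + 1)) : wp ω (.cond x p q) Q σ T := by
  by_cases hx : σ.reg x = 0
  · obtain ⟨σ', t, T', h, hT, hQ⟩ := hq hx; exact ⟨σ', _, T', .cond_zero hx h, by omega, hQ⟩
  · obtain ⟨σ', t, T', h, hT, hQ⟩ := hp hx; exact ⟨σ', _, T', .cond_pos hx h, by omega, hQ⟩

theorem wp_loop_pos (hx : σ.reg x ≠ 0)
    (h : wp ω p (fun σ' T' => wp ω (.loop x p) Q σ' T') σ (T + (1 + (σ.reg x).size))) :
    wp ω (.loop x p) Q σ T := by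
  obtain ⟨σ₁, t₁, T₁, h₁, hT₁, σ₂, t₂, T₂, h₂, hT₂, hQ⟩ := h
  exact ⟨σ₂, _, T₂, .loop_pos hx h₁ h₂, by omega, hQ⟩

theorem wp_loop_zero (hx : σ.reg x = 0) (h : Q σ (T + 1)) : wp ω (.loop x p) Q σ T :=
  ⟨_, _, _, .loop_zero hx, le_rfl, h⟩

/-! ### Loop-free programs -/

/-- For programs without loops the final state is a function of the initial one, so effects are
computed by `simp` through `Program.eval` and the side conditions are left to `decide`. -/
def Program.Flat : Program → Prop
  | .seq p q => p.Flat ∧ q.Flat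
  | .cond _ p q => p.Flat ∧ q.Flat
  | .loop _ _ => False
  | _ => True

def Program.eval (ω : ℕ → Bool) : Program → State → State
  | .skip, σ => σ
  | .const x c, σ => σ.setReg x c
  | .arith o x y z, σ => σ.setReg x (o.eval (σ.reg y) (σ.reg z))
  | .load b x y, σ => σ.setReg x (σ.arr b (σ.reg y))
  | .store b x y, σ => σ.setArr b (σ.reg x) (σ.reg y)
  | .random x y, σ => σ.setReg x (ω (σ.reg y)).toNat
  | .seq p q, σ => q.eval ω (p.eval ω σ)
  | .cond x p q, σ => if σ.reg x = 0 then q.eval ω σ else p.eval ω σ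
  | .loop _ _, σ => σ

/-- The registers a loop-free program writes in any case. -/
def Program.must : Program → Finset ℕ
  | .const x _ => {x}
  | .arith _ x _ _ => {x}
  | .load _ x _ => {x}
  | .random x _ => {x}
  | .seq p q => p.must ∪ q.must
  | .cond _ p q => p.must ∩ q.must
  | _ => ∅

/-- The registers a loop-free program may read before it writes them. -/
def Program.need : Program → Finset ℕ
  | .arith _ _ y z => {y, z}
  | .load _ _ y => {y}
  | .store _ x y => {x, y}
  | .random _ y => {y}
  | .seq p q => p.need ∪ (q.need \ p.must)
  | .cond x p q => {x} ∪ (p.need ∪ q.need)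
  | _ => ∅

/-- The arrays a program may read. -/
def Program.loads : Program → Finset ℕ
  | .load b _ _ => {b}
  | .seq p q => p.loads ∪ q.loads
  | .cond _ p q => p.loads ∪ q.loads
  | .loop _ p => p.loads
  | _ => ∅

/-- A factor by which the sizes of values grow, and that bounds the time, in a loop-free program. -/
def Program.weight : Program → ℕ
  | .const _ c => 1 + c.size
  | .seq p q => p.weight + q.weight * p.weight
  | .cond _ p q => 2 + p.weight + q.weight
  | _ => 3

theorem Program.one_le_weight : ∀ p : Program, 1 ≤ p.weight
  | .seq p q => by have := p.one_le_weight; simp only [Program.weight]; omega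
  | .const _ _ => by simp [Program.weight]
  | .cond _ _ _ => by simp only [Program.weight]; omega
  | .skip => by simp [Program.weight]
  | .arith _ _ _ _ => by simp [Program.weight]
  | .load _ _ _ => by simp [Program.weight]
  | .store _ _ _ => by simp [Program.weight]
  | .random _ _ => by simp [Program.weight]
  | .loop _ _ => by simp [Program.weight]

theorem size_add_le (x y : ℕ) : (x + y).size ≤ max x.size y.size + 1 := by
  rw [Nat.size_le, pow_succ]; have hx := Nat.lt_size_self x; have hy := Nat.lt_size_self y
  have h1 : 2 ^ x.size ≤ 2 ^ max x.size y.size := Nat.pow_le_pow_right (by norm_num) (by simp)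
  have h2 : 2 ^ y.size ≤ 2 ^ max x.size y.size := Nat.pow_le_pow_right (by norm_num) (by simp); omega

theorem size_mul_le (x y : ℕ) : (x * y).size ≤ x.size + y.size := by
  rw [Nat.size_le, pow_add]; exact Nat.mul_lt_mul'' (Nat.lt_size_self x) (Nat.lt_size_self y)

theorem size_le_of_le (h : x ≤ y) : x.size ≤ y.size := Nat.size_le_size h

theorem size_eval_le (o : BinOp) (x y : ℕ) : (o.eval x y).size ≤ x.size + y.size + 1 := by
  cases o with
  | plus => have := size_add_le x y; simp only [BinOp.eval]; omega
  | minus => have := size_le_of_le (Nat.sub_le x y); simp only [BinOp.eval]; omega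
  | times => have := size_mul_le x y; simp only [BinOp.eval]; omega
  | quot => have := size_le_of_le (Nat.div_le_self x y); simp only [BinOp.eval]; omega

theorem size_toNat_le (b : Bool) : b.toNat.size ≤ 1 := by
  cases b <;> simp

/-- Weights combine multiplicatively along `seq`: after `p` everything that `q` may read has size at
most `p.weight * L`, and this takes the place of `L` for `q`. Registers in `must` are known to be
small afterwards, whatever they contained, and therefore `need` may omit them. -/
theorem Flat.bound (hp : p.Flat) : ∀ {σ : State} {L : ℕ}, 1 ≤ L →
    (∀ x ∈ p.need, (σ.reg x).size ≤ L) → (∀ b ∈ p.loads, ∀ i, (σ.arr b i).size ≤ L) →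
    (∃ t ≤ p.weight * L, Exec ω p σ t (p.eval ω σ)) ∧
    (∀ x, ((p.eval ω σ).reg x = σ.reg x ∧ x ∉ p.must) ∨ ((p.eval ω σ).reg x).size ≤ p.weight * L) ∧
    ∀ b i, (p.eval ω σ).arr b i = σ.arr b i ∨ ((p.eval ω σ).arr b i).size ≤ p.weight * L := by
  induction p with
  | skip =>
    intro σ L hL _ _
    exact ⟨⟨1, by simp [Program.weight]; omega, .skip σ⟩,
      fun x => .inl ⟨rfl, by simp [Program.must]⟩, fun _ _ => .inl rfl⟩
  | const x c =>
    intro σ L hL _ _; have h : 1 + c.size ≤ (1 + c.size) * L := Nat.le_mul_of_pos_right _ hL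
    refine ⟨⟨_, h, .const σ x c⟩, fun y => ?_, fun _ _ => .inl rfl⟩
    by_cases hy : y = x
    · right; simp only [Program.eval, Program.weight, State.reg_setReg, hy, if_true]; omega
    · left; simp [Program.eval, Program.must, hy]
  | arith o x y z =>
    intro σ L hL hr _
    simp only [Program.need, Finset.mem_insert, Finset.mem_singleton, forall_eq_or_imp, forall_eq] at hr
    have := size_eval_le o (σ.reg y) (σ.reg z)
    refine ⟨⟨_, by simp only [Program.weight]; omega, .arith σ o x y z⟩, fun w => ?_,
      fun _ _ => .inl rfl⟩
    by_cases hw : w = x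
    · right; simp only [Program.eval, Program.weight, State.reg_setReg, hw, if_true]; omega
    · left; simp [Program.eval, Program.must, hw]
  | load b x y =>
    intro σ L hL hr ha; simp only [Program.need, Finset.mem_singleton, forall_eq] at hr
    have := ha b (by simp [Program.loads]) (σ.reg y)
    refine ⟨⟨_, by simp only [Program.weight]; omega, .load σ b x y⟩, fun w => ?_, fun _ _ => .inl rfl⟩
    by_cases hw : w = x
    · right; simp only [Program.eval, Program.weight, State.reg_setReg, hw, if_true]; omega
    · left; simp [Program.eval, Program.must, hw]
  | store b x y =>
    intro σ L hL hr _
    simp only [Program.need, Finset.mem_insert, Finset.mem_singleton, forall_eq_or_imp, forall_eq] at hr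
    refine ⟨⟨_, by simp only [Program.weight]; omega, .store σ b x y⟩,
      fun w => .inl ⟨rfl, by simp [Program.must]⟩, fun c i => ?_⟩
    simp only [Program.eval, Program.weight, State.arr_setArr_apply]; split_ifs
    · right; omega
    · left; rfl
  | random x y =>
    intro σ L hL hr _; simp only [Program.need, Finset.mem_singleton, forall_eq] at hr
    have := size_toNat_le (ω (σ.reg y))
    refine ⟨⟨_, by simp only [Program.weight]; omega, .random σ x y⟩, fun w => ?_, fun _ _ => .inl rfl⟩
    by_cases hw : w = x
    · right; simp only [Program.eval, Program.weight, State.reg_setReg, hw, if_true]; omega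
    · left; simp [Program.eval, Program.must, hw]
  | seq p q ihp ihq =>
    intro σ L hL hr ha
    obtain ⟨⟨t₁, ht₁, e₁⟩, r₁, a₁⟩ := ihp hp.1 hL (fun x hx => hr x (by simp [Program.need, hx]))
      (fun b hb => ha b (by simp [Program.loads, hb]))
    have hw := p.one_le_weight; have hw' := q.one_le_weight
    have hLL : L ≤ p.weight * L := Nat.le_mul_of_pos_left _ hw
    have hP : p.weight * L ≤ q.weight * (p.weight * L) := Nat.le_mul_of_pos_left _ hw'
    obtain ⟨⟨t₂, ht₂, e₂⟩, r₂, a₂⟩ := ihq hp.2 (σ := p.eval ω σ) (L := p.weight * L) (by omega)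
      (fun x hx => by
        rcases r₁ x with ⟨h, h'⟩ | h
        · rw [h]; exact (hr x (by simp [Program.need, hx, h'])).trans hLL
        · exact h)
      (fun b hb i => by
        rcases a₁ b i with h | h
        · rw [h]; exact (ha b (by simp [Program.loads, hb]) i).trans hLL
        · exact h)
    have hsum : (Program.seq p q).weight * L = p.weight * L + q.weight * (p.weight * L) := by
      simp only [Program.weight]; ring
    refine ⟨⟨t₁ + t₂, by omega, .seq e₁ e₂⟩, fun x => ?_, fun b i => ?_⟩
    · simp only [Program.eval]; rcases r₂ x with ⟨h, h'⟩ | h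
      · rw [h]; rcases r₁ x with ⟨h₁, h₁'⟩ | h₁
        · left; exact ⟨h₁, by simp [Program.must, h', h₁']⟩
        · right; omega
      · right; omega
    · simp only [Program.eval]; rcases a₂ b i with h | h
      · rw [h]; rcases a₁ b i with h₁ | h₁
        · left; exact h₁
        · right; omega
      · right; omega
  | cond x p q ihp ihq =>
    intro σ L hL hr ha; have hx := hr x (by simp [Program.need])
    have hsum : (Program.cond x p q).weight * L = 2 * L + p.weight * L + q.weight * L := by
      simp only [Program.weight]; ring
    by_cases h0 : σ.reg x = 0
    · obtain ⟨⟨t, ht, e⟩, r, a⟩ := ihq hp.2 (σ := σ) hL (fun y hy => hr y (by simp [Program.need, hy]))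
        (fun b hb => ha b (by simp [Program.loads, hb]))
      simp only [Program.eval, h0, if_true]
      refine ⟨⟨1 + t, by omega, .cond_zero h0 e⟩, fun y => ?_, fun b i => ?_⟩
      · rcases r y with ⟨h, h'⟩ | h
        · left; exact ⟨h, by simp [Program.must, h']⟩
        · right; omega
      · rcases a b i with h | h
        · left; exact h
        · right; omega
    · obtain ⟨⟨t, ht, e⟩, r, a⟩ := ihp hp.1 (σ := σ) hL (fun y hy => hr y (by simp [Program.need, hy]))
        (fun b hb => ha b (by simp [Program.loads, hb]))
      simp only [Program.eval, h0, if_false]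
      refine ⟨⟨_, by omega, .cond_pos h0 e⟩, fun y => ?_, fun b i => ?_⟩
      · rcases r y with ⟨h, h'⟩ | h
        · left; exact ⟨h, by simp [Program.must, h']⟩
        · right; omega
      · rcases a b i with h | h
        · left; exact h
        · right; omega
  | loop x p => exact hp.elim

theorem wp_flat (L : ℕ) (hp : p.Flat) (hL : 1 ≤ L) (hr : ∀ x ∈ p.need, (σ.reg x).size ≤ L)
    (ha : ∀ b ∈ p.loads, ∀ i, (σ.arr b i).size ≤ L)
    (hQ : Framed p σ (p.eval ω σ) → Q (p.eval ω σ) (T + p.weight * L)) : wp ω p Q σ T := by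
  obtain ⟨⟨t, ht, e⟩, -, -⟩ := Flat.bound (ω := ω) hp hL hr ha; exact ⟨_, t, _, e, by omega, hQ e.framed⟩

instance Program.decidableFlat : DecidablePred Program.Flat
  | .seq p q => @instDecidableAnd _ _ (decidableFlat p) (decidableFlat q)
  | .cond _ p q => @instDecidableAnd _ _ (decidableFlat p) (decidableFlat q)
  | .loop _ _ => instDecidableFalse
  | .skip | .const _ _ | .arith _ _ _ _ | .load _ _ _ | .store _ _ _ | .random _ _ => instDecidableTrue

theorem wp_flat_list (L : ℕ) (need loads : List ℕ) (hL : 1 ≤ L) (hr : ∀ x ∈ need, (σ.reg x).size ≤ L)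
    (ha : ∀ b ∈ loads, ∀ i, (σ.arr b i).size ≤ L)
    (hQ : Framed p σ (p.eval ω σ) → Q (p.eval ω σ) (T + p.weight * L))
    (hd : p.Flat ∧ (∀ x ∈ p.need, x ∈ need) ∧ ∀ b ∈ p.loads, b ∈ loads := by decide) : wp ω p Q σ T :=
  wp_flat L hd.1 hL (fun x hx => hr x (hd.2.1 x hx)) (fun b hb => ha b (hd.2.2 b hb)) hQ

theorem Framed.arr (h : Framed p σ σ') (hp : p.stores = ∅ := by decide) : σ'.arr = σ.arr :=
  funext fun b => h.2 b (by simp [hp])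

/-! ### Counting loops -/

/-- `for i := 0, …, r hi - 1 do body`, where register `one` contains `1` and `c` is auxiliary. -/
def forLoop (i hi c one : ℕ) (body : Program) : Program := .const i 0 ;; .arith .minus c hi i ;;
    .loop c (body ;; .arith .plus i i one ;; .arith .minus c hi i)

/-- The invariant may speak of time. It has to ignore the loop registers `i` and `c` (`stable`),
since these are updated after the body; `10 * (N.size + 1)` pays for one such update and the test.
-/
theorem wp_for {hi c one : ℕ} {body : Program} {σ₀ : State} (N : ℕ) (Inv : ℕ → State → ℕ → Prop)
    (hi₁ : i ∉ body.writes) (hi₂ : hi ∉ body.writes) (hi₃ : one ∉ body.writes)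
    (hd : i ≠ hi ∧ i ≠ c ∧ i ≠ one ∧ c ≠ hi ∧ c ≠ one)
    (hN : σ₀.reg hi = N) (hone : σ₀.reg one = 1)
    (stable : ∀ k σ T x y, Inv k σ T → Inv k ((σ.setReg i x).setReg c y) T)
    (start : Inv 0 σ₀ (T + 10 * (N.size + 1)))
    (step : ∀ k < N, ∀ σ T, Inv k σ T → Framed (forLoop i hi c one body) σ₀ σ → σ.reg i = k →
      wp ω body (fun σ' T' => Inv (k + 1) σ' (T' + 10 * (N.size + 1))) σ T)
    (fin : ∀ σ T, Inv N σ T → Framed (forLoop i hi c one body) σ₀ σ → Q σ T) :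
    wp ω (forLoop i hi c one body) Q σ₀ T := by
  obtain ⟨d1, d2, d3, d4, d5⟩ := hd
  have wr : ∀ x, x ∉ (forLoop i hi c one body).writes ↔ x ≠ i ∧ x ≠ c ∧ x ∉ body.writes := by
    intro x; simp [forLoop, Program.writes]; tauto
  have sr : ∀ b, b ∉ (forLoop i hi c one body).stores ↔ b ∉ body.stores := by
    intro x; simp [forLoop, Program.stores]
  -- Induction on the number `d` of remaining iterations, which register `c` contains. The `+ 1` in
  -- the invariant keeps the cost of the last test in reserve.
  have key : ∀ d k, k + d = N → ∀ σ T₁, Inv k σ (T₁ + 1) → Framed (forLoop i hi c one body) σ₀ σ →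
      σ.reg i = k → σ.reg c = d →
      wp ω (.loop c (body ;; .arith .plus i i one ;; .arith .minus c hi i)) Q σ T₁ := by
    intro d
    induction d with
    | zero =>
      intro k hk σ T₁ hI hF hik hc; obtain rfl : k = N := by omega
      exact wp_loop_zero hc (fin _ _ hI hF)
    | succ d ih =>
      intro k hk σ T₁ hI hF hik hc; refine wp_loop_pos (by omega) (wp_seq ?_)
      obtain ⟨σ₁, t₁, T₂, e₁, hT₂, hI₁⟩ := step k (by omega) σ _ hI hF hik; have f₁ := e₁.framed
      have sh : σ₁.reg hi = N := by
        rw [f₁.1 _ hi₂, hF.1 _ ((wr hi).2 ⟨d1.symm, d4.symm, hi₂⟩), hN]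
      have so : σ₁.reg one = 1 := by
        rw [f₁.1 _ hi₃, hF.1 _ ((wr one).2 ⟨d3.symm, d5.symm, hi₃⟩), hone]
      have si : σ₁.reg i = k := by rw [f₁.1 _ hi₁, hik]
      have zc : (σ.reg c).size ≤ N.size := size_le_of_le (by omega)
      have zk : k.size ≤ N.size := size_le_of_le (by omega)
      have zk' : (k + 1).size ≤ N.size := size_le_of_le (by omega); have z1 : (1 : ℕ).size = 1 := by simp
      refine ⟨σ₁, t₁, T₂ + (1 + (σ.reg c).size), e₁, by omega, wp_seq (wp_arith (wp_arith ?_))⟩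
      have key2 := ih (k + 1) (by omega) ((σ₁.setReg i (k + 1)).setReg c d)
        (T₂ + 10 * (N.size + 1) - 1) (by
          rw [show T₂ + 10 * (N.size + 1) - 1 + 1 = T₂ + 10 * (N.size + 1) by omega]
          exact stable _ _ _ _ _ hI₁)
        ⟨fun x hx => by
            have hx' := (wr x).1 hx; simp only [State.reg_setReg, hx'.1, hx'.2.1, if_false]
            rw [f₁.1 _ hx'.2.2, hF.1 _ hx],
          fun b hb => by
            simp only [State.arr_setReg]
            rw [f₁.2 _ ((sr b).1 hb), hF.2 _ hb]⟩
        (by simp [d2]) (by simp)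
      have e : ((σ₁.setReg i (BinOp.plus.eval (σ₁.reg i) (σ₁.reg one))).setReg c
          (BinOp.minus.eval ((σ₁.setReg i (BinOp.plus.eval (σ₁.reg i) (σ₁.reg one))).reg hi)
            ((σ₁.setReg i (BinOp.plus.eval (σ₁.reg i) (σ₁.reg one))).reg i))) =
          (σ₁.setReg i (k + 1)).setReg c d := by
        simp only [BinOp.eval, si, so, State.reg_setReg, d1.symm, if_false, if_true, sh]; congr 1; omega
      rw [e]; refine wp_time key2 ?_
      simp only [BinOp.eval, si, so, State.reg_setReg, d1.symm, if_false, if_true, sh, z1]; omega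
  refine wp_seq (wp_const (wp_seq (wp_arith ?_)))
  have e : ((σ₀.setReg i 0).setReg c
      (BinOp.minus.eval ((σ₀.setReg i 0).reg hi) ((σ₀.setReg i 0).reg i))) =
      (σ₀.setReg i 0).setReg c N := by
    simp [BinOp.eval, d1.symm, hN]
  rw [e]
  refine wp_time (key N 0 (by omega) ((σ₀.setReg i 0).setReg c N) (T + 10 * (N.size + 1) - 1) ?_ ?_
    (by simp [d2]) (by simp)) ?_
  · rw [show T + 10 * (N.size + 1) - 1 + 1 = T + 10 * (N.size + 1) by omega]
    exact stable _ _ _ _ _ start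
  · exact ⟨fun x hx => by
      have hx' := (wr x).1 hx
      simp [hx'.1, hx'.2.1], fun b hb => rfl⟩
  · simp [d1.symm, hN]; omega

/-! ### Simulation on a virtual memory with rollback, with fuel

Register `0` contains `0`, register `1` contains `1`, register `7` contains the stride `S` of the virtual
memory. The entry `i` of a virtual array `v` is found at position `i * S + z` of array `v`,
increased by one, where `z` is the current layer (register `31`, or `33` for the input array `11`); if
nothing has been written there, the layer of register `32` (or register `0`) counts. Bit `y` of the
simulated random string is bit `y * r 3 + r 34`. Register `35` contains the fuel. -/

/-- The register that names the current layer of a virtual array. -/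
def topLayer (v : ℕ) : ℕ := if v = 11 then 33 else 31

/-- The register that names the layer below. -/
def lowLayer (v : ℕ) : ℕ := if v = 11 then 0 else 32

/-- Entry `i` of the virtual array `v`. -/
def State.virt (σ : State) (v i : ℕ) : ℕ := if σ.arr v (i * σ.reg 7 + σ.reg (topLayer v)) = 0 then
    σ.arr v (i * σ.reg 7 + σ.reg (lowLayer v)) - 1
  else σ.arr v (i * σ.reg 7 + σ.reg (topLayer v)) - 1

def State.layerSize (σ : State) (v : ℕ) : ℕ :=
  1 + (σ.reg 7).size + (σ.reg (topLayer v)).size + (σ.reg (lowLayer v)).size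

/-- `r d :=` entry `r i` of the virtual array `v` -/
def vload (d v i : ℕ) : Program :=
  .arith .times 39 i 7 ;; .arith .plus 39 39 (topLayer v) ;; .load v d 39 ;;
    .cond d .skip (.arith .times 39 i 7 ;; .arith .plus 39 39 (lowLayer v) ;; .load v d 39) ;;
    .arith .minus d d 1

/-- entry `r i` of the virtual array `v` `:= r y` -/
def vstore (v i y : ℕ) : Program :=
  .arith .times 39 i 7 ;; .arith .plus 39 39 (topLayer v) ;; .arith .plus 44 y 1 ;; .store v 39 44

theorem size_sub_le (x y : ℕ) : (x - y).size ≤ x.size := size_le_of_le (Nat.sub_le x y)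

theorem size_le_size_pred (x : ℕ) : x.size ≤ (x - 1).size + 1 := by
  have := size_add_le (x - 1) 1; rcases Nat.eq_zero_or_pos x with rfl | h
  · simp
  · rw [Nat.sub_add_cancel h] at this
    by_cases h2 : x = 1
    · subst h2; simp
    · have : 1 ≤ (x - 1).size := by
        rw [Nat.one_le_iff_ne_zero, Ne, Nat.size_eq_zero]; omega
      simp at *; omega

theorem topLayer_cases (v : ℕ) : topLayer v = 33 ∨ topLayer v = 31 := by
  unfold topLayer; split_ifs <;> simp

theorem lowLayer_cases (v : ℕ) : lowLayer v = 0 ∨ lowLayer v = 32 := by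
  unfold lowLayer; split_ifs <;> simp

theorem wp_vload {d v : ℕ} (hd : d = 36 ∨ d = 37) (hi : i = 0 ∨ i = 36 ∧ d = 37) (h1 : σ.reg 1 = 1)
    (hQ : ∀ σ', σ'.arr = σ.arr → (∀ x, x ≠ d → x ≠ 39 → σ'.reg x = σ.reg x) →
      σ'.reg d = σ.virt v (σ.reg i) →
      Q σ' (T + 30 * ((σ.reg i).size + (σ.virt v (σ.reg i)).size + σ.layerSize v))) :
    wp ω (vload d v i) Q σ T := by
  have hid : i ≠ d := by omega
  have hi39 : i ≠ 39 := by omega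
  have hd39 : d ≠ 39 := by omega
  have hd7 : d ≠ 7 := by omega
  have hd1 : d ≠ 1 := by omega
  have ht : topLayer v ≠ 39 ∧ topLayer v ≠ d := by rcases topLayer_cases v with h | h <;> omega
  have hl : lowLayer v ≠ 39 ∧ lowLayer v ≠ d := by rcases lowLayer_cases v with h | h <;> omega
  have e1 := size_mul_le (σ.reg i) (σ.reg 7)
  have e2 := size_add_le (σ.reg i * σ.reg 7) (σ.reg (topLayer v))
  have e3 := size_add_le (σ.reg i * σ.reg 7) (σ.reg (lowLayer v)); have s1 : (1 : ℕ).size = 1 := by simp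
  have ev : σ.virt v (σ.reg i) = if σ.arr v (σ.reg i * σ.reg 7 + σ.reg (topLayer v)) = 0 then
      σ.arr v (σ.reg i * σ.reg 7 + σ.reg (lowLayer v)) - 1
      else σ.arr v (σ.reg i * σ.reg 7 + σ.reg (topLayer v)) - 1 := rfl
  have hL : σ.layerSize v =
    1 + (σ.reg 7).size + (σ.reg (topLayer v)).size + (σ.reg (lowLayer v)).size := rfl
  refine wp_slack (wp_seq (wp_arith (wp_seq (wp_arith (wp_seq (wp_load (wp_seq (wp_cond ?_ ?_))))))))
  · intro h; refine wp_skip (wp_arith ⟨_, ?_, hQ _ (by simp) (fun x hx hx' => by simp [hx, hx']) ?_⟩)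
    all_goals
      simp only [State.reg_setReg, State.arr_setReg, if_true, BinOp.eval, ht.1, if_false, hi39,
        hd39, hd1.symm, hd7, h1, (by decide : (1 : ℕ) ≠ 39), hd39.symm, s1] at h ⊢
    · rw [if_neg h] at ev
      have e4 := size_le_size_pred (σ.arr v (σ.reg i * σ.reg 7 + σ.reg (topLayer v))); rw [← ev] at e4
      omega
    · rw [ev, if_neg h]
  · intro h
    refine wp_seq (wp_arith (wp_seq (wp_arith (wp_load
      (wp_arith ⟨_, ?_, hQ _ (by simp) (fun x hx hx' => by simp [hx, hx']) ?_⟩)))))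
    all_goals
      simp only [State.reg_setReg, State.arr_setReg, if_true, BinOp.eval, ht.1, if_false, hi39,
        hd39, hd1.symm, hd7, h1, (by decide : (1 : ℕ) ≠ 39), hd39.symm, s1, hid, hd7.symm,
        hl.1, hl.2, (by decide : (7 : ℕ) ≠ 39)] at h ⊢
    · rw [if_pos h] at ev; rw [h]
      have e4 := size_le_size_pred (σ.arr v (σ.reg i * σ.reg 7 + σ.reg (lowLayer v))); rw [← ev] at e4
      simp only [Nat.size_zero]; omega
    · rw [ev, if_pos h]

theorem wp_vstore {v : ℕ} (hi : i ≠ 39) (hy : y ≠ 39) (h1 : σ.reg 1 = 1)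
    (hQ : ∀ σ', σ'.arr = (σ.setArr v (σ.reg i * σ.reg 7 + σ.reg (topLayer v)) (σ.reg y + 1)).arr →
      (∀ x, x ≠ 39 → x ≠ 44 → σ'.reg x = σ.reg x) →
      Q σ' (T + 30 * ((σ.reg i).size + (σ.reg y).size + σ.layerSize v))) :
    wp ω (vstore v i y) Q σ T := by
  have ht : topLayer v ≠ 39 ∧ topLayer v ≠ 44 := by rcases topLayer_cases v with h | h <;> omega
  have e1 := size_mul_le (σ.reg i) (σ.reg 7)
  have e2 := size_add_le (σ.reg i * σ.reg 7) (σ.reg (topLayer v)); have e3 := size_add_le (σ.reg y) 1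
  have s1 : (1 : ℕ).size = 1 := by simp
  have hL : σ.layerSize v =
    1 + (σ.reg 7).size + (σ.reg (topLayer v)).size + (σ.reg (lowLayer v)).size := rfl
  refine wp_slack (wp_seq (wp_arith (wp_seq (wp_arith (wp_seq (wp_arith (wp_store
    ⟨_, ?_, hQ _ ?_ (fun x hx hx' => by simp [hx, hx'])⟩)))))))
  all_goals
    simp only [State.reg_setReg, State.arr_setReg, if_true, BinOp.eval, ht.1, if_false, hi,
      h1, (by decide : (1 : ℕ) ≠ 39), (by decide : (39 : ℕ) ≠ 44), s1, hy]
  · omega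
  · funext c; simp [State.arr_setArr]

/-! ### Measuring the size of a number -/

/-- `r 42 := k` with `size u ≤ k ≤ 2 * size u + 1`, where `u` is the content of register `40`. -/
def sizeLoop : Program := .const 41 2 ;; .const 42 1 ;; .arith .plus 44 40 1 ;; .arith .minus 44 44 41 ;;
    .loop 44 (.arith .times 41 41 41 ;; .arith .plus 42 42 42 ;; .arith .plus 44 40 1 ;;
      .arith .minus 44 44 41)

/-- Squaring 2^k doubles `k`, and this happens only while k is less than the size of `u`; so the
final `k` exceeds the size at most by the factor 2, and a logarithmic number of squarings suffices.
There is no instruction for the size, and the fuel has to be charged with it. -/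
theorem wp_sizeLoop (h1 : σ.reg 1 = 1) (hQ : ∀ σ', σ'.arr = σ.arr →
      (∀ x, x ≠ 41 → x ≠ 42 → x ≠ 44 → σ'.reg x = σ.reg x) →
      (σ.reg 40).size ≤ σ'.reg 42 → σ'.reg 42 ≤ 2 * (σ.reg 40).size + 1 →
      Q σ' (T + 60 * (((σ.reg 40).size + 2) * ((σ.reg 40).size.size + 2)))) :
    wp ω sizeLoop Q σ T := by
  generalize hT₀ : T + 60 * (((σ.reg 40).size + 2) * ((σ.reg 40).size.size + 2)) = T₀ at hQ
  generalize hu : σ.reg 40 = u at hQ hT₀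
  have s1 : (1 : ℕ).size = 1 := by simp
  -- `j` bounds the number of squarings that are still needed.
  have key : ∀ j k σ₁ T₁, σ₁.arr = σ.arr → (∀ x, x ≠ 41 → x ≠ 42 → x ≠ 44 → σ₁.reg x = σ.reg x) →
      σ₁.reg 41 = 2 ^ k → σ₁.reg 42 = k → σ₁.reg 44 = u + 1 - 2 ^ k → k ≤ 2 * u.size + 1 →
      1 ≤ k → u.size ≤ k * 2 ^ j → T₁ + 60 * ((u.size + 2) * (j + 1)) ≤ T₀ →
      wp ω (.loop 44 (.arith .times 41 41 41 ;; .arith .plus 42 42 42 ;; .arith .plus 44 40 1 ;;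
      .arith .minus 44 44 41)) Q σ₁ T₁ := by
    intro j
    induction j with
    | zero =>
      intro k σ₁ T₁ ha hr h41 h42 h44 hk hk1 hj hT; simp only [pow_zero, mul_one] at hj
      have hlt := Nat.size_le.1 hj; refine wp_time (T := T₀ - 1) (wp_loop_zero (by omega) ?_) (by omega)
      rw [Nat.sub_add_cancel (by omega)]; exact hQ σ₁ ha hr (by omega) (by omega)
    | succ j ih =>
      intro k σ₁ T₁ ha hr h41 h42 h44 hk hk1 hj hT
      have hT' : 60 * ((u.size + 2) * (j + 1 + 1)) =
        60 * ((u.size + 2) * (j + 1)) + 60 * (u.size + 2) := by ring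
      by_cases h0 : σ₁.reg 44 = 0
      · have hlt : u < 2 ^ k := by omega
        refine wp_time (T := T₀ - 1) (wp_loop_zero (by omega) ?_) (by omega)
        rw [Nat.sub_add_cancel (by omega)]
        exact hQ σ₁ ha hr (by rw [h42]; exact Nat.size_le.2 hlt) (by omega)
      · have hle : k < u.size := Nat.lt_size.2 (by omega)
        have h40 : σ₁.reg 40 = u := by rw [hr 40 (by decide) (by decide) (by decide), hu]
        have h01 : σ₁.reg 1 = 1 := by rw [hr 1 (by decide) (by decide) (by decide), h1]
        have p2 : 2 ^ k * 2 ^ k = 2 ^ (2 * k) := by rw [← pow_add]; congr 1; omega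
        have z1 : (2 ^ k).size = k + 1 := Nat.size_pow
        have z2 : (2 ^ (2 * k)).size = 2 * k + 1 := Nat.size_pow
        have z3 : (u + 1 - 2 ^ k).size ≤ u.size := size_le_of_le (by have := Nat.one_le_two_pow (n := k); omega)
        have z4 := size_add_le u 1; have z5 : k.size ≤ k := Nat.size_le.2 Nat.lt_two_pow_self
        refine wp_loop_pos h0 (wp_seq (wp_arith (wp_seq (wp_arith (wp_seq (wp_arith (wp_arith ?_)))))))
        refine wp_time (ih (2 * k) _ (T₀ - 60 * ((u.size + 2) * (j + 1))) ?_ ?_ ?_ ?_ ?_ ?_ ?_ ?_ ?_) ?_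
        · simpa using ha
        · intro x hx hx' hx''; simp [hx, hx', hx'', hr x hx hx' hx'']
        · simp [BinOp.eval, h41, p2]
        · simp [BinOp.eval, h42]; omega
        · simp [BinOp.eval, h40, h01, h41, p2]
        · omega
        · omega
        · rw [pow_succ] at hj; linarith
        · omega
        · simp [BinOp.eval, h40, h01, h41, h42, h44, p2, z1, z2]; omega
  refine wp_seq (wp_const (wp_seq (wp_const (wp_seq (wp_arith (wp_seq (wp_arith ?_)))))))
  have z4 := size_add_le u 1
  have hT₁ : 60 * ((u.size + 2) * (u.size.size + 2)) =
        60 * ((u.size + 2) * (u.size.size + 1)) + 60 * (u.size + 2) := by ring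
  refine wp_time (key u.size.size 1 _ (T₀ - 60 * ((u.size + 2) * (u.size.size + 1)))
    ?_ ?_ ?_ ?_ ?_ ?_ ?_ ?_ ?_) ?_
  · simp
  · intro x hx hx' hx''; simp [hx, hx', hx'']
  · simp
  · simp
  · simp [BinOp.eval, hu, h1]
  · omega
  · omega
  · have := Nat.lt_size_self u.size; omega
  · omega
  · have z2 : (2 : ℕ).size = 2 := by decide
    simp [BinOp.eval, hu, h1, z2]; omega

/-! ### The simulation -/

/-- Fetch the operands into registers `36` and `37`, pay for them, and go on if fuel is left. -/
def basic (fetch act : Program) : Program :=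
  .cond 35 (fetch ;; .arith .plus 40 36 37 ;; sizeLoop ;; .arith .minus 35 35 42 ;;
    .arith .minus 35 35 1 ;; .cond 35 act .skip) .skip

/-- The time for paying for operands `x` and `y`. -/
def payTime (x y f : ℕ) : ℕ :=
  200 * ((x.size + y.size + 1) * ((x.size + y.size + 1).size + 2)) + 10 * f.size + 10

theorem size_add_le' (x y : ℕ) : (x + y).size ≤ x.size + y.size + 1 := by
  have := size_add_le x y; omega

/-- Fuel is deducted between fetching the operands and acting on them, so nothing is computed from
operands that have not been paid for. Only the fetch itself may cost more than the fuel that is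
left. -/
theorem wp_basic {fetch act : Program} (h0 : σ.reg 35 = 0 → Q σ (T + 2))
    (h1 : σ.reg 35 ≠ 0 → wp ω fetch (fun σ₁ T₁ => σ₁.reg 1 = 1 ∧ σ₁.reg 35 = σ.reg 35 ∧
      ∀ k σ₂, (σ₁.reg 36 + σ₁.reg 37).size ≤ k → k ≤ 2 * (σ₁.reg 36 + σ₁.reg 37).size + 1 →
        σ₂.arr = σ₁.arr →
        (∀ x, x ∉ ({35, 40, 41, 42, 44} : Finset ℕ) → σ₂.reg x = σ₁.reg x) →
        σ₂.reg 35 = σ.reg 35 - k - 1 →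
        (σ₂.reg 35 ≠ 0 → wp ω act Q σ₂ (T₁ + payTime (σ₁.reg 36) (σ₁.reg 37) (σ.reg 35))) ∧
        (σ₂.reg 35 = 0 → Q σ₂ (T₁ + payTime (σ₁.reg 36) (σ₁.reg 37) (σ.reg 35))))
      σ (T + 1 + (σ.reg 35).size)) : wp ω (basic fetch act) Q σ T := by
  refine wp_cond (fun hF => wp_seq ?_) (fun hF => wp_skip (h0 hF)); rw [← add_assoc]
  refine wp_mono (h1 hF) ?_; rintro σ₁ T₁ - ⟨h1₁, hF₁, h⟩
  refine wp_seq (wp_arith (wp_seq (wp_sizeLoop (by simpa using h1₁) ?_))); intro σ₃ ha hr hk hk'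
  refine wp_seq (wp_arith (wp_seq (wp_arith ?_)))
  simp only [State.reg_setReg, if_true, BinOp.eval, State.arr_setReg] at ha hr hk hk' ⊢
  have r35 : σ₃.reg 35 = σ.reg 35 := by
    rw [hr 35 (by decide) (by decide) (by decide), if_neg (by decide), hF₁]
  have r1 : σ₃.reg 1 = 1 := by
    rw [hr 1 (by decide) (by decide) (by decide), if_neg (by decide), h1₁]
  have hu := size_add_le' (σ₁.reg 36) (σ₁.reg 37); have hu2 := size_le_of_le hu
  have hk2 : (σ₃.reg 42).size ≤ σ₃.reg 42 := Nat.size_le.2 Nat.lt_two_pow_self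
  have hm := Nat.mul_le_mul (Nat.add_le_add_right hu 2) (Nat.add_le_add_right hu2 2)
  have hm2 : (σ₁.reg 36).size + (σ₁.reg 37).size + 1 ≤ ((σ₁.reg 36).size + (σ₁.reg 37).size + 1) *
      (((σ₁.reg 36).size + (σ₁.reg 37).size + 1).size + 2) :=
    Nat.le_mul_of_pos_right _ (by omega)
  have hm3 : ((σ₁.reg 36).size + (σ₁.reg 37).size + 1 + 2) *
      (((σ₁.reg 36).size + (σ₁.reg 37).size + 1).size + 2) ≤
      3 * (((σ₁.reg 36).size + (σ₁.reg 37).size + 1) *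
      (((σ₁.reg 36).size + (σ₁.reg 37).size + 1).size + 2)) := by
    rw [← mul_assoc]; exact Nat.mul_le_mul_right _ (by omega)
  have hs := size_sub_le (σ.reg 35) (σ₃.reg 42); have hs' := size_sub_le (σ.reg 35 - σ₃.reg 42) 1
  have s1 : (1 : ℕ).size = 1 := by simp
  obtain ⟨hA, hB⟩ := h (σ₃.reg 42) (((σ₃.setReg 35 (σ₃.reg 35 - σ₃.reg 42)).setReg 35
      (σ₃.reg 35 - σ₃.reg 42 - 1))) hk hk' (by simpa using ha)
      (fun x hx => by
        simp only [Finset.mem_insert, Finset.mem_singleton, not_or] at hx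
        simp [hx, hr x hx.2.2.1 hx.2.2.2.1 hx.2.2.2.2]) (by simp [r35])
  simp only [r1, r35, payTime, (by decide : (42 : ℕ) ≠ 35), (by decide : (1 : ℕ) ≠ 35), if_false] at hA hB ⊢
  refine wp_cond (fun h2 => ?_) (fun h2 => wp_slack (wp_skip ⟨_, ?_, hB h2⟩))
  · refine wp_time (hA h2) ?_; simp only [State.reg_setReg, if_true, s1]; omega
  · simp only [s1]; omega

/-- Test whether register `x` of the simulated program is non-zero; the result is in register `43`. -/
def testReg (x : ℕ) : Program :=
  .const 43 0 ;; basic (vload 36 (10 + 2 * x) 0 ;; .const 37 0) (.arith .plus 43 36 0)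

/-- Register `x` of the simulated program is entry `0` of the virtual array `10 + 2 * x`, and its array
`b` is the virtual array `11 + 2 * b`. -/
def simulate : Program → Program
  | .skip => .skip
  | .const x c => basic (.const 36 0 ;; .const 37 0) (.const 38 c ;; vstore (10 + 2 * x) 0 38)
  | .arith o x y z => basic (vload 36 (10 + 2 * y) 0 ;; vload 37 (10 + 2 * z) 0)
      (.arith o 38 36 37 ;; vstore (10 + 2 * x) 0 38)
  | .load b x y => basic (vload 36 (10 + 2 * y) 0 ;; vload 37 (11 + 2 * b) 36)
      (.arith .plus 38 37 0 ;; vstore (10 + 2 * x) 0 38)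
  | .store b x y => basic (vload 36 (10 + 2 * x) 0 ;; vload 37 (10 + 2 * y) 0)
      (.arith .plus 38 37 0 ;; vstore (11 + 2 * b) 36 38)
  | .random x y => basic (vload 36 (10 + 2 * y) 0 ;; .const 37 0)
      ((.arith .times 38 36 3 ;; .arith .plus 38 38 34 ;; .random 38 38) ;; vstore (10 + 2 * x) 0 38)
  | .seq p q => simulate p ;; simulate q
  | .cond x p q => testReg x ;; .cond 43 (simulate p) (simulate q)
  | .loop x p => testReg x ;; .loop 43 (simulate p ;; testReg x)

theorem writes_simulate (p : Program) : ∀ x ∈ (simulate p).writes, 35 ≤ x ∧ x ≤ 44 := by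
  induction p <;> intro x hx <;>
    simp [simulate, testReg, basic, Program.writes, vload, vstore, sizeLoop] at hx <;> grind

theorem stores_simulate (p : Program) : ∀ b ∈ (simulate p).stores, 10 ≤ b := by
  induction p <;> intro x hx <;>
    simp [simulate, testReg, basic, Program.stores, vload, vstore, sizeLoop] at hx <;> grind

/-! ### Time and memory of the simulation, whatever is simulated -/

/-- The potential that pays for the simulation: the fuel, and once the cost of running out of it. -/
def potential (B f : ℕ) : ℕ := if f = 0 then 0 else f + B

theorem potential_mono {B f f' : ℕ} (h : f' ≤ f) : potential B f' ≤ potential B f := by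
  unfold potential; split_ifs <;> omega

/-- The state of a virtual machine is moderate: `L` bounds the sizes of the parameters, `B` the sizes of
the memory cells, and `Fm` the fuel. -/
structure Moderate (L B Fm : ℕ) (σ : State) : Prop where
  zero : σ.reg 0 = 0
  one : σ.reg 1 = 1
  params : ∀ x ∈ ({3, 7, 31, 32, 33, 34} : Finset ℕ), (σ.reg x).size ≤ L
  fuel : σ.reg 35 ≤ Fm
  cells : ∀ v, 10 ≤ v → ∀ i, (σ.arr v i).size ≤ B

theorem Moderate.of_eq {L B Fm : ℕ} (h : Moderate L B Fm σ)
    (hr : ∀ x, x < 35 → σ'.reg x = σ.reg x) (hF : σ'.reg 35 ≤ Fm)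
    (ha : ∀ v, 10 ≤ v → ∀ i, (σ'.arr v i).size ≤ B) : Moderate L B Fm σ' where
  zero := (hr 0 (by decide)).trans h.zero
  one := (hr 1 (by decide)).trans h.one
  params x hx := by
    rw [hr x (by simp at hx; omega)]; exact h.params x hx
  fuel := hF
  cells := ha

theorem Moderate.layerSize_le {L B Fm : ℕ} (h : Moderate L B Fm σ) (v : ℕ) :
    σ.layerSize v ≤ 1 + 3 * L := by
  have h7 := h.params 7 (by decide)
  have ht : (σ.reg (topLayer v)).size ≤ L := by
    rcases topLayer_cases v with e | e <;> rw [e]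
    · exact h.params 33 (by decide)
    · exact h.params 31 (by decide)
  have hl : (σ.reg (lowLayer v)).size ≤ L := by
    rcases lowLayer_cases v with e | e <;> rw [e]
    · rw [h.zero]; simp
    · exact h.params 32 (by decide)
  unfold State.layerSize; omega

theorem Moderate.virt_le {L B Fm : ℕ} (h : Moderate L B Fm σ) {v : ℕ} (hv : 10 ≤ v)
    (i : ℕ) : (σ.virt v i).size ≤ B := by
  unfold State.virt; split_ifs
  all_goals exact (size_sub_le _ _).trans (h.cells v hv _)

/-- `p` started in a moderate state halts in a moderate state, does not increase the fuel,
changes only memory cells of the current layers, and is paid by the potential. -/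
def Paid (ω : ℕ → Bool) (L B Fm c : ℕ) (p : Program) : Prop :=
  ∀ σ T, Moderate L B Fm σ → wp ω p (fun σ' T' =>
    (∀ x, x < 35 → σ'.reg x = σ.reg x) ∧ σ'.reg 35 ≤ σ.reg 35 ∧
    T' + c * L * potential B (σ'.reg 35) ≤ T + c * L * (potential B (σ.reg 35) + 1) ∧
    (∀ v, 10 ≤ v → ∀ i, (σ'.arr v i).size ≤ B) ∧
    ∀ v i, σ'.arr v i ≠ σ.arr v i → ∃ j, i = j * σ.reg 7 + σ.reg (topLayer v)) σ T

/-- With operands of sizes x and y an instruction costs O((x + y + 1) * L). If fuel is left after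
the payment, the deduction was at least of order x + y + 1 and pays; moreover x and y were at most
the fuel, so the result fits into the bound `B`. If the fuel is used up, x and y are at most `B`,
and the summand `B` of the potential pays, once and for all. -/
theorem paid_instr {L B Fm w : ℕ} (hB : 2 * Fm + 2 + w ≤ B) (hL : B.size + 3 ≤ L)
    {fetch step : Program} {v : ℕ} (hv : 10 ≤ v) (hi : i = 0 ∨ i = 36)
    (hfetch : ∀ σ T Q, Moderate L B Fm σ → (∀ σ₁, σ₁.arr = σ.arr →
      (∀ x, x ≠ 36 → x ≠ 37 → x ≠ 39 → σ₁.reg x = σ.reg x) →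
      (σ₁.reg 36).size ≤ B → (σ₁.reg 37).size ≤ B →
      Q σ₁ (T + 300 * ((σ₁.reg 36).size + (σ₁.reg 37).size + L))) → wp ω fetch Q σ T)
    (hcalc : ∀ σ T Q, Moderate L B Fm σ → (∀ σ₁, σ₁.arr = σ.arr →
      (∀ x, x ≠ 38 → σ₁.reg x = σ.reg x) →
      (σ₁.reg 38).size ≤ (σ.reg 36).size + (σ.reg 37).size + 1 + w →
      Q σ₁ (T + 50 * ((σ.reg 36).size + (σ.reg 37).size + L + 1 + w))) → wp ω step Q σ T) :
    Paid ω L B Fm (4000 * (1 + w)) (basic fetch (step ;; vstore v i 38)) := by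
  intro σ T hσ
  have hF0 : (σ.reg 35).size ≤ L :=
    (size_le_of_le (hσ.fuel.trans (by omega))).trans (by omega : B.size ≤ L)
  have hL3 : 3 ≤ L := by omega
  have hcL : 2 ≤ 4000 * (1 + w) * L := calc 2 ≤ 4000 * 1 * 1 := by norm_num
      _ ≤ 4000 * (1 + w) * L := Nat.mul_le_mul (Nat.mul_le_mul_left _ (by omega)) (by omega)
  refine wp_basic (fun h0 => ⟨fun _ _ => rfl, le_rfl, ?_, hσ.cells, fun v i h => absurd rfl h⟩) ?_
  · rw [Nat.mul_add (4000 * (1 + w) * L)]; omega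
  intro hF; refine hfetch _ _ _ hσ ?_; intro σ₁ ha₁ hr₁ hx hy
  refine ⟨by rw [hr₁ 1 (by decide) (by decide) (by decide), hσ.one],
    hr₁ 35 (by decide) (by decide) (by decide), ?_⟩
  intro k σ₂ hk hk' ha₂ hr₂ hF₂
  have hsx : (σ₁.reg 36).size ≤ (σ₁.reg 36 + σ₁.reg 37).size := size_le_of_le (by omega)
  have hsy : (σ₁.reg 37).size ≤ (σ₁.reg 36 + σ₁.reg 37).size := size_le_of_le (by omega)
  generalize hx' : (σ₁.reg 36).size = x at *
  generalize hy' : (σ₁.reg 37).size = y at *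
  have e36 : σ₂.reg 36 = σ₁.reg 36 := hr₂ 36 (by decide)
  have e37 : σ₂.reg 37 = σ₁.reg 37 := hr₂ 37 (by decide)
  have low₂ : ∀ x, x < 35 → σ₂.reg x = σ.reg x := fun z hz => by
    rw [hr₂ z (by simp; omega), hr₁ z (by omega) (by omega) (by omega)]
  have hm₂ : Moderate L B Fm σ₂ := hσ.of_eq low₂ (by have := hσ.fuel; omega)
    (by rw [ha₂, ha₁]; exact hσ.cells)
  -- the total cost in terms of the operands
  have hpay : payTime (σ₁.reg 36) (σ₁.reg 37) (σ.reg 35) ≤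
      200 * ((x + y + 1) * (L + 2)) + 10 * L + 10 := by
    have h1 : (x + y + 1).size ≤ L := by
      have h2 : (x + y + 1).size ≤ (2 * B + 1).size := size_le_of_le (by omega)
      have h5 : (2 * B + 1).size ≤ B.size + 3 := by
        rw [Nat.size_le]; have := Nat.lt_size_self B; rw [pow_add]; omega
      omega
    have := Nat.mul_le_mul_left (x + y + 1) (Nat.add_le_add_right h1 2); simp only [payTime, hx', hy']
    omega
  have hX : (x + y + 1) * (L + 2) ≤ 2 * ((x + y + 1) * L) := by
    rw [mul_left_comm]; exact Nat.mul_le_mul_left _ (by omega)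
  have hXA : x + y + L ≤ (x + y + 1) * L := by
    have : (x + y) * 1 ≤ (x + y) * L := Nat.mul_le_mul_left _ (by omega); rw [add_mul]; omega
  have hAk : x + y + 1 ≤ 2 * (k + 1) := by omega
  constructor
  · intro hF₂'; have hkF : k + 2 ≤ σ.reg 35 := by omega
    have hFm := hσ.fuel; refine wp_seq (hcalc _ _ _ hm₂ ?_); intro σ₃ ha₃ hr₃ hz
    rw [e36, e37, hx', hy'] at hz
    have low₃ : ∀ x, x < 35 → σ₃.reg x = σ.reg x := fun z hz => by
      rw [hr₃ z (by omega), low₂ z hz]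
    have hm₃ : Moderate L B Fm σ₃ := hσ.of_eq low₃ (by rw [hr₃ 35 (by decide)]; omega)
      (by rw [ha₃, ha₂, ha₁]; exact hσ.cells)
    refine wp_slack (wp_vstore (by omega) (by decide) hm₃.one ?_); intro σ₄ ha₄ hr₄
    have hF₄ : σ₄.reg 35 = σ.reg 35 - k - 1 := by
      rw [hr₄ 35 (by decide) (by decide), hr₃ 35 (by decide), hF₂]
    have hii : (σ₃.reg i).size ≤ x := by
      rcases hi with rfl | rfl
      · rw [hm₃.zero]; simp
      · rw [hr₃ 36 (by decide), e36, hx']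
    have hls := hm₃.layerSize_le v
    have htop : σ₃.reg 7 = σ.reg 7 ∧ σ₃.reg (topLayer v) = σ.reg (topLayer v) :=
      ⟨low₃ 7 (by decide), low₃ _ (by rcases topLayer_cases v with h | h <;> omega)⟩
    have hcell : ∀ v' j, σ₄.arr v' j ≠ σ.arr v' j → v' = v ∧
        j = σ₃.reg i * σ.reg 7 + σ.reg (topLayer v) ∧ σ₄.arr v' j = σ₃.reg 38 + 1 := by
      intro v' j hne; rw [ha₄, State.arr_setArr_apply, ha₃, ha₂, ha₁, htop.1, htop.2] at hne ⊢
      split_ifs at hne ⊢ with h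
      · exact ⟨h.1, h.2, rfl⟩
      · exact absurd rfl hne
    have hw : (1 + w) * ((x + y + 1) * L) = (x + y + 1) * L + w * ((x + y + 1) * L) := by ring
    have hw2 : w ≤ w * ((x + y + 1) * L) := Nat.le_mul_of_pos_right _ (by
      have : 1 ≤ (x + y + 1) * L := by omega
      omega)
    refine ⟨T + 2000 * (1 + w) * ((x + y + 1) * L), ?_, fun z hz => ?_, ?_, ?_, ?_, ?_⟩
    · rw [mul_assoc, hw, e36, e37, hx', hy']; omega
    · rw [hr₄ z (by omega) (by omega), low₃ z hz]
    · omega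
    -- The drop of the potential is the deduction `k + 1`, and `x + y + 1 ≤ 2 * (k + 1)`.
    · have hd : potential B (σ₄.reg 35) + (k + 1) = potential B (σ.reg 35) := by
        unfold potential; rw [if_neg (by omega), if_neg hF]; omega
      rw [← hd]; have h6 : (x + y + 1) * L ≤ 2 * (k + 1) * L := Nat.mul_le_mul_right _ hAk
      have h7 : 2000 * (1 + w) * ((x + y + 1) * L) ≤ 2000 * (1 + w) * (2 * (k + 1) * L) :=
        Nat.mul_le_mul_left _ h6
      have h8 : 4000 * (1 + w) * L * (potential B (σ₄.reg 35) + (k + 1) + 1) =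
        4000 * (1 + w) * L * potential B (σ₄.reg 35) + 2000 * (1 + w) * (2 * (k + 1) * L)
          + 4000 * (1 + w) * L := by ring
      omega
    · intro v' hv' j
      by_cases hne : σ₄.arr v' j = σ.arr v' j
      · rw [hne]; exact hσ.cells v' hv' j
      · rw [(hcell v' j hne).2.2]; have := size_add_le' (σ₃.reg 38) 1; have := size_add_le (σ₃.reg 38) 1
        have z1 : (1 : ℕ).size = 1 := by simp
        omega
    · intro v' j hne; obtain ⟨rfl, rfl, -⟩ := hcell v' j hne; exact ⟨_, rfl⟩
  -- The fuel has run out: operands of size at most `B` were fetched in vain, at the expense of the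
  -- summand `B` of the potential.
  · intro hF₂'; refine ⟨low₂, by omega, ?_, hm₂.cells, fun v' j hne => absurd (by rw [ha₂, ha₁]) hne⟩
    have h9 : potential B (σ₂.reg 35) = 0 := by rw [hF₂']; rfl
    have h10 : potential B (σ.reg 35) = σ.reg 35 + B := by unfold potential; rw [if_neg hF]
    rw [h9, h10]; have h6 : (x + y + 1) * L ≤ 2 * (σ.reg 35 + B) * L := Nat.mul_le_mul_right _ (by omega)
    have h7 : 2000 * (1 + w) * ((x + y + 1) * L) ≤ 2000 * (1 + w) * (2 * (σ.reg 35 + B) * L) :=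
      Nat.mul_le_mul_left _ h6
    have h8 : 4000 * (1 + w) * L * (σ.reg 35 + B + 1) =
        2000 * (1 + w) * (2 * (σ.reg 35 + B) * L) + 4000 * (1 + w) * L := by ring
    have h11 : 2000 * ((x + y + 1) * L) ≤ 2000 * (1 + w) * ((x + y + 1) * L) :=
      Nat.mul_le_mul_right _ (by omega)
    omega

/-- A non-zero result is possible only if fuel was available and some of it was consumed. This makes
simulated loops terminate, and in this case the bound has room for reading register `43` in the
branch or loop that follows. -/
theorem paid_testReg {L B Fm : ℕ} (hB : 2 * Fm + 2 ≤ B) (hL : B.size + 3 ≤ L)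
    (x : ℕ) (σ : State) (T : ℕ) (hσ : Moderate L B Fm σ) : wp ω (testReg x) (fun σ' T' =>
      (∀ x, x < 35 → σ'.reg x = σ.reg x) ∧ σ'.arr = σ.arr ∧ σ'.reg 35 ≤ σ.reg 35 ∧
      T' + 4000 * L * potential B (σ'.reg 35) ≤ T + 4000 * L * (potential B (σ.reg 35) + 1) ∧
      (σ'.reg 43).size ≤ B ∧
      (σ'.reg 43 ≠ 0 → T' + 4000 * L * potential B (σ'.reg 35) + (σ'.reg 43).size + 1 ≤
        T + 4000 * L * (potential B (σ.reg 35) + 1) ∧ σ'.reg 35 < σ.reg 35)) σ T := by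
  have hF0 : (σ.reg 35).size ≤ L :=
    (size_le_of_le (hσ.fuel.trans (by omega))).trans (by omega : B.size ≤ L)
  refine wp_seq (wp_const ?_)
  have lowT : ∀ x, x < 35 → (σ.setReg 43 0).reg x = σ.reg x := fun y hy => by
    simp; omega
  refine wp_basic (fun h0 => ⟨lowT, rfl, by simp, ?_, by simp, fun h => absurd (by simp) h⟩) ?_
  · simp only [State.reg_setReg, (by decide : (35:ℕ) ≠ 43), if_false, Nat.size_zero]
    rw [Nat.mul_add (4000 * L)]; omega
  intro hF; refine wp_seq (wp_vload (Or.inl rfl) (Or.inl rfl) (by simp [hσ.one]) ?_)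
  intro σ₁ ha₁ hr₁ hv₁; refine wp_const ⟨?_, ?_, ?_⟩
  · simp [hr₁ 1 (by decide) (by decide), hσ.one]
  · simp [hr₁ 35 (by decide) (by decide)]
  intro k σ₂ hk hk' ha₂ hr₂ hF₂
  have hls : (σ.setReg 43 0).layerSize (10 + 2 * x) ≤ 1 + 3 * L :=
    (hσ.of_eq (σ' := σ.setReg 43 0) lowT (by simpa using hσ.fuel)
      (by simpa using hσ.cells)).layerSize_le _
  have hvl : ((σ.setReg 43 0).virt (10 + 2 * x) ((σ.setReg 43 0).reg 0)).size ≤ B :=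
    (hσ.of_eq (σ' := σ.setReg 43 0) lowT (by simpa using hσ.fuel)
      (by simpa using hσ.cells)).virt_le (by omega) _
  simp only [State.reg_setReg, if_true, (by decide : (36 : ℕ) ≠ 37), if_false, add_zero] at hk hk' hF₂ ⊢
  simp only [State.reg_setReg, (by decide : (35 : ℕ) ≠ 43), if_false] at hF₂ hF ⊢
  have e36 : σ₂.reg 36 = σ₁.reg 36 := by rw [hr₂ 36 (by decide)]; simp
  have e0 : σ₂.reg 0 = 0 := by
    rw [hr₂ 0 (by decide)]; simp [hr₁ 0 (by decide) (by decide), hσ.zero]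
  have e43 : σ₂.reg 43 = 0 := by
    rw [hr₂ 43 (by decide)]; simp [hr₁ 43 (by decide) (by decide)]
  have e00 : (σ.setReg 43 0).reg 0 = 0 := by simp [hσ.zero]
  rw [e00] at hv₁ hvl; rw [show (if (0 : ℕ) = 43 then 0 else σ.reg 0) = 0 by simp [hσ.zero]]
  rw [← hv₁] at hvl ⊢
  generalize hxx : (σ₁.reg 36).size = a at *
  have low₂ : ∀ x, x < 35 → σ₂.reg x = σ.reg x := fun z hz => by
    rw [hr₂ z (by simp; omega)]
    rw [State.reg_setReg, if_neg (by omega), hr₁ z (by omega) (by omega), lowT z hz]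
  have hpay : payTime (σ₁.reg 36) 0 (σ.reg 35) ≤ 200 * ((a + 1) * (L + 2)) + 10 * L + 10 := by
    have h1 : (a + 1).size ≤ L := by
      have h2 : (a + 1).size ≤ (B + 1).size := size_le_of_le (by omega); have h3 := size_add_le' B 1
      have z1 : (1 : ℕ).size = 1 := by simp
      omega
    have := Nat.mul_le_mul_left (a + 1) (Nat.add_le_add_right h1 2)
    simp only [payTime, hxx, Nat.size_zero, add_zero]; omega
  have hX : (a + 1) * (L + 2) ≤ 2 * ((a + 1) * L) := by
    rw [mul_left_comm]; exact Nat.mul_le_mul_left _ (by omega)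
  have hXA : a + L ≤ (a + 1) * L := by
    have : a * 1 ≤ a * L := Nat.mul_le_mul_left _ (by omega); rw [add_mul]; omega
  have z0 : (0 : ℕ).size = 0 := by simp
  constructor
  · intro hF₂'
    refine wp_slack (wp_arith ⟨T + 1000 * ((a + 1) * L), ?_, fun z hz => ?_, ?_, ?_, ?_, ?_, ?_⟩)
    · simp only [e36, e0, z0, hxx]; omega
    · rw [State.reg_setReg, if_neg (by omega), low₂ z hz]
    · simp [ha₂, ha₁]
    · simp only [State.reg_setReg, (by decide : (35 : ℕ) ≠ 43), if_false]; omega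
    all_goals
      simp only [State.reg_setReg, (by decide : (35 : ℕ) ≠ 43), if_false, if_true, BinOp.eval, e0,
        e36, hxx, add_zero]
      have hd : potential B (σ₂.reg 35) + (k + 1) = potential B (σ.reg 35) := by
        unfold potential; rw [if_neg (by omega), if_neg hF]; omega
      have h6 : (a + 1) * L ≤ 2 * (k + 1) * L := Nat.mul_le_mul_right _ (by omega)
      have h8 : 4000 * L * (potential B (σ₂.reg 35) + (k + 1) + 1) =
        4000 * L * potential B (σ₂.reg 35) + 2000 * (2 * (k + 1) * L) + 4000 * L := by ring
    · rw [← hd]; omega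
    · exact hvl
    · intro _; rw [← hd]; constructor <;> omega
  · intro hF₂'
    refine ⟨low₂, by rw [ha₂]; simp [ha₁], by omega, ?_, by simp [e43], fun h => absurd e43 h⟩
    have h9 : potential B (σ₂.reg 35) = 0 := by rw [hF₂']; rfl
    have h10 : potential B (σ.reg 35) = σ.reg 35 + B := by unfold potential; rw [if_neg hF]
    rw [h9, h10]; have h6 : (a + 1) * L ≤ 2 * (σ.reg 35 + B) * L := Nat.mul_le_mul_right _ (by omega)
    have h8 : 4000 * L * (σ.reg 35 + B + 1) = 2000 * (2 * (σ.reg 35 + B) * L) + 4000 * L := by ring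
    simp only [z0]; omega

/-- The conclusion of `Paid` with a separate additive error `e`, so that it composes transitively
with errors added up. -/
def PaidRel (L B c e : ℕ) (σ : State) (T : ℕ) (σ' : State) (T' : ℕ) : Prop :=
  (∀ x, x < 35 → σ'.reg x = σ.reg x) ∧ σ'.reg 35 ≤ σ.reg 35 ∧
    T' + c * L * potential B (σ'.reg 35) ≤ T + c * L * potential B (σ.reg 35) + e ∧
    (∀ v, 10 ≤ v → ∀ i, (σ'.arr v i).size ≤ B) ∧
    ∀ v i, σ'.arr v i ≠ σ.arr v i → ∃ j, i = j * σ.reg 7 + σ.reg (topLayer v)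

theorem paid_iff {L B Fm c : ℕ} : Paid ω L B Fm c p ↔
    ∀ σ T, Moderate L B Fm σ → wp ω p (PaidRel L B c (c * L) σ T) σ T := by
  simp only [Paid, Nat.mul_add, mul_one, ← add_assoc]; rfl

theorem PaidRel.mono {L B c c' e' : ℕ} {T' : ℕ}
    (h : PaidRel L B c e σ T σ' T') (hc : c ≤ c') (he : e ≤ e') :
    PaidRel L B c' e' σ T σ' T' := by
  obtain ⟨h1, h2, h3, h4⟩ := h; refine ⟨h1, h2, ?_, h4⟩; obtain ⟨d, rfl⟩ := Nat.exists_eq_add_of_le hc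
  have := Nat.mul_le_mul_left (d * L) (potential_mono (B := B) h2); rw [add_mul c d L, add_mul, add_mul]
  omega

theorem PaidRel.trans {L B c e₁ e₂ : ℕ} {σ₁ σ₂ : State} {T₁ T₂ : ℕ}
    (h : PaidRel L B c e₁ σ T σ₁ T₁) (h' : PaidRel L B c e₂ σ₁ T₁ σ₂ T₂) :
    PaidRel L B c (e₁ + e₂) σ T σ₂ T₂ := by
  obtain ⟨a1, a2, a3, a4, a5⟩ := h; obtain ⟨b1, b2, b3, b4, b5⟩ := h'
  refine ⟨fun x hx => by rw [b1 x hx, a1 x hx], b2.trans a2, by omega, b4, fun v i hne => ?_⟩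
  by_cases h1 : σ₁.arr v i = σ.arr v i
  · rw [← h1] at hne; obtain ⟨j, hj⟩ := b5 v i hne
    exact ⟨j, by rw [hj, a1 7 (by decide), a1 _ (by rcases topLayer_cases v with h | h <;> omega)]⟩
  · exact a5 v i h1

theorem PaidRel.moderate {L B c Fm : ℕ} {T' : ℕ}
    (h : PaidRel L B c e σ T σ' T') (hσ : Moderate L B Fm σ) : Moderate L B Fm σ' :=
  hσ.of_eq h.1 (h.2.1.trans hσ.fuel) h.2.2.2.1

/-- The greatest size of a constant of a program. -/
def Program.constSize : Program → ℕ
  | .const _ c => c.size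
  | .seq p q => max p.constSize q.constSize
  | .cond _ p q => max p.constSize q.constSize
  | .loop _ p => p.constSize
  | _ => 0

/-- The factor by which the simulation of a program is slower. -/
def Program.slowdown : Program → ℕ
  | .skip => 1
  | .const _ c => 4000 * (1 + c.size)
  | .seq p q => p.slowdown + q.slowdown
  | .cond _ p q => 4001 + p.slowdown + q.slowdown
  | .loop _ p => 2 * (4001 + p.slowdown)
  | _ => 4000

/-- Nothing is assumed about the simulated program; it may even diverge. Straight-line parts are
paid instruction by instruction, and each further iteration of a loop consumes fuel, so the
simulation halts at the latest when the fuel is gone. -/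
theorem paid_simulate {L B Fm : ℕ} (hL : B.size + 3 ≤ L) (p : Program)
    (hB : 2 * Fm + 2 + p.constSize ≤ B) : Paid ω L B Fm p.slowdown (simulate p) := by
  have z0 : (0 : ℕ).size = 0 := by simp
  have z1 : (1 : ℕ).size = 1 := by simp
  have hL3 : 3 ≤ L := by omega
  have load1 : ∀ (x : ℕ) (σ : State) (T : ℕ) (Q : State → ℕ → Prop), Moderate L B Fm σ →
      (∀ σ₁, σ₁.arr = σ.arr → (∀ x, x ≠ 36 → x ≠ 37 → x ≠ 39 → σ₁.reg x = σ.reg x) →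
      (σ₁.reg 36).size ≤ B → (σ₁.reg 37).size ≤ B →
      Q σ₁ (T + 300 * ((σ₁.reg 36).size + (σ₁.reg 37).size + L))) →
      wp ω (vload 36 (10 + 2 * x) 0 ;; .const 37 0) Q σ T := by
    intro x σ T Q hσ hQ; refine wp_slack (wp_seq (wp_vload (.inl rfl) (.inl rfl) hσ.one ?_))
    intro σ₁ ha hr hv; have h1 := hσ.layerSize_le (10 + 2 * x)
    have h2 := hσ.virt_le (v := 10 + 2 * x) (by omega) (σ.reg 0); rw [← hv] at h2 ⊢
    refine wp_const ⟨_, ?_, hQ _ (by simpa using ha) (fun y h36 h37 h39 => ?_) ?_ ?_⟩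
    · simp [hσ.zero]; omega
    · simp [h37, hr y h36 h39]
    · simpa using h2
    · simp
  have load2 : ∀ (x v i : ℕ), 10 ≤ v → i = 0 ∨ i = 36 → ∀ (σ : State) (T : ℕ)
      (Q : State → ℕ → Prop), Moderate L B Fm σ →
      (∀ σ₁, σ₁.arr = σ.arr → (∀ x, x ≠ 36 → x ≠ 37 → x ≠ 39 → σ₁.reg x = σ.reg x) →
      (σ₁.reg 36).size ≤ B → (σ₁.reg 37).size ≤ B →
      Q σ₁ (T + 300 * ((σ₁.reg 36).size + (σ₁.reg 37).size + L))) →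
      wp ω (vload 36 (10 + 2 * x) 0 ;; vload 37 v i) Q σ T := by
    intro x v i hv10 hi σ T Q hσ hQ; refine wp_slack (wp_seq (wp_vload (.inl rfl) (.inl rfl) hσ.one ?_))
    intro σ₁ ha hr hv; have h1 := hσ.layerSize_le (10 + 2 * x)
    have h2 := hσ.virt_le (v := 10 + 2 * x) (by omega) (σ.reg 0); rw [← hv] at h2 ⊢
    have hσ₁ : Moderate L B Fm σ₁ := hσ.of_eq (fun y hy => hr y (by omega) (by omega))
      (by rw [hr 35 (by decide) (by decide)]; exact hσ.fuel) (by rw [ha]; exact hσ.cells)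
    refine wp_vload (.inr rfl) (by tauto) hσ₁.one ?_; intro σ₂ ha₂ hr₂ hv₂; have h3 := hσ₁.layerSize_le v
    have h4 := hσ₁.virt_le (v := v) hv10 (σ₁.reg i)
    have h5 : (σ₁.reg i).size ≤ (σ₁.reg 36).size := by
      rcases hi with rfl | rfl
      · rw [hσ₁.zero]; simp
      · rfl
    rw [← hv₂] at h4 ⊢; refine ⟨_, ?_, hQ _ (by rw [ha₂, ha]) (fun y h36 h37 h39 => ?_) ?_ h4⟩
    · rw [hr₂ 36 (by decide) (by decide), hσ.zero, z0]; omega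
    · rw [hr₂ y h37 h39, hr y h36 h39]
    · rw [hr₂ 36 (by decide) (by decide)]; exact h2
  have move : ∀ (σ : State) (T : ℕ) (Q : State → ℕ → Prop), Moderate L B Fm σ →
      (∀ σ₁, σ₁.arr = σ.arr → (∀ x, x ≠ 38 → σ₁.reg x = σ.reg x) →
      (σ₁.reg 38).size ≤ (σ.reg 36).size + (σ.reg 37).size + 1 + 0 →
      Q σ₁ (T + 50 * ((σ.reg 36).size + (σ.reg 37).size + L + 1 + 0))) →
      wp ω (.arith .plus 38 37 0) Q σ T := by
    intro σ T Q hσ hQ; refine wp_slack (wp_arith ⟨_, ?_, hQ _ rfl (fun y hy => by simp [hy]) ?_⟩)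
    · rw [hσ.zero, z0]; omega
    · simp [BinOp.eval, hσ.zero]; omega
  induction p with
  | skip =>
    refine fun σ T hσ => wp_skip ⟨fun _ _ => rfl, le_rfl, ?_, hσ.cells, fun v i h => absurd rfl h⟩
    simp only [Program.slowdown, one_mul, Nat.mul_add, mul_one]; omega
  | const x c =>
    refine paid_instr (w := c.size) hB hL (by omega) (.inl rfl) ?_ ?_
    · intro σ T Q hσ hQ
      refine wp_slack (wp_seq (wp_const (wp_const ⟨_, ?_, hQ _ rfl (fun y h h' _ => by
        simp [h, h']) (by simp) (by simp)⟩)))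
      simp; omega
    · intro σ T Q hσ hQ; refine wp_slack (wp_const ⟨_, ?_, hQ _ rfl (fun y h => by simp [h]) (by simp)⟩)
      omega
  | arith o x y z =>
    refine paid_instr (w := 0) hB hL (by omega) (.inl rfl)
      (load2 y (10 + 2 * z) 0 (by omega) (.inl rfl)) ?_
    intro σ T Q hσ hQ; have := size_eval_le o (σ.reg 36) (σ.reg 37)
    refine wp_slack (wp_arith ⟨_, ?_, hQ _ rfl (fun y h => by simp [h]) (by simp; omega)⟩); omega
  | load b x y =>
    exact paid_instr (w := 0) hB hL (by omega) (.inl rfl)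
      (load2 y (11 + 2 * b) 36 (by omega) (.inr rfl)) move
  | store b x y =>
    exact paid_instr (w := 0) hB hL (by omega) (.inr rfl)
      (load2 x (10 + 2 * y) 0 (by omega) (.inl rfl)) move
  | random x y =>
    refine paid_instr (w := 0) hB hL (by omega) (.inl rfl) (load1 y) ?_; intro σ T Q hσ hQ
    have h3 := hσ.params 3 (by decide); have h34 := hσ.params 34 (by decide)
    have e1 := size_mul_le (σ.reg 36) (σ.reg 3); have e2 := size_add_le (σ.reg 36 * σ.reg 3) (σ.reg 34)
    refine wp_slack (wp_seq (wp_arith (wp_seq (wp_arith (wp_random ⟨_, ?_,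
      hQ _ rfl (fun y h => by simp [h]) ?_⟩)))))
    · simp [BinOp.eval]; omega
    · have := size_toNat_le (ω (σ.reg 36 * σ.reg 3 + σ.reg 34)); simp [BinOp.eval]; omega
  | seq p q ihp ihq =>
    simp only [Program.constSize] at hB; have hp := paid_iff.1 (ihp (by omega))
    have hq := paid_iff.1 (ihq (by omega))
    refine paid_iff.2 fun σ T hσ => wp_seq (wp_mono (hp σ T hσ) fun σ₁ T₁ _ h₁ => ?_)
    refine wp_mono (hq σ₁ T₁ (h₁.moderate hσ)) fun σ₂ T₂ _ h₂ => ?_; simp only [Program.slowdown]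
    refine ((h₁.mono (by omega) le_rfl).trans (h₂.mono (by omega) le_rfl)).mono le_rfl ?_; rw [add_mul]
  | cond x p q ihp ihq =>
    simp only [Program.constSize] at hB; have hp := paid_iff.1 (ihp (by omega))
    have hq := paid_iff.1 (ihq (by omega))
    refine paid_iff.2 fun σ T hσ => wp_seq (wp_mono
      (paid_testReg (by omega) hL x σ T hσ) fun σ₁ T₁ _ h₁ => ?_)
    obtain ⟨a1, a2, a3, a4, a5, a6⟩ := h₁
    have hr : ∀ e, T₁ + e + 4000 * L * potential B (σ₁.reg 35) ≤
        T + 4000 * L * (potential B (σ.reg 35) + 1) + L →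
        PaidRel L B 4000 (4001 * L) σ T σ₁ (T₁ + e) := fun e he =>
      ⟨a1, a3, by rw [Nat.mul_add] at he; omega, by rw [a2]; exact hσ.cells,
        fun v i hne => absurd (by rw [a2]) hne⟩
    have hw : ∀ c₁ c₂ : ℕ, (4001 + c₁ + c₂) * L = 4001 * L + c₁ * L + c₂ * L := by
      intros; ring
    refine wp_cond (fun h43 => ?_) (fun h43 => ?_)
    · have h := hr (1 + (σ₁.reg 43).size) (by have := (a6 h43).1; omega)
      refine wp_mono (hp σ₁ _ (h.moderate hσ)) fun σ₂ T₂ _ h₂ => ?_; simp only [Program.slowdown]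
      refine ((h.mono (by omega) le_rfl).trans (h₂.mono (by omega) le_rfl)).mono le_rfl ?_
      rw [hw]; omega
    · have h := hr 1 (by omega); refine wp_mono (hq σ₁ _ (h.moderate hσ)) fun σ₂ T₂ _ h₂ => ?_
      simp only [Program.slowdown]
      refine ((h.mono (by omega) le_rfl).trans (h₂.mono (by omega) le_rfl)).mono le_rfl ?_
      rw [hw]; omega
  | loop x p ihp =>
    simp only [Program.constSize] at hB; have hp := paid_iff.1 (ihp (by omega))
    simp only [Program.slowdown, simulate]
    generalize p.slowdown = c at hp ⊢
    -- Strong induction on the fuel: the loop goes on only after a test that has consumed some.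
    have key : ∀ f σ T, σ.reg 35 = f → Moderate L B Fm σ → σ.reg 43 ≠ 0 →
        wp ω (.loop 43 (simulate p ;; testReg x))
          (PaidRel L B (2 * (4001 + c)) ((4001 + c) * L) σ (T + (1 + (σ.reg 43).size))) σ T := by
      intro f
      induction f using Nat.strong_induction_on with
      | _ f ih =>
      intro σ T hf hσ h43; refine wp_loop_pos h43 (wp_seq (wp_mono (hp σ _ hσ) fun σ₁ T₁ _ h₁ => ?_))
      have hσ₁ := h₁.moderate hσ
      refine wp_mono (paid_testReg (by omega) hL x σ₁ T₁ hσ₁) fun σ₂ T₂ _ h₂ => ?_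
      obtain ⟨a1, a2, a3, a4, a5, a6⟩ := h₂
      have hr : ∀ e, T₂ + e + 4000 * L * potential B (σ₂.reg 35) ≤
          T₁ + 4000 * L * (potential B (σ₁.reg 35) + 1) + L →
          PaidRel L B 4000 (4001 * L) σ₁ T₁ σ₂ (T₂ + e) := fun e he =>
        ⟨a1, a3, by rw [Nat.mul_add] at he; omega, by rw [a2]; exact hσ₁.cells,
          fun v i hne => absurd (by rw [a2]) hne⟩
      by_cases h0 : σ₂.reg 43 = 0
      · have h := hr 1 (by omega); refine wp_loop_zero h0 ?_
        refine ((h₁.mono (by omega) le_rfl).trans (h.mono (by omega) le_rfl)).mono le_rfl ?_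
        rw [add_mul]; omega
      · have h := hr (1 + (σ₂.reg 43).size) (by have := (a6 h0).1; omega); have hlt := (a6 h0).2
        have h12 := (h₁.mono (c' := 4001 + c) (by omega) le_rfl).trans
          (h.mono (by omega) le_rfl)
        refine wp_mono (ih (σ₂.reg 35) (by have := h₁.2.1; omega) σ₂ T₂ rfl (h12.moderate hσ) h0)
          fun σ₃ T₃ _ h₃ => ?_
        -- The rate is twice what body and test require. As the potential drops by at least one per
        -- iteration, the second half absorbs the additive cost of the iteration, and errors do not
        -- accumulate over the loop.
        have hz : PaidRel L B (2 * (4001 + c)) 0 σ (T + (1 + (σ.reg 43).size)) σ₂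
            (T₂ + (1 + (σ₂.reg 43).size)) := by
          obtain ⟨b1, b2, b3, b4⟩ := h12; refine ⟨b1, b2, ?_, b4⟩
          have hpot : potential B (σ₂.reg 35) + 1 ≤ potential B (σ.reg 35) := by
            have := h₁.2.1; unfold potential; split_ifs <;> omega
          have h5 := Nat.mul_le_mul_left ((4001 + c) * L) hpot; rw [Nat.mul_add] at h5
          have h6 : ∀ y, 2 * (4001 + c) * L * y = (4001 + c) * L * y + (4001 + c) * L * y := by
            intro; ring
          have h7 : (4001 + c) * L = 4001 * L + c * L := by ring
          rw [h6, h6]; omega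
        exact (hz.trans h₃).mono le_rfl (by omega)
    refine paid_iff.2 fun σ T hσ => wp_seq (wp_mono
      (paid_testReg (by omega) hL x σ T hσ) fun σ₁ T₁ _ h₁ => ?_)
    obtain ⟨a1, a2, a3, a4, a5, a6⟩ := h₁
    have hr : ∀ e, T₁ + e + 4000 * L * potential B (σ₁.reg 35) ≤
        T + 4000 * L * (potential B (σ.reg 35) + 1) + L →
        PaidRel L B 4000 (4001 * L) σ T σ₁ (T₁ + e) := fun e he =>
      ⟨a1, a3, by rw [Nat.mul_add] at he; omega, by rw [a2]; exact hσ.cells,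
        fun v i hne => absurd (by rw [a2]) hne⟩
    have hw : 2 * (4001 + c) * L = 4001 * L + (4001 + c) * L + c * L := by ring
    by_cases h0 : σ₁.reg 43 = 0
    · exact wp_loop_zero h0 ((hr 1 (by omega)).mono (by omega) (by omega))
    · have h := hr (1 + (σ₁.reg 43).size) (by have := (a6 h0).1; omega)
      refine wp_mono (key _ σ₁ T₁ rfl (h.moderate hσ) h0) fun σ₂ T₂ _ h₂ => ?_
      exact ((h.mono (by omega) le_rfl).trans h₂).mono le_rfl (by omega)

/-! ### Correctness of the simulation -/

/-- Layers below the stride make the address `i * S + z` determine both `i` and `z` (`mul_add_inj`).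
-/
structure Layered (σ : State) : Prop where
  zero : σ.reg 0 = 0
  one : σ.reg 1 = 1
  lt : ∀ x ∈ ({31, 32, 33} : Finset ℕ), σ.reg x < σ.reg 7

theorem Layered.of_eq (h : Layered σ) (hr : ∀ x, x < 35 → σ'.reg x = σ.reg x) : Layered σ' where
  zero := by rw [hr 0 (by decide), h.zero]
  one := by rw [hr 1 (by decide), h.one]
  lt x hx := by
    rw [hr x (by simp at hx; omega), hr 7 (by decide)]; exact h.lt x hx

theorem Layered.topLayer_lt (h : Layered σ) (v : ℕ) : σ.reg (topLayer v) < σ.reg 7 := by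
  rcases topLayer_cases v with e | e <;> rw [e] <;> exact h.lt _ (by decide)

theorem Layered.lowLayer_lt (h : Layered σ) (v : ℕ) : σ.reg (lowLayer v) < σ.reg 7 := by
  rcases lowLayer_cases v with e | e <;> rw [e]
  · rw [h.zero]; exact (Nat.zero_le _).trans_lt (h.lt 31 (by decide))
  · exact h.lt _ (by decide)

theorem mul_add_inj {S : ℕ} (hy : y < S) (hz : z < S) (h : i * S + y = j * S + z) : i = j ∧ y = z := by
  have h1 : (i * S + y) / S = i := by
    rw [mul_comm, Nat.mul_add_div (by omega), Nat.div_eq_of_lt hy, add_zero]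
  have h2 : (j * S + z) / S = j := by
    rw [mul_comm, Nat.mul_add_div (by omega), Nat.div_eq_of_lt hz, add_zero]
  have : i = j := by rw [← h1, ← h2, h]
  subst this; exact ⟨rfl, by omega⟩

theorem State.virt_congr {v : ℕ} (ha : σ'.arr v = σ.arr v)
    (hr : ∀ x, x < 35 → σ'.reg x = σ.reg x) (i : ℕ) : σ'.virt v i = σ.virt v i := by
  have h7 := hr 7 (by decide)
  have ht := hr (topLayer v) (by rcases topLayer_cases v with e | e <;> omega)
  have hl := hr (lowLayer v) (by rcases lowLayer_cases v with e | e <;> omega)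
  simp only [State.virt, ha, h7, ht, hl]

theorem virt_store {v : ℕ} (hσ : Layered σ) (hr : ∀ x, x < 35 → σ'.reg x = σ.reg x)
    (ha : σ'.arr = (σ.setArr v (j * σ.reg 7 + σ.reg (topLayer v)) (y + 1)).arr) (v' i : ℕ) :
    σ'.virt v' i = if v' = v ∧ i = j then y else σ.virt v' i := by
  have h7 := hr 7 (by decide)
  have ht := hr (topLayer v') (by rcases topLayer_cases v' with e | e <;> omega)
  have hl := hr (lowLayer v') (by rcases lowLayer_cases v' with e | e <;> omega)
  have ht' := hσ.topLayer_lt v; have hl' := hσ.lowLayer_lt v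
  by_cases hv : v' = v
  · subst hv; simp only [State.virt, h7, ht, hl, ha, State.arr_setArr_apply, true_and]
    by_cases hij : i = j
    · subst hij; simp
    · have n1 : i * σ.reg 7 + σ.reg (topLayer v') ≠ j * σ.reg 7 + σ.reg (topLayer v') :=
        fun h => hij (mul_add_inj ht' ht' h).1
      have n2 : i * σ.reg 7 + σ.reg (lowLayer v') ≠ j * σ.reg 7 + σ.reg (topLayer v') :=
        fun h => hij (mul_add_inj hl' ht' h).1
      simp only [n1, n2, hij, if_false]
  · rw [if_neg (fun h => hv h.1)]; exact State.virt_congr (by rw [ha, State.arr_setArr, if_neg hv]) hr i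

/-- The virtual memory of `σ` contains the state `τ`. -/
def Rep (σ τ : State) : Prop :=
  (∀ x, τ.reg x = σ.virt (10 + 2 * x) 0) ∧ ∀ b i, τ.arr b i = σ.virt (11 + 2 * b) i

/-- The charge is at most 2 * size(x₁ + x₂) + 2, hence at most four times the cost 1 + size x₁ +
size x₂ of the simulated instruction. This is the origin of the factor 4 in all fuel bounds. -/
theorem rep_instr {fetch step : Program} {v x₁ x₂ : ℕ}
    (hσ : Layered σ) (hF : 4 * t < σ.reg 35) (ht : 1 + x₁.size + x₂.size ≤ t)
    (hi : i = 0 ∧ j = 0 ∨ i = 36 ∧ j = x₁)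
    (hfetch : ∀ T (Q : State → ℕ → Prop), (∀ σ₁ T₁, σ₁.arr = σ.arr →
      (∀ x, x ≠ 36 → x ≠ 37 → x ≠ 39 → σ₁.reg x = σ.reg x) →
      σ₁.reg 36 = x₁ → σ₁.reg 37 = x₂ → Q σ₁ T₁) → wp ω fetch Q σ T)
    (hstep : ∀ σ₂ T (Q : State → ℕ → Prop), (∀ x, x < 35 → σ₂.reg x = σ.reg x) →
      σ₂.reg 36 = x₁ → σ₂.reg 37 = x₂ → (∀ σ₃ T₃, σ₃.arr = σ₂.arr →
      (∀ x, x ≠ 38 → σ₃.reg x = σ₂.reg x) → σ₃.reg 38 = y → Q σ₃ T₃) → wp ω step Q σ₂ T) :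
    wp ω (basic fetch (step ;; vstore v i 38)) (fun σ' _ => (∀ x, x < 35 → σ'.reg x = σ.reg x) ∧
      (∀ v' i', σ'.virt v' i' = if v' = v ∧ i' = j then y else σ.virt v' i') ∧
      σ.reg 35 ≤ σ'.reg 35 + 4 * t) σ T := by
  refine wp_basic (fun h0 => by omega) fun _ => hfetch _ _ ?_; intro σ₁ T₁ ha₁ hr₁ h36 h37
  refine ⟨by rw [hr₁ 1 (by decide) (by decide) (by decide), hσ.one],
    hr₁ 35 (by decide) (by decide) (by decide), ?_⟩
  intro k σ₂ _ hk ha₂ hr₂ hF₂; rw [h36, h37] at hk; have hs := size_add_le' x₁ x₂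
  have low₂ : ∀ x, x < 35 → σ₂.reg x = σ.reg x := fun z hz => by
    rw [hr₂ z (by simp; omega), hr₁ z (by omega) (by omega) (by omega)]
  refine ⟨fun _ => ?_, fun h => by omega⟩
  refine wp_seq (hstep _ _ _ low₂ (by rw [hr₂ 36 (by decide), h36])
    (by rw [hr₂ 37 (by decide), h37]) ?_)
  intro σ₃ T₃ ha₃ hr₃ h38
  have low₃ : ∀ x, x < 35 → σ₃.reg x = σ.reg x := fun z hz => by
    rw [hr₃ z (by omega), low₂ z hz]
  refine wp_vstore (by omega) (by decide) (by rw [low₃ 1 (by decide), hσ.one]) ?_; intro σ₄ ha₄ hr₄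
  have low₄ : ∀ x, x < 35 → σ₄.reg x = σ₃.reg x := fun z hz =>
    hr₄ z (by omega) (by omega)
  have hij : σ₃.reg i = j := by
    rcases hi with ⟨rfl, rfl⟩ | ⟨rfl, rfl⟩
    · rw [low₃ 0 (by decide), hσ.zero]
    · rw [hr₃ 36 (by decide), hr₂ 36 (by decide), h36]
  refine ⟨fun z hz => by rw [low₄ z hz, low₃ z hz], fun v' i' => ?_, ?_⟩
  · rw [virt_store (hσ.of_eq low₃) low₄ (by rw [ha₄, hij, h38])]
    rw [State.virt_congr (by rw [ha₃, ha₂, ha₁]) low₃]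
  · rw [hr₄ 35 (by decide) (by decide), hr₃ 35 (by decide), hF₂]; omega

theorem rep_testReg (hσ : Layered σ)
    (ht : 1 + (σ.virt (10 + 2 * x) 0).size ≤ t) (hF : 4 * t < σ.reg 35) :
    wp ω (testReg x) (fun σ' _ => (∀ x, x < 35 → σ'.reg x = σ.reg x) ∧
      (∀ v' i', σ'.virt v' i' = σ.virt v' i') ∧ σ'.reg 43 = σ.virt (10 + 2 * x) 0 ∧
      σ.reg 35 ≤ σ'.reg 35 + 4 * t) σ T := by
  have low₀ : ∀ x, x < 35 → (σ.setReg 43 0).reg x = σ.reg x := fun y hy => by simp; omega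
  refine wp_seq (wp_const (wp_basic (fun h => by simp at h; omega) fun _ => ?_))
  refine wp_seq (wp_vload (.inl rfl) (.inl rfl) (by simp [hσ.one]) ?_); intro σ₁ ha₁ hr₁ hv₁
  refine wp_const ⟨by simp [hr₁ 1 (by decide) (by decide), hσ.one],
    by simp [hr₁ 35 (by decide) (by decide)], ?_⟩
  intro k σ₂ _ hk ha₂ hr₂ hF₂
  rw [low₀ 0 (by decide), hσ.zero, State.virt_congr (σ := σ) (σ' := σ.setReg 43 0) rfl low₀] at hv₁
  simp only [State.reg_setReg, if_true, (by decide : (36 : ℕ) ≠ 37), if_false, add_zero, hv₁,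
    (by decide : (35 : ℕ) ≠ 43)] at hk hF₂
  have low₂ : ∀ x, x < 35 → σ₂.reg x = σ.reg x := fun z hz => by
    rw [hr₂ z (by simp; omega), State.reg_setReg, if_neg (by omega), hr₁ z (by omega) (by omega),
      low₀ z hz]
  refine ⟨fun _ => wp_arith ?_, fun h => by omega⟩
  have low₃ : ∀ x, x < 35 → (σ₂.setReg 43 (BinOp.plus.eval (σ₂.reg 36) (σ₂.reg 0))).reg x =
    σ.reg x := fun z hz => by rw [State.reg_setReg, if_neg (by omega), low₂ z hz]
  refine ⟨low₃, fun v' i' => State.virt_congr (by simp [ha₂, ha₁]) low₃ i', ?_, ?_⟩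
  · rw [low₂ 0 (by decide), hσ.zero, hr₂ 36 (by decide)]; simp [BinOp.eval, hv₁]
  · simp only [State.reg_setReg, (by decide : (35 : ℕ) ≠ 43), if_false]; omega

theorem Rep.of_virt {τ : State} (h : Rep σ τ) (hv : ∀ v i, σ'.virt v i = σ.virt v i) :
    Rep σ' τ := ⟨fun x => by rw [hv, h.1], fun b i => by rw [hv, h.2]⟩

theorem Rep.setReg {τ : State} (h : Rep σ τ)
    (hv : ∀ v i, σ'.virt v i = if v = 10 + 2 * x ∧ i = 0 then y else σ.virt v i) :
    Rep σ' (τ.setReg x y) := by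
  refine ⟨fun z => ?_, fun b i => ?_⟩
  · rw [hv, State.reg_setReg]
    by_cases hz : z = x
    · simp [hz]
    · rw [if_neg hz, if_neg (by omega), h.1]
  · rw [hv, if_neg (by omega), State.arr_setReg, h.2]

theorem Rep.setArr {τ : State} {b : ℕ} (h : Rep σ τ)
    (hv : ∀ v i, σ'.virt v i = if v = 11 + 2 * b ∧ i = j then y else σ.virt v i) :
    Rep σ' (τ.setArr b j y) := by
  refine ⟨fun z => ?_, fun c i => ?_⟩
  · rw [hv, State.reg_setArr, if_neg (by omega), h.1]
  · rw [hv, State.arr_setArr_apply]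
    by_cases hc : c = b ∧ i = j
    · rw [if_pos hc, if_pos ⟨by omega, hc.2⟩]
    · rw [if_neg hc, if_neg (by omega), h.2]

/-- Induction on the simulated execution. The time of the simulation is not mentioned:
`paid_simulate` bounds it without any hypothesis, and uniqueness of executions joins both
assertions. -/
theorem rep_simulate {ω' : ℕ → Bool} {τ τ' : State}
    (h : Exec ω' p τ t τ') : ∀ σ T, Layered σ → (∀ y, ω' y = ω (y * σ.reg 3 + σ.reg 34)) →
    Rep σ τ → 4 * t < σ.reg 35 → wp ω (simulate p) (fun σ' _ =>
      (∀ x, x < 35 → σ'.reg x = σ.reg x) ∧ Rep σ' τ' ∧ σ.reg 35 ≤ σ'.reg 35 + 4 * t) σ T := by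
  have z0 : (0 : ℕ).size = 0 := by simp
  have load1 : ∀ (x : ℕ) (σ : State) (hσ : Layered σ) (T : ℕ) (Q : State → ℕ → Prop),
      (∀ σ₁ T₁, σ₁.arr = σ.arr → (∀ x, x ≠ 36 → x ≠ 37 → x ≠ 39 → σ₁.reg x = σ.reg x) →
      σ₁.reg 36 = σ.virt (10 + 2 * x) 0 → σ₁.reg 37 = 0 → Q σ₁ T₁) →
      wp ω (vload 36 (10 + 2 * x) 0 ;; .const 37 0) Q σ T := by
    intro x σ hσ T Q hQ; refine wp_seq (wp_vload (.inl rfl) (.inl rfl) hσ.one ?_); intro σ₁ ha hr hv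
    refine wp_const (hQ _ _ (by simpa using ha) (fun y h36 h37 h39 => ?_) ?_ ?_)
    · simp [h37, hr y h36 h39]
    · simp [hv, hσ.zero]
    · simp
  have load2 : ∀ (x v i : ℕ) (σ : State) (hσ : Layered σ) (j : ℕ),
      i = 0 ∧ j = 0 ∨ i = 36 ∧ j = σ.virt (10 + 2 * x) 0 → ∀ (T : ℕ) (Q : State → ℕ → Prop),
      (∀ σ₁ T₁, σ₁.arr = σ.arr → (∀ x, x ≠ 36 → x ≠ 37 → x ≠ 39 → σ₁.reg x = σ.reg x) →
      σ₁.reg 36 = σ.virt (10 + 2 * x) 0 → σ₁.reg 37 = σ.virt v j → Q σ₁ T₁) →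
      wp ω (vload 36 (10 + 2 * x) 0 ;; vload 37 v i) Q σ T := by
    intro x v i σ hσ j hi T Q hQ; refine wp_seq (wp_vload (.inl rfl) (.inl rfl) hσ.one ?_)
    intro σ₁ ha hr hv; rw [hσ.zero] at hv
    have low₁ : ∀ x, x < 35 → σ₁.reg x = σ.reg x := fun y hy => hr y (by omega) (by omega)
    refine wp_vload (.inr rfl) (by tauto) (hσ.of_eq low₁).one ?_; intro σ₂ ha₂ hr₂ hv₂
    refine hQ _ _ (by rw [ha₂, ha]) (fun y h36 h37 h39 => ?_) ?_ ?_
    · rw [hr₂ y h37 h39, hr y h36 h39]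
    · rw [hr₂ 36 (by decide) (by decide), hv]
    · rw [hv₂, State.virt_congr (by rw [ha]) low₁]; congr 1; rcases hi with ⟨rfl, rfl⟩ | ⟨rfl, rfl⟩
      · rw [low₁ 0 (by decide), hσ.zero]
      · rw [hv]
  have move : ∀ (σ : State) (hσ : Layered σ) (y : ℕ) (σ₂ : State) (T : ℕ)
      (Q : State → ℕ → Prop), (∀ x, x < 35 → σ₂.reg x = σ.reg x) → σ₂.reg 37 = y →
      (∀ σ₃ T₃, σ₃.arr = σ₂.arr → (∀ x, x ≠ 38 → σ₃.reg x = σ₂.reg x) → σ₃.reg 38 = y → Q σ₃ T₃) →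
      wp ω (.arith .plus 38 37 0) Q σ₂ T := by
    intro σ hσ y σ₂ T Q hr hy hQ
    exact wp_arith (hQ _ _ rfl (fun y h => by simp [h]) (by
      simp [BinOp.eval, hr 0 (by decide), hσ.zero, hy]))
  induction h with
  | skip τ =>
    intro σ T hσ _ hR _; exact wp_skip ⟨fun _ _ => rfl, hR, by omega⟩
  | const τ x c =>
    intro σ T hσ hω hR hF
    refine wp_mono (rep_instr (x₁ := 0) (x₂ := 0) (y := c) hσ hF (by simp) (.inl ⟨rfl, rfl⟩)
      ?_ ?_) fun σ' _ _ h => ⟨h.1, hR.setReg h.2.1, h.2.2⟩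
    · intro T Q hQ
      exact wp_seq (wp_const (wp_const (hQ _ _ rfl (fun y h h' _ => by simp [h, h'])
        (by simp) (by simp))))
    · intro σ₂ T Q _ _ _ hQ; exact wp_const (hQ _ _ rfl (fun y h => by simp [h]) (by simp))
  | arith τ o x y z =>
    intro σ T hσ hω hR hF
    refine wp_mono (rep_instr (x₁ := τ.reg y) (x₂ := τ.reg z)
      (y := o.eval (τ.reg y) (τ.reg z)) hσ hF (by omega) (.inl ⟨rfl, rfl⟩)
      ?_ ?_) fun σ' _ _ h => ⟨h.1, hR.setReg h.2.1, h.2.2⟩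
    · rw [hR.1, hR.1]; exact load2 y _ 0 σ hσ 0 (.inl ⟨rfl, rfl⟩)
    · intro σ₂ T Q _ h1 h2 hQ; exact wp_arith (hQ _ _ rfl (fun y h => by simp [h]) (by simp [h1, h2]))
  | load τ b x y =>
    intro σ T hσ hω hR hF
    refine wp_mono (rep_instr (x₁ := τ.reg y) (x₂ := τ.arr b (τ.reg y))
      (y := τ.arr b (τ.reg y)) hσ hF (by omega) (.inl ⟨rfl, rfl⟩)
      ?_ ?_) fun σ' _ _ h => ⟨h.1, hR.setReg h.2.1, h.2.2⟩
    · rw [hR.2, hR.1]; exact load2 y _ 36 σ hσ _ (.inr ⟨rfl, rfl⟩)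
    · intro σ₂ T Q h0 _ h2 hQ; exact move σ hσ _ σ₂ T Q h0 h2 hQ
  | store τ b x y =>
    intro σ T hσ hω hR hF
    refine wp_mono (rep_instr (x₁ := τ.reg x) (x₂ := τ.reg y)
      (y := τ.reg y) (j := τ.reg x) hσ hF (by omega) (.inr ⟨rfl, rfl⟩)
      ?_ ?_) fun σ' _ _ h => ⟨h.1, hR.setArr h.2.1, h.2.2⟩
    · rw [hR.1 x, hR.1 y]; exact load2 x _ 0 σ hσ 0 (.inl ⟨rfl, rfl⟩)
    · intro σ₂ T Q h0 _ h2 hQ; exact move σ hσ _ σ₂ T Q h0 h2 hQ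
  | random τ x y =>
    intro σ T hσ hω hR hF
    refine wp_mono (rep_instr (x₁ := τ.reg y) (x₂ := 0)
      (y := (ω' (τ.reg y)).toNat) hσ hF (by simp) (.inl ⟨rfl, rfl⟩)
      ?_ ?_) fun σ' _ _ h => ⟨h.1, hR.setReg h.2.1, h.2.2⟩
    · rw [hR.1]; exact load1 y σ hσ
    · intro σ₂ T Q h0 h1 _ hQ
      refine wp_seq (wp_arith (wp_seq (wp_arith (wp_random (hQ _ _ rfl (fun y h => by simp [h])
        ?_)))))
      simp [BinOp.eval, h1, h0 3 (by decide), h0 34 (by decide), hω]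
  | seq h₁ h₂ ih₁ ih₂ =>
    intro σ T hσ hω hR hF; refine wp_seq (wp_mono (ih₁ σ T hσ hω hR (by omega)) fun σ₁ T₁ _ hh₁ => ?_)
    obtain ⟨a1, a2, a3⟩ := hh₁
    refine wp_mono (ih₂ σ₁ T₁ (hσ.of_eq a1)
      (by rw [a1 3 (by decide), a1 34 (by decide)]; exact hω) a2 (by omega)) fun σ₂ T₂ _ hh₂ => ?_
    exact ⟨fun x hx => by rw [hh₂.1 x hx, a1 x hx], hh₂.2.1, by omega⟩
  | @cond_pos p q τ τ' x t hx _ ih =>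
    intro σ T hσ hω hR hF
    refine wp_seq (wp_mono (rep_testReg (t := 1 + (τ.reg x).size) hσ (by rw [hR.1]) (by omega))
      fun σ₁ T₁ _ hh₁ => ?_)
    obtain ⟨a1, a2, a3, a4⟩ := hh₁; rw [← hR.1] at a3
    refine wp_cond (fun _ => ?_) (fun h0 => absurd (a3.symm.trans h0) hx)
    refine wp_mono (ih σ₁ _ (hσ.of_eq a1)
      (by rw [a1 3 (by decide), a1 34 (by decide)]; exact hω) (hR.of_virt a2) (by omega))
      fun σ₂ T₂ _ hh₂ => ?_
    exact ⟨fun x hx => by rw [hh₂.1 x hx, a1 x hx], hh₂.2.1, by omega⟩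
  | @cond_zero p q τ τ' x t hx _ ih =>
    intro σ T hσ hω hR hF
    refine wp_seq (wp_mono (rep_testReg (t := 1) hσ (by rw [← hR.1, hx, z0]) (by omega))
      fun σ₁ T₁ _ hh₁ => ?_)
    obtain ⟨a1, a2, a3, a4⟩ := hh₁; rw [← hR.1] at a3
    refine wp_cond (fun h0 => absurd (a3.trans hx) h0) (fun _ => ?_)
    refine wp_mono (ih σ₁ _ (hσ.of_eq a1)
      (by rw [a1 3 (by decide), a1 34 (by decide)]; exact hω) (hR.of_virt a2) (by omega))
      fun σ₂ T₂ _ hh₂ => ?_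
    exact ⟨fun x hx => by rw [hh₂.1 x hx, a1 x hx], hh₂.2.1, by omega⟩
  | @loop_pos p τ τ₁ τ₂ x s t hx _ _ ih₁ ih₂ =>
    intro σ T hσ hω hR hF
    refine wp_seq (wp_mono (rep_testReg (t := 1 + (τ.reg x).size) hσ (by rw [hR.1]) (by omega))
      fun σ₁ T₁ _ hh₁ => ?_)
    obtain ⟨a1, a2, a3, a4⟩ := hh₁; rw [← hR.1] at a3
    -- After regrouping, the rest is again the test followed by the loop, to which the second
    -- induction hypothesis applies.
    refine wp_loop_pos (by rw [a3]; exact hx) (wp_seq_assoc' ?_)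
    refine wp_mono (ih₁ σ₁ _ (hσ.of_eq a1)
      (by rw [a1 3 (by decide), a1 34 (by decide)]; exact hω) (hR.of_virt a2) (by omega))
      fun σ₂ T₂ _ hh₂ => ?_
    obtain ⟨b1, b2, b3⟩ := hh₂
    have c1 : ∀ x, x < 35 → σ₂.reg x = σ.reg x := fun x hx => by rw [b1 x hx, a1 x hx]
    refine wp_mono (ih₂ σ₂ _ (hσ.of_eq c1)
      (by rw [c1 3 (by decide), c1 34 (by decide)]; exact hω) b2 (by omega))
      fun σ₃ T₃ _ hh₃ => ?_
    exact ⟨fun x hx => by rw [hh₃.1 x hx, c1 x hx], hh₃.2.1, by omega⟩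
  | @loop_zero p τ x hx =>
    intro σ T hσ hω hR hF
    refine wp_seq (wp_mono (rep_testReg (t := 1) hσ (by rw [← hR.1, hx, z0]) (by omega))
      fun σ₁ T₁ _ hh₁ => ?_)
    obtain ⟨a1, a2, a3, a4⟩ := hh₁; rw [← hR.1] at a3
    exact wp_loop_zero (a3.trans hx) ⟨a1, hR.of_virt a2, a4⟩

end RAM

namespace DynSC

/-! ### Generalities on sequences of operations -/

/-- The edges that are updated by a sequence of operations. -/
def updated {n : ℕ} (ops : List (Operation n)) : List (Fin n × Fin n) :=
  ops.filterMap fun op => match op with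
    | .update a b => some (a, b)
    | .query _ _ _ _ => none

theorem applyAll_incremental (ops : List (Operation n)) (E : Edges n)
    (e : Fin n × Fin n) : e ∈ applyAll .incremental E ops ↔ e ∈ E ∨ e ∈ updated ops := by
  induction ops generalizing E with
  | nil => simp [applyAll, updated]
  | cons op ops ih =>
    have h : applyAll .incremental E (op :: ops) =
      applyAll .incremental (apply .incremental E op) ops := rfl
    rw [h, ih]
    cases op <;> simp [apply, updated] <;> tauto

theorem applyAll_decremental (ops : List (Operation n)) (E : Edges n)
    (e : Fin n × Fin n) : e ∈ applyAll .decremental E ops ↔ e ∈ E ∧ e ∉ updated ops := by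
  induction ops generalizing E with
  | nil => simp [applyAll, updated]
  | cons op ops ih =>
    have h : applyAll .decremental E (op :: ops) =
      applyAll .decremental (apply .decremental E op) ops := rfl
    rw [h, ih]
    cases op <;> simp [apply, updated] <;> tauto

/-! ### The gadget

Vertices `0, …, a` form a path, `a+1, …, a+b` are columns, `a+b+1, …, 2a+b` are rows, the others are
padding. -/

/-- The four cases are the path, the entries of the block as edges from columns to rows, the way
back from the rows to 0, and the padding: each of its first `w` vertices has edges to all other
padding vertices. The padding is not connected to the rest and only serves to adjust the number of
edges. -/
def staticEdge (a b w : ℕ) (M : ℕ → ℕ → Bool) (x y : ℕ) : Prop := (x < a ∧ y = x + 1) ∨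
  (a < x ∧ x ≤ a + b ∧ a + b < y ∧ y ≤ 2 * a + b ∧ M (y - (a + b + 1)) (x - (a + 1)) = true) ∨
  (a + b < x ∧ x ≤ 2 * a + b ∧ y = 0) ∨
  (2 * a + b < x ∧ 2 * a + b < y ∧ x ≠ y ∧ x < 2 * a + b + 1 + w)

instance (a b w : ℕ) (M : ℕ → ℕ → Bool) (x y : ℕ) : Decidable (staticEdge a b w M x y) := by
  unfold staticEdge; infer_instance

def dynEdge (a b x y : ℕ) : Prop := x < a ∧ a < y ∧ y ≤ a + b

instance (a b x y : ℕ) : Decidable (dynEdge a b x y) := by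
  unfold dynEdge; infer_instance

/-- Without the edge (k, k+1) nothing on the path beyond k is reachable from 0, so edges at later
positions are harmless whatever they are; earlier positions have no edges to columns. Thus k is the
only exit to the columns, and all rows lead back to 0. -/
theorem reach_gadget {a b w : ℕ} {M : ℕ → ℕ → Bool} {v : ℕ → Bool} {X : ℕ → ℕ → Prop}
    {G : Edges n} (hn : 2 * a + b + 1 ≤ n) (hk : k < a)
    (hG : ∀ x y : Fin n, (x, y) ∈ G ↔
      (staticEdge a b w M x y ∨ dynEdge a b x y ∧ X x (y - (a + 1))) ∧ ¬ (x.val = k ∧ y.val = k + 1))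
    (hX : ∀ l < k, ∀ c < b, ¬ X l c) (hXk : ∀ c < b, X k c ↔ v c = true)
    {q r : Fin n} (hq : q.val = 0) (hi : i < a) (hr : r.val = a + b + 1 + i) :
    StronglyConnected G q r ↔ ∃ c < b, M i c = true ∧ v c = true := by
  constructor
  · rintro ⟨h, -⟩
    -- This set contains 0 and is closed under edges: the cut stops the path at k, selected columns
    -- lead to rows that are hit, rows lead only to 0.
    have key : ∀ z : Fin n, Reaches G q z → z.val ≤ k ∨
        (a < z.val ∧ z.val ≤ a + b ∧ v (z.val - (a + 1)) = true) ∨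
        (a + b < z.val ∧ z.val ≤ 2 * a + b ∧
          ∃ c < b, M (z.val - (a + b + 1)) c = true ∧ v c = true) := by
      intro z hz
      induction hz with
      | refl => left; omega
      | @tail x y _ hxy ih =>
        obtain ⟨hs | ⟨hd, hx⟩, hcut⟩ := (hG x y).1 hxy
        · rcases hs with hs | hs | hs | hs
          · rcases ih with ih | ih | ih <;> omega
          · right; right; refine ⟨hs.2.2.1, hs.2.2.2.1, x.val - (a + 1), ?_, hs.2.2.2.2, ?_⟩
            · omega
            rcases ih with ih | ih | ih
            exacts [by omega, ih.2.2, by omega]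
          · left; clear ih; omega
          · rcases ih with ih | ih | ih <;> omega
        · obtain ⟨h1, h2, h3⟩ := hd; rcases ih with ih | ih | ih
          · rcases Nat.lt_or_ge x.val k with hlt | hge
            · exact absurd hx (hX _ hlt _ (by omega))
            · right; left; have : x.val = k := by omega
              rw [this] at hx; exact ⟨h2, h3, (hXk _ (by omega)).1 hx⟩
          all_goals omega
    rcases key r h with h | h | ⟨_, _, h⟩
    exacts [by omega, by omega, by rwa [hr, Nat.add_sub_cancel_left] at h]
  · rintro ⟨c, hc, hM, hv⟩
    have chain : ∀ l ≤ k, ∀ z : Fin n, z.val = l → Reaches G q z := by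
      intro l
      induction l with
      | zero =>
        intro _ z hz; have : z = q := Fin.ext (by omega); subst this; exact .refl
      | succ l ih =>
        intro hl z hz
        refine (ih (by omega) ⟨l, by omega⟩ rfl).tail ((hG _ _).2 ⟨.inl (.inl ⟨?_, ?_⟩), ?_⟩) <;>
          simp <;> omega
    refine ⟨?_, ?_⟩
    · have h₁ : Reaches G q ⟨k, by omega⟩ := chain k le_rfl _ rfl
      have h₂ : Reaches G q ⟨a + 1 + c, by omega⟩ := by
        refine Relation.ReflTransGen.tail h₁ ((hG _ _).2 ⟨.inr ⟨⟨?_, ?_, ?_⟩, ?_⟩, ?_⟩)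
        all_goals first | (simp; omega) | simpa using (hXk c hc).2 hv
      refine Relation.ReflTransGen.tail h₂ ((hG _ _).2 ⟨.inl (.inr (.inl ⟨?_, ?_, ?_, ?_, ?_⟩)), ?_⟩)
      all_goals first | (simp; omega) | omega | simpa [hr] using hM
    · refine Relation.ReflTransGen.single ((hG _ _).2 ⟨.inl (.inr (.inr (.inl ⟨?_, ?_, ?_⟩))), ?_⟩)
      all_goals omega

/-! ### The instance for a block of the matrix -/

/-- The vertex of the path that is used in phase `s`. -/
def position : Mode → ℕ → ℕ → ℕ
  | .incremental, a, s => a - 1 - s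
  | .decremental, _, s => s

/-- The value of the entries that are updated before the queries of a phase. -/
def polarity : Mode → Bool
  | .incremental => true
  | .decremental => false

/-- The data of an instance: matrix `M`, and vector `V s` in phase `s`. -/
structure Block where
  mode : Mode
  n : ℕ
  a : ℕ
  b : ℕ
  w : ℕ
  hn : 2 * a + b + 1 ≤ n
  M : ℕ → ℕ → Bool
  V : ℕ → ℕ → Bool

namespace Block

variable (K : Block)

def vertex (x : ℕ) : Fin K.n := ⟨x % K.n, Nat.mod_lt _ (by have := K.hn; omega)⟩

theorem vertex_val (hx : x < K.n) : (K.vertex x).val = x := Nat.mod_eq_of_lt hx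

/-- The number of steps of a phase. -/
def phaseLen : ℕ := 2 * K.b + K.a

/-- The operation in step `e` of phase `s`, if there is one. -/
def opOf (s e : ℕ) : Option (Operation K.n) := let k := position K.mode K.a s
  if e < K.b then
    if K.V s e = polarity K.mode then some (.update (K.vertex k) (K.vertex (K.a + 1 + e))) else none
  else if e < K.b + K.a then
    some (.query (K.vertex 0) (K.vertex (K.a + K.b + 1 + (e - K.b))) (K.vertex k) (K.vertex (k + 1)))
  else
    if K.V s (e - K.b - K.a) = polarity K.mode then none
    else some (.update (K.vertex k) (K.vertex (K.a + 1 + (e - K.b - K.a))))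

def opAt (τ : ℕ) : Option (Operation K.n) :=
  if τ < K.a * K.phaseLen then K.opOf (τ / K.phaseLen) (τ % K.phaseLen) else none

/-- The operations before step `T`. -/
def opsTo (T : ℕ) : List (Operation K.n) := (List.range T).filterMap K.opAt

open Classical in
noncomputable def start : Edges K.n := Finset.univ.filter fun e => staticEdge K.a K.b K.w K.M e.1 e.2 ∨
    K.mode = .decremental ∧ dynEdge K.a K.b e.1 e.2

def full : Edges K.n :=
  Finset.univ.filter fun e => staticEdge K.a K.b K.w K.M e.1 e.2 ∨ dynEdge K.a K.b e.1 e.2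

theorem mem_start (x y : Fin K.n) : (x, y) ∈ K.start ↔
    staticEdge K.a K.b K.w K.M x y ∨ K.mode = .decremental ∧ dynEdge K.a K.b x y := by
  simp [start]

theorem mem_full (x y : Fin K.n) : (x, y) ∈ K.full ↔
    staticEdge K.a K.b K.w K.M x y ∨ dynEdge K.a K.b x y := by
  simp [full]

theorem position_lt {mode : Mode} {a : ℕ} (hs : s < a) : position mode a s < a := by
  cases mode <;> simp only [position] <;> omega

theorem position_inj {mode : Mode} {a s' : ℕ} (hs : s < a) (hs' : s' < a)
    (h : position mode a s = position mode a s') : s = s' := by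
  cases mode <;> simp only [position] at h <;> omega

/-- The step in which the entry `c` of the vector of phase `s` is updated. -/
def stepOf (s c : ℕ) : ℕ := s * K.phaseLen + if K.V s c = polarity K.mode then c else K.b + K.a + c

theorem stepOf_lt {c : ℕ} (hs : s < K.a) (hc : c < K.b) : K.stepOf s c < K.a * K.phaseLen := by
  have h : (s + 1) * K.phaseLen ≤ K.a * K.phaseLen := Nat.mul_le_mul_right _ hs
  have h' : K.phaseLen = 2 * K.b + K.a := rfl; rw [add_mul] at h; unfold stepOf; split_ifs <;> omega

theorem div_mod_step (he : e < K.phaseLen) :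
    (s * K.phaseLen + e) / K.phaseLen = s ∧ (s * K.phaseLen + e) % K.phaseLen = e := by
  constructor
  · rw [mul_comm, Nat.mul_add_div (by omega), Nat.div_eq_of_lt he, add_zero]
  · rw [mul_comm, Nat.mul_add_mod, Nat.mod_eq_of_lt he]

theorem opAt_update {τ : ℕ} {x y : Fin K.n} : K.opAt τ = some (.update x y) ↔
    ∃ s < K.a, ∃ c < K.b, τ = K.stepOf s c ∧ x.val = position K.mode K.a s ∧ y.val = K.a + 1 + c := by
  have hn := K.hn; have hE : K.phaseLen = 2 * K.b + K.a := rfl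
  have vv : ∀ s c, s < K.a → c < K.b → ∀ x y : Fin K.n,
      ((K.vertex (position K.mode K.a s) = x ∧ K.vertex (K.a + 1 + c) = y) ↔
      (x.val = position K.mode K.a s ∧ y.val = K.a + 1 + c)) := by
    intro s c hs hc x y; have h1 := position_lt (mode := K.mode) hs
    rw [Fin.ext_iff, Fin.ext_iff, K.vertex_val (by omega), K.vertex_val (by omega)]
    constructor <;> rintro ⟨h, h'⟩ <;> exact ⟨h.symm, h'.symm⟩
  constructor
  · intro h; simp only [opAt, opOf] at h
    split_ifs at h with hτ h1 h2 _ h2 <;>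
      simp only [Option.some.injEq, Operation.update.injEq, reduceCtorEq] at h
    all_goals
      have hs : τ / K.phaseLen < K.a := Nat.div_lt_of_lt_mul (by rwa [mul_comm])
      have he := Nat.mod_lt τ (Nat.pos_of_ne_zero fun h0 : K.phaseLen = 0 => by simp [h0] at hτ)
      have hdm := Nat.div_add_mod' τ K.phaseLen
    · exact ⟨_, hs, _, h1, by rw [stepOf, if_pos h2, hdm], (vv _ _ hs h1 x y).1 h⟩
    · exact ⟨_, hs, τ % K.phaseLen - K.b - K.a, by omega, by rw [stepOf, if_neg h2]; omega,
        (vv _ _ hs (by omega) x y).1 h⟩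
  · rintro ⟨s, hs, c, hc, rfl, hx⟩; rw [opAt, if_pos (K.stepOf_lt hs hc)]; unfold stepOf
    split_ifs with h
    · rw [(K.div_mod_step (by omega)).1, (K.div_mod_step (by omega)).2, opOf]
      simp only [hc, h, if_true, Option.some.injEq, Operation.update.injEq]
      exact (vv s c hs hc x y).2 hx
    · rw [(K.div_mod_step (by omega)).1, (K.div_mod_step (by omega)).2, opOf]
      have e1 : K.b + K.a + c - K.b - K.a = c := by omega
      have e2 : ¬ K.b + K.a + c < K.b := by omega
      have e3 : ¬ K.b + K.a + c < K.b + K.a := by omega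
      simp only [e1, e2, e3, h, if_false, Option.some.injEq, Operation.update.injEq]
      exact (vv s c hs hc x y).2 hx

theorem opAt_query {τ : ℕ} {u v x y : Fin K.n} (h : K.opAt τ = some (.query u v x y)) :
    ∃ s < K.a, ∃ i < K.a, τ = s * K.phaseLen + K.b + i ∧ u.val = 0 ∧
      v.val = K.a + K.b + 1 + i ∧ x.val = position K.mode K.a s ∧
      y.val = position K.mode K.a s + 1 := by
  have hn := K.hn; have hE : K.phaseLen = 2 * K.b + K.a := rfl; simp only [opAt, opOf] at h
  split_ifs at h with hτ h1 _ h2 <;>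
    simp only [Option.some.injEq, Operation.query.injEq, reduceCtorEq] at h
  have hs : τ / K.phaseLen < K.a := Nat.div_lt_of_lt_mul (by rwa [mul_comm])
  have hdm := Nat.div_add_mod' τ K.phaseLen; have hp := position_lt (mode := K.mode) hs
  obtain ⟨rfl, rfl, rfl, rfl⟩ := h
  refine ⟨_, hs, τ % K.phaseLen - K.b, by omega, by omega, ?_, ?_, ?_, ?_⟩ <;>
    (apply K.vertex_val; omega)

theorem mem_updated_opsTo {x y : Fin K.n} : (x, y) ∈ updated (K.opsTo T) ↔
    ∃ τ < T, K.opAt τ = some (.update x y) := by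
  simp only [updated, opsTo, List.mem_filterMap, List.mem_range]; constructor
  · rintro ⟨op, ⟨τ, hτ, ho⟩, h⟩
    cases op with
    | update a b => simp at h; obtain ⟨rfl, rfl⟩ := h; exact ⟨τ, hτ, ho⟩
    | query => simp at h
  · rintro ⟨τ, hτ, ho⟩; exact ⟨_, ⟨τ, hτ, ho⟩, rfl⟩

theorem dynEdge_of_opAt {τ : ℕ} {x y : Fin K.n} (h : K.opAt τ = some (.update x y)) :
    dynEdge K.a K.b x y := by
  obtain ⟨s, hs, c, hc, -, hx, hy⟩ := K.opAt_update.1 h; have := position_lt (mode := K.mode) hs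
  exact ⟨by omega, by omega, by omega⟩

theorem not_static_of_dynEdge {a b w : ℕ} {M : ℕ → ℕ → Bool} (h : dynEdge a b x y) :
    ¬ staticEdge a b w M x y := by
  obtain ⟨h1, h2, h3⟩ := h; unfold staticEdge; omega

/-- The edge set before step `T`. -/
theorem mem_applyAll (T : ℕ) (x y : Fin K.n) :
    (x, y) ∈ applyAll K.mode K.start (K.opsTo T) ↔ staticEdge K.a K.b K.w K.M x y ∨
      dynEdge K.a K.b x y ∧ ((∃ τ < T, K.opAt τ = some (.update x y)) ↔ K.mode = .incremental) := by
  have h := K.mem_start x y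
  have h2 : (∃ τ < T, K.opAt τ = some (.update x y)) → dynEdge K.a K.b x y :=
    fun ⟨τ, _, h⟩ => K.dynEdge_of_opAt h
  have h3 := not_static_of_dynEdge (a := K.a) (b := K.b) (w := K.w) (M := K.M) (x := x) (y := y)
  have h4 := K.mem_updated_opsTo (T := T) (x := x) (y := y)
  generalize K.start = S at *
  generalize (∃ τ < T, K.opAt τ = some (.update x y)) = P at *
  cases hm : K.mode with
  | incremental =>
    rw [applyAll_incremental, h, hm, h4]; simp only [reduceCtorEq, false_and, or_false, iff_true]
    tauto
  | decremental =>
    rw [applyAll_decremental, h, hm, h4]; simp only [reduceCtorEq, true_and, iff_false]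
    tauto

theorem opsTo_take {op : Operation K.n} (h : (K.opsTo (K.a * K.phaseLen))[i]? = some op) :
    ∃ τ < K.a * K.phaseLen, K.opAt τ = some op ∧ (K.opsTo (K.a * K.phaseLen)).take i = K.opsTo τ := by
  generalize K.a * K.phaseLen = T at h ⊢
  induction T with
  | zero => simp [opsTo] at h
  | succ T ih =>
    have e : K.opsTo (T + 1) = K.opsTo T ++ (K.opAt T).toList := by
      unfold opsTo; rw [List.range_succ, List.filterMap_append]
      cases ho : K.opAt T <;> simp [ho]
    rw [e] at h ⊢
    by_cases hi : i < (K.opsTo T).length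
    · rw [List.getElem?_append_left hi] at h; obtain ⟨τ, hτ, h1, h2⟩ := ih h
      exact ⟨τ, by omega, h1, by rw [List.take_append_of_le_length hi.le, h2]⟩
    · rw [List.getElem?_append_right (by omega)] at h
      cases ho : K.opAt T with
      | none => rw [ho] at h; simp at h
      | some op' =>
        rw [ho] at h; simp only [Option.toList_some] at h
        have : i = (K.opsTo T).length := by
          by_contra hne; rw [List.getElem?_eq_none (by simp; omega)] at h; exact absurd h (by simp)
        subst this; simp at h; subst h; exact ⟨T, by omega, ho, by simp⟩

theorem opsTo_append {τ : ℕ} {op : Operation K.n} (hτ : τ < T) (h : K.opAt τ = some op) :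
    ∃ rest, K.opsTo T = K.opsTo τ ++ op :: rest := by
  refine ⟨(List.range (T - τ - 1)).filterMap fun j => K.opAt (τ + 1 + j), ?_⟩
  have e : T = (τ + 1) + (T - τ - 1) := by omega
  unfold opsTo
  conv_lhs => rw [e, List.range_add, List.filterMap_append, List.range_succ, List.filterMap_append]
  simp [h, List.filterMap_map, Function.comp_def]

/-- Admissible because positions of different phases differ: each dynamic edge is updated in exactly
one step. The queried path edges are static. -/
noncomputable def toInstance : Instance K.mode K.n where
  start := K.start
  loopless x := by
    rw [mem_start]; unfold staticEdge dynEdge; omega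
  ops := K.opsTo (K.a * K.phaseLen)
  admissible i op h := by
    obtain ⟨τ, hτ, ho, ht⟩ := K.opsTo_take h; rw [ht]; have hmem := K.mem_applyAll τ
    cases op with
    | update x y =>
      have hd := K.dynEdge_of_opAt ho
      have hfresh : ¬ ∃ τ' < τ, K.opAt τ' = some (.update x y) := by
        rintro ⟨τ', hlt, h'⟩; obtain ⟨s, hs, c, hc, e, hx, hy⟩ := K.opAt_update.1 ho
        obtain ⟨s', hs', c', hc', e', hx', hy'⟩ := K.opAt_update.1 h'
        have := position_inj hs hs' (hx.symm.trans hx'); subst this; have : c = c' := by omega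
        subst this; omega
      have hm := hmem x y; have hxy : x ≠ y := by rintro rfl; unfold dynEdge at hd; omega
      have hns := not_static_of_dynEdge (w := K.w) (M := K.M) hd
      generalize applyAll K.mode K.start (K.opsTo τ) = S at hm ⊢
      cases hK : K.mode with
      | incremental =>
        rw [hK] at hm; exact ⟨hxy, fun hS => by simp [hns, hfresh] at hm; exact hm hS⟩
      | decremental =>
        rw [hK] at hm; simp only [Admissible]; rw [hm]; right; exact ⟨hd, by simp only [hfresh]; simp⟩
    | query u v x y =>
      obtain ⟨s, hs, i, hi, -, -, -, hx, hy⟩ := K.opAt_query ho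
      have hp := position_lt (mode := K.mode) hs
      have hS : (x, y) ∈ applyAll K.mode K.start (K.opsTo τ) := by
        rw [hmem]; left; left; omega
      generalize applyAll K.mode K.start (K.opsTo τ) = S at hS ⊢
      cases K.mode <;> exact hS

/-- Each entry of each vector is updated either before or after the queries of its phase. So in the
end all dynamic edges have been inserted (or, in the decremental case, all were present at the
start), and the count can be given to the preprocessing before any vector is known. -/
theorem numEdges_toInstance : K.toInstance.numEdges = K.full.card := by
  have h : K.mode = .incremental → applyAll K.mode K.start (K.opsTo (K.a * K.phaseLen)) = K.full := by
    intro hm; ext ⟨x, y⟩; rw [mem_applyAll]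
    have hall : (∃ τ < K.a * K.phaseLen, K.opAt τ = some (.update x y)) ↔ dynEdge K.a K.b x y := by
      refine ⟨fun ⟨τ, _, h⟩ => K.dynEdge_of_opAt h, fun hd => ?_⟩; obtain ⟨h1, h2, h3⟩ := hd
      obtain ⟨s, hs, hp⟩ : ∃ s < K.a, x.val = position K.mode K.a s := by
        cases K.mode with
        | incremental => exact ⟨K.a - 1 - x, by omega, by simp only [position]; omega⟩
        | decremental => exact ⟨x, h1, rfl⟩
      have hc : y.val - (K.a + 1) < K.b := by omega
      exact ⟨_, K.stepOf_lt hs hc, K.opAt_update.2 ⟨s, hs, _, hc, rfl, hp, by omega⟩⟩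
    rw [hall]; simp [mem_full, hm]
  have hstart : ∀ x y, (x, y) ∈ K.start ↔ staticEdge K.a K.b K.w K.M x y ∨
    K.mode = .decremental ∧ dynEdge K.a K.b x y := K.mem_start
  have hfull := K.mem_full; unfold toInstance
  generalize_proofs p1 p2
  revert p1 p2 h hstart hfull
  generalize K.start = S
  generalize K.opsTo (K.a * K.phaseLen) = ops
  generalize K.full = F
  cases K.mode with
  | incremental =>
    intro h _ _ _ _; simp only [Instance.numEdges]; rw [h rfl]
  | decremental =>
    intro _ hS hF _ _; simp only [Instance.numEdges]; congr 1; ext ⟨x, y⟩; rw [hS, hF]; simp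

/-- The number of the operation in step `τ`. -/
theorem getElem?_ops {τ : ℕ} {op : Operation K.n} (h : K.opAt τ = some op) :
    K.toInstance.ops[(K.opsTo τ).length]? = some op ∧
      K.toInstance.ops.take (K.opsTo τ).length = K.opsTo τ := by
  have hτ : τ < K.a * K.phaseLen := by
    by_contra hn; rw [opAt, if_neg hn] at h; exact absurd h (by simp)
  obtain ⟨rest, hr⟩ := K.opsTo_append hτ h; have e : K.toInstance.ops = K.opsTo (K.a * K.phaseLen) := rfl
  rw [e, hr]; simp

/-- The state at the time of a query fits `reach_gadget`: positions before k have no edges to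
columns, as they belong to later phases (incremental) or to phases that have deleted everything
(decremental). -/
theorem query_iff (hs : s < K.a) (hi : i < K.a) :
    StronglyConnected ((applyAll K.mode K.start (K.opsTo (s * K.phaseLen + K.b + i))).erase
      (K.vertex (position K.mode K.a s), K.vertex (position K.mode K.a s + 1)))
      (K.vertex 0) (K.vertex (K.a + K.b + 1 + i)) ↔ ∃ c < K.b, K.M i c = true ∧ K.V s c = true := by
  have hn := K.hn; have hE : K.phaseLen = 2 * K.b + K.a := rfl
  have hp := position_lt (mode := K.mode) hs
  refine reach_gadget (w := K.w) (k := position K.mode K.a s)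
    (X := fun l c => (∃ s' < K.a, l = position K.mode K.a s' ∧
      K.stepOf s' c < s * K.phaseLen + K.b + i) ↔ K.mode = .incremental)
    K.hn hp ?_ ?_ ?_ (K.vertex_val (by omega)) hi (K.vertex_val (by omega))
  · intro x y; rw [Finset.mem_erase, mem_applyAll, and_comm]
    refine and_congr (or_congr Iff.rfl (and_congr_right fun hd => ?_)) ?_
    · have : (∃ τ < s * K.phaseLen + K.b + i, K.opAt τ = some (.update x y)) ↔
          ∃ s' < K.a, x.val = position K.mode K.a s' ∧
            K.stepOf s' (y.val - (K.a + 1)) < s * K.phaseLen + K.b + i := by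
        constructor
        · rintro ⟨τ, hτ, h⟩; obtain ⟨s', hs', c, hc, rfl, hx, hy⟩ := K.opAt_update.1 h
          refine ⟨s', hs', hx, ?_⟩
          rwa [hy, Nat.add_sub_cancel_left]
        · rintro ⟨s', hs', hx, h⟩; obtain ⟨h1, h2, h3⟩ := hd
          exact ⟨_, h, K.opAt_update.2 ⟨s', hs', _, by omega, rfl, hx, by omega⟩⟩
      rw [this]
    · rw [Ne, Prod.mk.injEq, Fin.ext_iff, Fin.ext_iff, K.vertex_val (by omega), K.vertex_val (by omega)]
  · intro l hl c hc
    have hmul : ∀ s' c', c' < K.b → K.stepOf s' c' < (s' + 1) * K.phaseLen := by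
      intro s' c' hc'; rw [add_mul]; unfold stepOf; split_ifs <;> omega
    cases hm : K.mode with
    | incremental =>
      rw [hm] at hl; simp only [position] at hl; simp only [iff_true, not_exists, not_and, not_lt]
      intro s' hs' hls; simp only [position] at hls
      have h1 : (s + 1) * K.phaseLen ≤ s' * K.phaseLen := Nat.mul_le_mul_right _ (by omega)
      rw [add_mul] at h1; have h2 : s' * K.phaseLen ≤ K.stepOf s' c := by unfold stepOf; omega
      omega
    | decremental =>
      rw [hm] at hl; simp only [position] at hl; simp only [reduceCtorEq, iff_false, not_not]
      refine ⟨l, by omega, rfl, ?_⟩; have h1 := hmul l c hc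
      have h2 : (l + 1) * K.phaseLen ≤ s * K.phaseLen := Nat.mul_le_mul_right _ (by omega); omega
  -- At position k exactly the entries with the value `polarity` have been updated before the
  -- queries: the ones are inserted, or the zeros are deleted. In both cases the ones are present.
  · intro c hc
    have h1 : (∃ s' < K.a, position K.mode K.a s = position K.mode K.a s' ∧
        K.stepOf s' c < s * K.phaseLen + K.b + i) ↔ K.V s c = polarity K.mode := by
      constructor
      · rintro ⟨s', hs', he, h⟩; have := position_inj hs hs' he; subst this; unfold stepOf at h
        by_contra hne; rw [if_neg hne] at h; omega
      · intro h; refine ⟨s, hs, rfl, ?_⟩; unfold stepOf; rw [if_pos h]; omega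
    rw [h1]
    cases K.mode <;> cases K.V s c <;> simp [polarity]

theorem opAt_query' (hs : s < K.a) (hi : i < K.a) :
    K.opAt (s * K.phaseLen + K.b + i) = some (.query (K.vertex 0)
      (K.vertex (K.a + K.b + 1 + i)) (K.vertex (position K.mode K.a s))
      (K.vertex (position K.mode K.a s + 1))) := by
  have hE : K.phaseLen = 2 * K.b + K.a := rfl
  have h : (s + 1) * K.phaseLen ≤ K.a * K.phaseLen := Nat.mul_le_mul_right _ hs; rw [add_mul] at h
  have hdm := K.div_mod_step (s := s) (e := K.b + i) (by omega); rw [← add_assoc] at hdm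
  rw [opAt, if_pos (by omega), hdm.1, hdm.2, opOf]; simp [show ¬ K.b + i < K.b by omega, hi]

end Block
end DynSC

namespace RAM

/-! ### Sequences of calls -/

/-- `Trace ω σ calls σ' u`: the calls lead from `σ` to `σ'` and cost `u` altogether. -/
def Trace (ω : ℕ → Bool) : State → List (Program × (ℕ → ℕ)) → State → ℕ → Prop
  | σ, [], σ', u => σ' = σ ∧ u = 0
  | σ, c :: l, σ', u => ∃ t σ₁ u₁, Exec ω c.1 (σ.withInput c.2) t σ₁ ∧ Trace ω σ₁ l σ' u₁ ∧ u = t + u₁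

theorem Trace.append {l₁ l₂ : List (Program × (ℕ → ℕ))} {σ₁ σ₂ : State}
    {u₁ u₂ : ℕ} (h₁ : Trace ω σ l₁ σ₁ u₁) (h₂ : Trace ω σ₁ l₂ σ₂ u₂) :
    Trace ω σ (l₁ ++ l₂) σ₂ (u₁ + u₂) := by
  induction l₁ generalizing σ u₁ with
  | nil => obtain ⟨rfl, rfl⟩ := h₁; simpa using h₂
  | cons c l ih =>
    obtain ⟨t, τ, u, he, ht, rfl⟩ := h₁; exact ⟨t, τ, u + u₂, he, ih ht, by omega⟩

theorem Trace.snoc {l : List (Program × (ℕ → ℕ))} {c : Program × (ℕ → ℕ)}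
    {σ₁ σ₂ : State} {u : ℕ} (h : Trace ω σ l σ₁ u) (he : Exec ω c.1 (σ₁.withInput c.2) t σ₂) :
    Trace ω σ (l ++ [c]) σ₂ (u + t) :=
  h.append ⟨t, σ₂, 0, he, ⟨rfl, rfl⟩, rfl⟩

theorem Session.det {l : List (Program × (ℕ → ℕ))} {r r' : List Result}
    (h : Session ω σ l r) (h' : Session ω σ l r') : r = r' := by
  induction h generalizing r' with
  | nil => cases h'; rfl
  | cons he _ ih =>
    cases h' with
    | cons he' hs' =>
      obtain ⟨rfl, rfl⟩ := he.det he'; rw [ih hs']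

/-- The next call after a trace is part of the session. -/
theorem Session.next {l₁ l₂ : List (Program × (ℕ → ℕ))} {c : Program × (ℕ → ℕ)}
    {τ : State} {res : List Result} {u : ℕ} (h : Session ω σ (l₁ ++ c :: l₂) res)
    (hT : Trace ω σ l₁ τ u) : ∃ t τ', Exec ω c.1 (τ.withInput c.2) t τ' ∧
      res[l₁.length]? = some ⟨t, τ'.output⟩ ∧ u + t ≤ (res.map Result.time).sum := by
  induction l₁ generalizing σ u res with
  | nil =>
    obtain ⟨rfl, rfl⟩ := hT
    cases h with
    | cons he hs => exact ⟨_, _, he, by simp, by simp⟩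
  | cons d l ih =>
    obtain ⟨t, σ₁, u₁, he, ht, rfl⟩ := hT
    cases h with
    | cons he' hs =>
      obtain ⟨rfl, rfl⟩ := he.det he'; obtain ⟨t', τ', h1, h2, h3⟩ := ih hs ht
      exact ⟨t', τ', h1, by simpa using h2, by simp; omega⟩

theorem Session.length {l : List (Program × (ℕ → ℕ))} {r : List Result}
    (h : Session ω σ l r) : r.length = l.length := by
  induction h with
  | nil => rfl
  | cons _ _ ih => simp [ih]

/-! ### Only finitely many random bits matter -/

theorem Exec.finitary (h : Exec ω p σ t σ') :
    ∃ N, ∀ ω' : ℕ → Bool, (∀ i < N, ω' i = ω i) → Exec ω' p σ t σ' := by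
  induction h with
  | skip σ => exact ⟨0, fun _ _ => .skip σ⟩
  | const σ x c => exact ⟨0, fun _ _ => .const σ x c⟩
  | arith σ o x y z => exact ⟨0, fun _ _ => .arith σ o x y z⟩
  | load σ b x y => exact ⟨0, fun _ _ => .load σ b x y⟩
  | store σ b x y => exact ⟨0, fun _ _ => .store σ b x y⟩
  | random σ x y =>
    refine ⟨σ.reg y + 1, fun ω' h => ?_⟩; rw [← h (σ.reg y) (by omega)]; exact .random σ x y
  | seq _ _ ih₁ ih₂ =>
    obtain ⟨N₁, h₁⟩ := ih₁; obtain ⟨N₂, h₂⟩ := ih₂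
    exact ⟨max N₁ N₂, fun ω' h => .seq (h₁ ω' fun i hi => h i (by omega))
      (h₂ ω' fun i hi => h i (by omega))⟩
  | cond_pos hx _ ih => obtain ⟨N, h⟩ := ih; exact ⟨N, fun ω' h' => .cond_pos hx (h ω' h')⟩
  | cond_zero hx _ ih => obtain ⟨N, h⟩ := ih; exact ⟨N, fun ω' h' => .cond_zero hx (h ω' h')⟩
  | loop_pos hx _ _ ih₁ ih₂ =>
    obtain ⟨N₁, h₁⟩ := ih₁; obtain ⟨N₂, h₂⟩ := ih₂
    exact ⟨max N₁ N₂, fun ω' h => .loop_pos hx (h₁ ω' fun i hi => h i (by omega))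
      (h₂ ω' fun i hi => h i (by omega))⟩
  | loop_zero hx => exact ⟨0, fun _ _ => .loop_zero hx⟩

theorem Session.finitary {l : List (Program × (ℕ → ℕ))} {r : List Result} (h : Session ω σ l r) :
    ∃ N, ∀ ω' : ℕ → Bool, (∀ i < N, ω' i = ω i) → Session ω' σ l r := by
  induction h with
  | nil σ => exact ⟨0, fun _ _ => .nil σ⟩
  | cons he _ ih =>
    obtain ⟨N₁, h₁⟩ := he.finitary; obtain ⟨N₂, h₂⟩ := ih
    exact ⟨max N₁ N₂, fun ω' h => .cons (h₁ ω' fun i hi => h i (by omega))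
      (h₂ ω' fun i hi => h i (by omega))⟩

/-- A halting session reads finitely many bits, so the set is open. -/
theorem measurableSet_session (σ : State) (l : List (Program × (ℕ → ℕ)))
    (P : List Result → Prop) : MeasurableSet {ω | ∃ res, Session ω σ l res ∧ P res} := by
  apply IsOpen.measurableSet; rw [isOpen_iff_forall_mem_open]; rintro ω ⟨res, hs, hP⟩
  obtain ⟨N, hN⟩ := hs.finitary
  refine ⟨(Set.Iio N).pi fun i => {ω i}, fun ω' h => ⟨res, hN ω' fun i hi => ?_, hP⟩,
    isOpen_set_pi (Set.finite_Iio N) fun i _ => isOpen_discrete _, fun i _ => rfl⟩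
  simpa using h i hi

/-! ### Independent copies of the random bits -/

open MeasureTheory ProbabilityTheory

instance : IsProbabilityMeasure coin := by unfold coin; infer_instance

/-- The random bits of copy `c` of `R`. -/
def tape (R c : ℕ) (ω : ℕ → Bool) : ℕ → Bool := fun y => ω (y * R + c)

theorem measurable_tape (R c : ℕ) : Measurable (tape R c) :=
  measurable_pi_lambda _ fun y => measurable_pi_apply _

theorem map_tape {R c : ℕ} (hR : 0 < R) : coin.map (tape R c) = coin := by
  unfold coin
  exact Measure.map_infinitePi_infinitePi_of_inj (f := fun y : ℕ => y * R + c)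
    (P := fun _ : ℕ => (PMF.uniformOfFintype Bool).toMeasure)
    (fun y z h => Nat.eq_of_mul_eq_mul_right hR (by simpa using h))

/-- For c < R the map (c, y) ↦ y * R + c is injective, so the tapes together are a product measure
on pairs, which is then curried. -/
theorem iIndepFun_tape (R : ℕ) : iIndepFun (fun (c : Fin R) ω => tape R c ω) coin := by
  rw [iIndepFun_iff_map_fun_eq_infinitePi_map fun c : Fin R => measurable_tape R c]
  have h1 : (fun (ω : ℕ → Bool) (c : Fin R) => tape R c ω) = MeasurableEquiv.curry (Fin R) ℕ Bool ∘
        fun (ω : ℕ → Bool) (p : Fin R × ℕ) => ω (p.2 * R + p.1.val) := rfl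
  have hf : Function.Injective fun p : Fin R × ℕ => p.2 * R + p.1.val := by
    rintro ⟨c, y⟩ ⟨c', y'⟩ h; obtain ⟨h1, h2⟩ := mul_add_inj c.2 c'.2 h; exact Prod.ext (Fin.ext h2) h1
  have h2 : coin.map (fun (ω : ℕ → Bool) (p : Fin R × ℕ) => ω (p.2 * R + p.1.val)) =
      Measure.infinitePi fun _ : Fin R × ℕ => (PMF.uniformOfFintype Bool).toMeasure :=
    Measure.map_infinitePi_infinitePi_of_inj (P := fun _ : ℕ => (PMF.uniformOfFintype Bool).toMeasure) hf
  rw [h1, ← Measure.map_map (by fun_prop) (by fun_prop), h2,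
    Measure.infinitePi_map_curry fun (_ : Fin R) (_ : ℕ) => (PMF.uniformOfFintype Bool).toMeasure]
  congr 1; funext c; rw [map_tape (Nat.zero_lt_of_lt c.2)]; rfl

open Classical in
/-- The majority of independent copies is wrong with exponentially small probability. -/
theorem coin_majority {A : Set (ℕ → Bool)} (hA : MeasurableSet A) (h : 2 / 3 ≤ coin A) {R : ℕ}
    (hR : 0 < R) : coin.real {ω | R ≤ 2 * ((Finset.range R).filter fun c => tape R c ω ∉ A).card} ≤
      Real.exp (-(R : ℝ) / 18) := by
  set Y : (ℕ → Bool) → ℝ := Aᶜ.indicator fun _ => 1 with hY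
  have mY : Measurable Y := measurable_const.indicator hA.compl
  have hmean : ∀ c, coin[fun ω => Y (tape R c ω)] = coin.real Aᶜ := by
    intro c
    rw [← integral_map (φ := tape R c) (f := Y) (measurable_tape R c).aemeasurable
      mY.aestronglyMeasurable, map_tape hR, hY, integral_indicator hA.compl]
    simp
  have hsmall : coin.real Aᶜ ≤ 1 / 3 := by
    have h3 : (2 / 3 : ℝ) ≤ coin.real A := by
      have := ENNReal.toReal_mono (measure_ne_top coin A) h; simpa [Measure.real] using this
    rw [probReal_compl_eq_one_sub hA]; linarith
  have hsub : ∀ c ∈ (Finset.univ : Finset (Fin R)), HasSubgaussianMGF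
      (fun ω => Y (tape R c ω) - coin.real Aᶜ) ((‖(1 : ℝ) - 0‖₊ / 2) ^ 2) coin := by
    intro c _
    have := hasSubgaussianMGF_of_mem_Icc (μ := coin) (X := fun ω => Y (tape R c ω)) (a := 0) (b := 1)
      (mY.comp (measurable_tape R c)).aemeasurable (ae_of_all _ fun ω => by
        simp only [hY, Set.indicator_apply]; split_ifs <;> simp)
    rwa [hmean] at this
  have hind : iIndepFun (fun (c : Fin R) ω => Y (tape R c ω) - coin.real Aᶜ) coin :=
    (iIndepFun_tape R).comp (fun _ ω => Y ω - coin.real Aᶜ) fun _ => mY.sub_const _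
  -- Failures have mean at most 1/3, so R/2 of them exceed the mean sum by R/6. Each summand is
  -- sub-Gaussian with parameter 1/4 (Hoeffding's lemma), and (R/6)² / (2 * R/4) = R/18.
  have key := HasSubgaussianMGF.measure_sum_ge_le_of_iIndepFun hind hsub
    (ε := (R : ℝ) / 6) (by positivity)
  have hR' : (0 : ℝ) < R := by exact_mod_cast hR
  refine (measureReal_mono ?_ (by finiteness)).trans (key.trans (Real.exp_le_exp.2 (le_of_eq ?_)))
  · intro ω hω; simp only [Set.mem_ofPred_eq] at hω ⊢
    have e : ((((Finset.range R).filter fun c => tape R c ω ∉ A).card : ℕ) : ℝ) =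
        ∑ c : Fin R, Y (tape R c ω) := by
      rw [Finset.card_filter, Finset.sum_range]; push_cast; refine Finset.sum_congr rfl fun c _ => ?_
      simp [hY, Set.indicator_apply]
    have hω' : (R : ℝ) ≤ 2 * (((Finset.range R).filter fun c => tape R c ω ∉ A).card : ℕ) := by
      exact_mod_cast hω
    rw [e] at hω'; rw [Finset.sum_sub_distrib]
    simp only [Finset.sum_const, Finset.card_univ, Fintype.card_fin, nsmul_eq_mul]; nlinarith
  · simp
    field_simp
    norm_num

/-! ### Tests -/

/-- if `r x < r y` then `p` else `q` -/
def ifLt (x y : ℕ) (p q : Program) : Program := .arith .minus 45 y x ;; .cond 45 p q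

/-- if `r x = r y` then `p` else `q` -/
def ifEq (x y : ℕ) (p q : Program) : Program := ifLt x y q (ifLt y x q p)

theorem eval_ifLt (ω : ℕ → Bool) (x y : ℕ) (p q : Program) (σ : State) :
    (ifLt x y p q).eval ω σ = if σ.reg x < σ.reg y then p.eval ω (σ.setReg 45 (σ.reg y - σ.reg x))
      else q.eval ω (σ.setReg 45 (σ.reg y - σ.reg x)) := by
  simp only [ifLt, Program.eval, BinOp.eval, State.reg_setReg, if_true, Nat.sub_eq_zero_iff_le]
  by_cases h : σ.reg x < σ.reg y
  · rw [if_pos h, if_neg (by omega)]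
  · rw [if_neg h, if_pos (by omega)]

theorem State.setReg_setReg (σ : State) (x u v : ℕ) : (σ.setReg x u).setReg x v = σ.setReg x v := by
  simp [State.setReg]

theorem eval_ifEq (ω : ℕ → Bool) (p q : Program) (σ : State) (hx : x ≠ 45) (hy : y ≠ 45) :
    (ifEq x y p q).eval ω σ = if σ.reg x = σ.reg y then
        p.eval ω (σ.setReg 45 (max (σ.reg x) (σ.reg y) - min (σ.reg x) (σ.reg y)))
      else q.eval ω (σ.setReg 45 (max (σ.reg x) (σ.reg y) - min (σ.reg x) (σ.reg y))) := by
  simp only [ifEq, eval_ifLt, State.reg_setReg, hx, hy, if_false, State.setReg_setReg]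
  rcases lt_trichotomy (σ.reg x) (σ.reg y) with h | h | h
  · rw [if_pos h, if_neg (by omega), max_eq_right h.le, min_eq_left h.le]
  · rw [if_neg (by omega), if_neg (by omega), if_pos h, max_eq_left h.ge, min_eq_right h.ge]
  · rw [if_neg (by omega), if_pos h, if_neg (by omega), max_eq_left h.le, min_eq_right h.le]

theorem Flat.framed (hp : p.Flat) : ∀ σ, Framed p σ (p.eval ω σ) := by
  induction p with
  | skip => exact fun σ => (Exec.skip (ω := ω) σ).framed
  | const x c => exact fun σ => (Exec.const (ω := ω) σ x c).framed
  | arith o x y z => exact fun σ => (Exec.arith (ω := ω) σ o x y z).framed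
  | load b x y => exact fun σ => (Exec.load (ω := ω) σ b x y).framed
  | store b x y => exact fun σ => (Exec.store (ω := ω) σ b x y).framed
  | random x y => exact fun σ => (Exec.random (ω := ω) σ x y).framed
  | seq p q ihp ihq =>
    refine fun σ => ⟨fun x hx => ?_, fun b hb => ?_⟩
    · simp [Program.writes] at hx; rw [Program.eval, (ihq hp.2 _).1 _ hx.2, (ihp hp.1 _).1 _ hx.1]
    · simp [Program.stores] at hb; rw [Program.eval, (ihq hp.2 _).2 _ hb.2, (ihp hp.1 _).2 _ hb.1]
  | cond y p q ihp ihq =>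
    intro σ; unfold Program.eval; split_ifs
    · exact ⟨fun x hx => (ihq hp.2 _).1 _ (by simp [Program.writes] at hx; exact hx.2),
        fun b hb => (ihq hp.2 _).2 _ (by simp [Program.stores] at hb; exact hb.2)⟩
    · exact ⟨fun x hx => (ihp hp.1 _).1 _ (by simp [Program.writes] at hx; exact hx.1),
        fun b hb => (ihp hp.1 _).2 _ (by simp [Program.stores] at hb; exact hb.1)⟩
  | loop x p => exact hp.elim

/-- A counting loop each step of which costs at most `C`, up to a change of the potential `pot`. -/
theorem wp_for_cost {hi c one : ℕ} {body : Program}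
    {σ₀ : State} (N C : ℕ) (Inv : ℕ → State → Prop) (pot : State → ℕ)
    (hi₁ : i ∉ body.writes) (hi₂ : hi ∉ body.writes) (hi₃ : one ∉ body.writes)
    (hd : i ≠ hi ∧ i ≠ c ∧ i ≠ one ∧ c ≠ hi ∧ c ≠ one)
    (hN : σ₀.reg hi = N) (hone : σ₀.reg one = 1)
    (stable : ∀ k σ x y, Inv k σ → Inv k ((σ.setReg i x).setReg c y))
    (stable' : ∀ σ x y, pot ((σ.setReg i x).setReg c y) = pot σ)
    (start : Inv 0 σ₀)
    (step : ∀ k < N, ∀ σ T, Inv k σ → Framed (forLoop i hi c one body) σ₀ σ → σ.reg i = k →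
      wp ω body (fun σ' T' => Inv (k + 1) σ' ∧ T' + pot σ' ≤ T + pot σ + C) σ T)
    (fin : ∀ σ T', Inv N σ → Framed (forLoop i hi c one body) σ₀ σ →
      T' + pot σ ≤ T + pot σ₀ + (N * (C + 10 * (N.size + 1)) + 10 * (N.size + 1)) → Q σ T') :
    wp ω (forLoop i hi c one body) Q σ₀ T := by
  refine wp_for N (fun k σ T' => Inv k σ ∧
    T' + pot σ ≤ T + pot σ₀ + (k * (C + 10 * (N.size + 1)) + 10 * (N.size + 1)))
    hi₁ hi₂ hi₃ hd hN hone ?_ ⟨start, by omega⟩ ?_ ?_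
  · rintro k σ T' x y ⟨h1, h2⟩; exact ⟨stable k σ x y h1, by rw [stable']; exact h2⟩
  · rintro k hk σ T' ⟨h1, h2⟩ hF hik; refine wp_mono (step k hk σ T' h1 hF hik) ?_
    rintro σ' T'' - ⟨h3, h4⟩; refine ⟨h3, ?_⟩; rw [add_mul, one_mul]; omega
  · rintro σ T' ⟨h1, h2⟩ hF; exact fin σ T' h1 hF h2

theorem wp_for_const {hi c one : ℕ} {body : Program} {σ₀ : State} (N C : ℕ) (Inv : ℕ → State → Prop)
    (hN : σ₀.reg hi = N) (hone : σ₀.reg one = 1)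
    (stable : ∀ k σ x y, Inv k σ → Inv k ((σ.setReg i x).setReg c y)) (start : Inv 0 σ₀)
    (step : ∀ k < N, ∀ σ T, Inv k σ → Framed (forLoop i hi c one body) σ₀ σ → σ.reg i = k →
      wp ω body (fun σ' T' => Inv (k + 1) σ' ∧ T' ≤ T + C) σ T)
    (fin : ∀ σ T', Inv N σ → Framed (forLoop i hi c one body) σ₀ σ →
      T' ≤ T + (N * (C + 10 * (N.size + 1)) + 10 * (N.size + 1)) → Q σ T')
    (hd : (i ∉ body.writes ∧ hi ∉ body.writes ∧ one ∉ body.writes) ∧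
      (i ≠ hi ∧ i ≠ c ∧ i ≠ one ∧ c ≠ hi ∧ c ≠ one) := by decide) :
    wp ω (forLoop i hi c one body) Q σ₀ T :=
  wp_for_cost N C Inv (fun _ => 0) hd.1.1 hd.1.2.1 hd.1.2.2 hd.2 hN hone stable (fun _ _ _ => rfl) start
    step fin

/-- The assertions of `q` hold after `p`, together with those of `p`: executions are unique. -/
theorem wp_and {R : State → Prop} {T₂ : ℕ} (h : wp ω p Q σ T) (h' : wp ω p (fun σ' _ => R σ') σ T₂) :
    wp ω p (fun σ' T' => Q σ' T' ∧ R σ') σ T := by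
  obtain ⟨σ₁, t₁, T₁, e₁, hT₁, hQ⟩ := h; obtain ⟨σ₂, t₂, T₂, e₂, -, hR⟩ := h'
  obtain ⟨-, rfl⟩ := e₁.det e₂; exact ⟨σ₁, t₁, T₁, e₁, hT₁, hQ, hR⟩

theorem wp_and_of {H : Prop} {R : State → Prop} {T₂ : ℕ} (h : wp ω p Q σ T)
    (h' : H → wp ω p (fun σ' _ => R σ') σ T₂) :
    wp ω p (fun σ' T' => Q σ' T' ∧ (H → R σ')) σ T := by
  by_cases hH : H
  · exact wp_mono (wp_and h (h' hH)) fun _ _ _ h => ⟨h.1, fun _ => h.2⟩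
  · exact wp_mono h fun _ _ _ h => ⟨h, fun h => absurd h hH⟩

end RAM

namespace DynSC

open RAM

/-! ### Parameters of the reduction -/

/-- The parameters for matrices of order `n`: `g` copies of each machine, blocks with `a` rows and `b`
columns, digraphs with `nG` vertices, fuel for preprocessing and for a run, and a flag that
enforces exhaustive search. -/
structure Par where
  D : DataStructure
  mode : Mode
  n : ℕ
  g : ℕ
  a : ℕ
  b : ℕ
  nG : ℕ
  Fpre : ℕ
  Frun : ℕ
  force : ℕ
  hn : 1 ≤ n
  hg : 1 ≤ g
  ha : 1 ≤ a
  hb : 1 ≤ b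
  hbn : b ≤ n
  hnG : 1 ≤ nG

namespace Par

variable (P : Par)

/-- The row length of the stored matrix. Column indices of blocks that stick out at the right stay
below it and hit zeros instead of the next row. -/
def W : ℕ := 2 * P.n + 1
def Br : ℕ := P.n / P.a + 1
def Bc : ℕ := P.n / P.b + 1
def BB : ℕ := P.Br * P.Bc
/-- the number of blocks, for all guesses of the number of edges -/
def NB : ℕ := P.g ^ 3 * P.BB
/-- the number of virtual machines -/
def NV : ℕ := P.NB * P.g
def NQ : ℕ := P.NB * P.a
def E : ℕ := 2 * P.b + P.a
def nGG : ℕ := P.nG * P.nG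
-- The stride exceeds the number of layers: `n + 2` for each machine (the base and runs 0, …, n),
-- and, in the input array, one for each call (`ctr_lt`).
def S : ℕ := (P.n + 2) * ((P.NV + 1) * (P.E + 2))
def Fm : ℕ := P.Fpre + P.Frun
/-- the bound for the sizes of memory cells -/
def B : ℕ := 2 * P.Fm + 2 + (P.D.preprocess.constSize + P.D.update.constSize + P.D.query.constSize) +
    (P.nGG + 2 * P.a + P.b + P.nG + 10)
-- A crude common bound whose logarithm is the unit of cost `L`. `B` is included since the
-- simulation requires `B.size + 3 ≤ L`.
def X : ℕ := P.S + P.B + P.W + P.NB + P.NV + P.NQ + P.BB + P.Bc + P.E + P.nGG + P.n + P.g + P.a +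
  P.b + P.nG + P.Fpre + P.Frun + P.force + 10
/-- the bound for the sizes of registers -/
def L : ℕ := P.X.size + 3

/-- The contents of the registers that do not change after the setup. -/
structure Regs (σ : State) : Prop where
  r0 : σ.reg 0 = 0
  r1 : σ.reg 1 = 1
  r2 : σ.reg 2 = P.n
  r3 : σ.reg 3 = P.g
  r4 : σ.reg 4 = P.a
  r5 : σ.reg 5 = P.b
  r6 : σ.reg 6 = P.nG
  r7 : σ.reg 7 = P.S
  r8 : σ.reg 8 = P.W
  r9 : σ.reg 9 = P.NV
  r10 : σ.reg 10 = P.NQ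
  r11 : σ.reg 11 = P.BB
  r12 : σ.reg 12 = P.Bc
  r13 : σ.reg 13 = P.Fpre
  r14 : σ.reg 14 = P.Frun
  r15 : σ.reg 15 = P.force
  r16 : σ.reg 16 = P.E
  r17 : σ.reg 17 = P.nGG
  r18 : σ.reg 18 = P.n + 2

variable {P}

theorem Regs.of_eq (h : P.Regs σ) (he : ∀ x < 19, σ'.reg x = σ.reg x) : P.Regs σ' := by
  constructor <;> rw [he _ (by norm_num)]
  exacts [h.r0, h.r1, h.r2, h.r3, h.r4, h.r5, h.r6, h.r7, h.r8, h.r9, h.r10, h.r11, h.r12, h.r13,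
    h.r14, h.r15, h.r16, h.r17, h.r18]

theorem size_le_L (h : x ≤ P.X) : x.size + 3 ≤ P.L := Nat.add_le_add_right (size_le_of_le h) 3

theorem Regs.size_le (h : P.Regs σ) (hx : x < 19) : (σ.reg x).size + 3 ≤ P.L := by
  have hS : P.n + 2 ≤ P.S := Nat.le_mul_of_pos_right _ (by positivity); apply size_le_L; obtain ⟨⟩ := h
  interval_cases x <;> simp only [*] <;> unfold X <;> omega

theorem L_pos : 3 ≤ P.L := by unfold L; omega

theorem Br_pos : 1 ≤ P.Br := Nat.le_add_left 1 _
theorem Bc_pos : 1 ≤ P.Bc := Nat.le_add_left 1 _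
theorem BB_pos : 1 ≤ P.BB := Nat.mul_pos Br_pos Bc_pos

/-- The guess, the row and the column of a block. -/
def guess (P : Par) (β : ℕ) : ℕ := β / P.BB
def row (P : Par) (β : ℕ) : ℕ := β % P.BB / P.Bc
def col (P : Par) (β : ℕ) : ℕ := β % P.BB % P.Bc

/-- The layers of machine `id`. -/
def zBase (P : Par) (id : ℕ) : ℕ := id * (P.n + 2)
def zRun (P : Par) (id ρ : ℕ) : ℕ := id * (P.n + 2) + 1 + ρ

/-! ### Auxiliary programs -/

/-- Find guess (`24`), row (`26`) and column (`27`) of the block in register `23`, and the first row (`28`)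
and column (`29`) of the block in the matrix. -/
def decodeBlock : Program := .arith .quot 24 23 11 ;; .arith .times 25 24 11 ;; .arith .minus 25 23 25 ;;
    .arith .quot 26 25 12 ;; .arith .times 27 26 12 ;; .arith .minus 27 25 27 ;;
    .arith .times 28 26 4 ;; .arith .times 29 27 5

/-- Block (`23`), copy (`34`) and base layer (`32`) of the machine in register `50`. -/
def decode : Program :=
  .arith .quot 23 50 3 ;; .arith .times 34 23 3 ;; .arith .minus 34 50 34 ;; decodeBlock ;;
    .arith .times 32 50 18

theorem sub_div_mul (x y : ℕ) : x - x / y * y = x % y := by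
  have := Nat.mod_add_div x y; rw [mul_comm] at this; omega

/-- The result of `decodeBlock`. -/
structure Block (P : Par) (β : ℕ) (σ : State) : Prop where
  r23 : σ.reg 23 = β
  r24 : σ.reg 24 = P.guess β
  r26 : σ.reg 26 = P.row β
  r27 : σ.reg 27 = P.col β
  r28 : σ.reg 28 = P.row β * P.a
  r29 : σ.reg 29 = P.col β * P.b

theorem eval_decode (ω : ℕ → Bool) (h : P.Regs σ) (hid : σ.reg 50 = id) :
    Block P (id / P.g) (decode.eval ω σ) ∧ (decode.eval ω σ).reg 34 = id % P.g ∧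
    (decode.eval ω σ).reg 32 = P.zBase id := by
  refine ⟨⟨?_, ?_, ?_, ?_, ?_, ?_⟩, ?_, ?_⟩ <;>
    simp [decode, decodeBlock, Program.eval, BinOp.eval, hid, h.r3, h.r4, h.r5, h.r11, h.r12, h.r18,
      sub_div_mul, guess, row, col, zBase]

/-! ### The state between calls -/

/-- What holds of the state at any time: `A` is the stored copy of the matrix, and the layers of the
input array from `κ` on are unused. -/
structure Safe (P : Par) (A : ℕ → ℕ) (κ : ℕ) (σ : State) : Prop where
  regs : P.Regs σ
  ctr : σ.reg 22 = κ
  mat : σ.arr 2 = A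
  bit : ∀ i, A i ≤ 1
  fuel : ∀ i, σ.arr 5 i ≤ P.Fm
  dead : ∀ i, σ.arr 4 i ≤ 1
  ans : ∀ i, σ.arr 3 i ≤ 1
  cells : ∀ v, 10 ≤ v → ∀ i, (σ.arr v i).size ≤ P.B
  fresh : ∀ i z, z = 0 ∨ κ ≤ z → z < P.S → σ.arr 11 (i * P.S + z) = 0

theorem Safe.of_eq (h : P.Safe A κ σ)
    (hr : ∀ x < 23, σ'.reg x = σ.reg x) (ha : ∀ v, σ'.arr v = σ.arr v) : P.Safe A κ σ' where
  regs := h.regs.of_eq fun x hx => hr x (by omega)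
  ctr := by rw [hr 22 (by norm_num), h.ctr]
  mat := by rw [ha, h.mat]
  bit := h.bit
  fuel := by rw [ha]; exact h.fuel
  dead := by rw [ha]; exact h.dead
  ans := by rw [ha]; exact h.ans
  cells v := by rw [ha]; exact h.cells v
  fresh := by rw [ha]; exact h.fresh

theorem S_pos : 0 < P.S := by unfold S; positivity

/-- Layers other than `z` are not affected. -/
def Local (P : Par) (z : ℕ) (σ σ' : State) : Prop := ∀ v, 10 ≤ v → v ≠ 11 → ∀ i y, y < P.S → y ≠ z →
    σ'.arr v (i * P.S + y) = σ.arr v (i * P.S + y)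

theorem Local.trans {σ₁ σ₂ : State} (h : P.Local z σ σ₁) (h' : P.Local z σ₁ σ₂) :
    P.Local z σ σ₂ := fun v hv hv' i y hy hne => by
  rw [h' v hv hv' i y hy hne, h v hv hv' i y hy hne]

theorem Local.of_eq (h : ∀ v, 10 ≤ v → v ≠ 11 → σ'.arr v = σ.arr v) :
    P.Local z σ σ' := fun v hv hv' i y _ _ => by rw [h v hv hv']

theorem zBase_div (id : ℕ) : P.zBase id / (P.n + 2) = id := by
  unfold zBase; exact Nat.mul_div_cancel _ (by omega)

theorem zRun_div (id : ℕ) {ρ : ℕ} (hρ : ρ ≤ P.n) : P.zRun id ρ / (P.n + 2) = id := by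
  unfold zRun
  rw [add_assoc, mul_comm, Nat.mul_add_div (by omega), Nat.div_eq_of_lt (by omega), add_zero]

theorem zRun_lt {ρ : ℕ} (hid : id < P.NV) (hρ : ρ ≤ P.n) : P.zRun id ρ < P.S := by
  unfold zRun S; have h1 : (id + 1) * (P.n + 2) ≤ P.NV * (P.n + 2) := Nat.mul_le_mul_right _ hid
  have h2 : (P.n + 2) * (P.NV * 1) ≤ (P.n + 2) * ((P.NV + 1) * (P.E + 2)) :=
    Nat.mul_le_mul_left _ (Nat.mul_le_mul (by omega) (by omega))
  rw [add_mul] at h1; rw [mul_one, mul_comm] at h2; omega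

theorem zBase_lt (hid : id < P.NV) : P.zBase id < P.S := by
  have := zRun_lt (P := P) (ρ := 0) hid (Nat.zero_le _); unfold zRun at this; unfold zBase; omega

theorem S_le_X : P.S ≤ P.X := by unfold X; omega

/-- The registers that a call of a machine depends on: machine `id` runs in layer `z`, the input is in
layer `z'` of the input array. -/
structure Machine (P : Par) (id z z' : ℕ) (σ : State) : Prop where
  r31 : σ.reg 31 = z
  r32 : σ.reg 32 = P.zBase id
  r33 : σ.reg 33 = z'
  r34 : σ.reg 34 = id % P.g
  fuel : σ.reg 35 ≤ P.Fm
  id_lt : id < P.NV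
  z_lt : z < P.S
  z'_lt : z' < P.S

theorem Machine.moderate (h : P.Machine id z z' σ) (hs : P.Safe A κ σ) : Moderate P.L P.B P.Fm σ where
  zero := hs.regs.r0
  one := hs.regs.r1
  fuel := h.fuel
  cells := hs.cells
  params x hx := by
    have hX := S_le_X (P := P); have hg : P.g ≤ P.X := by unfold X; omega
    have := P.hg; have h1 := Nat.mod_lt id P.hg; have h2 := zBase_lt h.id_lt; have h3 := h.z_lt
    have h4 := h.z'_lt; refine (Nat.le_add_right _ 3).trans (size_le_L (P := P) ?_)
    simp only [Finset.mem_insert, Finset.mem_singleton] at hx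
    rcases hx with rfl | rfl | rfl | rfl | rfl | rfl <;>
      simp only [hs.regs.r3, hs.regs.r7, h.r31, h.r32, h.r33, h.r34] <;> omega

theorem Machine.layered (h : P.Machine id z z' σ) (hs : P.Safe A κ σ) : Layered σ where
  zero := hs.regs.r0
  one := hs.regs.r1
  lt x hx := by
    simp only [Finset.mem_insert, Finset.mem_singleton] at hx; rw [hs.regs.r7]
    rcases hx with rfl | rfl | rfl
    · rw [h.r31]; exact h.z_lt
    · rw [h.r32]; exact zBase_lt h.id_lt
    · rw [h.r33]; exact h.z'_lt

/-- A call of a machine is safe. -/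
theorem safe_simulate (hp : p.constSize ≤ P.D.preprocess.constSize + P.D.update.constSize + P.D.query.constSize) (hs : P.Safe A κ σ)
    (hm : P.Machine id z z' σ) (hz₀ : z' ≠ 0) (hz : z' < κ) :
    wp ω (simulate p) (fun σ' T' => P.Safe A κ σ' ∧ P.Machine id z z' σ' ∧ P.Local z σ σ' ∧
      T' + p.slowdown * P.L * potential P.B (σ'.reg 35) ≤
        T + p.slowdown * P.L * potential P.B (σ.reg 35) + p.slowdown * P.L ∧
      σ'.reg 35 ≤ σ.reg 35) σ T := by
  have hB : P.B ≤ P.X := by unfold X; omega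
  refine wp_mono (paid_simulate (ω := ω) (L := P.L) (B := P.B) (Fm := P.Fm) (size_le_L hB) p
    (by unfold B; omega) σ T (hm.moderate hs)) ?_
  rintro σ' T' hF ⟨h1, h2, h3, h4, h5⟩
  have hst : ∀ v, v < 10 → σ'.arr v = σ.arr v := fun v hv =>
    hF.2 v fun hmem => by have := stores_simulate p v hmem; omega
  have h7 := hs.regs.r7
  refine ⟨⟨hs.regs.of_eq fun x hx => h1 x (by omega), by rw [h1 22 (by norm_num), hs.ctr],
    by rw [hst 2 (by norm_num), hs.mat], hs.bit, by rw [hst 5 (by norm_num)]; exact hs.fuel,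
    by rw [hst 4 (by norm_num)]; exact hs.dead, by rw [hst 3 (by norm_num)]; exact hs.ans, h4, ?_⟩,
    ⟨by rw [h1 _ (by norm_num), hm.r31], by rw [h1 _ (by norm_num), hm.r32],
    by rw [h1 _ (by norm_num), hm.r33], by rw [h1 _ (by norm_num), hm.r34], h2.trans hm.fuel,
    hm.id_lt, hm.z_lt, hm.z'_lt⟩, ?_, ?_, h2⟩
  -- Stores of the simulated program into its input array go to layer `z'`, which is neither `0` nor
  -- one of the layers from `κ` on; so unused input layers remain empty.
  · intro i y hy hyS; rw [← hs.fresh i y hy hyS]; by_contra hne; obtain ⟨j, hj⟩ := h5 _ _ hne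
    rw [h7, topLayer, if_pos rfl, hm.r33] at hj; have := (mul_add_inj hyS hm.z'_lt hj).2; omega
  · intro v hv hv' i y hy hyd; by_contra hne; obtain ⟨j, hj⟩ := h5 _ _ hne
    rw [h7, topLayer, if_neg hv', hm.r31] at hj; have := (mul_add_inj hy hm.z_lt hj).2; exact hyd this
  · rw [mul_add, mul_one] at h3; omega

/-- Entry `i` of the virtual array `v` with top layer `z` and lower layer `z₀`. -/
def cell (P : Par) (σ : State) (z z₀ v i : ℕ) : ℕ :=
  if σ.arr v (i * P.S + z) = 0 then σ.arr v (i * P.S + z₀) - 1 else σ.arr v (i * P.S + z) - 1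

/-- The layers `z` and `z₀` contain the state `τ`, except for its input array. -/
structure MemRep (P : Par) (σ : State) (z z₀ : ℕ) (τ : State) : Prop where
  reg : ∀ x, τ.reg x = P.cell σ z z₀ (10 + 2 * x) 0
  arr : ∀ b, 1 ≤ b → ∀ i, τ.arr b i = P.cell σ z z₀ (11 + 2 * b) i

theorem MemRep.of_eq {τ : State} {z₀ : ℕ} (h : P.MemRep σ z z₀ τ) (hz : z < P.S) (hz₀ : z₀ < P.S)
    (he : ∀ v, 10 ≤ v → v ≠ 11 → ∀ i y, y < P.S → y = z ∨ y = z₀ →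
      σ'.arr v (i * P.S + y) = σ.arr v (i * P.S + y)) : P.MemRep σ' z z₀ τ where
  reg x := by
    rw [h.reg, cell, cell, he _ (by omega) (by omega) _ z hz (.inl rfl),
      he _ (by omega) (by omega) _ z₀ hz₀ (.inr rfl)]
  arr b hb i := by
    rw [h.arr b hb, cell, cell, he _ (by omega) (by omega) _ z hz (.inl rfl),
      he _ (by omega) (by omega) _ z₀ hz₀ (.inr rfl)]

theorem Machine.virt (h : P.Machine id z z' σ) (hs : P.Safe A κ σ) {v : ℕ} (hv : v ≠ 11) (i : ℕ) :
    σ.virt v i = P.cell σ z (P.zBase id) v i := by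
  rw [State.virt, cell, topLayer, lowLayer, if_neg hv, if_neg hv, h.r31, h.r32, hs.regs.r7]

theorem Machine.virt_input (h : P.Machine id z z' σ)
    (hs : P.Safe A κ σ) (i : ℕ) : σ.virt 11 i = σ.arr 11 (i * P.S + z') - 1 := by
  have h0 := hs.fresh i 0 (.inl rfl) S_pos
  rw [State.virt, topLayer, lowLayer, if_pos rfl, if_pos rfl, h.r33, hs.regs.r0, hs.regs.r7, h0]
  split_ifs with h <;> simp [h]

/-- A call of a machine whose memory is known. -/
theorem rep_call {τ τ' : State} {inp : ℕ → ℕ} (hs : P.Safe A κ σ) (hm : P.Machine id z z' σ)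
    (hτ : P.MemRep σ z (P.zBase id) τ) (hinp : ∀ i, inp i = σ.arr 11 (i * P.S + z') - 1)
    (he : Exec (tape P.g (id % P.g) ω) p (τ.withInput inp) t τ') (ht : 4 * t < σ.reg 35) :
    wp ω (simulate p) (fun σ' _ => P.MemRep σ' z (P.zBase id) τ' ∧ σ.reg 35 ≤ σ'.reg 35 + 4 * t ∧
      σ'.virt 13 0 = τ'.output 0) σ T := by
  refine wp_mono (rep_simulate he σ T (hm.layered hs) (fun y => ?_) ?_ ht) ?_
  · rw [hs.regs.r3, hm.r34, tape]
  · refine ⟨fun x => ?_, fun b i => ?_⟩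
    · rw [hm.virt hs (by omega), ← hτ.reg x]; rfl
    · rcases Nat.eq_zero_or_pos b with rfl | hb
      · rw [hm.virt_input hs, ← hinp]; simp [State.withInput]
      · rw [hm.virt hs (by omega), ← hτ.arr b hb]
        simp [State.withInput, Function.update_apply, Nat.pos_iff_ne_zero.1 hb]
  · rintro σ' _ - ⟨h1, h2, h3⟩
    have hv : ∀ v, v ≠ 11 → ∀ i, σ'.virt v i = P.cell σ' z (P.zBase id) v i := fun v hv i => by
      rw [State.virt, cell, topLayer, lowLayer, if_neg hv, if_neg hv, h1 31 (by norm_num),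
        h1 32 (by norm_num), h1 7 (by norm_num), hm.r31, hm.r32, hs.regs.r7]
    exact ⟨⟨fun x => by rw [h2.1, hv _ (by omega)], fun b hb i => by rw [h2.2, hv _ (by omega)]⟩, h3,
      (h2.2 1 0).symm⟩

variable {P : Par}

/-- `v` is `1` if `p` holds and `0` otherwise. -/
def IsBit (v : ℕ) (p : Prop) : Prop := (p → v = 1) ∧ (¬ p → v = 0)

/-! ### Writing the initial digraph to the memory of a machine -/

/-- `r 57 := 1` and, in the decremental case, `r 56 := 1` -/
def dynMark : Mode → Program
  | .incremental => .const 57 1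
  | .decremental => .const 56 1 ;; .const 57 1

/-- For the pair of vertices `r 54`, `r 55`: is it an edge in the beginning (`56`), is it ever an edge
(`57`)? -/
def edgeTest (mode : Mode) : Program :=
  .const 56 0 ;; .const 57 0 ;; .arith .plus 58 4 5 ;; .arith .plus 59 58 4 ;;
  ifLt 54 4 (.arith .plus 60 54 1 ;; ifEq 55 60 (.const 56 1 ;; .const 57 1)
      (ifLt 4 55 (ifLt 58 55 .skip (dynMark mode)) .skip))
    (ifLt 4 54 (ifLt 58 54 (ifLt 59 54 (ifLt 59 55 (ifEq 54 55 .skip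
              (.arith .plus 60 59 1 ;; .arith .plus 60 60 30 ;;
                ifLt 54 60 (.const 56 1 ;; .const 57 1) .skip)) .skip)
          (.cond 55 .skip (.const 56 1 ;; .const 57 1)))
        (ifLt 58 55 (ifLt 59 55 .skip
            (.arith .plus 60 58 1 ;; .arith .minus 60 55 60 ;; .arith .plus 60 60 28 ;;
              .arith .times 60 60 8 ;; .arith .plus 61 4 1 ;; .arith .minus 61 54 61 ;;
              .arith .plus 61 61 29 ;; .arith .plus 60 60 61 ;; .load 2 56 60 ;;
              .arith .plus 57 56 0)) .skip)) .skip)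

/-- The matrix of block `β` in the copy `A` of the matrix. -/
def blockMat (P : Par) (A : ℕ → ℕ) (β : ℕ) (i c : ℕ) : Bool :=
  decide (A ((i + P.row β * P.a) * P.W + (c + P.col β * P.b)) ≠ 0)

/-- number of edges from the padding, in units of rows -/
def width (P : Par) (β : ℕ) : ℕ := P.guess β * P.b

theorem eval_edgeTest (ω : ℕ → Bool) (h : P.Regs σ) {β : ℕ} (hx : σ.reg 54 = x)
    (hy : σ.reg 55 = y) (h28 : σ.reg 28 = P.row β * P.a) (h29 : σ.reg 29 = P.col β * P.b)
    (h30 : σ.reg 30 = P.width β) (hA : ∀ i, σ.arr 2 i ≤ 1) :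
    IsBit (((edgeTest P.mode).eval ω σ).reg 56) (staticEdge P.a P.b (P.width β)
      (P.blockMat (σ.arr 2) β) x y ∨ P.mode = Mode.decremental ∧ dynEdge P.a P.b x y) ∧
    IsBit (((edgeTest P.mode).eval ω σ).reg 57) (staticEdge P.a P.b (P.width β)
      (P.blockMat (σ.arr 2) β) x y ∨ dynEdge P.a P.b x y) := by
  have h4 := h.r4; have h5 := h.r5; have h0 := h.r0; have h1 := h.r1; have h8 := h.r8
  have hM : P.blockMat (σ.arr 2) β (y - (P.a + P.b + 1)) (x - (P.a + 1)) = true ↔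
      σ.arr 2 ((y - (P.a + P.b + 1) + P.row β * P.a) * P.W + (x - (P.a + 1) + P.col β * P.b)) = 1 := by
    have := hA ((y - (P.a + P.b + 1) + P.row β * P.a) * P.W + (x - (P.a + 1) + P.col β * P.b))
    simp [blockMat]; omega
  have hA' := hA ((y - (P.a + P.b + 1) + P.row β * P.a) * P.W + (x - (P.a + 1) + P.col β * P.b))
  unfold staticEdge dynEdge IsBit; rw [hM]; clear hM
  generalize P.mode = mode
  cases mode
  all_goals
    simp only [edgeTest, dynMark, Program.eval, BinOp.eval, eval_ifLt, eval_ifEq, ne_eq,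
      not_false_eq_true, State.reg_setReg, State.arr_setReg, h4, h5, hx, h1, h8, h0, hy, h28, h29,
      h30, Nat.reduceEqDiff, reduceIte, reduceCtorEq, false_and, or_false, true_and]
    split_ifs
    all_goals
      refine ⟨⟨fun hp => ?_, fun hp => ?_⟩, fun hp => ?_, fun hp => ?_⟩ <;>
        simp only [State.reg_setReg, Nat.reduceEqDiff, if_true, if_false] <;> omega

/-- Write the pair of vertices number `r 52` to the input, and count the edges in register `20`. -/
def edgeBody (mode : Mode) : Program :=
  (.arith .quot 54 52 6 ;; .arith .times 55 54 6 ;; .arith .minus 55 52 55) ;; edgeTest mode ;;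
    .arith .plus 20 20 57 ;; .const 61 2 ;; .arith .plus 61 61 52 ;; .arith .times 61 61 7 ;;
    .arith .plus 61 61 33 ;; .arith .plus 56 56 1 ;; .store 11 61 56

open Classical in
/-- Is the pair of vertices number `e` an edge in the beginning? -/
noncomputable def startBit (P : Par) (A : ℕ → ℕ) (β e : ℕ) : ℕ :=
  if staticEdge P.a P.b (P.width β) (P.blockMat A β) (e / P.nG) (e % P.nG) ∨
    P.mode = Mode.decremental ∧ dynEdge P.a P.b (e / P.nG) (e % P.nG) then 1 else 0

/-- Is the pair of vertices number `e` ever an edge? -/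
def fullBit (P : Par) (A : ℕ → ℕ) (β e : ℕ) : ℕ :=
  if staticEdge P.a P.b (P.width β) (P.blockMat A β) (e / P.nG) (e % P.nG) ∨
    dynEdge P.a P.b (e / P.nG) (e % P.nG) then 1 else 0

theorem flat_edgeTest : (edgeTest P.mode).Flat := by
  cases P.mode <;> simp [edgeTest, Program.Flat, ifLt, ifEq, dynMark]

theorem eval_edgeBody (ω : ℕ → Bool) (h : P.Regs σ) {β : ℕ}
    (he : σ.reg 52 = e) (h28 : σ.reg 28 = P.row β * P.a) (h29 : σ.reg 29 = P.col β * P.b)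
    (h30 : σ.reg 30 = P.width β) (h33 : σ.reg 33 = z) (hA : ∀ i, σ.arr 2 i ≤ 1) :
    ((edgeBody P.mode).eval ω σ).reg 20 = σ.reg 20 + P.fullBit (σ.arr 2) β e ∧
    ((edgeBody P.mode).eval ω σ).arr =
      (σ.setArr 11 ((2 + e) * P.S + z) (P.startBit (σ.arr 2) β e + 1)).arr := by
  unfold edgeBody; rw [Program.eval]
  set σ₁ := (Program.arith BinOp.quot 54 52 6 ;; Program.arith BinOp.times 55 54 6 ;;
    Program.arith BinOp.minus 55 52 55).eval ω σ with hσ₁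
  have hr : ∀ x, x ≠ 54 → x ≠ 55 → σ₁.reg x = σ.reg x := by
    intro x h1 h2; simp [hσ₁, Program.eval, h1, h2]
  have ha : σ₁.arr = σ.arr := by simp [hσ₁, Program.eval]
  have h54 : σ₁.reg 54 = e / P.nG := by simp [hσ₁, Program.eval, BinOp.eval, he, h.r6]
  have h55 : σ₁.reg 55 = e % P.nG := by
    simp [hσ₁, Program.eval, BinOp.eval, he, h.r6, sub_div_mul]
  have key := eval_edgeTest ω (h.of_eq (σ' := σ₁) fun x hx => hr x (by omega) (by omega)) h54 h55
    (by rw [hr 28 (by norm_num) (by norm_num), h28]) (by rw [hr 29 (by norm_num) (by norm_num), h29])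
    (by rw [hr 30 (by norm_num) (by norm_num), h30]) (by rw [ha]; exact hA)
  have hF := Flat.framed (ω := ω) (flat_edgeTest (P := P)) σ₁; rw [Program.eval]
  set σ₂ := (edgeTest P.mode).eval ω σ₁ with hσ₂
  have w1 : ∀ x ∈ ({1, 7, 20, 33, 52} : Finset ℕ), x ∉ (edgeTest P.mode).writes := by
    cases P.mode <;> decide
  have w2 : (edgeTest P.mode).stores = ∅ := by cases P.mode <;> decide
  have hr₂ : ∀ x ∈ ({1, 7, 20, 33, 52} : Finset ℕ), σ₂.reg x = σ.reg x := fun x hx => by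
    rw [hF.1 x (w1 x hx), hr x (by rintro rfl; simp at hx) (by rintro rfl; simp at hx)]
  have ha₂ : σ₂.arr = σ.arr := by
    funext v; rw [hF.2 v (by rw [w2]; simp), ha]
  rw [ha] at key
  have k1 : σ₂.reg 56 = P.startBit (σ.arr 2) β e := by
    unfold startBit; split_ifs with hp
    · exact key.1.1 hp
    · exact key.1.2 hp
  have k2 : σ₂.reg 57 = P.fullBit (σ.arr 2) β e := by
    unfold fullBit; split_ifs with hp
    · exact key.2.1 hp
    · exact key.2.2 hp
  have e1 := hr₂ 1 (by decide); have e7 := hr₂ 7 (by decide); have e20 := hr₂ 20 (by decide)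
  have e33 := hr₂ 33 (by decide); have e52 := hr₂ 52 (by decide); constructor
  · simp [Program.eval, BinOp.eval, e20, k2]
  · funext v
    simp [Program.eval, BinOp.eval, e1, e7, e33, e52, k1, State.arr_setArr, ha₂, h.r1, h.r7, h33, he]

variable {P : Par}

/-! ### Preprocessing of a machine -/

def preHead : Program :=
  decode ;; .arith .times 30 24 5 ;; .arith .plus 31 32 0 ;; .arith .plus 33 22 0 ;;
    .arith .plus 22 22 1 ;; .arith .plus 35 13 0 ;; .const 20 0

def preTail : Program :=
  .arith .plus 61 6 1 ;; .store 11 33 61 ;; .arith .plus 61 20 1 ;; .arith .plus 60 7 33 ;;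
    .store 11 60 61

/-- Load the initial digraph and run the preprocessing program. -/
def preMachine (D : DataStructure) (mode : Mode) : Program :=
  (preHead ;; forLoop 52 17 53 1 (edgeBody mode) ;; preTail) ;; simulate D.preprocess ;; .store 5 50 35

/-- The input of the preprocessing program. -/
noncomputable def preInput (P : Par) (A : ℕ → ℕ) (β i : ℕ) : ℕ :=
  if i = 0 then P.nG else if i = 1 then ∑ e ∈ Finset.range P.nGG, P.fullBit A β e
  else if i < P.nGG + 2 then P.startBit A β (i - 2) else 0

theorem fullBit_le (A : ℕ → ℕ) (β e : ℕ) : P.fullBit A β e ≤ 1 := by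
  unfold fullBit; split_ifs <;> omega

theorem startBit_le (A : ℕ → ℕ) (β e : ℕ) : P.startBit A β e ≤ 1 := by
  unfold startBit; split_ifs <;> omega

theorem sum_fullBit_le (A : ℕ → ℕ) (β k : ℕ) : ∑ e ∈ Finset.range k, P.fullBit A β e ≤ k := by
  simpa using Finset.sum_le_card_nsmul (Finset.range k) _ 1 fun e _ => P.fullBit_le A β e

theorem size_le_self (x : ℕ) : x.size ≤ x := Nat.size_le.2 Nat.lt_two_pow_self

theorem row_mul_le (β : ℕ) : P.row β * P.a ≤ P.n := by
  have h : P.row β < P.Br := by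
    unfold row; refine Nat.div_lt_of_lt_mul ?_; rw [mul_comm]; exact Nat.mod_lt _ BB_pos
  unfold Br at h; exact (Nat.mul_le_mul_right _ (by omega)).trans (Nat.div_mul_le_self P.n P.a)

theorem col_mul_le (β : ℕ) : P.col β * P.b ≤ P.n := by
  have h : P.col β < P.Bc := Nat.mod_lt _ Bc_pos; unfold Bc at h
  exact (Nat.mul_le_mul_right _ (by omega)).trans (Nat.div_mul_le_self P.n P.b)

theorem NB_le_NV : P.NB ≤ P.NV := Nat.le_mul_of_pos_right _ P.hg

theorem width_le {β : ℕ} (hβ : β < P.NB) : P.width β ≤ P.S := by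
  have h1 : P.guess β ≤ β := Nat.div_le_self _ _; have h2 := NB_le_NV (P := P)
  have h3 : P.guess β * P.b ≤ (P.NV + 1) * (P.E + 2) := Nat.mul_le_mul (by omega) (by unfold E; omega)
  exact h3.trans (Nat.le_mul_of_pos_left _ (by omega))

theorem block_lt (hid : id < P.NV) : id / P.g < P.NB :=
  Nat.div_lt_of_lt_mul (by rw [mul_comm]; exact hid)

theorem size_le (h : x ≤ P.X) : x.size ≤ P.L := (Nat.le_add_right _ 3).trans (size_le_L h)

theorem one_le_L : 1 ≤ P.L := by have := L_pos (P := P); omega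

theorem Regs.wp (hr : P.Regs σ) (need loads : List ℕ) (h : ∀ x ∈ need, σ.reg x ≤ P.X)
    (ha : ∀ b ∈ loads, ∀ i, σ.arr b i ≤ P.X)
    (hQ : Framed p σ (p.eval ω σ) → Q (p.eval ω σ) (T + p.weight * P.L))
    (hd : p.Flat ∧ (∀ x ∈ p.need, x < 19 ∨ x ∈ need) ∧ ∀ b ∈ p.loads, b ∈ loads := by decide) :
    RAM.wp ω p Q σ T :=
  wp_flat P.L hd.1 one_le_L (fun x hx => (hd.2.1 x hx).elim
    (fun h' => (Nat.le_add_right _ 3).trans (hr.size_le h')) fun h' => Par.size_le (h x h'))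
    (fun b hb i => Par.size_le (ha b (hd.2.2 b hb) i)) hQ

theorem one_le_X : 1 ≤ P.X := by unfold X; omega

def loadCost (mode : Mode) : ℕ := preHead.weight + (edgeBody mode).weight + preTail.weight + 20

-- Each call gets a new layer `κ` of the input array over the empty layer `0`, so an old input never
-- has to be erased. The machine itself works directly in its base layer here.
set_option maxRecDepth 4000 in
theorem wp_loadGraph (hs : P.Safe A κ σ)
    (hid : id < P.NV) (h50 : σ.reg 50 = id) (hκ : κ < P.S) (hκ₀ : κ ≠ 0) :
    wp ω (preHead ;; forLoop 52 17 53 1 (edgeBody P.mode) ;; preTail) (fun σ' T' =>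
      P.Safe A (κ + 1) σ' ∧ P.Machine id (P.zBase id) κ σ' ∧ σ'.reg 35 = P.Fpre ∧
      σ'.reg 50 = id ∧ (∀ v, v ≠ 11 → σ'.arr v = σ.arr v) ∧
      (∀ i, P.preInput A (id / P.g) i = σ'.arr 11 (i * P.S + κ) - 1) ∧
      T' ≤ T + loadCost P.mode * P.L * (P.nGG + 1)) σ T := by
  have hL := one_le_L (P := P); have hr := hs.regs; have h0 := hr.r0; have h13 := hr.r13
  have h22 := hs.ctr; have hSX := S_le_X (P := P); have hXid : id ≤ P.X := by unfold X; omega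
  refine wp_seq (hr.wp [22, 50] [] (by simp [h22, h50]; omega) (by simp) fun hF => ?_)
  obtain ⟨hb, h34, h32⟩ := eval_decode ω hr h50; set σd := decode.eval ω σ with hσd
  have hFd : Framed decode σ σd := Flat.framed (by simp [decode, decodeBlock, Program.Flat]) σ
  have d0 : σd.reg 0 = 0 := (hFd.1 0 (by decide)).trans h0
  have d5 : σd.reg 5 = P.b := (hFd.1 5 (by decide)).trans hr.r5
  have d13 : σd.reg 13 = P.Fpre := (hFd.1 13 (by decide)).trans h13
  have d22 : σd.reg 22 = κ := (hFd.1 22 (by decide)).trans h22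
  have d1 : σd.reg 1 = 1 := (hFd.1 1 (by decide)).trans hr.r1
  obtain ⟨σ₁, hσ₁⟩ : ∃ σ₁, preHead.eval ω σ = σ₁ := ⟨_, rfl⟩
  have e31 : σ₁.reg 31 = P.zBase id := by
    rw [← hσ₁]; simp [preHead, Program.eval, BinOp.eval, ← hσd, d0, h32]
  have e32 : σ₁.reg 32 = P.zBase id := by
    rw [← hσ₁]; simp [preHead, Program.eval, BinOp.eval, ← hσd, h32]
  have e33 : σ₁.reg 33 = κ := by
    rw [← hσ₁]; simp [preHead, Program.eval, BinOp.eval, ← hσd, d22, d0]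
  have e22 : σ₁.reg 22 = κ + 1 := by
    rw [← hσ₁]; simp [preHead, Program.eval, BinOp.eval, ← hσd, d22, d1]
  have e34 : σ₁.reg 34 = id % P.g := by
    rw [← hσ₁]; simp [preHead, Program.eval, BinOp.eval, ← hσd, h34]
  have e35 : σ₁.reg 35 = P.Fpre := by
    rw [← hσ₁]; simp [preHead, Program.eval, BinOp.eval, ← hσd, d13, d0]
  have e20 : σ₁.reg 20 = 0 := by
    rw [← hσ₁]; simp [preHead, Program.eval, BinOp.eval]
  have e28 : σ₁.reg 28 = P.row (id / P.g) * P.a := by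
    rw [← hσ₁]; simp [preHead, Program.eval, BinOp.eval, ← hσd, hb.r28]
  have e29 : σ₁.reg 29 = P.col (id / P.g) * P.b := by
    rw [← hσ₁]; simp [preHead, Program.eval, BinOp.eval, ← hσd, hb.r29]
  have e30 : σ₁.reg 30 = P.width (id / P.g) := by
    rw [← hσ₁]; simp [preHead, Program.eval, BinOp.eval, ← hσd, hb.r24, d5, width]
  rw [hσ₁] at hF ⊢; have ha := hF.arr
  have hr₁ : P.Regs σ₁ := hr.of_eq fun x hx =>
    hF.1 x ((by decide : ∀ x < 19, x ∉ preHead.writes) x hx)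
  have e50 : σ₁.reg 50 = id := (hF.1 50 (by decide)).trans h50
  have sE : (forLoop 52 17 53 1 (edgeBody P.mode)).stores = {11} := by cases P.mode <;> decide
  have wF : ∀ x, x < 52 ∧ x ≠ 20 ∧ x ≠ 45 → x ∉ (forLoop 52 17 53 1 (edgeBody P.mode)).writes := by
    intro x h hx
    have : (forLoop 52 17 53 1 (edgeBody P.mode)).writes ⊆
        {20, 45, 52, 53, 54, 55, 56, 57, 58, 59, 60, 61} := by cases P.mode <;> decide
    have := this hx; simp at this; omega
  set β := id / P.g with hβ
  refine wp_seq (wp_for_const P.nGG ((edgeBody P.mode).weight * P.L)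
    (fun k σ' => σ'.reg 20 = ∑ e ∈ Finset.range k, P.fullBit A β e ∧
      ∀ i y, y < P.S → σ'.arr 11 (i * P.S + y) =
        if y = κ ∧ 2 ≤ i ∧ i < k + 2 then P.startBit A β (i - 2) + 1 else σ₁.arr 11 (i * P.S + y))
    hr₁.r17 hr₁.r1 ?_ ?_ ?_ ?_ (by cases P.mode <;> decide))
  · rintro k σ' x y ⟨h1, h2⟩; exact ⟨by simpa using h1, by simpa using h2⟩
  · refine ⟨by simp [e20], fun i y _ => ?_⟩; rw [if_neg (by omega)]
  · rintro k hk σ₂ T₂ ⟨h1, h2⟩ hF₂ h52; have hfr := fun x h => hF₂.1 x (wF x h)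
    have hr₂ : P.Regs σ₂ := hr₁.of_eq fun x hx => hfr x (by omega)
    have m₂ : σ₂.arr 2 = A := by
      rw [hF₂.2 2 (by simp [sE]), ha, hs.mat]
    have e28' := (hfr 28 (by simp)).trans e28; have e29' := (hfr 29 (by simp)).trans e29
    have e30' := (hfr 30 (by simp)).trans e30; have e33' := (hfr 33 (by simp)).trans e33
    have hev := eval_edgeBody ω hr₂ h52 e28' e29' e30' e33' (by rw [m₂]; exact hs.bit); rw [m₂] at hev
    refine hr₂.wp [20, 28, 29, 30, 33, 52] [2] ?_ ?_ ?_ (by cases P.mode <;> decide)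
    · simp only [List.forall_mem_cons, h1, e28', e29', e30', e33', h52]
      have := sum_fullBit_le (P := P) A β k; have := row_mul_le (P := P) β; have := col_mul_le (P := P) β
      have : P.width β ≤ P.S := width_le (block_lt hid); have : P.n + P.nGG ≤ P.X := by unfold X; omega
      exact ⟨by omega, by omega, by omega, by omega, by omega, by omega, by simp⟩
    · simpa [m₂] using fun i => (hs.bit i).trans one_le_X
    · intro _; refine ⟨⟨?_, ?_⟩, by omega⟩
      · rw [hev.1, h1, Finset.sum_range_succ]
      · intro i y hy; rw [hev.2, State.arr_setArr_apply]
        by_cases hiy : i = 2 + k ∧ y = κ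
        · rw [hiy.1, hiy.2, if_pos ⟨rfl, rfl⟩, if_pos (by omega)]; simp
        · rw [if_neg (fun hc => hiy (mul_add_inj hy hκ hc.2)), h2 i y hy]
          by_cases hc : y = κ ∧ 2 ≤ i ∧ i < k + 2
          · rw [if_pos hc, if_pos (by omega)]
          · rw [if_neg hc, if_neg (by omega)]
  · rintro σ₂ T₂ ⟨h1, h2⟩ hF₂ hT₂; have hfr := fun x h => hF₂.1 x (wF x h)
    have hr₂ : P.Regs σ₂ := hr₁.of_eq fun x hx => hfr x (by omega)
    have f33 : σ₂.reg 33 = κ := (hfr 33 (by simp)).trans e33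
    have ha₂ : ∀ v, v ≠ 11 → σ₂.arr v = σ.arr v := fun v hv => by
      rw [hF₂.2 v (by simp [sE, hv]), ha]
    have hm := sum_fullBit_le (P := P) A β P.nGG; have hG : P.nGG ≤ P.X := by unfold X; omega
    refine hr₂.wp [20, 33] [] (by simp [h1, f33]; omega) (by simp) ?_
    · intro hF₃; obtain ⟨σ₃, hσ₃⟩ : ∃ σ₃, preTail.eval ω σ₂ = σ₃ := ⟨_, rfl⟩
      -- Input position 1, at address `1 * S + κ`, is the number of edges; it can be filled only
      -- now, as the loop has counted the edges while writing the adjacency matrix.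
      have g11 : ∀ i, σ₃.arr 11 i = if i = P.S + κ then
          ∑ e ∈ Finset.range P.nGG, P.fullBit A β e + 1 else if i = κ then P.nG + 1 else
            σ₂.arr 11 i := by
        intro i; rw [← hσ₃]
        simp only [preTail, Program.eval, BinOp.eval, State.arr_setArr_apply, State.reg_setReg,
          State.reg_setArr, State.arr_setReg, hr₂.r1, hr₂.r6, hr₂.r7, f33, h1, Nat.reduceEqDiff,
          if_true, if_false, true_and]
      rw [hσ₃] at hF₃ ⊢
      have hall := fun x (h : x < 52 ∧ x ≠ 20 ∧ x ≠ 45) => (hF₃.1 x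
        ((by decide : ∀ x < 60, x ∉ preTail.writes) x (by omega))).trans (hfr x h)
      have ha₃ : ∀ v, v ≠ 11 → σ₃.arr v = σ.arr v := fun v hv => by
        rw [hF₃.2 v (by simpa [(by decide : preTail.stores = {11})] using hv), ha₂ v hv]
      have hS := S_pos (P := P)
      have c11 : ∀ i y, y < P.S → σ₃.arr 11 (i * P.S + y) = if y = κ ∧ i < P.nGG + 2 then
          P.preInput A β i + 1 else σ.arr 11 (i * P.S + y) := by
        intro i y hy; rw [g11]
        by_cases q1 : i = 1 ∧ y = κ
        · rw [q1.1, q1.2, one_mul, if_pos rfl, if_pos (by omega)]; simp [preInput]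
        · rw [if_neg (fun hc => q1 (mul_add_inj hy hκ (by rw [hc, one_mul])))]
          by_cases q0 : i = 0 ∧ y = κ
          · rw [q0.1, q0.2, zero_mul, zero_add, if_pos rfl, if_pos (by omega)]; simp [preInput]
          · rw [if_neg (fun hc => q0 (mul_add_inj hy hκ (by rw [hc, zero_mul, zero_add]))), h2 i y hy, ha]
            by_cases hc : y = κ ∧ 2 ≤ i ∧ i < P.nGG + 2
            · rw [if_pos hc, if_pos ⟨hc.1, hc.2.2⟩, preInput, if_neg (by omega), if_neg (by omega),
                if_pos hc.2.2]
            · rw [if_neg hc, if_neg (by omega)]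
      have hI : ∀ i, P.preInput A β i ≤ P.nG + P.nGG + 1 := by
        intro i; unfold preInput; have := startBit_le (P := P) A β (i - 2); split_ifs <;> omega
      refine ⟨⟨hr₁.of_eq fun x hx => hall x (by omega), (hall 22 (by simp)).trans e22,
        by rw [ha₃ 2 (by norm_num), hs.mat], hs.bit, by rw [ha₃ 5 (by norm_num)]; exact hs.fuel,
        by rw [ha₃ 4 (by norm_num)]; exact hs.dead, by rw [ha₃ 3 (by norm_num)]; exact hs.ans, ?_, ?_⟩,
        ⟨(hall 31 (by simp)).trans e31, (hall 32 (by simp)).trans e32, (hall 33 (by simp)).trans e33,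
          (hall 34 (by simp)).trans e34,
          by rw [hall 35 (by simp), e35]; unfold Fm; omega,
          hid, zBase_lt hid, hκ⟩,
        (hall 35 (by simp)).trans e35,
        (hall 50 (by simp)).trans e50, ha₃, ?_, ?_⟩
      · intro v hv i
        by_cases hv11 : v = 11
        · subst hv11; have := Nat.div_add_mod i P.S; rw [mul_comm] at this
          rw [← this, c11 _ _ (Nat.mod_lt _ hS)]; split_ifs
          · refine (size_le_self _).trans ?_; have := hI (i / P.S); unfold B; omega
          · exact hs.cells 11 (by norm_num) _
        · rw [ha₃ v hv11]; exact hs.cells v hv i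
      · intro i y hy hyS; rw [c11 i y hyS, if_neg (by omega)]; exact hs.fresh i y (by omega) hyS
      · intro i; rw [c11 i κ hκ]
        by_cases hi : i < P.nGG + 2
        · rw [if_pos ⟨rfl, hi⟩]; simp
        · rw [if_neg (by omega), hs.fresh i κ (by omega) hκ, preInput, if_neg (by omega),
            if_neg (by omega), if_neg (by omega)]
      · have hz : P.nGG.size + 1 ≤ P.L := by have := size_le_L hG; omega
        have m1 : P.nGG * (10 * (P.nGG.size + 1)) ≤ P.nGG * (10 * P.L) :=
          Nat.mul_le_mul_left _ (by omega)
        have e : loadCost P.mode * P.L * (P.nGG + 1) = (preHead.weight * P.L + preTail.weight * P.L +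
          10 * P.L) + P.nGG * ((edgeBody P.mode).weight * P.L) + P.nGG * (10 * P.L) +
          ((preHead.weight * P.L + preTail.weight * P.L + 10 * P.L) * P.nGG +
            ((edgeBody P.mode).weight * P.L + 10 * P.L)) := by unfold loadCost; ring
        rw [mul_add] at hT₂; rw [e]; omega

variable {P : Par}

def preCost (D : DataStructure) (mode : Mode) : ℕ := loadCost mode + D.preprocess.slowdown + 10

theorem potential_le (f : ℕ) (hf : f ≤ P.Fm) : potential P.B f ≤ P.Fm + P.B := by
  unfold potential; split_ifs <;> omega

/-- The first half (safety and cost) holds for any program; the second half needs a genuine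
preprocessing that is short compared to the fuel. The remaining fuel goes to array `5`, where zero
means that the machine is out of action. -/
theorem wp_preMachine (hs : P.Safe A κ σ) (hid : id < P.NV) (h50 : σ.reg 50 = id) (hκ : κ < P.S) (hκ₀ : κ ≠ 0) :
    wp ω (preMachine P.D P.mode) (fun σ' T' =>
      (P.Safe A (κ + 1) σ' ∧ P.Local (P.zBase id) σ σ' ∧ (∀ j, j ≠ id → σ'.arr 5 j = σ.arr 5 j) ∧
      T' ≤ T + preCost P.D P.mode * P.L * (2 * P.B)) ∧
      ((∀ v, 10 ≤ v → v ≠ 11 → ∀ i, σ.arr v (i * P.S + P.zBase id) = 0) → ∀ t τ,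
        Exec (tape P.g (id % P.g) ω) P.D.preprocess (State.blank.withInput (P.preInput A (id / P.g)))
          t τ → 4 * t < P.Fpre → P.MemRep σ' (P.zBase id) (P.zBase id) τ ∧ σ'.arr 5 id ≠ 0)) σ T := by
  have hBm : P.nGG + 1 + P.Fm ≤ P.B := by unfold B; omega
  have hpre : P.Fpre ≤ P.Fm := Nat.le_add_right _ _
  refine wp_seq (wp_mono (wp_loadGraph hs hid h50 hκ hκ₀) ?_)
  rintro σ₁ T₁ - ⟨s₁, m₁, f₁, g₁, a₁, i₁, t₁⟩
  have hsz : (σ₁.reg 50).size ≤ P.L := by rw [g₁]; exact size_le (by unfold X; omega)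
  have hFX : P.Fm ≤ P.X := by unfold X Fm; omega
  -- The existence of a short execution is part of the condition `H`, since the simulation lemma
  -- needs a concrete one. Any other execution mentioned in `R` coincides with it by determinism.
  refine wp_seq (wp_mono (wp_and_of (T₂ := 0) (H := (∀ v, 10 ≤ v → v ≠ 11 → ∀ i,
      σ.arr v (i * P.S + P.zBase id) = 0) ∧ ∃ t τ, Exec (tape P.g (id % P.g) ω) P.D.preprocess
        (State.blank.withInput (P.preInput A (id / P.g))) t τ ∧ 4 * t < P.Fpre)
    (R := fun σ₂ => ∀ t τ, Exec (tape P.g (id % P.g) ω) P.D.preprocess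
        (State.blank.withInput (P.preInput A (id / P.g))) t τ → 4 * t < P.Fpre →
        P.MemRep σ₂ (P.zBase id) (P.zBase id) τ ∧ σ₂.reg 35 ≠ 0)
    (safe_simulate (ω := ω) (p := P.D.preprocess) (by omega) s₁ m₁ hκ₀ (by omega)) ?_) ?_)
  · rintro ⟨hz, t, τ, he, ht⟩
    refine wp_mono (rep_call (T := 0) s₁ m₁ (τ := State.blank) ⟨fun x => ?_, fun b hb i => ?_⟩ i₁ he
      (by rw [f₁]; exact ht)) ?_
    · rw [cell, a₁ _ (by omega), hz _ (by omega) (by omega)]; rfl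
    · rw [cell, a₁ _ (by omega), hz _ (by omega) (by omega)]; rfl
    · rintro σ₂ _ - ⟨h1, h2, -⟩ t' τ' he' ht'; obtain ⟨rfl, rfl⟩ := he.det he'
      exact ⟨h1, by rw [f₁] at h2; omega⟩
  · rintro σ₂ T₂ hF₂ ⟨⟨s₂, m₂, l₂, t₂, -⟩, r₂⟩
    have w50 : σ₂.reg 50 = id := by
      rw [hF₂.1 50 (fun h => by have := writes_simulate _ _ h; omega), g₁]
    have l5 : σ₂.arr 5 = σ.arr 5 := by
      rw [hF₂.2 5 (fun h => by have := stores_simulate _ _ h; omega), a₁ 5 (by norm_num)]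
    refine RAM.wp_store ⟨⟨⟨s₂.regs.of_eq fun x _ => rfl, s₂.ctr, ?_, s₂.bit, ?_, ?_, ?_, ?_, ?_⟩, ?_,
      ?_, ?_⟩, ?_⟩
    · rw [State.arr_setArr, if_neg (by norm_num), s₂.mat]
    · intro i; rw [State.arr_setArr_apply]; split_ifs
      · exact m₂.fuel
      · exact s₂.fuel i
    · rw [State.arr_setArr, if_neg (by norm_num)]; exact s₂.dead
    · rw [State.arr_setArr, if_neg (by norm_num)]; exact s₂.ans
    · intro v hv; rw [State.arr_setArr, if_neg (by omega)]; exact s₂.cells v hv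
    · rw [State.arr_setArr, if_neg (by norm_num)]; exact s₂.fresh
    · refine Local.trans (Local.of_eq fun v _ hv => a₁ v hv) (l₂.trans (Local.of_eq fun v hv _ => ?_))
      rw [State.arr_setArr, if_neg (by omega)]
    · intro j hj; rw [State.arr_setArr_apply, if_neg (by rw [w50]; omega), l5]
    · have z1 : (σ₂.reg 35).size ≤ P.L := size_le (m₂.fuel.trans hFX)
      have hp := potential_le (P := P) (σ₁.reg 35) m₁.fuel; have hL := one_le_L (P := P)
      have b1 : loadCost P.mode * P.L * (P.nGG + 1) ≤ loadCost P.mode * P.L * (2 * P.B) :=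
        Nat.mul_le_mul_left _ (by omega)
      have b2 : P.D.preprocess.slowdown * P.L * potential P.B (σ₁.reg 35) +
          P.D.preprocess.slowdown * P.L ≤ P.D.preprocess.slowdown * P.L * (2 * P.B) := by
        rw [← Nat.mul_succ]; exact Nat.mul_le_mul_left _ (by omega)
      have b3 : 3 * P.L ≤ 10 * P.L * (2 * P.B) := by
        have : 3 * P.L * 1 ≤ 10 * P.L * (2 * P.B) := Nat.mul_le_mul (by omega) (by omega); omega
      have e : preCost P.D P.mode * P.L * (2 * P.B) = loadCost P.mode * P.L * (2 * P.B) +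
        P.D.preprocess.slowdown * P.L * (2 * P.B) + 10 * P.L * (2 * P.B) := by unfold preCost; ring
      have z2 : (σ₂.reg 50).size ≤ P.L := by rw [w50, ← g₁]; exact hsz
      omega
    · intro hz t τ he ht; obtain ⟨h1, h2⟩ := r₂ ⟨hz, t, τ, he, ht⟩ t τ he ht
      refine ⟨h1.of_eq (zBase_lt hid) (zBase_lt hid) fun v hv _ i y _ _ => ?_, ?_⟩
      · rw [State.arr_setArr, if_neg (by omega)]
      · rw [State.arr_setArr_apply, if_pos ⟨rfl, w50.symm⟩]; exact h2

set_option maxRecDepth 4000 in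
theorem writes_preMachine (x : ℕ) (h : x ∈ (preMachine P.D P.mode).writes) :
    20 ≤ x ∧ x ≠ 50 ∧ x ≠ 51 ∧ x ≠ 21 := by
  have h1 : (preHead ;; forLoop 52 17 53 1 (edgeBody P.mode) ;; preTail).writes ⊆ {20, 22, 23, 24, 25,
      26, 27, 28, 29, 30, 31, 32, 33, 34, 35, 45, 52, 53, 54, 55, 56, 57, 58, 59, 60, 61} := by
    cases P.mode <;> decide
  have h : x ∈ (preHead ;; forLoop 52 17 53 1 (edgeBody P.mode) ;; preTail).writes ∪
      ((simulate P.D.preprocess).writes ∪ ∅) := h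
  rw [Finset.mem_union, Finset.mem_union] at h; rcases h with h | h | h
  · have := h1 h; simp only [Finset.mem_insert, Finset.mem_singleton] at this; omega
  · have := writes_simulate _ _ h; omega
  · simp at h

/-- Preprocessing of all machines. -/
def preAll (D : DataStructure) (mode : Mode) : Program := forLoop 50 9 51 1 (preMachine D mode)

/-- The layers used in the input array: the empty one, one for each machine's preprocessing, and at
most `E` per machine and multiplication. -/
theorem ctr_lt (ht : t ≤ P.n) (hκ : κ ≤ 1 + P.NV + t * (P.NV * P.E)) : κ < P.S := by
  have h1 : t * (P.NV * P.E) ≤ P.n * (P.NV * P.E) := Nat.mul_le_mul_right _ ht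
  have h2 : P.S = P.n * (P.NV * P.E) + 2 * (P.NV * P.E) + P.n * (2 * P.NV + P.E + 2) +
    (4 * P.NV + 2 * P.E + 4) := by unfold S; ring
  omega

theorem zBase_inj (h : P.zBase i = P.zBase j) : i = j := by
  rw [← zBase_div (P := P) i, h, zBase_div]

theorem wp_preAll (hs : P.Safe A 1 σ) (hz : ∀ v, 10 ≤ v → ∀ i, σ.arr v i = 0) :
    wp ω (preAll P.D P.mode) (fun σ' T' => P.Safe A (1 + P.NV) σ' ∧ σ'.reg 21 = σ.reg 21 ∧
      T' ≤ T + (P.NV + 1) * (preCost P.D P.mode * P.L * (2 * P.B) + 10 * P.L) ∧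
      (∀ v, 10 ≤ v → v ≠ 11 → ∀ i y, y < P.S → (∀ id, y ≠ P.zBase id) → σ'.arr v (i * P.S + y) = 0) ∧
      ∀ id < P.NV, ∀ t τ, Exec (tape P.g (id % P.g) ω) P.D.preprocess
        (State.blank.withInput (P.preInput A (id / P.g))) t τ → 4 * t < P.Fpre →
        P.MemRep σ' (P.zBase id) (P.zBase id) τ ∧ σ'.arr 5 id ≠ 0) σ T := by
  refine wp_for_cost P.NV (preCost P.D P.mode * P.L * (2 * P.B)) (fun k σ' => P.Safe A (1 + k) σ' ∧
      (∀ v, 10 ≤ v → v ≠ 11 → ∀ i y, y < P.S → (∀ id < k, y ≠ P.zBase id) → σ'.arr v (i * P.S + y) = 0) ∧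
      ∀ id < k, ∀ t τ, Exec (tape P.g (id % P.g) ω) P.D.preprocess
        (State.blank.withInput (P.preInput A (id / P.g))) t τ → 4 * t < P.Fpre →
        P.MemRep σ' (P.zBase id) (P.zBase id) τ ∧ σ'.arr 5 id ≠ 0) (fun _ => 0)
    (fun h => by have := writes_preMachine _ h; omega)
    (fun h => by have := writes_preMachine _ h; omega)
    (fun h => by have := writes_preMachine _ h; omega) (by norm_num) hs.regs.r9 hs.regs.r1 ?_
    (fun _ _ _ => rfl) ⟨hs, fun v hv _ i y _ _ => hz v hv _, fun _ h => absurd h (Nat.not_lt_zero _)⟩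
    ?_ ?_
  · rintro k σ' x y ⟨h1, h2, h3⟩
    refine ⟨h1.of_eq (fun z hz => ?_) fun _ => rfl, h2, fun id hid t τ he ht => ?_⟩
    · rw [State.reg_setReg, if_neg (by omega), State.reg_setReg, if_neg (by omega)]
    · obtain ⟨h4, h5⟩ := h3 id hid t τ he ht; exact ⟨⟨h4.reg, h4.arr⟩, h5⟩
  · rintro k hk σ₁ T₁ ⟨h1, h2, h3⟩ hF h50
    refine wp_mono (wp_preMachine h1 hk h50 (ctr_lt (Nat.zero_le _) (by omega)) (by omega)) ?_
    rintro σ₂ T₂ - ⟨⟨s₂, l₂, f₂, t₂⟩, r₂⟩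
    refine ⟨⟨s₂, fun v hv hv' i y hy hid => ?_, fun id hid t τ he ht => ?_⟩, by omega⟩
    · rw [l₂ v hv hv' i y hy (hid k (by omega))]; exact h2 v hv hv' i y hy fun id h => hid id (by omega)
    · by_cases hik : id = k
      · subst hik; refine r₂ (fun v hv hv' i => h2 v hv hv' i _ (zBase_lt hk) fun id h e => ?_) t τ he ht
        have := zBase_inj e; omega
      · obtain ⟨h4, h5⟩ := h3 id (by omega) t τ he ht
        refine ⟨h4.of_eq (zBase_lt (by omega)) (zBase_lt (by omega))
          fun v hv hv' i y hy hyz => l₂ v hv hv' i y hy ?_, by rw [f₂ id hik]; exact h5⟩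
        rintro rfl; rcases hyz with e | e <;> exact hik (zBase_inj e).symm
  · rintro σ' T' ⟨h1, h2, h3⟩ hF hT
    have hz : P.NV.size + 1 ≤ P.L := by
      have := size_le_L (P := P) (x := P.NV) (by unfold X; omega); omega
    refine ⟨h1, hF.1 21 (fun h => ?_), ?_, fun v hv hv' i y hy hid =>
      h2 v hv hv' i y hy fun id _ => hid id, h3⟩
    · simp only [forLoop, Program.writes, Finset.mem_union, Finset.mem_singleton] at h
      rcases h with h | h | h | h | h
      · omega
      · omega
      · have := writes_preMachine _ h; omega
      · omega
      · omega
    · have m1 : P.NV * (preCost P.D P.mode * P.L * (2 * P.B) + 10 * (P.NV.size + 1)) ≤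
        P.NV * (preCost P.D P.mode * P.L * (2 * P.B) + 10 * P.L) := Nat.mul_le_mul_left _ (by omega)
      have e : (P.NV + 1) * (preCost P.D P.mode * P.L * (2 * P.B) + 10 * P.L) =
        P.NV * (preCost P.D P.mode * P.L * (2 * P.B) + 10 * P.L) +
          (preCost P.D P.mode * P.L * (2 * P.B) + 10 * P.L) := by ring
      simp only [add_zero] at hT; omega

end Par
end DynSC

/-! ### Computing powers, and reading the input list -/

namespace RAM

/-- `r d := r x ^ k` -/
def powProg (d x : ℕ) : ℕ → Program
  | 0 => .const d 1
  | k + 1 => powProg d x k ;; .arith .times d d x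

theorem wp_pow {d : ℕ} (hdx : x ≠ d) {L : ℕ} (hL : 1 ≤ L) : ∀ (k : ℕ)
    {Q : State → ℕ → Prop} {σ : State} {T : ℕ}, (σ.reg x).size ≤ L →
    Q (σ.setReg d (σ.reg x ^ k)) (T + (powProg d x k).weight * L) → wp ω (powProg d x k) Q σ T := by
  have key : ∀ k, (powProg d x k).Flat ∧ (powProg d x k).need ⊆ {x} ∧ d ∈ (powProg d x k).must ∧
      (powProg d x k).loads = ∅ ∧
      ∀ σ, (powProg d x k).eval ω σ = σ.setReg d (σ.reg x ^ k) := by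
    intro k
    induction k with
    | zero => simp [powProg, Program.Flat, Program.need, Program.must, Program.loads, Program.eval]
    | succ k ih =>
      obtain ⟨h1, h2, h3, h4, h5⟩ := ih; refine ⟨⟨h1, trivial⟩, ?_, ?_, ?_, fun σ => ?_⟩
      · intro y hy
        simp only [powProg, Program.need, Finset.mem_union, Finset.mem_sdiff, Finset.mem_insert,
          Finset.mem_singleton] at hy
        rcases hy with hy | ⟨rfl | rfl, hy⟩
        · exact h2 hy
        · exact absurd h3 hy
        · simp
      · simp [powProg, Program.must]
      · simp [powProg, Program.loads, h4]
      · simp only [powProg, Program.eval, h5, BinOp.eval, State.reg_setReg, if_true, hdx, if_false,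
          State.setReg_setReg, pow_succ]
  intro k Q σ T hx hQ; obtain ⟨h1, h2, h3, h4, h5⟩ := key k
  refine wp_flat L h1 hL (fun y hy => ?_) (fun b hb => ?_) (fun _ => ?_)
  · have := h2 hy; rw [Finset.mem_singleton] at this; rw [this]; exact hx
  · rw [h4] at hb; simp at hb
  · rw [h5]; exact hQ

theorem getD_flatMap {α : Type*} {f : α → List ℕ} (hf : ∀ x, (f x).length = n)
    (hj : j < n) : ∀ (l : List α) (i : ℕ) (hi : i < l.length),
    (l.flatMap f).getD (i * n + j) 0 = (f l[i]).getD j 0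
  | [], i, hi => absurd hi (by simp)
  | x :: l, 0, _ => by
    rw [List.flatMap_cons, zero_mul, zero_add, List.getD_append _ _ _ _ (by rw [hf]; exact hj)]; rfl
  | x :: l, i + 1, hi => by
    rw [List.flatMap_cons, List.getD_append_right _ _ _ _ (by rw [hf, add_mul]; omega), hf,
      show (i + 1) * n + j - n = i * n + j by rw [add_mul]; omega]
    exact getD_flatMap hf hj l i (by simpa using hi)

theorem getD_rows (M : Fin n → Fin n → Bool) (i j : Fin n) :
    (rows M).getD (i.val * n + j.val) 0 = (M i j).toNat := by
  rw [rows, getD_flatMap (fun _ => by simp) j.2 _ _ (by simp)]; simp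

theorem length_rows (M : Fin n → Fin n → Bool) : (rows M).length = n * n := by
  simp [rows]

theorem getD_rows_le (M : Fin n → Fin n → Bool) (k : ℕ) : (rows M).getD k 0 ≤ 1 := by
  by_cases hk : k < n * n
  · have hn : 0 < n := by rcases Nat.eq_zero_or_pos n with rfl | h; · simp at hk
                          exact h
    have := getD_rows M ⟨k / n, Nat.div_lt_of_lt_mul hk⟩ ⟨k % n, Nat.mod_lt _ hn⟩
    simp only [Nat.div_add_mod'] at this; rw [this]; exact Bool.toNat_le _
  · rw [List.getD_eq_default _ _ (by rw [length_rows]; omega)]; omega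

end RAM
-- Integer roots, the parameters and the setup of the algorithm
namespace DynSC
open RAM

/-- The constants of the reduction: the parameters are powers of `g`, the integral part of the `K`-th
root of `n`. -/
structure Consts where
  D : DataStructure
  mode : Mode
  s : ℕ
  r : ℕ
  K : ℕ
  kp : ℕ
  kr : ℕ
  g₀ : ℕ
  hK : 1 ≤ K
  hr : r ≤ K

namespace Consts

/-- The integral part of the `K`-th root of `n`. -/
def root (c : Consts) (n : ℕ) : ℕ := Nat.findGreatest (fun x => x ^ c.K ≤ n) n

theorem root_pow_le (c : Consts) (hn : 1 ≤ n) : c.root n ^ c.K ≤ n :=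
  Nat.findGreatest_spec (P := fun x => x ^ c.K ≤ n) hn (by simpa using hn)

theorem one_le_root (c : Consts) (hn : 1 ≤ n) : 1 ≤ c.root n :=
  Nat.le_findGreatest hn (by simpa using hn)

theorem lt_root_succ_pow (c : Consts) (hn : 1 ≤ n) : n < (c.root n + 1) ^ c.K := by
  by_cases h : c.root n + 1 ≤ n
  · exact not_le.1 (Nat.findGreatest_is_greatest (P := fun x => x ^ c.K ≤ n)
      (Nat.lt_succ_self (c.root n)) h)
  · exact lt_of_lt_of_le (by omega) (Nat.le_self_pow (by have := c.hK; omega) _)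

/-- The parameters for matrices of order `n`. -/
def par (c : Consts) (n : ℕ) (hn : 1 ≤ n) : Par where
  D := c.D
  mode := c.mode
  n := n
  g := c.root n
  -- `c.s` is the exponent of the number of vertices, so for `1 ≤ c.s` there are g times as many
  -- vertices as rows in a block.
  a := c.root n ^ (c.s - 1)
  b := c.root n ^ c.r
  nG := c.root n ^ c.s
  Fpre := c.root n ^ c.kp
  Frun := c.root n ^ c.kr
  -- Truncated subtraction: non-zero exactly for roots below `g₀`, where everything is verified
  -- exhaustively.
  force := c.g₀ - c.root n
  hn := hn
  hg := c.one_le_root hn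
  ha := Nat.one_le_pow _ _ (c.one_le_root hn)
  hb := Nat.one_le_pow _ _ (c.one_le_root hn)
  hbn := (Nat.pow_le_pow_right (c.one_le_root hn) c.hr).trans (c.root_pow_le hn)
  hnG := Nat.one_le_pow _ _ (c.one_le_root hn)

variable (c : Consts)

/-- Try the next candidate for the root. -/
def rootBody : Program :=
  .arith .plus 52 50 1 ;; powProg 53 52 c.K ;; ifLt 2 53 .skip (.arith .plus 3 52 0)

/-- Compute the parameters. -/
def params : Program :=
  powProg 4 3 (c.s - 1) ;; powProg 5 3 c.r ;; powProg 6 3 c.s ;; powProg 13 3 c.kp ;;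
    powProg 14 3 c.kr ;; powProg 53 3 3 ;; (.const 15 c.g₀ ;; .arith .minus 15 15 3 ;;
    .arith .plus 8 2 2 ;; .arith .plus 8 8 1 ;; .arith .quot 12 2 5 ;; .arith .plus 12 12 1 ;;
    .arith .quot 11 2 4 ;; .arith .plus 11 11 1 ;; .arith .times 11 11 12 ;;
    .arith .times 19 53 11 ;; .arith .times 9 19 3 ;; .arith .times 10 19 4 ;;
    .arith .plus 16 5 5 ;; .arith .plus 16 16 4 ;; .arith .times 17 6 6 ;; .arith .plus 18 2 1 ;;
    .arith .plus 18 18 1 ;; .arith .plus 52 9 1 ;; .arith .plus 7 16 1 ;; .arith .plus 7 7 1 ;;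
    .arith .times 7 52 7 ;; .arith .times 7 18 7 ;; .const 22 1)

def copyBody : Program :=
  .arith .times 54 50 2 ;; .arith .plus 54 54 52 ;; .arith .plus 54 54 1 ;; .load 0 55 54 ;;
    .arith .times 56 50 8 ;; .arith .plus 56 56 52 ;; .store 2 56 55

def setup : Program := (.const 1 1 ;; .load 0 2 0) ;; forLoop 50 2 51 1 c.rootBody ;; c.params ;;
    forLoop 50 2 51 1 (forLoop 52 2 53 1 copyBody)

end Consts

/-- The copy of the matrix in the input. -/
def Par.copy (P : Par) (inp : ℕ → ℕ) (x : ℕ) : ℕ :=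
  if x / P.W < P.n ∧ x % P.W < P.n then inp (x / P.W * P.n + x % P.W + 1) else 0

namespace Consts

theorem size_pow_le (x k : ℕ) : (x ^ k).size ≤ k * x.size + 1 := by
  induction k with
  | zero => simp
  | succ k ih =>
    have := size_mul_le (x ^ k) x; rw [pow_succ, add_mul]; omega

variable (c : Consts)

/-- All candidates up to `n` are tried; linear time is negligible. Because the condition is
monotone, the last candidate that passes is the greatest. -/
theorem wp_root {hn : 1 ≤ n} (h0 : σ.reg 0 = 0) (h1 : σ.reg 1 = 1) (h2 : σ.reg 2 = n) (h3 : σ.reg 3 = 0)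
    (hQ : ∀ σ' T', (∀ x, x < 50 ∧ x ≠ 3 ∧ x ≠ 45 → σ'.reg x = σ.reg x) → σ'.arr = σ.arr →
      σ'.reg 3 = c.root n → T' ≤ T + ((powProg 53 52 c.K).weight + 10 * c.K + 40) * (c.par n hn).L * (n + 1) →
      Q σ' T') :
    wp ω (forLoop 50 2 51 1 c.rootBody) Q σ T := by
  set P := c.par n hn with hP; have hL := Par.one_le_L (P := P); have hPn : P.n = n := rfl
  have hnX : n + 5 ≤ P.X := by unfold Par.X; omega
  have wpow : ∀ k, (powProg 53 52 k).writes = {53} ∧ (powProg 53 52 k).stores = ∅ := by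
    intro k
    induction k with
    | zero => simp [powProg, Program.writes, Program.stores]
    | succ k ih => simp [powProg, Program.writes, Program.stores, ih]
  have wB : c.rootBody.writes = {52, 53, 45, 3} := by
    simp only [rootBody, Program.writes, (wpow c.K).1, ifLt]; decide
  have sB : c.rootBody.stores = ∅ := by
    simp [rootBody, Program.stores, (wpow c.K).2, ifLt]
  have wF : ∀ x, x < 50 ∧ x ≠ 3 ∧ x ≠ 45 → x ∉ (forLoop 50 2 51 1 c.rootBody).writes := by
    intro x hx; simp [forLoop, Program.writes, wB]; omega
  refine wp_for_const n (((powProg 53 52 c.K).weight + 10 * c.K + 20) * P.L)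
    (fun k σ' => σ'.reg 3 = Nat.findGreatest (fun x => x ^ c.K ≤ n) k) h2 h1
    (fun k σ' x y h => by simpa using h) (by simpa using h3) ?_ ?_ (by rw [wB]; decide)
  · intro k hk σ₁ T₁ hI hF hik; have f0 : σ₁.reg 0 = 0 := (hF.1 0 (wF 0 (by simp))).trans h0
    have f1 : σ₁.reg 1 = 1 := (hF.1 1 (wF 1 (by simp))).trans h1
    have f2 : σ₁.reg 2 = n := (hF.1 2 (wF 2 (by simp))).trans h2
    have zk : k.size ≤ P.L := Par.size_le (by omega)
    have zk1 : (k + 1).size ≤ P.L := Par.size_le (by omega)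
    have zn : n.size ≤ P.L := Par.size_le (by omega)
    have hfg : Nat.findGreatest (fun x => x ^ c.K ≤ n) (k + 1) =
        if (k + 1) ^ c.K ≤ n then k + 1 else Nat.findGreatest (fun x => x ^ c.K ≤ n) k :=
      Nat.findGreatest_succ k
    have z1 : (1 : ℕ).size = 1 := by simp
    have zp := size_pow_le (k + 1) c.K
    have zp' : c.K * (k + 1).size ≤ c.K * P.L := Nat.mul_le_mul_left _ zk1
    have zs := size_sub_le ((k + 1) ^ c.K) n
    have etot : ((powProg 53 52 c.K).weight + 10 * c.K + 20) * P.L =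
      (powProg 53 52 c.K).weight * P.L + 10 * (c.K * P.L) + 20 * P.L := by ring
    refine wp_slack (wp_seq (wp_arith (wp_seq (wp_pow (by norm_num) hL _ ?_ (wp_seq (wp_arith
      (wp_cond ?_ ?_)))))))
    · simpa [BinOp.eval, hik, f1] using zk1
    · intro hlt; refine wp_skip ⟨_, le_rfl, ?_, ?_⟩
      · simp [BinOp.eval, hik, f1, f2] at hlt ⊢; rw [hfg, if_neg (by omega), hI]
      · simp [BinOp.eval, hik, f1, f2] at hlt ⊢; rw [etot]; omega
    · intro hge; refine wp_arith ⟨_, le_rfl, ?_, ?_⟩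
      · simp [BinOp.eval, hik, f1, f2, f0] at hge ⊢; rw [hfg, if_pos (by omega)]
      · simp [BinOp.eval, hik, f1, f2, f0] at hge ⊢; rw [etot]; omega
  · intro σ' T' hI hF hT
    refine hQ σ' T' (fun x h => hF.1 x (wF x h)) (hF.arr (by simp [forLoop, Program.stores, sB])) hI ?_
    · have zn : n.size + 1 ≤ P.L := by have := Par.size_le_L (P := P) (x := n) (by omega); omega
      have m1 : n * (((powProg 53 52 c.K).weight + 10 * c.K + 20) * P.L + 10 * (n.size + 1)) ≤
        n * (((powProg 53 52 c.K).weight + 10 * c.K + 20) * P.L + 10 * P.L) := Nat.mul_le_mul_left _ (by omega)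
      have e : ((powProg 53 52 c.K).weight + 10 * c.K + 40) * P.L * (n + 1) =
        n * (((powProg 53 52 c.K).weight + 10 * c.K + 20) * P.L + 10 * P.L) + n * (10 * P.L) +
          ((powProg 53 52 c.K).weight + 10 * c.K + 40) * P.L := by ring
      have : 40 * P.L ≤ ((powProg 53 52 c.K).weight + 10 * c.K + 40) * P.L := Nat.mul_le_mul_right _ (by omega)
      omega

/-- The last part of `params`. -/
def params' : Program := .const 15 c.g₀ ;; .arith .minus 15 15 3 ;;
    .arith .plus 8 2 2 ;; .arith .plus 8 8 1 ;; .arith .quot 12 2 5 ;; .arith .plus 12 12 1 ;;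
    .arith .quot 11 2 4 ;; .arith .plus 11 11 1 ;; .arith .times 11 11 12 ;;
    .arith .times 19 53 11 ;; .arith .times 9 19 3 ;; .arith .times 10 19 4 ;;
    .arith .plus 16 5 5 ;; .arith .plus 16 16 4 ;; .arith .times 17 6 6 ;; .arith .plus 18 2 1 ;;
    .arith .plus 18 18 1 ;; .arith .plus 52 9 1 ;; .arith .plus 7 16 1 ;; .arith .plus 7 7 1 ;;
    .arith .times 7 52 7 ;; .arith .times 7 18 7 ;; .const 22 1

def paramsCost : ℕ := (powProg 4 3 (c.s - 1)).weight + (powProg 5 3 c.r).weight +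
  (powProg 6 3 c.s).weight + (powProg 13 3 c.kp).weight + (powProg 14 3 c.kr).weight +
  (powProg 53 3 3).weight + c.params'.weight

theorem wp_params {hn : 1 ≤ n}
    (h0 : σ.reg 0 = 0) (h1 : σ.reg 1 = 1) (h2 : σ.reg 2 = n) (h3 : σ.reg 3 = c.root n)
    (hQ : ∀ σ' T', (c.par n hn).Regs σ' → σ'.reg 22 = 1 → σ'.reg 21 = σ.reg 21 →
      σ'.arr = σ.arr → T' ≤ T + c.paramsCost * (c.par n hn).L → Q σ' T') :
    wp ω c.params Q σ T := by
  set P := c.par n hn with hP; have hL := Par.one_le_L (P := P)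
  have hnX : P.n ≤ P.X := by unfold Par.X; omega
  have hgX : P.g ≤ P.X := by unfold Par.X; omega
  have hg3 : P.g ^ 3 ≤ P.X := (Nat.le_mul_of_pos_right _ P.BB_pos).trans
    (show P.NB ≤ _ by unfold Par.X; omega)
  have haX : P.a ≤ P.X := by unfold Par.X; omega
  have hbX : P.b ≤ P.X := by unfold Par.X; omega
  have hGX : P.nG ≤ P.X := by unfold Par.X; omega
  have zg : (c.root n).size ≤ P.L := Par.size_le hgX
  iterate 6 refine wp_seq (wp_pow (by norm_num) hL _ (by simpa [h3] using zg) ?_)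
  obtain ⟨σ₁, hσ₁⟩ : ∃ σ₁, σ₁ = State.setReg (State.setReg (State.setReg (State.setReg (State.setReg
    (σ.setReg 4 (c.root n ^ (c.s - 1))) 5 (c.root n ^ c.r)) 6 (c.root n ^ c.s)) 13
    (c.root n ^ c.kp)) 14 (c.root n ^ c.kr)) 53 (c.root n ^ 3) := ⟨_, rfl⟩
  simp only [State.reg_setReg, h3, Nat.reduceEqDiff, if_false]; rw [← hσ₁]
  have f0 : σ₁.reg 0 = 0 := by simp [hσ₁, h0]
  have f1 : σ₁.reg 1 = 1 := by simp [hσ₁, h1]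
  have f2 : σ₁.reg 2 = n := by simp [hσ₁, h2]
  have f3 : σ₁.reg 3 = c.root n := by simp [hσ₁, h3]
  have f4 : σ₁.reg 4 = c.root n ^ (c.s - 1) := by simp [hσ₁]
  have f5 : σ₁.reg 5 = c.root n ^ c.r := by simp [hσ₁]
  have f6 : σ₁.reg 6 = c.root n ^ c.s := by simp [hσ₁]
  have f13 : σ₁.reg 13 = c.root n ^ c.kp := by simp [hσ₁]
  have f14 : σ₁.reg 14 = c.root n ^ c.kr := by simp [hσ₁]
  have f53 : σ₁.reg 53 = c.root n ^ 3 := by simp [hσ₁]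
  have f21 : σ₁.reg 21 = σ.reg 21 := by simp [hσ₁]
  have fa : σ₁.arr = σ.arr := by simp [hσ₁]
  refine wp_flat (p := c.params') P.L (by simp [params', Program.Flat]) hL ?_ ?_ ?_
  · intro x hx
    have : c.params'.need ⊆ {1, 2, 3, 4, 5, 6, 53} := by
      intro y hy; simp [params', Program.need, Program.must] at hy ⊢; omega
    have hx' := this hx; simp only [Finset.mem_insert, Finset.mem_singleton] at hx'
    rcases hx' with rfl | rfl | rfl | rfl | rfl | rfl | rfl
    · rw [f1]; simpa using hL
    · rw [f2]; exact Par.size_le hnX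
    · rw [f3]; exact Par.size_le hgX
    · rw [f4]; exact Par.size_le haX
    · rw [f5]; exact Par.size_le hbX
    · rw [f6]; exact Par.size_le hGX
    · rw [f53]; exact Par.size_le hg3
  · intro b hb; simp [params', Program.loads] at hb
  · intro hF
    have e : c.paramsCost * P.L = (powProg 4 3 (c.s - 1)).weight * P.L +
      (powProg 5 3 c.r).weight * P.L + (powProg 6 3 c.s).weight * P.L +
      (powProg 13 3 c.kp).weight * P.L + (powProg 14 3 c.kr).weight * P.L +
      (powProg 53 3 3).weight * P.L + c.params'.weight * P.L := by unfold paramsCost; ring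
    refine hQ _ _ ⟨?_, ?_, ?_, ?_, ?_, ?_, ?_, ?_, ?_, ?_, ?_, ?_, ?_, ?_, ?_, ?_, ?_, ?_, ?_⟩ ?_ ?_ ?_
      (by rw [e]; omega)
    all_goals
      simp only [params', Program.eval, BinOp.eval, State.reg_setReg, State.arr_setReg, f0, f1, f2, f3,
        f4, f5, f6, f13, f14, f53, f21, fa, Nat.reduceEqDiff, if_true, if_false]
    all_goals first | rfl | skip
    · show _ = (n + 2) * ((c.root n ^ 3 * ((n / c.root n ^ (c.s - 1) + 1) * (n / c.root n ^ c.r + 1)) *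
        c.root n + 1) * (2 * c.root n ^ c.r + c.root n ^ (c.s - 1) + 2))
      ring
    · show n + n + 1 = 2 * n + 1; ring
    · show _ = 2 * c.root n ^ c.r + c.root n ^ (c.s - 1); ring

end Consts
namespace Consts

variable (c : Consts)

theorem wp_copy {P : Par} (h : P.Regs σ) (hinp : ∀ i, σ.arr 0 i ≤ P.X) (hz : ∀ i, σ.arr 2 i = 0)
    (hQ : ∀ σ' T', (∀ x < 50, σ'.reg x = σ.reg x) → (∀ b, b ≠ 2 → σ'.arr b = σ.arr b) →
      σ'.arr 2 = P.copy (σ.arr 0) → T' ≤ T + (copyBody.weight + 50) * P.L * ((P.n + 1) * (P.n + 1)) →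
      Q σ' T') :
    wp ω (forLoop 50 2 51 1 (forLoop 52 2 53 1 copyBody)) Q σ T := by
  have hL := Par.one_le_L (P := P); have hnX : P.n + 10 ≤ P.X := by unfold Par.X; omega
  have zn : P.n.size + 1 ≤ P.L := by have := Par.size_le_L (P := P) (x := P.n) (by omega); omega
  have hW : P.n < P.W := by unfold Par.W; omega
  have hr : ∀ {σ'}, Framed (forLoop 50 2 51 1 (forLoop 52 2 53 1 copyBody)) σ σ' →
      ∀ x < 50, σ'.reg x = σ.reg x := fun hF x hx => hF.1 x ((by decide :
    ∀ x < 50, x ∉ (forLoop 50 2 51 1 (forLoop 52 2 53 1 copyBody)).writes) x hx)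
  refine wp_for_const P.n (P.n * (copyBody.weight * P.L + 10 * P.L) + 10 * P.L)
    (fun k σ' => ∀ x, σ'.arr 2 x = if x / P.W < k then P.copy (σ.arr 0) x else 0) h.r2 h.r1
    (fun k σ' x y hI => by simpa using hI) (by simpa using hz) ?_ ?_
  · intro k hk σ₁ T₁ hI hF hik; have e0 : σ₁.arr 0 = σ.arr 0 := hF.2 0 (by decide)
    have r1 : P.Regs σ₁ := h.of_eq fun x hx => hr hF x (by omega)
    refine wp_for_const P.n (copyBody.weight * P.L)
      (fun j σ' => ∀ x, σ'.arr 2 x = if x / P.W < k ∨ x / P.W = k ∧ x % P.W < j then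
        P.copy (σ.arr 0) x else 0) r1.r2 r1.r1
      (fun k σ' x y hI => by simpa using hI) (fun x => by simp [hI x]) ?_ ?_
    · intro j hj σ₂ T₂ hI₂ hF₂ hij
      have r2 : P.Regs σ₂ := r1.of_eq fun x hx => hF₂.1 x ((by decide :
        ∀ x < 19, x ∉ (forLoop 52 2 53 1 copyBody).writes) x hx)
      have e0' : σ₂.arr 0 = σ.arr 0 := (hF₂.2 0 (by decide)).trans e0
      have e50 : σ₂.reg 50 = k := (hF₂.1 50 (by decide)).trans hik
      refine r2.wp [50, 52] [0] (by simp [e50, hij]; omega) (by simpa [e0'] using hinp) ?_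
      · intro _; refine ⟨?_, by omega⟩; intro x
        have hv : (copyBody.eval ω σ₂).arr 2 x = if x = k * P.W + j then
            σ.arr 0 (k * P.n + j + 1) else σ₂.arr 2 x := by
          simp [copyBody, Program.eval, BinOp.eval, State.arr_setArr_apply, e50, hij, r2.r1, r2.r2, r2.r8,
            e0']
        rw [hv, hI₂ x]; have hdm := Nat.div_add_mod' x P.W
        have hm := Nat.mod_lt x (show 0 < P.W by omega)
        by_cases hx : x = k * P.W + j
        · have h1 := mul_add_inj (i := x / P.W) (j := k) hm (show j < P.W by omega) (by omega)
          rw [if_pos hx, if_pos (by omega), Par.copy, h1.1, h1.2, if_pos (by omega)]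
        · rw [if_neg hx]
          have : ¬ (x / P.W = k ∧ x % P.W = j) := by
            rintro ⟨h1, h2⟩; rw [h1, h2] at hdm; omega
          by_cases hc : x / P.W < k ∨ x / P.W = k ∧ x % P.W < j
          · rw [if_pos hc, if_pos (by omega)]
          · rw [if_neg hc, if_neg (by omega)]
    · intro σ₂ T₂ hI₂ hF₂ hT₂; refine ⟨fun x => ?_, ?_⟩
      · rw [hI₂ x]
        by_cases h1 : x / P.W < k
        · rw [if_pos (.inl h1), if_pos (by omega)]
        · by_cases h2 : x / P.W = k
          · rw [if_pos (show x / P.W < k + 1 by omega)]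
            by_cases h3 : x % P.W < P.n
            · rw [if_pos (.inr ⟨h2, h3⟩)]
            · rw [if_neg (by omega), Par.copy, if_neg (by omega)]
          · rw [if_neg (by omega), if_neg (by omega)]
      · have m1 : P.n * (copyBody.weight * P.L + 10 * (P.n.size + 1)) ≤
          P.n * (copyBody.weight * P.L + 10 * P.L) := Nat.mul_le_mul_left _ (by omega)
        omega
  · intro σ' T' hI hF hT
    refine hQ σ' T' (hr hF) (fun b hb => hF.2 b (by simpa [(by decide : (forLoop 50 2 51 1
      (forLoop 52 2 53 1 copyBody)).stores = {2})] using hb)) ?_ ?_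
    · funext x; rw [hI x]; split_ifs with h1
      · rfl
      · rw [Par.copy, if_neg (by omega)]
    · have m1 : P.n * (P.n * (copyBody.weight * P.L + 10 * P.L) + 10 * P.L + 10 * (P.n.size + 1)) ≤
        P.n * (P.n * (copyBody.weight * P.L + 10 * P.L) + 10 * P.L + 10 * P.L) :=
        Nat.mul_le_mul_left _ (by omega)
      have e : (copyBody.weight + 50) * P.L * ((P.n + 1) * (P.n + 1)) =
        P.n * (P.n * (copyBody.weight * P.L + 10 * P.L) + 10 * P.L + 10 * P.L) +
        (40 * (P.n * P.n * P.L) + 80 * (P.n * P.L) + 2 * (copyBody.weight * P.L * P.n) +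
          copyBody.weight * P.L) + 50 * P.L := by ring
      omega

theorem wp_setup (hn : 1 ≤ n) {inp : ℕ → ℕ} (h0 : inp 0 = n) (hinp : ∀ i, inp (i + 1) ≤ 1) :
    wp ω c.setup (fun σ T' => (c.par n hn).Safe ((c.par n hn).copy inp) 1 σ ∧ σ.reg 21 = 0 ∧
      (∀ v, 10 ≤ v → ∀ i, σ.arr v i = 0) ∧ (∀ i, σ.arr 4 i = 0) ∧
      T' ≤ T + (c.paramsCost + (powProg 53 52 c.K).weight + 10 * c.K + copyBody.weight + 100) *
        (c.par n hn).L * ((n + 1) * (n + 1))) (State.blank.withInput inp) T := by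
  set P := c.par n hn with hP; have hPn : P.n = n := rfl; have hL := Par.L_pos (P := P)
  have hnX : n + 10 ≤ P.X := by unfold Par.X; omega
  have zn : n.size ≤ P.L := Par.size_le (by omega); have z1 : (1 : ℕ).size = 1 := by simp
  refine wp_seq (wp_seq (RAM.wp_const (RAM.wp_load ?_)))
  obtain ⟨σ₁, hσ₁⟩ : ∃ σ₁, σ₁ = ((State.blank.withInput inp).setReg 1 1).setReg 2 n := ⟨_, rfl⟩
  have e : ((State.blank.withInput inp).setReg 1 1).arr 0 (((State.blank.withInput inp).setReg 1 1).reg 0) = n := by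
    simp [State.withInput, State.blank, h0]
  rw [e, ← hσ₁]; have a0 : σ₁.arr 0 = inp := by simp [hσ₁, State.withInput]
  have a1 : ∀ b, b ≠ 0 → ∀ i, σ₁.arr b i = 0 := by
    intro b hb i; simp [hσ₁, State.withInput, State.blank, hb]
  refine wp_seq (c.wp_root (hn := hn) (by simp [hσ₁, State.withInput, State.blank]) (by simp [hσ₁])
    (by simp [hσ₁]) (by simp [hσ₁, State.withInput, State.blank]) ?_)
  intro σ₂ T₂ r₂ a₂ g₂ t₂
  refine wp_seq (c.wp_params (hn := hn)
    (by rw [r₂ 0 (by simp)]; simp [hσ₁, State.withInput, State.blank])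
    (by rw [r₂ 1 (by simp)]; simp [hσ₁])
    (by rw [r₂ 2 (by simp)]; simp [hσ₁]) g₂ ?_)
  intro σ₃ T₃ r₃ ctr₃ k₃ a₃ t₃; have a30 : σ₃.arr 0 = inp := by rw [a₃, a₂, a0]
  have a31 : ∀ b, b ≠ 0 → ∀ i, σ₃.arr b i = 0 := by
    intro b hb i; rw [a₃, a₂, a1 b hb]
  have hinp' : ∀ i, inp i ≤ P.X := by
    intro i
    cases i with
    | zero => rw [h0]; omega
    | succ i => have := hinp i; omega
  refine wp_copy r₃ (by rw [a30]; exact hinp') (a31 2 (by simp)) ?_; intro σ₄ T₄ r₄ b₄ a₄ t₄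
  have z : ∀ b, b ≠ 0 → b ≠ 2 → ∀ i, σ₄.arr b i = 0 := fun b hb hb' i => by
    rw [b₄ b hb', a31 b hb]
  refine ⟨⟨r₃.of_eq fun x hx => r₄ x (by omega), by rw [r₄ 22 (by simp), ctr₃], by rw [a₄, a30],
    ?_, ?_, ?_, ?_, ?_, ?_⟩, ?_, fun v hv i => z v (by omega) (by omega) i, z 4 (by simp) (by simp), ?_⟩
  · intro i; unfold Par.copy; split_ifs
    · exact hinp _
    · omega
  · intro i; rw [z 5 (by simp) (by simp)]; omega
  · intro i; rw [z 4 (by simp) (by simp)]; omega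
  · intro i; rw [z 3 (by simp) (by simp)]; omega
  · intro v hv i; rw [z v (by omega) (by omega)]; simp
  · intro i y _ _; rw [z 11 (by simp) (by simp)]
  · rw [r₄ 21 (by simp), k₃, r₂ 21 (by simp)]; simp [hσ₁, State.withInput, State.blank]
  · rw [hPn] at t₄
    have m1 : ((powProg 53 52 c.K).weight + 10 * c.K + 40) * P.L * (n + 1) ≤
      ((powProg 53 52 c.K).weight + 10 * c.K + 40) * P.L * ((n + 1) * (n + 1)) :=
      Nat.mul_le_mul_left _ (Nat.le_mul_of_pos_left _ (by omega))
    have m2 : c.paramsCost * P.L * 1 ≤ c.paramsCost * P.L * ((n + 1) * (n + 1)) :=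
      Nat.mul_le_mul_left _ (Nat.mul_pos (by omega) (by omega))
    have m3 : 10 * P.L * 1 ≤ 10 * P.L * ((n + 1) * (n + 1)) :=
      Nat.mul_le_mul_left _ (Nat.mul_pos (by omega) (by omega))
    have e : (c.paramsCost + (powProg 53 52 c.K).weight + 10 * c.K + copyBody.weight + 100) * P.L *
        ((n + 1) * (n + 1)) = ((powProg 53 52 c.K).weight + 10 * c.K + 40) * P.L * ((n + 1) * (n + 1)) +
        c.paramsCost * P.L * ((n + 1) * (n + 1)) + (copyBody.weight + 50) * P.L * ((n + 1) * (n + 1)) +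
        10 * P.L * ((n + 1) * (n + 1)) := by ring
    have s0 : ((State.blank.withInput inp).setReg 1 1).reg 0 = 0 := by
      simp [State.withInput, State.blank]
    rw [s0, z1, Nat.size_zero, ← hP] at t₂; rw [← hP] at t₃ t₄; omega

end Consts
end DynSC

namespace RAM

/-! ### Watching the answer

The memory cell that contains the answer of a program may be too large to be read for every query.
Therefore a register is added that always contains the answer if this is `0` or `1`, and `0`
otherwise. -/

/-- A bound for the registers that occur in a program. -/
def Program.regBound : Program → ℕ
  | .skip => 0
  | .const x _ => x + 1
  | .arith _ x y z => x + y + z + 1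
  | .load _ x y => x + y + 1
  | .store _ x y => x + y + 1
  | .random x y => x + y + 1
  | .seq p q => max p.regBound q.regBound
  | .cond x p q => max (x + 1) (max p.regBound q.regBound)
  | .loop x p => max (x + 1) p.regBound

/-- Register `N` contains the answer; register `N + 1` is auxiliary. -/
def watch (N : ℕ) : Program → Program
  | .store b x y => if b = 1 then .store 1 x y ;; .cond x .skip (.const (N + 1) 1 ;;
      .arith .minus (N + 1) y (N + 1) ;; .cond (N + 1) (.const N 0)
        (.cond y (.const N 1) (.const N 0))) else .store b x y
  | .seq p q => watch N p ;; watch N q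
  | .cond x p q => .cond x (watch N p) (watch N q)
  | .loop x p => .loop x (watch N p)
  | p => p

/-- `τ'` is the state `τ` with a watched answer. -/
structure Watched (N : ℕ) (τ τ' : State) : Prop where
  arr : τ'.arr = τ.arr
  reg : ∀ x < N, τ'.reg x = τ.reg x
  flag : τ'.reg N = if τ.arr 1 0 ≤ 1 then τ.arr 1 0 else 0

theorem Watched.setReg {N : ℕ} {τ τ' : State} (h : Watched N τ τ') (hx : x < N) (v : ℕ) :
    Watched N (τ.setReg x v) (τ'.setReg x v) where
  arr := h.arr
  reg y hy := by simp only [State.reg_setReg, h.reg y hy]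
  flag := by rw [State.reg_setReg, if_neg (by omega), h.flag]; rfl

theorem Watched.withInput {N : ℕ} {τ τ' : State} (h : Watched N τ τ') (inp : ℕ → ℕ) :
    Watched N (τ.withInput inp) (τ'.withInput inp) where
  arr := by simp only [State.withInput, h.arr]
  reg := h.reg
  flag := h.flag

theorem Watched.blank (N : ℕ) : Watched N State.blank State.blank :=
  ⟨rfl, fun _ _ => rfl, by simp [State.blank]⟩

/-- Only stores to array `1` are extended, by a bounded number of instructions on operands for which
the store has already been charged; hence the constant factor. -/
theorem Watched.exec {τ τ₁ : State} {N : ℕ} (h : Exec ω p τ t τ₁)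
    (hN : p.regBound ≤ N) : ∀ {τ'}, Watched N τ τ' → ∃ τ₁' t', Exec ω (watch N p) τ' t' τ₁' ∧
      t' ≤ 10 * t ∧ Watched N τ₁ τ₁' := by
  induction h with
  | skip τ => exact fun {τ'} hW => ⟨τ', 1, .skip _, by omega, hW⟩
  | const τ x c =>
    simp only [Program.regBound] at hN
    exact fun {τ'} hW => ⟨_, _, .const τ' x c, by omega, hW.setReg (by omega) _⟩
  | arith τ o x y z =>
    simp only [Program.regBound] at hN; intro τ' hW; refine ⟨_, _, .arith τ' o x y z, ?_, ?_⟩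
    · rw [hW.reg y (by omega), hW.reg z (by omega)]; omega
    · rw [hW.reg y (by omega), hW.reg z (by omega)]; exact hW.setReg (by omega) _
  | load τ b x y =>
    simp only [Program.regBound] at hN; intro τ' hW; refine ⟨_, _, .load τ' b x y, ?_, ?_⟩
    · rw [hW.reg y (by omega), hW.arr]; omega
    · rw [hW.reg y (by omega), hW.arr]; exact hW.setReg (by omega) _
  | random τ x y =>
    simp only [Program.regBound] at hN; intro τ' hW; refine ⟨_, _, .random τ' x y, ?_, ?_⟩
    · rw [hW.reg y (by omega)]; omega
    · rw [hW.reg y (by omega)]; exact hW.setReg (by omega) _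
  | store τ b x y =>
    simp only [Program.regBound] at hN; intro τ' hW; have hx := hW.reg x (by omega)
    have hy := hW.reg y (by omega); have e1 := Exec.store (ω := ω) τ' b x y
    have ha : (τ'.setArr b (τ'.reg x) (τ'.reg y)).arr = (τ.setArr b (τ.reg x) (τ.reg y)).arr := by
      simp only [State.setArr, hx, hy, hW.arr]
    by_cases hb : b = 1
    · subst hb; have z1 : (1 : ℕ).size = 1 := by simp
      have z0 : (0 : ℕ).size = 0 := by simp
      have zy : ∀ w, w ≤ 1 → w.size ≤ 1 := fun w hw => (size_le_of_le hw).trans z1.le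
      have hys := size_le_of_le (Nat.sub_le (τ.reg y) 1); simp only [watch, if_true]
      by_cases h0 : τ'.reg x = 0
      · have h0' : τ.reg x = 0 := by rw [← hx, h0]
        set τ₂ := τ'.setArr 1 (τ'.reg x) (τ'.reg y) with hτ₂; have hne : y ≠ N + 1 := by omega
        have e2 := Exec.const (ω := ω) τ₂ (N + 1) 1
        have e3 := Exec.arith (ω := ω) (τ₂.setReg (N + 1) 1) .minus (N + 1) y (N + 1)
        have v3 : BinOp.minus.eval ((τ₂.setReg (N + 1) 1).reg y)
            ((τ₂.setReg (N + 1) 1).reg (N + 1)) = τ.reg y - 1 := by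
          simp [BinOp.eval, hne, hτ₂, hy]
        rw [v3] at e3; set τ₃ := (τ₂.setReg (N + 1) 1).setReg (N + 1) (τ.reg y - 1) with hτ₃
        have r3 : τ₃.reg (N + 1) = τ.reg y - 1 := by simp [hτ₃]
        have r3' : τ₃.reg y = τ.reg y := by simp [hτ₃, hne, hτ₂, hy]
        have r2 : (τ₂.setReg (N + 1) 1).reg y = τ.reg y := by simp [hne, hτ₂, hy]
        have r2' : (τ₂.setReg (N + 1) 1).reg (N + 1) = 1 := by simp
        rw [r2, r2'] at e3
        have hval : (τ.setArr 1 (τ.reg x) (τ.reg y)).arr 1 0 = τ.reg y := by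
          rw [State.arr_setArr_apply, if_pos ⟨rfl, h0'.symm⟩]
        have hreg : ∀ v, ∀ z < N, (τ₃.setReg N v).reg z = (τ.setArr 1 (τ.reg x) (τ.reg y)).reg z := by
          intro v z hz; rw [State.reg_setReg, if_neg (by omega), State.reg_setArr, ← hW.reg z hz]
          simp [hτ₃, hτ₂, show z ≠ N + 1 by omega]
        rw [hx, hy] at e1
        by_cases hlarge : τ.reg y ≤ 1
        · have hs := zy _ hlarge; have hc : τ₃.reg (N + 1) = 0 := by rw [r3]; omega
          by_cases hy0 : τ.reg y = 0
          · refine ⟨_, _, .seq e1 (.cond_zero (by simpa [hτ₂] using h0) (.seq e2 (.seq e3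
              (.cond_zero hc (.cond_zero (by rw [r3', hy0]) (.const _ _ _)))))), ?_, ?_, hreg _, ?_⟩
            · simp only [z1, z0]; omega
            · exact ha
            · rw [hval, hy0]; simp
          · refine ⟨_, _, .seq e1 (.cond_zero (by simpa [hτ₂] using h0) (.seq e2 (.seq e3
              (.cond_zero hc (.cond_pos (by rw [r3']; exact hy0) (.const _ _ _)))))), ?_, ?_, hreg _, ?_⟩
            · simp only [z1, z0, r3']; omega
            · exact ha
            · rw [hval, show τ.reg y = 1 by omega]; simp
        · refine ⟨_, _, .seq e1 (.cond_zero (by simpa [hτ₂] using h0) (.seq e2 (.seq e3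
              (.cond_pos (by rw [r3]; omega) (.const _ _ _))))), ?_, ?_, hreg _, ?_⟩
          · simp only [z1, z0, r3]; omega
          · exact ha
          · rw [hval, if_neg hlarge]; simp
      · refine ⟨_, _, .seq e1 (.cond_pos (by simpa using h0) (.skip _)), ?_, ha, ?_, ?_⟩
        · simp only [State.reg_setArr, hx, hy]; omega
        · exact fun z hz => hW.reg z hz
        · have h0' : ¬ (0 = τ.reg x) := by rw [← hx]; omega
          simp only [State.reg_setArr, hW.flag, State.arr_setArr_apply, true_and, if_neg h0']
    · simp only [watch, if_neg hb]
      refine ⟨_, _, e1, by rw [hx, hy]; omega, ha, fun z hz => hW.reg z hz, ?_⟩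
      have hb' : ¬ (1 = b ∧ 0 = τ.reg x) := fun h => hb h.1.symm
      simp only [State.reg_setArr, hW.flag, State.arr_setArr_apply, if_neg hb']
  | seq _ _ ih₁ ih₂ =>
    intro τ' hW; simp only [Program.regBound, max_le_iff] at hN; obtain ⟨_, _, e₁, h₁, W₁⟩ := ih₁ hN.1 hW
    obtain ⟨_, _, e₂, h₂, W₂⟩ := ih₂ hN.2 W₁; exact ⟨_, _, .seq e₁ e₂, by omega, W₂⟩
  | cond_pos hx _ ih =>
    intro τ' hW; simp only [Program.regBound, max_le_iff] at hN
    obtain ⟨_, _, e₁, h₁, W₁⟩ := ih hN.2.1 hW; have hr := hW.reg _ (Nat.lt_of_succ_le hN.1)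
    exact ⟨_, _, .cond_pos (by rwa [hr]) e₁, by rw [hr]; omega, W₁⟩
  | cond_zero hx _ ih =>
    intro τ' hW; simp only [Program.regBound, max_le_iff] at hN
    obtain ⟨_, _, e₁, h₁, W₁⟩ := ih hN.2.2 hW; have hr := hW.reg _ (Nat.lt_of_succ_le hN.1)
    exact ⟨_, _, .cond_zero (by rwa [hr]) e₁, by omega, W₁⟩
  | loop_pos hx _ _ ih₁ ih₂ =>
    intro τ' hW; have hN' := hN; simp only [Program.regBound, max_le_iff] at hN
    obtain ⟨_, _, e₁, h₁, W₁⟩ := ih₁ hN.2 hW; obtain ⟨_, _, e₂, h₂, W₂⟩ := ih₂ hN' W₁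
    have hr := hW.reg _ (Nat.lt_of_succ_le hN.1)
    exact ⟨_, _, .loop_pos (by rwa [hr]) e₁ e₂, by rw [hr]; omega, W₂⟩
  | loop_zero hx =>
    intro τ' hW; simp only [Program.regBound, max_le_iff] at hN
    have hr := hW.reg _ (Nat.lt_of_succ_le hN.1); exact ⟨_, _, .loop_zero (by rwa [hr]), by omega, hW⟩

end RAM

/-! ### Machines with a watched answer -/

namespace DynSC
open RAM

/-- A bound for the registers of a data structure. -/
def DataStructure.bound (D : DataStructure) : ℕ :=
  D.preprocess.regBound + D.update.regBound + D.query.regBound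

/-- The data structure with a watched answer. -/
def DataStructure.watched (D : DataStructure) : DataStructure :=
  ⟨watch D.bound D.preprocess, watch D.bound D.update, watch D.bound D.query⟩

namespace Par
variable {P : Par}

/-- The layers `z` and `z₀` contain the state `τ` and its answer. -/
def Holds (P : Par) (N : ℕ) (σ : State) (z z₀ : ℕ) (τ : State) : Prop :=
  ∃ τ', Watched N τ τ' ∧ P.MemRep σ z z₀ τ'

theorem Holds.of_eq {N : ℕ} {τ : State} {z₀ : ℕ} (h : P.Holds N σ z z₀ τ) (hz : z < P.S)
    (hz₀ : z₀ < P.S) (he : ∀ v, 10 ≤ v → v ≠ 11 → ∀ i y, y < P.S → y = z ∨ y = z₀ →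
      σ'.arr v (i * P.S + y) = σ.arr v (i * P.S + y)) : P.Holds N σ' z z₀ τ := by
  obtain ⟨τ', h1, h2⟩ := h; exact ⟨τ', h1, h2.of_eq hz hz₀ he⟩

/-- A call of a watched program in a machine whose memory is known. -/
theorem holds_call {N : ℕ} (hp : p.regBound ≤ N) {τ τ' : State}
    {inp : ℕ → ℕ} (hs : P.Safe A κ σ) (hm : P.Machine id z z' σ)
    (hτ : P.Holds N σ z (P.zBase id) τ) (hinp : ∀ i, inp i = σ.arr 11 (i * P.S + z') - 1)
    (he : Exec (tape P.g (id % P.g) ω) p (τ.withInput inp) t τ') (ht : 40 * t < σ.reg 35) :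
    wp ω (simulate (watch N p)) (fun σ' _ => P.Holds N σ' z (P.zBase id) τ' ∧
      σ.reg 35 ≤ σ'.reg 35 + 40 * t) σ T := by
  obtain ⟨τ₁, h1, h2⟩ := hτ; obtain ⟨τ₂, t₂, e₂, ht₂, W₂⟩ := Watched.exec he hp (h1.withInput inp)
  -- The watched program is slower by the factor 10, and each unit of its time takes 4 units of
  -- fuel: `40 * t` in total.
  refine wp_mono (rep_call hs hm h2 hinp e₂ (by omega)) ?_; rintro σ' _ - ⟨h3, h4, -⟩
  exact ⟨⟨τ₂, W₂, h3⟩, by omega⟩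

/-- `r 49 := 1` if the watched answer is not zero, and `r 49 := 0` otherwise -/
def answer (N : ℕ) : Program := testReg N ;; .cond 43 (.const 49 1) (.const 49 0)

/-- The watched register never exceeds `1`, so reading it takes at most 8 units of fuel. The output
cell itself could be arbitrarily long, and its length is not covered by the cost of the query. -/
theorem wp_answer {N : ℕ} (hs : P.Safe A κ σ) (hm : P.Machine id z z' σ) :
    wp ω (answer N) (fun σ' T' => (P.Safe A κ σ' ∧ P.Machine id z z' σ' ∧ σ'.arr = σ.arr ∧
      σ'.reg 49 ≤ 1 ∧ T' + 4000 * P.L * potential P.B (σ'.reg 35) ≤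
        T + 4000 * P.L * potential P.B (σ.reg 35) + 4010 * P.L ∧ σ'.reg 35 ≤ σ.reg 35) ∧
      ((∃ τ, P.Holds N σ z (P.zBase id) τ ∧ 8 < σ.reg 35) → ∀ τ, P.Holds N σ z (P.zBase id) τ →
        σ'.reg 49 = (if τ.output 0 = 1 then 1 else 0) ∧ σ.reg 35 ≤ σ'.reg 35 + 8)) σ T := by
  have hL := one_le_L (P := P); have hB : P.B ≤ P.X := by unfold X; omega
  have z1 : (1 : ℕ).size = 1 := by simp
  have z0 : (0 : ℕ).size = 0 := by simp
  have hv : ∀ τ, P.Holds N σ z (P.zBase id) τ → σ.virt (10 + 2 * N) 0 =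
      if τ.output 0 ≤ 1 then τ.output 0 else 0 := by
    rintro τ ⟨τ', h1, h2⟩; rw [hm.virt hs (by omega), ← h2.reg, h1.flag]; rfl
  have hrep : (∃ τ, P.Holds N σ z (P.zBase id) τ ∧ 8 < σ.reg 35) → wp ω (testReg N) (fun σ' _ =>
      ∀ τ, P.Holds N σ z (P.zBase id) τ → σ'.reg 43 = (if τ.output 0 = 1 then 1 else 0) ∧
        σ.reg 35 ≤ σ'.reg 35 + 8) σ 0 := by
    rintro ⟨τ, hτ, hF⟩
    have hsz : (σ.virt (10 + 2 * N) 0).size ≤ 1 := by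
      refine (size_le_of_le (y := 1) ?_).trans z1.le; rw [hv τ hτ]; split_ifs <;> omega
    refine wp_mono (rep_testReg (t := 2) (hm.layered hs) (by omega) (by omega)) ?_
    rintro σ' _ - ⟨-, -, h3, h4⟩ τ₁ hτ₁; refine ⟨?_, h4⟩; rw [h3, hv τ₁ hτ₁]; split_ifs <;> omega
  refine wp_seq (wp_mono (wp_and_of (paid_testReg (L := P.L) (B := P.B) (Fm := P.Fm)
    (by unfold B; omega) (size_le_L hB) N σ T (hm.moderate hs)) hrep) ?_)
  rintro σ₁ T₁ - ⟨⟨h1, h2, h3, h4, -, h6⟩, h7⟩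
  have s₁ : ∀ v, P.Safe A κ (σ₁.setReg 49 v) := fun v => hs.of_eq (fun x hx => by
    rw [State.reg_setReg, if_neg (by omega), h1 x (by omega)]) fun b => by rw [State.arr_setReg, h2]
  have m₁ : ∀ v, P.Machine id z z' (σ₁.setReg 49 v) := fun v => by
    obtain ⟨a1, a2, a3, a4, a5, a6, a7, a8⟩ := hm
    exact ⟨by rw [State.reg_setReg, if_neg (by norm_num), h1 31 (by norm_num), a1],
      by rw [State.reg_setReg, if_neg (by norm_num), h1 32 (by norm_num), a2],
      by rw [State.reg_setReg, if_neg (by norm_num), h1 33 (by norm_num), a3],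
      by rw [State.reg_setReg, if_neg (by norm_num), h1 34 (by norm_num), a4],
      by rw [State.reg_setReg, if_neg (by norm_num)]; exact h3.trans a5, a6, a7, a8⟩
  rw [mul_add, mul_one] at h4
  refine RAM.wp_cond (fun h0 => RAM.wp_const ⟨⟨s₁ _, m₁ _, h2, by simp, ?_, by simpa using h3⟩, fun hH τ hτ => ?_⟩)
    (fun h0 => RAM.wp_const ⟨⟨s₁ _, m₁ _, h2, by simp, ?_, by simpa using h3⟩, fun hH τ hτ => ?_⟩)
  · have := (h6 h0).1; rw [mul_add, mul_one] at this
    simp only [State.reg_setReg, (by decide : (35 : ℕ) ≠ 49), if_false, z1]; omega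
  · obtain ⟨e1, e2⟩ := h7 hH τ hτ
    simp only [State.reg_setReg, (by decide : (35 : ℕ) ≠ 49), if_false, if_true]; refine ⟨?_, e2⟩
    rw [e1] at h0; split_ifs at h0 ⊢ <;> simp at h0 ⊢
  · simp only [State.reg_setReg, (by decide : (35 : ℕ) ≠ 49), if_false, z0]; omega
  · obtain ⟨e1, e2⟩ := h7 hH τ hτ
    simp only [State.reg_setReg, (by decide : (35 : ℕ) ≠ 49), if_false, if_true]; refine ⟨?_, e2⟩
    rw [e1] at h0; split_ifs at h0 ⊢ <;> simp at h0 ⊢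

variable {P : Par}

/-! ### One step of a phase -/

/-- `r 54 := 1` if bit `r 61` of the input has the value that is written in this part of the phase -/
def polarTest (v : Bool) : Program := .arith .plus 61 61 29 ;; .load 0 61 61 ;;
    bif v then .cond 61 (.const 54 1) .skip else .cond 61 .skip (.const 54 1)

/-- Find out whether there is an operation in step `r 52` (`54`) and whether it is a query (`59`), and
its arguments (`55`-`58`). -/
def stepArgs (mode : Mode) : Program :=
  .const 54 0 ;; .const 59 0 ;; .const 57 0 ;; .const 58 0 ;; .arith .plus 55 48 0 ;;
    .arith .plus 56 4 1 ;; .arith .plus 60 4 5 ;; 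
    ifLt 52 5 (.arith .plus 56 56 52 ;; .arith .plus 61 52 0 ;; polarTest (polarity mode))
      (ifLt 52 60 (.const 54 1 ;; .const 59 1 ;; .arith .plus 56 56 52 ;; .const 55 0 ;;
          .arith .plus 57 48 0 ;; .arith .plus 58 48 1)
        (.arith .minus 61 52 60 ;; .arith .plus 56 56 61 ;; polarTest (!polarity mode)))

/-- Write the arguments to a new layer of the input array. -/
def stepStore : Program :=
  .arith .plus 33 22 0 ;; .arith .plus 22 22 1 ;; .arith .plus 55 55 1 ;; .arith .plus 56 56 1 ;;
    .arith .plus 57 57 1 ;; .arith .plus 58 58 1 ;; .arith .plus 61 33 0 ;; .store 11 61 55 ;;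
    .arith .plus 61 61 7 ;; .store 11 61 56 ;; .arith .plus 61 61 7 ;; .store 11 61 57 ;;
    .arith .plus 61 61 7 ;; .store 11 61 58

def stepLoad (mode : Mode) : Program := stepArgs mode ;; stepStore

/-- Write the answer of a query to the table of answers. -/
def record : Program :=
  .arith .times 61 50 4 ;; .arith .plus 61 61 52 ;; .arith .minus 61 61 5 ;; .store 3 61 49

def stepBody (D : DataStructure) (N : ℕ) (mode : Mode) : Program :=
  stepLoad mode ;; .cond 54 (.cond 59 (simulate D.query ;; answer N ;; record) (simulate D.update)) .skip

/-- The arguments of the operation in step `e`, if the phase uses position `k`. -/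
def args (P : Par) (k e : ℕ) : List ℕ :=
  if e < P.b then [k, P.a + 1 + e] else if e < P.a + P.b then [0, P.a + 1 + e, k, k + 1]
  else [k, P.a + 1 + (e - (P.a + P.b))]

/-- Is there an operation in step `e`? -/
def active (P : Par) (v : ℕ → Bool) (e : ℕ) : Prop :=
  if e < P.b then v e = polarity P.mode else if e < P.a + P.b then True
  else v (e - (P.a + P.b)) ≠ polarity P.mode

instance (v : ℕ → Bool) (e : ℕ) : Decidable (P.active v e) := by unfold active; infer_instance

/-- The part of the input that belongs to the block `β`. -/
def blockVec (P : Par) (inp : ℕ → ℕ) (β c : ℕ) : Bool := decide (inp (c + P.col β * P.b) ≠ 0)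

theorem eval_stepArgs (ω : ℕ → Bool) (h : P.Regs σ) {β : ℕ} (he : σ.reg 52 = e)
    (h29 : σ.reg 29 = P.col β * P.b) (h48 : σ.reg 48 = k) :
    (((stepArgs P.mode).eval ω σ).reg 54 ≠ 0 ↔ P.active (P.blockVec (σ.arr 0) β) e) ∧
    (((stepArgs P.mode).eval ω σ).reg 59 ≠ 0 ↔ P.b ≤ e ∧ e < P.a + P.b) ∧
    ((stepArgs P.mode).eval ω σ).reg 55 = (P.args k e).getD 0 0 ∧
    ((stepArgs P.mode).eval ω σ).reg 56 = (P.args k e).getD 1 0 ∧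
    ((stepArgs P.mode).eval ω σ).reg 57 = (P.args k e).getD 2 0 ∧
    ((stepArgs P.mode).eval ω σ).reg 58 = (P.args k e).getD 3 0 ∧
    ((stepArgs P.mode).eval ω σ).reg 54 ≤ 1 ∧ ((stepArgs P.mode).eval ω σ).reg 59 ≤ 1 := by
  have h4 := h.r4; have h5 := h.r5; have h0 := h.r0; have h1 := h.r1; unfold args active blockVec
  generalize P.mode = mode
  cases mode
  all_goals
    by_cases c1 : e < P.b
    · by_cases c2 : σ.arr 0 (e + P.col β * P.b) = 0 <;>
      simp [stepArgs, polarTest, polarity, Program.eval, BinOp.eval, eval_ifLt, h4, h5, h0, h1, he, h29, h48, c1, c2]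
    by_cases c3 : e < P.a + P.b
    · simp [stepArgs, polarTest, polarity, Program.eval, BinOp.eval, eval_ifLt, h4, h5, h0, h1, he, h29, h48, c1, c3] <;> omega
    · by_cases c2 : σ.arr 0 (e - (P.a + P.b) + P.col β * P.b) = 0 <;>
      simp [stepArgs, polarTest, polarity, Program.eval, BinOp.eval, eval_ifLt, h4, h5, h0, h1, he, h29, h48, c1, c2, c3]

theorem eval_stepStore (ω : ℕ → Bool) (h : P.Regs σ) (hκ : κ < P.S) (h22 : σ.reg 22 = κ) :
    (stepStore.eval ω σ).reg 22 = κ + 1 ∧ (stepStore.eval ω σ).reg 33 = κ ∧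
    ∀ i y, y < P.S → (stepStore.eval ω σ).arr 11 (i * P.S + y) =
      if y = κ ∧ i < 4 then σ.reg (55 + i) + 1 else σ.arr 11 (i * P.S + y) := by
  have h7 := h.r7; have h0 := h.r0; have h1 := h.r1
  refine ⟨by simp [stepStore, Program.eval, BinOp.eval, h22, h1],
    by simp [stepStore, Program.eval, BinOp.eval, h22, h0], fun i y hy => ?_⟩
  have e : (stepStore.eval ω σ).arr 11 (i * P.S + y) =
      if i * P.S + y = 3 * P.S + κ then σ.reg 58 + 1 else if i * P.S + y = 2 * P.S + κ then
        σ.reg 57 + 1 else if i * P.S + y = 1 * P.S + κ then σ.reg 56 + 1 else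
        if i * P.S + y = 0 * P.S + κ then σ.reg 55 + 1 else σ.arr 11 (i * P.S + y) := by
    have e3 : 3 * P.S + κ = κ + P.S + P.S + P.S := by ring
    have e2 : 2 * P.S + κ = κ + P.S + P.S := by ring
    have e1 : 1 * P.S + κ = κ + P.S := by ring
    rw [e1, e2, e3]; simp [stepStore, Program.eval, BinOp.eval, State.arr_setArr_apply, h22, h0, h1, h7]
  have inj : ∀ j, i * P.S + y = j * P.S + κ ↔ i = j ∧ y = κ := fun j =>
    ⟨fun h => mul_add_inj hy hκ h, fun h => by rw [h.1, h.2]⟩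
  rw [e]; simp only [inj]
  by_cases hyκ : y = κ
  · simp only [hyκ, and_true, true_and]
    by_cases hi : i < 4
    · interval_cases i <;> simp
    · rw [if_neg (by omega), if_neg (by omega), if_neg (by omega), if_neg (by omega), if_neg hi]
  · simp [hyκ]

variable {P : Par}

/-- Machine `id` runs in layer `z`, in a phase that uses position `k`. -/
structure Running (P : Par) (id z k : ℕ) (σ : State) : Prop where
  r29 : σ.reg 29 = P.col (id / P.g) * P.b
  r31 : σ.reg 31 = z
  r32 : σ.reg 32 = P.zBase id
  r34 : σ.reg 34 = id % P.g
  fuel : σ.reg 35 ≤ P.Fm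
  r48 : σ.reg 48 = k
  r50 : σ.reg 50 = id
  id_lt : id < P.NV
  z_lt : z < P.S
  k_lt : k < P.a

theorem Running.machine (h : P.Running id z k σ) (h33 : σ.reg 33 = z')
    (hz' : z' < P.S) : P.Machine id z z' σ :=
  ⟨h.r31, h.r32, h33, h.r34, h.fuel, h.id_lt, h.z_lt, hz'⟩

theorem Running.of_eq (h : P.Running id z k σ)
    (hr : ∀ x ∈ ({29, 31, 32, 34, 48, 50} : Finset ℕ), σ'.reg x = σ.reg x) (hF : σ'.reg 35 ≤ P.Fm) :
    P.Running id z k σ' where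
  r29 := (hr 29 (by decide)).trans h.r29
  r31 := (hr 31 (by decide)).trans h.r31
  r32 := (hr 32 (by decide)).trans h.r32
  r34 := (hr 34 (by decide)).trans h.r34
  fuel := hF
  r48 := (hr 48 (by decide)).trans h.r48
  r50 := (hr 50 (by decide)).trans h.r50
  id_lt := h.id_lt
  z_lt := h.z_lt
  k_lt := h.k_lt

theorem args_le (hk : k < P.a) (he : e < P.E) (i : ℕ) :
    (P.args k e).getD i 0 + 1 ≤ 2 * P.a + P.b + 2 := by
  have : ∀ x ∈ P.args k e, x + 1 ≤ 2 * P.a + P.b + 2 := by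
    intro x hx; unfold E at he; unfold args at hx; split_ifs at hx <;> simp at hx <;> omega
  by_cases hi : i < (P.args k e).length
  · rw [List.getD_eq_getElem _ _ hi]; exact this _ (List.getElem_mem hi)
  · rw [List.getD_eq_default _ _ (by omega)]; omega

theorem args_getD (k e i : ℕ) (hi : 4 ≤ i) : (P.args k e).getD i 0 = 0 := by
  apply List.getD_eq_default; unfold args; split_ifs <;> simp <;> omega

set_option maxRecDepth 4000 in
theorem wp_stepLoad (hs : P.Safe A κ σ) (hR : P.Running id z k σ) (h52 : σ.reg 52 = e) (he : e < P.E)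
    (hinp : ∀ i, σ.arr 0 i ≤ 1) (hκ : κ < P.S) (hκ₀ : κ ≠ 0) :
    wp ω (stepLoad P.mode) (fun σ' T' => P.Safe A (κ + 1) σ' ∧ P.Running id z k σ' ∧
      σ'.reg 33 = κ ∧ σ'.reg 35 = σ.reg 35 ∧ (∀ b, b ≠ 11 → σ'.arr b = σ.arr b) ∧
      (∀ i, ofList (P.args k e) i = σ'.arr 11 (i * P.S + κ) - 1) ∧
      (σ'.reg 54 ≠ 0 ↔ P.active (P.blockVec (σ.arr 0) (id / P.g)) e) ∧
      (σ'.reg 59 ≠ 0 ↔ P.b ≤ e ∧ e < P.a + P.b) ∧ σ'.reg 54 ≤ 1 ∧ σ'.reg 59 ≤ 1 ∧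
      T' ≤ T + (stepLoad P.mode).weight * P.L) σ T := by
  have hL := one_le_L (P := P); have hr := hs.regs
  have hX : P.S + P.n + P.a + P.E ≤ P.X := by unfold X; omega
  have hc := col_mul_le (P := P) (id / P.g); have hk := hR.k_lt
  refine hr.wp [22, 29, 48, 52] [0]
    (by simp only [List.forall_mem_cons, hs.ctr, hR.r29, hR.r48, h52]; simp; omega)
    (by simpa using fun i => (hinp i).trans one_le_X) ?_ (by cases P.mode <;> decide)
  intro hF
  obtain ⟨a54, a59, a55, a56, a57, a58, b54, b59⟩ := eval_stepArgs ω hr (β := id / P.g) h52 hR.r29 hR.r48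
  have fA : Framed (stepArgs P.mode) σ ((stepArgs P.mode).eval ω σ) := Flat.framed (by
    cases P.mode <;> simp [stepArgs, polarTest, polarity, ifLt, Program.Flat]) σ
  have wA : ∀ x < 54, x ≠ 45 → x ∉ (stepArgs P.mode).writes := by cases P.mode <;> decide
  have hev : (stepLoad P.mode).eval ω σ = stepStore.eval ω ((stepArgs P.mode).eval ω σ) := rfl
  rw [hev] at hF ⊢; set σ₁ := (stepArgs P.mode).eval ω σ with hσ₁
  have ha₁ := fA.arr (by cases P.mode <;> decide)
  have hr₁ : P.Regs σ₁ := hr.of_eq fun x hx => fA.1 x (wA x (by omega) (by omega))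
  have h22 : σ₁.reg 22 = κ := (fA.1 22 (wA _ (by simp) (by simp))).trans hs.ctr
  obtain ⟨s22, s33, s11⟩ := eval_stepStore ω hr₁ hκ h22
  have fS : Framed stepStore σ₁ (stepStore.eval ω σ₁) := Flat.framed (by
    simp [stepStore, Program.Flat]) σ₁
  set σ₂ := stepStore.eval ω σ₁ with hσ₂
  have wS : ∀ x < 60, x ∉ ({22, 33, 55, 56, 57, 58} : Finset ℕ) → σ₂.reg x = σ₁.reg x := fun x h h' =>
    fS.1 x ((by decide : ∀ x < 60, x ∉ ({22, 33, 55, 56, 57, 58} : Finset ℕ) → x ∉ stepStore.writes) x h h')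
  have hall : ∀ x, x < 54 ∧ x ≠ 22 ∧ x ≠ 33 ∧ x ≠ 45 → σ₂.reg x = σ.reg x := fun x h => by
    rw [wS x (by omega) (by simp; omega), fA.1 x (wA x h.1 h.2.2.2)]
  have ha₂ : ∀ b, b ≠ 11 → σ₂.arr b = σ.arr b := fun b hb => by
    rw [fS.2 b (by simpa [(by decide : stepStore.stores = {11})] using hb), ha₁]
  have hv : ∀ i < 4, σ₁.reg (55 + i) = (P.args k e).getD i 0 := by
    intro i hi
    interval_cases i <;> assumption
  have c11 : ∀ i y, y < P.S → σ₂.arr 11 (i * P.S + y) = if y = κ ∧ i < 4 then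
      (P.args k e).getD i 0 + 1 else σ.arr 11 (i * P.S + y) := by
    intro i y hy; rw [s11 i y hy]; split_ifs with hc
    · rw [hv i hc.2]
    · rw [ha₁]
  have hS := S_pos (P := P)
  refine ⟨⟨hr.of_eq fun x hx => hall x (by omega), s22,
    by rw [ha₂ 2 (by simp), hs.mat], hs.bit, by rw [ha₂ 5 (by simp)]; exact hs.fuel,
    by rw [ha₂ 4 (by simp)]; exact hs.dead, by rw [ha₂ 3 (by simp)]; exact hs.ans, ?_, ?_⟩,
    hR.of_eq (fun x hx => ?_) ?_, s33, hall 35 (by simp),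
    ha₂, fun i => ?_, ?_, ?_, ?_, ?_, le_rfl⟩
  · intro v hv' i
    by_cases hv11 : v = 11
    · subst hv11; have := Nat.div_add_mod' i P.S; rw [← this, c11 _ _ (Nat.mod_lt _ hS)]; split_ifs
      · refine (size_le_self _).trans ?_; have := args_le hR.k_lt he (i / P.S); unfold B; omega
      · exact hs.cells 11 (by simp) _
    · rw [ha₂ v hv11]; exact hs.cells v hv' i
  · intro i y hy hyS; rw [c11 i y hyS, if_neg (by omega)]; exact hs.fresh i y (by omega) hyS
  · simp only [Finset.mem_insert, Finset.mem_singleton] at hx; exact hall x (by omega)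
  · rw [hall 35 (by simp)]; exact hR.fuel
  · rw [c11 i κ hκ]
    by_cases hi : i < 4
    · rw [if_pos ⟨rfl, hi⟩]; rfl
    · rw [if_neg (by omega), hs.fresh i κ (by omega) hκ, ofList, args_getD _ _ _ (by omega)]
  all_goals rwa [wS _ (by simp) (by decide)]

/-- The factor of the potential of a machine. -/
def rate (D : DataStructure) : ℕ := D.query.slowdown + D.update.slowdown + 4000

def stepCost (D : DataStructure) (mode : Mode) : ℕ :=
  (stepLoad mode).weight + record.weight + D.query.slowdown + D.update.slowdown + 4030

theorem rate_mono {c c' L B f f' T' : ℕ} (hc : c ≤ c') (hf : f' ≤ f)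
    (h : T' + c * L * potential B f' ≤ T + c * L * potential B f + e) :
    T' + c' * L * potential B f' ≤ T + c' * L * potential B f + e := by
  obtain ⟨d, rfl⟩ := Nat.exists_eq_add_of_le hc
  have := Nat.mul_le_mul_left (d * L) (potential_mono (B := B) hf); rw [add_mul c d L, add_mul, add_mul]
  omega

theorem Running.simulate (h : P.Running id z k σ)
    (hF : Framed (simulate p) σ σ') (hm : P.Machine id z κ σ') : P.Running id z k σ' :=
  h.of_eq (fun x hx => hF.1 x fun hw => by
    have := writes_simulate _ _ hw; simp at hx
    omega) hm.fuel

/-- What is known of machine `id` after a step in layer `z`. -/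
structure Stepped (P : Par) (A : ℕ → ℕ) (κ id z k : ℕ) (σ σ' : State) : Prop where
  safe : P.Safe A κ σ'
  run : P.Running id z k σ'
  loc : P.Local z σ σ'
  arr : ∀ b < 10, b ≠ 3 → σ'.arr b = σ.arr b

theorem wp_record (hs : P.Safe A κ σ) (hR : P.Running id z k σ) (h52 : σ.reg 52 = e) (h49 : σ.reg 49 ≤ 1)
    (he : P.b ≤ e) (he' : e < P.a + P.b) :
    wp ω record (fun σ' T' => P.Safe A κ σ' ∧ P.Running id z k σ' ∧ σ'.reg 35 = σ.reg 35 ∧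
      (∀ b, b ≠ 3 → σ'.arr b = σ.arr b) ∧ (∀ j, σ'.arr 3 j = if j = id * P.a + (e - P.b) then
        σ.reg 49 else σ.arr 3 j) ∧ T' ≤ T + record.weight * P.L) σ T := by
  have hL := one_le_L (P := P); have hr := hs.regs; have hX : P.NV + P.E ≤ P.X := by unfold X; omega
  have := hR.id_lt
  refine hr.wp [49, 50, 52] [] (by simp [hR.r50, h52, h49.trans one_le_X]; unfold E at hX; omega) (by simp) ?_
  intro hF
  have hreg : ∀ x, x ≠ 61 → (record.eval ω σ).reg x = σ.reg x := fun x hx =>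
    hF.1 x (by simpa [(by decide : record.writes = {61})] using hx)
  have harr : ∀ b, b ≠ 3 → (record.eval ω σ).arr b = σ.arr b := fun x hx =>
    hF.2 x (by simpa [(by decide : record.stores = {3})] using hx)
  have e3 : ∀ j, (record.eval ω σ).arr 3 j = if j = id * P.a + (e - P.b) then
        σ.reg 49 else σ.arr 3 j := by
    intro j; rw [← Nat.add_sub_assoc he]
    simp [record, Program.eval, BinOp.eval, State.arr_setArr_apply, hR.r50, h52, hr.r4, hr.r5]
  refine ⟨⟨hr.of_eq fun x hx => hreg x (by omega), by rw [hreg 22 (by simp), hs.ctr],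
    by rw [harr 2 (by simp), hs.mat], hs.bit, by rw [harr 5 (by simp)]; exact hs.fuel,
    by rw [harr 4 (by simp)]; exact hs.dead, fun j => ?_,
    fun v hv => by rw [harr v (by omega)]; exact hs.cells v hv,
    by rw [harr 11 (by simp)]; exact hs.fresh⟩,
    hR.of_eq (fun x hx => hreg x (by rintro rfl; simp at hx)) (by rw [hreg 35 (by simp)]; exact hR.fuel),
    hreg 35 (by simp), harr, e3, le_rfl⟩
  rw [e3]; split_ifs
  · exact h49
  · exact hs.ans j

end Par
end DynSC

namespace RAM

/-- A family of assertions holds after `p` if each of them does: executions are unique. -/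
theorem wp_and_all {ι : Type*} {H : ι → Prop} {R : ι → State → Prop} (h : wp ω p Q σ T)
    (h' : ∀ i, H i → wp ω p (fun σ' _ => R i σ') σ 0) :
    wp ω p (fun σ' T' => Q σ' T' ∧ ∀ i, H i → R i σ') σ T := by
  obtain ⟨σ₁, t₁, T₁, e₁, hT₁, hQ⟩ := h; refine ⟨σ₁, t₁, T₁, e₁, hT₁, hQ, fun i hi => ?_⟩
  obtain ⟨σ₂, t₂, T₂, e₂, -, hR⟩ := h' i hi; obtain ⟨-, rfl⟩ := e₁.det e₂; exact hR

end RAM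
-- One step of a phase: safety, cost and effect
namespace DynSC
open RAM
namespace Par
variable {P : Par}

/-- The program that is called in step `e`. -/
def stepProg (P : Par) (D : DataStructure) (e : ℕ) : Program :=
  if P.b ≤ e ∧ e < P.a + P.b then D.query else D.update

/-- The effect of a step on a machine whose memory is known. -/
structure StepRep (P : Par) (D : DataStructure) (ω : ℕ → Bool) (id z k e : ℕ) (σ σ' τ : State) :
    Prop where
  idle : ¬ P.active (P.blockVec (σ.arr 0) (id / P.g)) e →
    P.Holds D.bound σ' z (P.zBase id) τ ∧ σ.reg 35 ≤ σ'.reg 35 ∧ σ'.arr 3 = σ.arr 3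
  call : P.active (P.blockVec (σ.arr 0) (id / P.g)) e → ∀ t τ',
    Exec (tape P.g (id % P.g) ω) (P.stepProg D e) (τ.withInput (ofList (P.args k e))) t τ' →
    40 * t + 8 < σ.reg 35 → P.Holds D.bound σ' z (P.zBase id) τ' ∧
      σ.reg 35 ≤ σ'.reg 35 + (40 * t + 8) ∧ (P.b ≤ e ∧ e < P.a + P.b →
        σ'.arr 3 (id * P.a + (e - P.b)) = if τ'.output 0 = 1 then 1 else 0)

theorem size_one_le (x : ℕ) (h : x ≤ 1) : x.size ≤ 1 := (size_le_of_le h).trans (by simp)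

/-- Safety and cost are unconditional. The effect is conjoined as a family indexed by triples (τ, t,
τ'), as the state that the machine holds and the call to be simulated are known only under the
hypotheses of `StepRep`. -/
theorem wp_stepBody (hD : P.D = D.watched)
    (hs : P.Safe A κ σ) (hR : P.Running id z k σ) (h52 : σ.reg 52 = e) (he : e < P.E)
    (hinp : ∀ i, σ.arr 0 i ≤ 1) (hκ : κ < P.S) (hκ₀ : κ ≠ 0) :
    wp ω (stepBody P.D D.bound P.mode) (fun σ' T' =>
      P.Stepped A (κ + 1) id z k σ σ' ∧ (∀ j, ¬ (P.b ≤ e ∧ e < P.a + P.b ∧ j = id * P.a + (e - P.b)) →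
        σ'.arr 3 j = σ.arr 3 j) ∧
      T' + rate P.D * P.L * potential P.B (σ'.reg 35) ≤
        T + rate P.D * P.L * potential P.B (σ.reg 35) + stepCost P.D P.mode * P.L ∧
      ∀ τ, P.Holds D.bound σ z (P.zBase id) τ → P.StepRep D ω id z k e σ σ' τ) σ T := by
  have hL := one_le_L (P := P)
  have hcost : stepCost P.D P.mode * P.L = (stepLoad P.mode).weight * P.L + record.weight * P.L +
    P.D.query.slowdown * P.L + P.D.update.slowdown * P.L + 4030 * P.L := by unfold stepCost; ring
  have hbq : D.query.regBound ≤ D.bound := by unfold DataStructure.bound; omega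
  have hbu : D.update.regBound ≤ D.bound := by unfold DataStructure.bound; omega
  have hDq : P.D.query = watch D.bound D.query := by rw [hD]; rfl
  have hDu : P.D.update = watch D.bound D.update := by rw [hD]; rfl
  refine wp_seq (wp_mono (wp_stepLoad hs hR h52 he hinp hκ hκ₀) ?_)
  rintro σ₁ T₁ hF₁ ⟨s₁, R₁, h33, h35, a₁, i₁, act, qry, b54, b59, t₁⟩
  have e52 : σ₁.reg 52 = e := by
    rw [hF₁.1 52, h52]
    have : (stepLoad P.mode).writes ⊆ {22, 33, 45, 54, 55, 56, 57, 58, 59, 60, 61} := by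
      cases P.mode <;> decide
    exact fun h => by have := this h; simp at this
  have m₁ := R₁.machine h33 hκ
  have hz₁ : ∀ τ, P.Holds D.bound σ z (P.zBase id) τ → P.Holds D.bound σ₁ z (P.zBase id) τ :=
    fun τ h => h.of_eq hR.z_lt (zBase_lt hR.id_lt) fun v _ hv i y _ _ => by rw [a₁ v hv]
  have l₁ : P.Local z σ σ₁ := Local.of_eq fun v _ hv => a₁ v hv; have z54 := size_one_le _ b54
  have z59 := size_one_le _ b59
  refine RAM.wp_cond (fun h54 => RAM.wp_cond (fun h59 => ?_) (fun h59 => ?_)) (fun h54 => ?_)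
  · refine wp_seq (wp_mono (wp_and_all (ι := State × ℕ × State) (H := fun i =>
      P.Holds D.bound σ z (P.zBase id) i.1 ∧ Exec (tape P.g (id % P.g) ω) D.query
        (i.1.withInput (ofList (P.args k e))) i.2.1 i.2.2 ∧ 40 * i.2.1 < σ.reg 35)
      (R := fun i σ₂ => P.Holds D.bound σ₂ z (P.zBase id) i.2.2 ∧ σ.reg 35 ≤ σ₂.reg 35 + 40 * i.2.1)
      (safe_simulate (ω := ω) (p := P.D.query) (by omega) s₁ m₁ hκ₀ (by omega)) ?_) ?_)
    · rintro ⟨τ, t, τ'⟩ ⟨h1, h2, h3⟩; rw [hDq, ← h35]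
      exact holds_call hbq s₁ m₁ (hz₁ τ h1) i₁ h2 (by rw [h35]; exact h3)
    rintro σ₂ T₂ hF₂ ⟨⟨s₂, m₂, l₂, t₂, f₂⟩, r₂⟩; have R₂ := R₁.simulate hF₂ m₂
    have e52₂ : σ₂.reg 52 = e := by
      rw [hF₂.1 52 fun h => by have := writes_simulate _ _ h; omega, e52]
    have st₂ : ∀ v < 10, σ₂.arr v = σ₁.arr v := fun v hv => hF₂.2 v fun hm => by
      have := stores_simulate _ _ hm; omega
    refine wp_seq (wp_mono (wp_answer (N := D.bound) s₂ m₂) ?_)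
    rintro σ₃ T₃ hF₃ ⟨⟨s₃, m₃, a₃, b₃, t₃, f₃⟩, r₃⟩
    have wans : (answer D.bound).writes ⊆ {35, 36, 37, 39, 40, 41, 42, 43, 44, 49} := by
      intro x hx; simp [answer, testReg, basic, Program.writes, vload, sizeLoop] at hx ⊢; omega
    have R₃ : P.Running id z k σ₃ := R₂.of_eq (fun x hx => hF₃.1 x fun hw => by
      have := wans hw; simp only [Finset.mem_insert, Finset.mem_singleton] at hx this
      omega) m₃.fuel
    have e52₃ : σ₃.reg 52 = e := by
      rw [hF₃.1 52 fun h => by have := wans h; simp at this, e52₂]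
    have hq := qry.1 h59; refine wp_mono (wp_record s₃ R₃ e52₃ b₃ hq.1 hq.2) ?_
    rintro σ₄ T₄ - ⟨s₄, R₄, f₄, a₄, c₄, t₄⟩
    have ea : ∀ v < 10, v ≠ 3 → σ₄.arr v = σ.arr v := fun v hv hv3 => by
      rw [a₄ v hv3, a₃, st₂ v hv, a₁ v (by omega)]
    have l₄ : P.Local z σ σ₄ := l₁.trans (l₂.trans (Local.of_eq fun v hv _ => by
      rw [a₄ v (by omega), a₃]))
    refine ⟨⟨s₄, R₄, l₄, ea⟩, fun j hj => ?_, ?_, fun τ hτ => ⟨fun hna => ?_, fun _ t τ' hex ht => ?_⟩⟩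
    · rw [c₄, if_neg fun h => hj ⟨hq.1, hq.2, h⟩, a₃, st₂ 3 (by norm_num), a₁ 3 (by norm_num)]
    · have k2 := rate_mono (c' := rate P.D) (by unfold rate; omega) f₂ t₂
      have k3 := rate_mono (c' := rate P.D) (by unfold rate; omega) f₃ t₃; rw [h35] at k2; rw [f₄]; omega
    · exact absurd (act.1 h54) hna
    · rw [stepProg, if_pos hq] at hex
      obtain ⟨g1, g2⟩ := r₂ (τ, t, τ') ⟨hτ, hex, by show 40 * t < _; omega⟩
      have g3 : 8 < σ₂.reg 35 := by simp only at g2; omega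
      obtain ⟨g4, g5⟩ := r₃ ⟨τ', g1, g3⟩ τ' g1
      refine ⟨g1.of_eq hR.z_lt (zBase_lt hR.id_lt) fun v hv _ i y _ _ => by
        rw [a₄ v (by omega), a₃], ?_, fun _ => ?_⟩
      · simp only at g2; rw [f₄]; omega
      · rw [c₄, if_pos rfl, g4]
  · refine wp_mono (wp_and_all (ι := State × ℕ × State) (H := fun i =>
      P.Holds D.bound σ z (P.zBase id) i.1 ∧ Exec (tape P.g (id % P.g) ω) D.update
        (i.1.withInput (ofList (P.args k e))) i.2.1 i.2.2 ∧ 40 * i.2.1 < σ.reg 35)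
      (R := fun i σ₂ => P.Holds D.bound σ₂ z (P.zBase id) i.2.2 ∧ σ.reg 35 ≤ σ₂.reg 35 + 40 * i.2.1)
      (safe_simulate (ω := ω) (p := P.D.update) (by omega) s₁ m₁ hκ₀ (by omega)) ?_) ?_
    · rintro ⟨τ, t, τ'⟩ ⟨h1, h2, h3⟩; rw [hDu, ← h35]
      exact holds_call hbu s₁ m₁ (hz₁ τ h1) i₁ h2 (by rw [h35]; exact h3)
    rintro σ₂ T₂ hF₂ ⟨⟨s₂, m₂, l₂, t₂, f₂⟩, r₂⟩; have R₂ := R₁.simulate hF₂ m₂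
    have st₂ : ∀ v < 10, σ₂.arr v = σ.arr v := fun v hv => by
      rw [hF₂.2 v fun hm => by have := stores_simulate _ _ hm; omega, a₁ v (by omega)]
    have hnq : ¬ (P.b ≤ e ∧ e < P.a + P.b) := fun h => (qry.2 h) h59
    refine ⟨⟨s₂, R₂, l₁.trans l₂, fun v hv _ => st₂ v hv⟩, fun j hj => by rw [st₂ 3 (by norm_num)], ?_,
      fun τ hτ => ⟨fun hna => absurd (act.1 h54) hna, fun _ t τ' hex ht => ?_⟩⟩
    · have k2 := rate_mono (c' := rate P.D) (by unfold rate; omega) f₂ t₂; rw [h35] at k2; omega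
    · rw [stepProg, if_neg hnq] at hex
      obtain ⟨g1, g2⟩ := r₂ (τ, t, τ') ⟨hτ, hex, by show 40 * t < _; omega⟩; simp only at g2
      exact ⟨g1, by omega, fun h => absurd h hnq⟩
  · refine wp_skip ⟨⟨s₁, R₁, l₁, fun v hv _ => a₁ v (by omega)⟩, fun j _ => by rw [a₁ 3 (by norm_num)], ?_,
      fun τ hτ => ⟨fun _ => ⟨hz₁ τ hτ, by rw [h35], a₁ 3 (by norm_num)⟩,
        fun ha => absurd h54 (act.2 ha)⟩⟩
    rw [h35]; omega

end Par
theorem Block.opsTo_succ (K : Block) (T : ℕ) : K.opsTo (T + 1) = K.opsTo T ++ (K.opAt T).toList := by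
  unfold opsTo; rw [List.range_succ, List.filterMap_append]
  cases ho : K.opAt T <;> simp [ho]

theorem Block.opAt_phase (K : Block) (hs : s < K.a) (he : e < K.phaseLen) :
    K.opAt (s * K.phaseLen + e) = K.opOf s e := by
  have h : (s + 1) * K.phaseLen ≤ K.a * K.phaseLen := Nat.mul_le_mul_right _ hs; rw [add_mul] at h
  rw [opAt, if_pos (by omega), (K.div_mod_step he).1, (K.div_mod_step he).2]

theorem Block.opOf_eq_none (K : Block) (h1 : e < K.b → K.V s e ≠ polarity K.mode)
    (h2 : ¬ e < K.b → ¬ e < K.b + K.a ∧ K.V s (e - K.b - K.a) = polarity K.mode) :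
    K.opOf s e = none := by
  unfold opOf; simp only
  by_cases h : e < K.b
  · rw [if_pos h, if_neg (h1 h)]
  · rw [if_neg h, if_neg (h2 h).1, if_pos (h2 h).2]

theorem Block.call_opOf (K : Block) (D : DataStructure) (hs : s < K.a) (he : e < 2 * K.b + K.a)
    (ha : if e < K.b then K.V s e = polarity K.mode else if e < K.a + K.b then True else
      K.V s (e - (K.a + K.b)) ≠ polarity K.mode) : ∃ op, K.opOf s e = some op ∧
      D.call op = (if K.b ≤ e ∧ e < K.a + K.b then D.query else D.update,
        ofList (if e < K.b then [position K.mode K.a s, K.a + 1 + e] else if e < K.a + K.b then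
          [0, K.a + 1 + e, position K.mode K.a s, position K.mode K.a s + 1]
          else [position K.mode K.a s, K.a + 1 + (e - (K.a + K.b))])) := by
  have hp := position_lt (mode := K.mode) hs; have hn := K.hn; unfold opOf
  by_cases h1 : e < K.b
  · rw [if_pos h1] at ha
    simp only [if_pos h1, ha, if_true, Option.some.injEq, exists_eq_left', DataStructure.call]
    rw [if_neg (by omega), K.vertex_val (by omega), K.vertex_val (by omega)]
  · rw [if_neg h1] at ha
    by_cases h2 : e < K.a + K.b
    · have h2' : e < K.b + K.a := by omega
      simp only [if_neg h1, if_pos h2, if_pos h2', Option.some.injEq, exists_eq_left',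
        DataStructure.call]
      rw [if_pos (by omega), K.vertex_val (by omega), K.vertex_val (by omega),
        K.vertex_val (by omega), K.vertex_val (by omega)]
      rw [show K.a + K.b + 1 + (e - K.b) = K.a + 1 + e by omega]
    · have h2' : ¬ e < K.b + K.a := by omega
      rw [if_neg h2] at ha; have e1 : e - K.b - K.a = e - (K.a + K.b) := by omega
      simp only [if_neg h1, if_neg h2, if_neg h2', e1, if_neg ha, Option.some.injEq, exists_eq_left',
        DataStructure.call]
      rw [if_neg (by omega), K.vertex_val (by omega), K.vertex_val (by omega)]

namespace Par
variable {P : Par}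

/-! ### The runs of a machine -/

/-- The instance on which machine `id` works in run `ρ`, if `vec t` is the input of the multiplication
number `t`. -/
def runBlock (P : Par) (h : 2 * P.a + P.b + 1 ≤ P.nG) (A : ℕ → ℕ) (vec : ℕ → ℕ → ℕ) (id ρ : ℕ) :
    DynSC.Block where
  mode := P.mode
  n := P.nG
  a := P.a
  b := P.b
  w := P.width (id / P.g)
  hn := h
  M := P.blockMat A (id / P.g)
  V s := P.blockVec (vec (ρ * P.a + s)) (id / P.g)

variable {h : 2 * P.a + P.b + 1 ≤ P.nG} {A : ℕ → ℕ} {vec : ℕ → ℕ → ℕ} {ω : ℕ → Bool} {id ρ : ℕ}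
  {D : DataStructure} {τ₀ : State}

theorem opOf_active (hs : s < P.a) (he : e < P.E)
    (ha : P.active (P.blockVec (vec (ρ * P.a + s)) (id / P.g)) e) :
    ∃ op, (P.runBlock h A vec id ρ).opOf s e = some op ∧
      D.call op = (P.stepProg D e, ofList (P.args (position P.mode P.a s) e)) :=
  (P.runBlock h A vec id ρ).call_opOf D hs he ha

theorem opOf_idle (ha : ¬ P.active (P.blockVec (vec (ρ * P.a + s)) (id / P.g)) e) :
    (P.runBlock h A vec id ρ).opOf s e = none := by
  unfold active at ha
  refine (P.runBlock h A vec id ρ).opOf_eq_none (fun (h1 : e < P.b) => ?_) fun (h1 : ¬ e < P.b) => ?_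
  · rw [if_pos h1] at ha; exact ha
  · rw [if_neg h1] at ha
    have h2 : ¬ e < P.a + P.b := fun h2 => by rw [if_pos h2] at ha; exact ha trivial
    rw [if_neg h2, not_not] at ha; have e1 : e - P.b - P.a = e - (P.a + P.b) := by omega
    refine ⟨show ¬ e < P.b + P.a by omega, ?_⟩; show P.blockVec _ _ (e - P.b - P.a) = _
    rw [e1]; exact ha

/-- The calls of a run before step `S`. -/
def runCalls (P : Par) (h : 2 * P.a + P.b + 1 ≤ P.nG) (D : DataStructure) (A : ℕ → ℕ)
    (vec : ℕ → ℕ → ℕ) (id ρ S : ℕ) : List (Program × (ℕ → ℕ)) :=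
  ((P.runBlock h A vec id ρ).opsTo S).map D.call

/-- Preprocessing leads machine `id` to state `τ₀`, and all its runs from there need little time. -/
structure Legit (P : Par) (D : DataStructure) (A : ℕ → ℕ) (vec : ℕ → ℕ → ℕ) (ω : ℕ → Bool) (id : ℕ)
    (τ₀ : State) : Prop where
  large : 2 * P.a + P.b + 1 ≤ P.nG
  boot : ∃ t, Exec (tape P.g (id % P.g) ω) D.preprocess
    (State.blank.withInput (P.preInput A (id / P.g))) t τ₀ ∧ 40 * t < P.Fpre
  run : ∀ ρ ≤ P.n, ∃ rs, Session (tape P.g (id % P.g) ω) τ₀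
    (P.runCalls large D A vec id ρ (P.a * P.E)) rs ∧
      40 * (rs.map Result.time).sum + 8 * (P.a * P.E) < P.Frun

/-- Machine `id` has done `S` steps of run `ρ`, and has fuel `F`. -/
def Progress (P : Par) (h : 2 * P.a + P.b + 1 ≤ P.nG) (D : DataStructure) (A : ℕ → ℕ)
    (vec : ℕ → ℕ → ℕ) (ω : ℕ → Bool) (id ρ : ℕ) (τ₀ : State) (S : ℕ) (σ : State) (F : ℕ) : Prop :=
  ∃ τ u, Trace (tape P.g (id % P.g) ω) τ₀ (P.runCalls h D A vec id ρ S) τ u ∧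
    P.Holds D.bound σ (P.zRun id ρ) (P.zBase id) τ ∧ P.Frun ≤ F + 40 * u + 8 * S

/-- The recorded answer to query `i` in phase `s` of run `ρ` is the answer of the data structure. -/
def Verdict (P : Par) (h : 2 * P.a + P.b + 1 ≤ P.nG) (D : DataStructure) (A : ℕ → ℕ)
    (vec : ℕ → ℕ → ℕ) (ω : ℕ → Bool) (id ρ : ℕ) (τ₀ : State) (s i : ℕ) (σ : State) : Prop :=
  ∀ rs, Session (tape P.g (id % P.g) ω) τ₀ (P.runCalls h D A vec id ρ (P.a * P.E)) rs →
    ∀ r, rs[((P.runBlock h A vec id ρ).opsTo (s * P.E + P.b + i)).length]? = some r →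
      σ.arr 3 (id * P.a + i) = if r.out 0 = 1 then 1 else 0

/-- A legitimate run has a complete session of total cost below the fuel. The calls made so far are
a prefix of it, so the next call occurs in the session too and is covered by the remaining fuel
(`Session.next`). The summand 8 per step is for reading the answer. -/
theorem Progress.step (hL : P.Legit D A vec ω id τ₀) (hρ : ρ ≤ P.n) (hs : s < P.a) (he : e < P.E)
    (hp : P.Progress hL.large D A vec ω id ρ τ₀ (s * P.E + e) σ (σ.reg 35))
    (hinp : σ.arr 0 = vec (ρ * P.a + s))
    (hr : ∀ τ, P.Holds D.bound σ (P.zRun id ρ) (P.zBase id) τ →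
      P.StepRep D ω id (P.zRun id ρ) (position P.mode P.a s) e σ σ' τ) :
    P.Progress hL.large D A vec ω id ρ τ₀ (s * P.E + (e + 1)) σ' (σ'.reg 35) ∧
    (P.b ≤ e → e < P.a + P.b → P.Verdict hL.large D A vec ω id ρ τ₀ s (e - P.b) σ') := by
  obtain ⟨τ, u, hT, hH, hF⟩ := hp; obtain ⟨rs, hrs, hsum⟩ := hL.run ρ hρ; have hst := hr τ hH
  have hop := (P.runBlock hL.large A vec id ρ).opAt_phase (s := s) (e := e) hs he
  have hE : (P.runBlock hL.large A vec id ρ).phaseLen = P.E := rfl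
  have hstep : (s + 1) * P.E ≤ P.a * P.E := Nat.mul_le_mul_right _ hs; rw [add_mul, one_mul] at hstep
  rw [hE] at hop
  by_cases ha : P.active (P.blockVec (vec (ρ * P.a + s)) (id / P.g)) e
  · obtain ⟨op, ho, hc⟩ := opOf_active (h := hL.large) (A := A) (D := D) hs he ha; rw [ho] at hop
    obtain ⟨rest, hrest⟩ := (P.runBlock hL.large A vec id ρ).opsTo_append (T := P.a * P.E) (by omega) hop
    have hcalls : P.runCalls hL.large D A vec id ρ (P.a * P.E) =
        P.runCalls hL.large D A vec id ρ (s * P.E + e) ++ D.call op :: rest.map D.call := by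
      simp only [runCalls, hrest, List.map_append, List.map_cons]
    have hrs' := hrs; rw [hcalls] at hrs'; obtain ⟨t, τ', hex, hres, ht⟩ := hrs'.next hT; rw [hc] at hex
    obtain ⟨g1, g2, g3⟩ := hst.call (by rw [hinp]; exact ha) t τ' hex (by omega)
    refine ⟨⟨τ', u + t, ?_, g1, by omega⟩, fun hb hb' rs₂ hrs₂ r hr₂ => ?_⟩
    · have : P.runCalls hL.large D A vec id ρ (s * P.E + (e + 1)) =
          P.runCalls hL.large D A vec id ρ (s * P.E + e) ++ [D.call op] := by
        simp only [runCalls, ← add_assoc, DynSC.Block.opsTo_succ, hop, Option.toList_some, List.map_append,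
          List.map_cons, List.map_nil]
      rw [this]; refine hT.snoc ?_; rw [hc]; exact hex
    · obtain rfl := hrs.det hrs₂
      have hl : (P.runCalls hL.large D A vec id ρ (s * P.E + e)).length =
          ((P.runBlock hL.large A vec id ρ).opsTo (s * P.E + P.b + (e - P.b))).length := by
        rw [runCalls, List.length_map]; congr 2; omega
      rw [← hl, hres] at hr₂; obtain rfl := Option.some.inj hr₂; exact g3 ⟨hb, hb'⟩
  · rw [opOf_idle ha] at hop; obtain ⟨g1, g2, g3⟩ := hst.idle (by rw [hinp]; exact ha)
    refine ⟨⟨τ, u, ?_, g1, by omega⟩, fun hb hb' => ?_⟩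
    · have : P.runCalls hL.large D A vec id ρ (s * P.E + (e + 1)) =
          P.runCalls hL.large D A vec id ρ (s * P.E + e) := by
        simp only [runCalls, ← add_assoc, DynSC.Block.opsTo_succ, hop, Option.toList_none, List.append_nil]
      rw [this]; exact hT
    · exfalso
      apply ha; rw [active, if_neg (by omega), if_pos hb']
      trivial

variable {P : Par}

/-! ### One phase of a machine -/

/-- Prepare phase `r 47` of run `r 46` of machine `r 50`; in the first phase the fuel is restored. -/
def vmHead : Program := decode ;; .arith .plus 31 32 1 ;; .arith .plus 31 31 46 ;; .load 5 35 50 ;;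
    .cond 47 .skip (.cond 35 (.arith .plus 35 14 0) .skip)

def vmBody (D : DataStructure) (N : ℕ) (mode : Mode) : Program :=
  vmHead ;; forLoop 52 16 53 1 (stepBody D N mode) ;; .store 5 50 35

theorem fuel_le_X : P.Fm ≤ P.X := by unfold X Fm; omega

/-- Refilling happens only in the first phase of a run and only if fuel is left. It thus raises the
potential by at most `Frun`, and the summand `B` is never paid twice by the same machine. -/
theorem wp_vmHead {ρ : ℕ}
    (hs : P.Safe A κ σ) (hid : id < P.NV) (h50 : σ.reg 50 = id) (h46 : σ.reg 46 = ρ) (hρ : ρ ≤ P.n)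
    (h47 : σ.reg 47 = s) (hs' : s < P.a) (h48 : σ.reg 48 = k) (hk : k < P.a) :
    wp ω vmHead (fun σ' T' => P.Safe A κ σ' ∧ P.Running id (P.zRun id ρ) k σ' ∧ σ'.arr = σ.arr ∧
      σ'.reg 35 = (if s = 0 ∧ σ.arr 5 id ≠ 0 then P.Frun else σ.arr 5 id) ∧
      T' ≤ T + vmHead.weight * P.L) σ T := by
  have hL := one_le_L (P := P); have hr := hs.regs
  have hX : P.NV + P.n + P.a ≤ P.X := by unfold X; omega
  refine hr.wp [46, 47, 50] [5] (by simp [h46, h47, h50]; omega)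
    (by simpa using fun i => (hs.fuel i).trans fuel_le_X) ?_
  intro hF; obtain ⟨hb, h34, h32⟩ := eval_decode ω hr h50; set σd := decode.eval ω σ with hσd
  have hFd : Framed decode σ σd := Flat.framed (by simp [decode, decodeBlock, Program.Flat]) σ
  have d0 : σd.reg 0 = 0 := (hFd.1 0 (by decide)).trans hr.r0
  have d1 : σd.reg 1 = 1 := (hFd.1 1 (by decide)).trans hr.r1
  have d14 : σd.reg 14 = P.Frun := (hFd.1 14 (by decide)).trans hr.r14
  have d46 : σd.reg 46 = ρ := (hFd.1 46 (by decide)).trans h46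
  have d47 : σd.reg 47 = s := (hFd.1 47 (by decide)).trans h47
  have d48 : σd.reg 48 = k := (hFd.1 48 (by decide)).trans h48
  have d50 : σd.reg 50 = id := (hFd.1 50 (by decide)).trans h50; have da := hFd.arr
  obtain ⟨σ₂, hσ₂⟩ : ∃ σ₂, σ₂ = ((σd.setReg 31 (P.zBase id + 1)).setReg 31
    (P.zBase id + 1 + ρ)).setReg 35 (σ.arr 5 id) := ⟨_, rfl⟩
  have e0 : σ₂.reg 0 = 0 := by simp [hσ₂, d0]
  have e14 : σ₂.reg 14 = P.Frun := by simp [hσ₂, d14]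
  have e47 : σ₂.reg 47 = s := by simp [hσ₂, d47]
  have e35 : σ₂.reg 35 = σ.arr 5 id := by simp [hσ₂]
  have hev : vmHead.eval ω σ = if s = 0 ∧ σ.arr 5 id ≠ 0 then σ₂.setReg 35 P.Frun else σ₂ := by
    simp only [vmHead, Program.eval, ← hσd, BinOp.eval, State.reg_setReg, h32, d1, d46, d47, d50,
      da, State.arr_setReg, d0, d14, Nat.reduceEqDiff, if_true, if_false, add_zero, ← hσ₂, e0, e14, e47, e35]
    by_cases c1 : s = 0
    · by_cases c2 : σ.arr 5 id = 0 <;> simp [c1, c2]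
    · simp [c1]
  have hv : ∀ x, x ≠ 31 → x ≠ 35 → (vmHead.eval ω σ).reg x = σd.reg x := by
    intro x h1 h2; rw [hev]; split_ifs <;> simp [hσ₂, h1, h2]
  have v31 : (vmHead.eval ω σ).reg 31 = P.zRun id ρ := by
    rw [hev]; split_ifs <;> simp [hσ₂, zBase, zRun]
  have v35 : (vmHead.eval ω σ).reg 35 = if s = 0 ∧ σ.arr 5 id ≠ 0 then P.Frun else σ.arr 5 id := by
    rw [hev]; split_ifs <;> simp [hσ₂]
  have va : (vmHead.eval ω σ).arr = σ.arr := by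
    rw [hev]; split_ifs <;> simp [hσ₂, da]
  have hw : ∀ x < 23, x ∉ vmHead.writes := by decide
  refine ⟨hs.of_eq (fun x hx => hF.1 x (hw x hx)) (fun v => by rw [va]),
    ⟨?_, v31, ?_, ?_, ?_, ?_, ?_, hid, zRun_lt hid hρ, hk⟩, va, v35, le_rfl⟩
  · rw [hv 29 (by simp) (by simp), hb.r29]
  · rw [hv 32 (by simp) (by simp), h32]
  · rw [hv 34 (by simp) (by simp), h34]
  · rw [v35]; split_ifs
    · unfold Fm; omega
    · exact hs.fuel id
  · rw [hv 48 (by simp) (by simp), d48]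
  · rw [hv 50 (by simp) (by simp), d50]

def vmCost (D : DataStructure) (mode : Mode) : ℕ := vmHead.weight + stepCost D mode + 40

theorem writes_stepBody (hD : P.D = D.watched) (x : ℕ) (hx : x ∈ (stepBody P.D D.bound P.mode).writes) :
    x = 22 ∨ x = 33 ∨ (35 ≤ x ∧ x ≤ 45) ∨ x = 49 ∨ 54 ≤ x := by
  have h1 : (stepLoad P.mode).writes ⊆ {22, 33, 45, 54, 55, 56, 57, 58, 59, 60, 61} := by
    cases P.mode <;> decide
  have h2 : (answer D.bound).writes ⊆ {35, 36, 37, 39, 40, 41, 42, 43, 44, 49} := by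
    intro x hx; simp [answer, testReg, basic, Program.writes, vload, sizeLoop] at hx ⊢; omega
  simp only [stepBody, Program.writes, Finset.mem_union, (by decide : record.writes = {61})] at hx
  rcases hx with hx | (((hx | hx | hx) | hx) | hx)
  · have := h1 hx; simp at this; omega
  · have := writes_simulate _ _ hx; omega
  · have := h2 hx; simp at this; omega
  · simp at hx; omega
  · have := writes_simulate _ _ hx; omega
  · simp at hx

theorem Progress.of_eq {h : 2 * P.a + P.b + 1 ≤ P.nG} {ρ S F : ℕ} {τ₀ : State}
    (hp : P.Progress h D A vec ω id ρ τ₀ S σ F) (hid : id < P.NV) (hρ : ρ ≤ P.n)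
    (he : ∀ v, 10 ≤ v → v ≠ 11 → ∀ i y, y < P.S → y / (P.n + 2) = id →
      σ'.arr v (i * P.S + y) = σ.arr v (i * P.S + y)) : P.Progress h D A vec ω id ρ τ₀ S σ' F := by
  obtain ⟨τ, u, h1, h2, h3⟩ := hp
  refine ⟨τ, u, h1, h2.of_eq (zRun_lt hid hρ) (zBase_lt hid) fun v hv hv' i y hy hyz => ?_, h3⟩
  refine he v hv hv' i y hy ?_; rcases hyz with rfl | rfl
  · exact zRun_div id hρ
  · exact zBase_div id

/-- What a phase does to a machine that is known to work well. -/
structure PhaseRep (P : Par) (D : DataStructure) (A : ℕ → ℕ) (vec : ℕ → ℕ → ℕ) (ω : ℕ → Bool)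
    (id ρ s : ℕ) (σ σ' : State) : Prop where
  rep : ∀ τ₀ (hL : P.Legit D A vec ω id τ₀), P.Holds D.bound σ (P.zBase id) (P.zBase id) τ₀ →
    (s = 0 → (∀ v, 10 ≤ v → v ≠ 11 → ∀ i, σ.arr v (i * P.S + P.zRun id ρ) = 0) ∧ σ.arr 5 id ≠ 0) →
    (s ≠ 0 → P.Progress hL.large D A vec ω id ρ τ₀ (s * P.E) σ (σ.arr 5 id)) →
    P.Progress hL.large D A vec ω id ρ τ₀ ((s + 1) * P.E) σ' (σ'.arr 5 id) ∧
      ∀ i < P.a, P.Verdict hL.large D A vec ω id ρ τ₀ s i σ'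

theorem wp_vmBody (hD : P.D = D.watched) {ρ : ℕ}
    (hs : P.Safe A κ σ) (hid : id < P.NV) (h50 : σ.reg 50 = id) (h46 : σ.reg 46 = ρ) (hρ : ρ ≤ P.n)
    (h47 : σ.reg 47 = s) (hs' : s < P.a) (h48 : σ.reg 48 = position P.mode P.a s)
    (hvec : σ.arr 0 = vec (ρ * P.a + s)) (hinp : ∀ i, σ.arr 0 i ≤ 1) (hκ : κ + P.E ≤ P.S)
    (hκ₀ : κ ≠ 0) :
    wp ω (vmBody P.D D.bound P.mode) (fun σ' T' => P.Safe A (κ + P.E) σ' ∧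
      P.Local (P.zRun id ρ) σ σ' ∧ (∀ b < 10, b ≠ 3 → b ≠ 5 → σ'.arr b = σ.arr b) ∧
      (∀ j, j ≠ id → σ'.arr 5 j = σ.arr 5 j) ∧
      (∀ j, ¬ (id * P.a ≤ j ∧ j < (id + 1) * P.a) → σ'.arr 3 j = σ.arr 3 j) ∧
      T' + rate P.D * P.L * potential P.B (σ'.arr 5 id) ≤
        T + rate P.D * P.L * potential P.B (σ.arr 5 id) +
          (if s = 0 then rate P.D * P.L * P.Frun else 0) + vmCost P.D P.mode * P.L * (P.E + 1) ∧
      P.PhaseRep D A vec ω id ρ s σ σ') σ T := by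
  have hL := one_le_L (P := P); have hk := DynSC.Block.position_lt (mode := P.mode) hs'
  have hzl := zRun_lt hid hρ; have hEX : P.E ≤ P.X := by unfold X; omega
  have zE : P.E.size + 1 ≤ P.L := by have := size_le_L hEX; omega
  refine wp_seq (wp_mono (wp_vmHead hs hid h50 h46 hρ h47 hs' h48 hk) ?_)
  rintro σ₁ T₁ hF₁ ⟨s₁, R₁, a₁, f₁, t₁⟩
  have hpot : potential P.B (σ₁.reg 35) ≤ potential P.B (σ.arr 5 id) + if s = 0 then P.Frun else 0 := by
    rw [f₁]; unfold potential
    by_cases c1 : s = 0 <;> by_cases c2 : σ.arr 5 id = 0 <;> simp [c1, c2] <;> split_ifs <;> omega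
  have hw : ∀ x, x ∈ (stepBody P.D D.bound P.mode).writes → _ := writes_stepBody hD
  refine wp_seq (wp_for_cost P.E (stepCost P.D P.mode * P.L)
    (fun k σ' => P.Stepped A (κ + k) id (P.zRun id ρ) (position P.mode P.a s) σ₁ σ' ∧
      (∀ j, ¬ (id * P.a ≤ j ∧ j < (id + 1) * P.a) → σ'.arr 3 j = σ₁.arr 3 j) ∧
      ∀ τ₀ (hL : P.Legit D A vec ω id τ₀), P.Holds D.bound σ (P.zBase id) (P.zBase id) τ₀ →
        (s = 0 → (∀ v, 10 ≤ v → v ≠ 11 → ∀ i, σ.arr v (i * P.S + P.zRun id ρ) = 0) ∧ σ.arr 5 id ≠ 0) →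
        (s ≠ 0 → P.Progress hL.large D A vec ω id ρ τ₀ (s * P.E) σ (σ.arr 5 id)) →
        P.Progress hL.large D A vec ω id ρ τ₀ (s * P.E + k) σ' (σ'.reg 35) ∧
          ∀ i < P.a, P.b + i < k → P.Verdict hL.large D A vec ω id ρ τ₀ s i σ')
    (fun σ' => rate P.D * P.L * potential P.B (σ'.reg 35))
    (fun h => by have := hw _ h; omega) (fun h => by have := hw _ h; omega)
    (fun h => by have := hw _ h; omega) (by simp) s₁.regs.r16 s₁.regs.r1 ?_ ?_ ?_ ?_ ?_)
  · rintro k σ' x y ⟨⟨h1, h2, h3, h4⟩, h5, h6⟩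
    refine ⟨⟨h1.of_eq (fun z hz => ?_) fun _ => rfl, h2.of_eq (fun z hz => ?_) ?_, h3, h4⟩, h5,
      fun τ₀ hL a1 a2 a3 => ?_⟩
    · rw [State.reg_setReg, if_neg (by omega), State.reg_setReg, if_neg (by omega)]
    · simp at hz; rw [State.reg_setReg, if_neg (by omega), State.reg_setReg, if_neg (by omega)]
    · simpa using h2.fuel
    · obtain ⟨g1, g2⟩ := h6 τ₀ hL a1 a2 a3; refine ⟨?_, g2⟩
      have := g1.of_eq (σ' := (σ'.setReg 52 x).setReg 53 y) hid hρ fun _ _ _ _ _ _ _ => rfl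
      simpa using this
  · intro σ' x y; simp
  · refine ⟨⟨s₁, R₁, Local.of_eq fun _ _ _ => rfl, fun _ _ _ => rfl⟩, fun _ _ => rfl,
      fun τ₀ hL a1 a2 a3 => ⟨?_, fun i _ h => by omega⟩⟩
    rw [add_zero, f₁]
    by_cases c1 : s = 0
    -- A new run works in a layer that is still empty, so every read falls through to the base
    -- layer: the state after preprocessing is restored at no cost.
    · obtain ⟨b1, b2⟩ := a2 c1; rw [if_pos ⟨c1, b2⟩, c1, zero_mul]; obtain ⟨τ', w1, w2⟩ := a1
      refine ⟨τ₀, 0, ⟨rfl, rfl⟩, ⟨τ', w1, ⟨fun x => ?_, fun b hb i => ?_⟩⟩, by omega⟩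
      · rw [w2.reg, cell, cell, a₁, b1 _ (by omega) (by omega), if_pos rfl]; split_ifs <;> rfl
      · rw [w2.arr b hb, cell, cell, a₁, b1 _ (by omega) (by omega), if_pos rfl]; split_ifs <;> rfl
    · rw [if_neg (fun h => c1 h.1)]; exact (a3 c1).of_eq hid hρ fun v _ _ i y _ _ => by rw [a₁]
  · rintro k hk' σ₂ T₂ ⟨⟨s₂, R₂, l₂, e₂⟩, o₂, r₂⟩ hF₂ h52
    have hinp₂ : σ₂.arr 0 = σ.arr 0 := by rw [e₂ 0 (by simp) (by simp), a₁]
    refine wp_mono (wp_stepBody hD s₂ R₂ h52 hk' (by rw [hinp₂]; exact hinp) (by omega) (by omega)) ?_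
    rintro σ₃ T₃ - ⟨⟨s₃, R₃, l₃, e₃⟩, o₃, t₃, r₃⟩
    refine ⟨⟨⟨s₃, R₃, l₂.trans l₃, fun v hv hv3 => by rw [e₃ v hv hv3, e₂ v hv hv3]⟩, fun j hj => ?_,
      fun τ₀ hL a1 a2 a3 => ?_⟩, t₃⟩
    · rw [o₃ j fun hc => hj ?_, o₂ j hj]; rw [add_mul]; omega
    · obtain ⟨g1, g2⟩ := r₂ τ₀ hL a1 a2 a3
      obtain ⟨g3, g4⟩ := g1.step hL hρ hs' hk' (by rw [hinp₂, hvec]) r₃; refine ⟨g3, fun i hi hik => ?_⟩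
      by_cases hlast : P.b + i = k
      · have := g4 (by omega) (by omega)
        rwa [show k - P.b = i by omega] at this
      · intro rs hrs r hr; rw [o₃ _ fun hc => hlast (by omega)]; exact g2 i hi (by omega) rs hrs r hr
  · rintro σ₂ T₂ ⟨⟨s₂, R₂, l₂, e₂⟩, o₂, r₂⟩ hF₂ t₂
    refine RAM.wp_store ⟨⟨s₂.regs.of_eq fun x _ => rfl, s₂.ctr, ?_, s₂.bit, ?_, ?_, ?_, ?_, ?_⟩, ?_,
      fun b hb hb3 hb5 => ?_, fun j hj => ?_, fun j hj => ?_, ?_, ⟨fun τ₀ hL a1 a2 a3 => ?_⟩⟩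
    · rw [State.arr_setArr, if_neg (by simp), s₂.mat]
    · intro i; rw [State.arr_setArr_apply]; split_ifs
      · exact R₂.fuel
      · exact s₂.fuel i
    · rw [State.arr_setArr, if_neg (by simp)]; exact s₂.dead
    · rw [State.arr_setArr, if_neg (by simp)]; exact s₂.ans
    · intro v hv; rw [State.arr_setArr, if_neg (by omega)]; exact s₂.cells v hv
    · rw [State.arr_setArr, if_neg (by simp)]; exact s₂.fresh
    · refine Local.trans (Local.of_eq fun v _ _ => by rw [a₁]) (l₂.trans (Local.of_eq fun v hv _ => ?_))
      rw [State.arr_setArr, if_neg (by omega)]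
    · rw [State.arr_setArr, if_neg hb5, e₂ b hb hb3, a₁]
    · rw [State.arr_setArr_apply, if_neg (by rw [R₂.r50]; omega), e₂ 5 (by simp) (by simp), a₁]
    · rw [State.arr_setArr, if_neg (by simp), o₂ j hj, a₁]
    · rw [State.arr_setArr_apply, if_pos ⟨rfl, R₂.r50.symm⟩]
      have z1 : (σ₂.reg 35).size ≤ P.L := size_le (R₂.fuel.trans fuel_le_X)
      have z2 : (σ₂.reg 50).size ≤ P.L := by
        rw [R₂.r50]; exact size_le (by unfold X; omega)
      have m1 : P.E * (stepCost P.D P.mode * P.L + 10 * (P.E.size + 1)) ≤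
        P.E * (stepCost P.D P.mode * P.L + 10 * P.L) := Nat.mul_le_mul_left _ (by omega)
      have m2 := Nat.mul_le_mul_left (rate P.D * P.L) hpot
      have m3 : rate P.D * P.L * (potential P.B (σ.arr 5 id) + if s = 0 then P.Frun else 0) =
        rate P.D * P.L * potential P.B (σ.arr 5 id) + (if s = 0 then rate P.D * P.L * P.Frun else 0) := by
        split_ifs <;> ring
      have e : vmCost P.D P.mode * P.L * (P.E + 1) = P.E * (stepCost P.D P.mode * P.L + 10 * P.L) +
        vmHead.weight * P.L + 40 * P.L + (vmHead.weight * P.L * P.E + stepCost P.D P.mode * P.L +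
          30 * (P.L * P.E)) := by unfold vmCost; ring
      omega
    · obtain ⟨g1, g2⟩ := r₂ τ₀ hL a1 a2 a3; refine ⟨?_, fun i hi rs hrs r hr => ?_⟩
      · rw [State.arr_setArr_apply, if_pos ⟨rfl, R₂.r50.symm⟩, add_mul, one_mul]
        exact g1.of_eq hid hρ fun v hv _ i y _ _ => by rw [State.arr_setArr, if_neg (by omega)]
      · rw [State.arr_setArr, if_neg (by simp)]
        exact g2 i hi (by unfold E; have := P.hb; omega) rs hrs r hr

end Par
end DynSC

namespace RAM

theorem Trace.time : ∀ {l : List (Program × (ℕ → ℕ))} {σ σ' : State} {u : ℕ}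
    {rs : List Result}, Trace ω σ l σ' u → Session ω σ l rs → u = (rs.map Result.time).sum
  | [], _, _, _, _, h, .nil _ => by simpa using h.2
  | _ :: _, _, _, _, _, ⟨t₁, σ₁, u₁, he, ht, hu⟩, .cons he' hs => by
    obtain ⟨rfl, rfl⟩ := he.det he'; simp [Trace.time ht hs, hu]

end RAM
namespace DynSC
open RAM
namespace Par
variable {P : Par}

/-! ### One phase of all machines -/

/-- The memory of machine `id` before multiplication number `t`. -/
def Ready (P : Par) (D : DataStructure) (A : ℕ → ℕ) (vec : ℕ → ℕ → ℕ) (ω : ℕ → Bool) (t : ℕ) (σ : State)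
    (id : ℕ) : Prop :=
  (∀ ρ ≤ P.n, t ≤ ρ * P.a → ∀ v, 10 ≤ v → v ≠ 11 → ∀ i, σ.arr v (i * P.S + P.zRun id ρ) = 0) ∧
  ∀ τ₀ (hL : P.Legit D A vec ω id τ₀), P.Holds D.bound σ (P.zBase id) (P.zBase id) τ₀ ∧
    (t % P.a = 0 → σ.arr 5 id ≠ 0) ∧
    (t % P.a ≠ 0 → P.Progress hL.large D A vec ω id (t / P.a) τ₀ (t % P.a * P.E) σ (σ.arr 5 id))

/-- The answers of machine `id` in multiplication number `t` are those of the data structure. -/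
def Voted (P : Par) (D : DataStructure) (A : ℕ → ℕ) (vec : ℕ → ℕ → ℕ) (ω : ℕ → Bool) (t : ℕ) (σ : State)
    (id : ℕ) : Prop :=
  ∀ τ₀ (hL : P.Legit D A vec ω id τ₀), ∀ i < P.a,
    P.Verdict hL.large D A vec ω id (t / P.a) τ₀ (t % P.a) i σ

variable {D : DataStructure} {A : ℕ → ℕ} {vec : ℕ → ℕ → ℕ} {ω : ℕ → Bool}

theorem Ready.of_eq (h : P.Ready D A vec ω t σ id) (hid : id < P.NV)
    (ht : t ≤ P.n) (he : ∀ v, 10 ≤ v → v ≠ 11 → ∀ i y, y < P.S → y / (P.n + 2) = id →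
      σ'.arr v (i * P.S + y) = σ.arr v (i * P.S + y)) (h5 : σ'.arr 5 id = σ.arr 5 id) :
    P.Ready D A vec ω t σ' id := by
  have hρ : t / P.a ≤ P.n := (Nat.div_le_self _ _).trans ht
  refine ⟨fun ρ hρ ht v hv hv' i => ?_, fun τ₀ hL => ?_⟩
  · rw [he v hv hv' i _ (zRun_lt hid hρ) (zRun_div id hρ), h.1 ρ hρ ht v hv hv']
  · obtain ⟨h1, h2, h3⟩ := h.2 τ₀ hL; rw [h5]
    refine ⟨h1.of_eq (zBase_lt hid) (zBase_lt hid) fun v hv hv' i y hy hyz => ?_, h2,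
      fun h0 => (h3 h0).of_eq hid hρ he⟩
    refine he v hv hv' i y hy ?_; rcases hyz with rfl | rfl <;> exact zBase_div id

theorem succ_mod_div {a : ℕ} (ha : 1 ≤ a) : (t % a + 1 < a ∧ (t + 1) % a = t % a + 1 ∧
    (t + 1) / a = t / a) ∨ (t % a + 1 = a ∧ (t + 1) % a = 0) := by
  have h1 := Nat.mod_lt t ha; have h2 := Nat.div_add_mod t a
  by_cases h : t % a + 1 < a
  · refine Or.inl ⟨h, ?_, ?_⟩
    · conv_lhs => rw [← h2, add_assoc, Nat.mul_add_mod, Nat.mod_eq_of_lt h]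
    · conv_lhs => rw [← h2, add_assoc, Nat.mul_add_div ha, Nat.div_eq_of_lt h, add_zero]
  · refine Or.inr ⟨by omega, ?_⟩
    conv_lhs => rw [← h2, add_assoc, Nat.mul_add_mod, show t % a + 1 = a by omega, Nat.mod_self]

/-- Within a run the progress is carried on. At its end the base layer is unchanged and the layers
of later runs are still empty, so the next run can start. -/
theorem Ready.step (h : P.Ready D A vec ω t σ id) (hid : id < P.NV)
    (ht : t < P.n) (hl : P.Local (P.zRun id (t / P.a)) σ σ')
    (hr : P.PhaseRep D A vec ω id (t / P.a) (t % P.a) σ σ') :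
    P.Ready D A vec ω (t + 1) σ' id ∧ P.Voted D A vec ω t σ' id := by
  have hρ : t / P.a ≤ P.n := (Nat.div_le_self _ _).trans ht.le; have hm := Nat.div_mul_le_self t P.a
  have key := fun τ₀ hL => hr.rep τ₀ hL (h.2 τ₀ hL).1
    (fun h0 => ⟨h.1 _ hρ (by have := Nat.div_add_mod t P.a; rw [mul_comm] at this; omega),
      (h.2 τ₀ hL).2.1 h0⟩) (h.2 τ₀ hL).2.2
  refine ⟨⟨fun ρ hρ' ht' v hv hv' i => ?_, fun τ₀ hL => ?_⟩, fun τ₀ hL => (key τ₀ hL).2⟩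
  · rw [hl v hv hv' i _ (zRun_lt hid hρ'), h.1 ρ hρ' (by omega) v hv hv']; intro e
    have : ρ = t / P.a := by unfold zRun at e; omega
    subst this; omega
  · obtain ⟨h1, -, -⟩ := h.2 τ₀ hL; obtain ⟨g, -⟩ := key τ₀ hL
    refine ⟨h1.of_eq (zBase_lt hid) (zBase_lt hid) fun v hv hv' i y hy hyz => ?_, fun h0 => ?_,
      fun h0 => ?_⟩
    · refine hl v hv hv' i y hy ?_; rintro rfl
      have : P.zBase id < P.zRun id (t / P.a) := Nat.le_add_right (_ + 1) _; omega
    · rcases succ_mod_div (t := t) P.ha with ⟨_, e, _⟩ | ⟨e, _⟩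
      · omega
      -- The run is complete, its cost is that of the whole session and stays below `Frun`. So fuel
      -- is left, which permits refilling.
      · rw [e] at g; obtain ⟨τ, u, hT, -, hF⟩ := g; obtain ⟨rs, hrs, hsum⟩ := hL.run _ hρ
        have := hT.time hrs; omega
    · rcases succ_mod_div (t := t) P.ha with ⟨_, e1, e2⟩ | ⟨_, e⟩
      · rw [e1, e2]; exact g
      · exact absurd e h0

def vmLoop (D : DataStructure) (N : ℕ) (mode : Mode) : Program := forLoop 50 9 51 1 (vmBody D N mode)

theorem writes_vmBody (hD : P.D = D.watched) (x : ℕ) (hx : x ∈ (vmBody P.D D.bound P.mode).writes) :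
    22 ≤ x ∧ x ≠ 46 ∧ x ≠ 47 ∧ x ≠ 48 ∧ x ≠ 50 ∧ x ≠ 51 := by
  have h1 : vmHead.writes ⊆ {23, 24, 25, 26, 27, 28, 29, 31, 32, 34, 35} := by decide
  simp only [vmBody, forLoop, Program.writes, Finset.mem_union, Finset.mem_singleton] at hx
  rcases hx with hx | (hx | hx | hx | hx | hx) | hx
  · have := h1 hx; simp only [Finset.mem_insert, Finset.mem_singleton] at this; omega
  · omega
  · omega
  · have := writes_stepBody hD _ hx; omega
  · omega
  · omega
  · simp at hx

/-- The fuel of all machines. -/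
def totalPot (P : Par) (σ : State) : ℕ :=
  rate P.D * P.L * ∑ id ∈ Finset.range P.NV, potential P.B (σ.arr 5 id)

def vmLoopCost (P : Par) (s : ℕ) : ℕ := (P.NV + 1) * ((if s = 0 then rate P.D * P.L * P.Frun else 0) +
    vmCost P.D P.mode * P.L * (P.E + 1) + 10 * P.L)

theorem totalPot_change (hid : id < P.NV) (h : ∀ j, j ≠ id → σ'.arr 5 j = σ.arr 5 j) : P.totalPot σ' +
      rate P.D * P.L * potential P.B (σ.arr 5 id) = P.totalPot σ +
        rate P.D * P.L * potential P.B (σ'.arr 5 id) := by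
  have hm := Finset.mem_range.2 hid; unfold totalPot
  rw [← Finset.add_sum_erase _ _ hm, ← Finset.add_sum_erase _ (fun i => potential P.B (σ.arr 5 i)) hm,
    Finset.sum_congr rfl fun j hj => by rw [h j (Finset.ne_of_mem_erase hj)]]
  ring

/-- Machines do not disturb one another: they own disjoint layers, fuel cells and segments of the
table of answers. The sum of their potentials pays for the simulation, with a new charge for `Frun`
only at the beginning of a run. -/
theorem wp_vmLoop (hD : P.D = D.watched) (hs : P.Safe A κ σ)
    (h46 : σ.reg 46 = t / P.a) (h47 : σ.reg 47 = t % P.a)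
    (h48 : σ.reg 48 = position P.mode P.a (t % P.a)) (ht : t < P.n) (hvec : σ.arr 0 = vec t)
    (hinp : ∀ i, σ.arr 0 i ≤ 1) (hκ : κ + P.NV * P.E ≤ P.S) (hκ₀ : κ ≠ 0)
    (hr : ∀ id < P.NV, P.Ready D A vec ω t σ id) :
    wp ω (vmLoop P.D D.bound P.mode) (fun σ' T' => P.Safe A (κ + P.NV * P.E) σ' ∧
      (∀ b < 10, b ≠ 3 → b ≠ 5 → σ'.arr b = σ.arr b) ∧ σ'.reg 21 = σ.reg 21 ∧
      (∀ id < P.NV, P.Ready D A vec ω (t + 1) σ' id ∧ P.Voted D A vec ω t σ' id) ∧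
      T' + P.totalPot σ' ≤ T + P.totalPot σ + P.vmLoopCost (t % P.a)) σ T := by
  have hw := writes_vmBody (P := P) hD; have hρ : t / P.a ≤ P.n := (Nat.div_le_self _ _).trans ht.le
  have hmod := Nat.mod_lt t P.ha
  refine wp_for_cost P.NV ((if t % P.a = 0 then rate P.D * P.L * P.Frun else 0) +
      vmCost P.D P.mode * P.L * (P.E + 1))
    (fun k σ' => P.Safe A (κ + k * P.E) σ' ∧ (∀ b < 10, b ≠ 3 → b ≠ 5 → σ'.arr b = σ.arr b) ∧
      (∀ id < P.NV, id < k → P.Ready D A vec ω (t + 1) σ' id ∧ P.Voted D A vec ω t σ' id) ∧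
      ∀ id < P.NV, k ≤ id → P.Ready D A vec ω t σ' id) P.totalPot
    (fun h => by have := hw _ h; omega) (fun h => by have := hw _ h; omega)
    (fun h => by have := hw _ h; omega) (by norm_num) hs.regs.r9 hs.regs.r1 ?_
    (fun _ _ _ => rfl) ⟨by simpa using hs, fun _ _ _ _ => rfl, fun _ _ h => absurd h (Nat.not_lt_zero _),
      fun id hid _ => hr id hid⟩ ?_ ?_
  · rintro k σ' x y ⟨h1, h2, h3, h4⟩
    have key : ∀ {t' id}, id < P.NV → t' ≤ P.n → P.Ready D A vec ω t' σ' id →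
        P.Ready D A vec ω t' ((σ'.setReg 50 x).setReg 51 y) id := fun hid ht h =>
      h.of_eq hid ht (fun _ _ _ _ _ _ _ => rfl) rfl
    refine ⟨h1.of_eq (fun z hz => ?_) fun _ => rfl, h2, fun id hid hk =>
      ⟨key hid ht (h3 id hid hk).1, (h3 id hid hk).2⟩, fun id hid hk => key hid ht.le (h4 id hid hk)⟩
    rw [State.reg_setReg, if_neg (by omega), State.reg_setReg, if_neg (by omega)]
  · rintro k hk σ₁ T₁ ⟨h1, h2, h3, h4⟩ hF h50
    have hfr : ∀ x, x = 46 ∨ x = 47 ∨ x = 48 → σ₁.reg x = σ.reg x := by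
      intro x hx; refine hF.1 x fun h => ?_
      simp only [forLoop, Program.writes, Finset.mem_union, Finset.mem_singleton] at h
      rcases h with h | h | h | h | h
      · omega
      · omega
      · have := hw _ h; omega
      · omega
      · omega
    have hkE : (k + 1) * P.E ≤ P.NV * P.E := Nat.mul_le_mul_right _ hk; rw [add_mul, one_mul] at hkE
    have a0 := h2 0 (by norm_num) (by norm_num) (by norm_num)
    refine wp_mono (wp_vmBody hD (vec := vec) (ρ := t / P.a) (s := t % P.a) h1 hk h50
      (by rw [hfr 46 (by simp), h46]) hρ (by rw [hfr 47 (by simp), h47]) hmod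
      (by rw [hfr 48 (by simp), h48])
      (by rw [a0, hvec, show t / P.a * P.a + t % P.a = t from Nat.div_add_mod' t P.a])
      (by rw [a0]; exact hinp) (by omega) (by omega)) ?_
    rintro σ₂ T₂ - ⟨s₂, l₂, b₂, f₂, v₂, t₂, r₂⟩
    have hother : ∀ id, id ≠ k → ∀ v, 10 ≤ v → v ≠ 11 → ∀ i y, y < P.S → y / (P.n + 2) = id →
        σ₂.arr v (i * P.S + y) = σ₁.arr v (i * P.S + y) := by
      intro id hid v hv hv' i y hy hyd; refine l₂ v hv hv' i y hy ?_; rintro rfl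
      rw [zRun_div k hρ] at hyd; exact hid hyd.symm
    refine ⟨⟨by rw [add_mul, one_mul, ← add_assoc]; exact s₂, fun b hb hb3 hb5 => by rw [b₂ b hb hb3 hb5, h2 b hb hb3 hb5],
      fun id hN hid => ?_, fun id hid hk' => ?_⟩, ?_⟩
    · by_cases hik : id = k
      · subst hik; exact (h4 id hk le_rfl).step hk ht l₂ r₂
      · obtain ⟨g1, g2⟩ := h3 id hN (by omega)
        refine ⟨g1.of_eq (by omega) ht (hother id hik) (f₂ id hik), fun τ₀ hL i hi rs hrs r hr => ?_⟩
        · rw [v₂ _ ?_]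
          · exact g2 τ₀ hL i hi rs hrs r hr
          · have : (id + 1) * P.a ≤ k * P.a := Nat.mul_le_mul_right _ (by omega); rw [add_mul] at this
            omega
    · exact (h4 id hid (by omega)).of_eq hid ht.le (hother id (by omega)) (f₂ id (by omega))
    · have := totalPot_change (P := P) hk f₂; omega
  · rintro σ' T' ⟨h1, h2, h3, h4⟩ hF hT
    have hz : P.NV.size + 1 ≤ P.L := by
      have := size_le_L (P := P) (x := P.NV) (by unfold X; omega); omega
    refine ⟨h1, h2, hF.1 21 (fun h => ?_), fun id hid => h3 id hid hid, hT.trans ?_⟩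
    · simp only [forLoop, Program.writes, Finset.mem_union, Finset.mem_singleton] at h
      rcases h with h | h | h | h | h
      · omega
      · omega
      · have := hw _ h; omega
      · omega
      · omega
    · have m1 : P.NV * (((if t % P.a = 0 then rate P.D * P.L * P.Frun else 0) +
          vmCost P.D P.mode * P.L * (P.E + 1)) + 10 * (P.NV.size + 1)) ≤ P.NV * (((if t % P.a = 0 then
          rate P.D * P.L * P.Frun else 0) + vmCost P.D P.mode * P.L * (P.E + 1)) + 10 * P.L) :=
        Nat.mul_le_mul_left _ (by omega)
      unfold vmLoopCost; rw [add_mul, one_mul]; omega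

variable {P : Par}

/-! ### Claims and their verification -/

/-- Query `r 50`: its block, its row in the block (`54`) and in the matrix (`55`). -/
def claimHead : Program :=
  .arith .quot 23 50 4 ;; decodeBlock ;; .arith .times 54 23 4 ;; .arith .minus 54 50 54 ;;
    .arith .plus 55 28 54 ;; .arith .times 56 23 3 ;; .const 57 0

/-- Add the vote of copy `r 52` to register `57`. -/
def voteBody : Program :=
  .arith .plus 58 56 52 ;; .arith .times 58 58 4 ;; .arith .plus 58 58 54 ;; .load 3 58 58 ;;
    .arith .plus 57 57 58

/-- `r 59 := 1` if the votes have to be verified, otherwise `r 59 := 0` -/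
def claimTest : Program :=
  .const 59 0 ;; .arith .plus 57 57 57 ;; .load 4 60 24 ;; ifLt 3 57 (.const 59 1) .skip ;;
    .cond 60 (.const 59 0) .skip ;; .cond 15 (.const 59 1) .skip ;; .load 1 61 55 ;;
    .cond 61 (.const 59 0) .skip

def scanHead : Program := .const 57 0 ;; .arith .times 60 55 8 ;; .arith .plus 60 60 29

/-- Add the product of the entries number `r 52` of the block row and of the vector to register
`57`. -/
def scanBody : Program :=
  .arith .plus 58 29 52 ;; .load 0 58 58 ;; .arith .plus 61 60 52 ;; .load 2 61 61 ;;
    .arith .times 58 58 61 ;; .arith .plus 57 57 58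

def scan : Program := scanHead ;; forLoop 52 5 53 1 scanBody ;; .cond 57 (.store 1 55 1) (.store 4 24 1)

def claimBody : Program := claimHead ;; forLoop 52 3 53 1 voteBody ;; claimTest ;; .cond 59 scan .skip

/-- The row of the matrix that query `q` is about. -/
def line (P : Par) (q : ℕ) : ℕ := P.row (q / P.a) * P.a + q % P.a

def votes (P : Par) (σ : State) (q : ℕ) : ℕ :=
  ∑ c ∈ Finset.range P.g, σ.arr 3 ((q / P.a * P.g + c) * P.a + q % P.a)

def Hit (P : Par) (A inp : ℕ → ℕ) (q : ℕ) : Prop :=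
  ∃ c < P.b, P.blockMat A (q / P.a) (q % P.a) c = true ∧ P.blockVec inp (q / P.a) c = true

/-- The answer to query `q` has to be verified. -/
def Claimed (P : Par) (σ : State) (q : ℕ) : Prop := σ.arr 1 (P.line q) = 0 ∧
    (P.force ≠ 0 ∨ σ.arr 4 (P.guess (q / P.a)) = 0 ∧ P.g < 2 * P.votes σ q)

def scanCost : ℕ := scanHead.weight + 3 * scanBody.weight + 40
def claimCost : ℕ := claimHead.weight + 3 * voteBody.weight + claimTest.weight + 40

open Classical in
/-- The effect of a verification. -/
noncomputable def verdict (P : Par) (A : ℕ → ℕ) (σ : State) (q : ℕ) : State := if P.Claimed σ q then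
    if P.Hit A (σ.arr 0) q then σ.setArr 1 (P.line q) 1 else σ.setArr 4 (P.guess (q / P.a)) 1
  else σ

theorem line_lt : P.line q < P.n + P.a := Nat.add_lt_add_of_le_of_lt (row_mul_le _) (Nat.mod_lt _ P.ha)

theorem query_lt (hq : q < P.NQ) : q / P.a < P.NB := Nat.div_lt_of_lt_mul (by rw [mul_comm]; exact hq)

theorem guess_lt {β : ℕ} (hβ : β < P.NB) : P.guess β < P.g ^ 3 :=
  Nat.div_lt_of_lt_mul (by rw [mul_comm]; exact hβ)

theorem wp_scan (hs : P.Safe A κ σ)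
    (hq : q < P.NQ) (h24 : σ.reg 24 = P.guess (q / P.a)) (h29 : σ.reg 29 = P.col (q / P.a) * P.b)
    (h55 : σ.reg 55 = P.line q) (ha : P.a ≤ P.n) (hinp : ∀ i, σ.arr 0 i ≤ 1) :
    wp ω scan (fun σ' T' => (σ'.arr = (open Classical in if P.Hit A (σ.arr 0) q then
        σ.setArr 1 (P.line q) 1 else σ.setArr 4 (P.guess (q / P.a)) 1).arr) ∧
      T' ≤ T + scanCost * P.L * (P.b + 1)) σ T := by
  have hL := one_le_L (P := P); have hr := hs.regs; have hline := line_lt (P := P) (q := q)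
  have hcol := col_mul_le (P := P) (q / P.a)
  have hg : P.guess (q / P.a) ≤ P.NB := (Nat.div_le_self _ _).trans (query_lt hq).le
  have hW : P.line q ≤ P.W := by unfold W; omega
  have zb : P.b.size + 1 ≤ P.L := by
    have := size_le_L (P := P) (x := P.b) (by unfold X; omega); omega
  refine wp_seq (hr.wp [29, 55] [] (by simp [h29, h55, X]; omega) (by simp) fun hF => ?_)
  set σ₁ := scanHead.eval ω σ with hσ₁
  have e60 : σ₁.reg 60 = P.line q * P.W + P.col (q / P.a) * P.b := by
    simp [hσ₁, scanHead, Program.eval, BinOp.eval, h55, h29, hr.r8]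
  have e57 : σ₁.reg 57 = 0 := by simp [hσ₁, scanHead, Program.eval]
  have fr : ∀ x < 57, σ₁.reg x = σ.reg x := fun x hx =>
    hF.1 x ((by decide : ∀ x < 57, x ∉ scanHead.writes) x hx)
  -- Addresses in the stored matrix are products, whose sizes are at most `3 * L`; the loop below is
  -- measured in this unit.
  have z60 : (P.line q * P.W + P.col (q / P.a) * P.b).size ≤ 3 * P.L := by
    have h1 := size_mul_le (P.line q) P.W
    have h2 := size_add_le (P.line q * P.W) (P.col (q / P.a) * P.b)
    have h3 : (P.line q).size ≤ P.L := size_le (by unfold X; omega)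
    have h4 : P.W.size ≤ P.L := size_le (by unfold X; omega)
    have h5 : (P.col (q / P.a) * P.b).size ≤ P.L := size_le (by unfold X; omega); omega
  refine wp_seq (wp_for_const P.b (scanBody.weight * (3 * P.L)) (fun k σ' => σ'.reg 57 ≤ k ∧
    (σ'.reg 57 ≠ 0 ↔ ∃ c < k, P.blockMat A (q / P.a) (q % P.a) c = true ∧
      P.blockVec (σ.arr 0) (q / P.a) c = true)) ((fr 5 (by simp)).trans hr.r5)
    ((fr 1 (by simp)).trans hr.r1) ?_ ?_ ?_ ?_)
  · rintro k σ' x y h; simpa using h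
  · rw [e57]; simp
  · rintro k hk σ₂ T₂ ⟨h1, h2⟩ hF₂ h52; have ar₂ := hF₂.arr.trans hF.arr
    have e60' := (hF₂.1 60 (by decide)).trans e60
    have e29' := (hF₂.1 29 (by decide)).trans ((fr 29 (by simp)).trans h29)
    have sz : ∀ {x}, x ≤ P.X → x.size ≤ 3 * P.L := fun h => (size_le h).trans (by omega)
    refine wp_flat_list (3 * P.L) [29, 52, 57, 60] [0, 2] (by omega) ?_ ?_ fun hF₃ => ?_
    · simp only [List.forall_mem_cons, e29', h52, e60']
      exact ⟨sz (by unfold X; omega), sz (by unfold X; omega), sz (by unfold X; omega), z60, by simp⟩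
    · rw [ar₂]; simp only [List.forall_mem_cons, hs.mat]
      exact ⟨fun i => sz ((hinp i).trans one_le_X), fun i => sz ((hs.bit i).trans one_le_X), by simp⟩
    · have e : (scanBody.eval ω σ₂).reg 57 = σ₂.reg 57 + σ.arr 0 (P.col (q / P.a) * P.b + k) *
          A (P.line q * P.W + P.col (q / P.a) * P.b + k) := by
        simp [scanBody, Program.eval, BinOp.eval, e29', e60', h52, ar₂, hs.mat]
      have b1 := hinp (P.col (q / P.a) * P.b + k)
      have b2 := hs.bit (P.line q * P.W + P.col (q / P.a) * P.b + k)
      have hsplit : (∃ c < k + 1, P.blockMat A (q / P.a) (q % P.a) c = true ∧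
          P.blockVec (σ.arr 0) (q / P.a) c = true) ↔ (∃ c < k, P.blockMat A (q / P.a) (q % P.a) c = true ∧
          P.blockVec (σ.arr 0) (q / P.a) c = true) ∨ (σ.arr 0 (P.col (q / P.a) * P.b + k) ≠ 0 ∧
          A (P.line q * P.W + P.col (q / P.a) * P.b + k) ≠ 0) := by
        have : (P.blockMat A (q / P.a) (q % P.a) k = true ∧ P.blockVec (σ.arr 0) (q / P.a) k = true) ↔
            (σ.arr 0 (P.col (q / P.a) * P.b + k) ≠ 0 ∧
            A (P.line q * P.W + P.col (q / P.a) * P.b + k) ≠ 0) := by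
          unfold blockMat blockVec line
          rw [decide_eq_true_iff, decide_eq_true_iff, and_comm, add_comm k, add_comm (q % P.a), add_assoc]
        rw [← this]; constructor
        · rintro ⟨c, hc, h⟩; rcases Nat.lt_succ_iff_lt_or_eq.1 hc with hc | rfl
          · exact Or.inl ⟨c, hc, h⟩
          · exact Or.inr h
        · rintro (⟨c, hc, h⟩ | h)
          · exact ⟨c, by omega, h⟩
          · exact ⟨k, by omega, h⟩
      refine ⟨⟨?_, ?_⟩, by omega⟩
      · rw [e]; have := Nat.mul_le_mul b1 b2; omega
      · rw [hsplit, ← h2, e, ← mul_ne_zero_iff]; omega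
  · rintro σ₂ T₂ ⟨h1, h2⟩ hF₂ t₂; have ar₂ := hF₂.arr.trans hF.arr
    have f1 := (hF₂.1 1 (by decide)).trans ((fr 1 (by simp)).trans hr.r1)
    have f55 := (hF₂.1 55 (by decide)).trans ((fr 55 (by simp)).trans h55)
    have f24 := (hF₂.1 24 (by decide)).trans ((fr 24 (by simp)).trans h24)
    have s1 : (1 : ℕ).size = 1 := by simp
    have s55 : (P.line q).size ≤ P.L := size_le (by unfold X; omega)
    have s24 : (P.guess (q / P.a)).size ≤ P.L := size_le (by unfold X; omega)
    have s57 : (σ₂.reg 57).size ≤ P.L := size_le (by unfold X; omega)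
    have m1 : P.b * (scanBody.weight * (3 * P.L) + 10 * (P.b.size + 1)) ≤
      P.b * (scanBody.weight * (3 * P.L) + 10 * P.L) := Nat.mul_le_mul_left _ (by omega)
    have e : scanCost * P.L * (P.b + 1) = P.b * (scanBody.weight * (3 * P.L) + 10 * P.L) +
      scanHead.weight * P.L + 40 * P.L + 30 * (P.b * P.L) + scanHead.weight * P.L * P.b +
      3 * (scanBody.weight * P.L) := by unfold scanCost; ring
    refine RAM.wp_cond (fun h0 => RAM.wp_store ⟨?_, ?_⟩) (fun h0 => RAM.wp_store ⟨?_, ?_⟩)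
    · have hit : P.Hit A (σ.arr 0) q := h2.1 h0; rw [if_pos hit, f1, f55]; simp only [State.setArr, ar₂]
    · rw [f1, f55]; omega
    · have hit : ¬ P.Hit A (σ.arr 0) q := fun h => h2.2 h h0; rw [if_neg hit, f1, f24]
      simp only [State.setArr, ar₂]
    · rw [f1, f24]; omega

open Classical in
theorem wp_claimBody (hs : P.Safe A κ σ)
    (hq : q < P.NQ) (h50 : σ.reg 50 = q) (ha : P.a ≤ P.n) (hinp : ∀ i, σ.arr 0 i ≤ 1)
    (hout : ∀ i, σ.arr 1 i ≤ 1) :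
    wp ω claimBody (fun σ' T' => P.Safe A κ σ' ∧ σ'.arr = (P.verdict A σ q).arr ∧
      T' ≤ T + claimCost * P.L * (P.g + 1) +
        if P.Claimed σ q then scanCost * P.L * (P.b + 1) else 0) σ T := by
  have hL := one_le_L (P := P); have hr := hs.regs; have hline := line_lt (P := P) (q := q)
  have hqX : q ≤ P.X := by unfold X; omega
  have hβ := query_lt hq; have hi := Nat.mod_lt q P.ha
  have zg : P.g.size + 1 ≤ P.L := by
    have := size_le_L (P := P) (x := P.g) (by unfold X; omega); omega
  refine wp_seq (hr.wp [50] [] (by simpa [h50] using hqX) (by simp) fun hF => ?_)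
  set σ₁ := claimHead.eval ω σ with hσ₁
  have fr : ∀ x < 23, σ₁.reg x = σ.reg x := fun x hx =>
    hF.1 x ((by decide : ∀ x < 23, x ∉ claimHead.writes) x hx)
  have e24 : σ₁.reg 24 = P.guess (q / P.a) := by
    simp [hσ₁, claimHead, decodeBlock, Program.eval, BinOp.eval, h50, hr.r4, hr.r11, guess]
  have e29 : σ₁.reg 29 = P.col (q / P.a) * P.b := by
    simp [hσ₁, claimHead, decodeBlock, Program.eval, BinOp.eval, h50, hr.r4, hr.r5, hr.r11, hr.r12,
      sub_div_mul, col]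
  have e54 : σ₁.reg 54 = q % P.a := by
    simp [hσ₁, claimHead, decodeBlock, Program.eval, BinOp.eval, h50, hr.r4, sub_div_mul]
  have e55 : σ₁.reg 55 = P.line q := by
    simp [hσ₁, claimHead, decodeBlock, Program.eval, BinOp.eval, h50, hr.r4, hr.r5, hr.r11, hr.r12,
      sub_div_mul, row, line]
  have e56 : σ₁.reg 56 = q / P.a * P.g := by
    simp [hσ₁, claimHead, decodeBlock, Program.eval, BinOp.eval, h50, hr.r3, hr.r4]
  have e57 : σ₁.reg 57 = 0 := by simp [hσ₁, claimHead, decodeBlock, Program.eval]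
  have idle : ∀ c < P.g, q / P.a * P.g + c < P.NV := fun c hc => by
    have h1 : (q / P.a + 1) * P.g ≤ P.NB * P.g := Nat.mul_le_mul_right _ hβ; rw [add_mul] at h1
    unfold NV; omega
  refine wp_seq (wp_for_const P.g (voteBody.weight * (3 * P.L)) (fun k σ' => σ'.reg 57 ≤ k ∧
    σ'.reg 57 = ∑ c ∈ Finset.range k, σ.arr 3 ((q / P.a * P.g + c) * P.a + q % P.a))
    ((fr 3 (by simp)).trans hr.r3) ((fr 1 (by simp)).trans hr.r1) ?_ ?_ ?_ ?_)
  · rintro k σ' x y h; simpa using h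
  · rw [e57]; simp
  · rintro k hk σ₂ T₂ ⟨h1, h2⟩ hF₂ h52; have ar₂ := hF₂.arr.trans hF.arr
    have e56' := (hF₂.1 56 (by decide)).trans e56; have e54' := (hF₂.1 54 (by decide)).trans e54
    have e4' := (hF₂.1 4 (by decide)).trans ((fr 4 (by simp)).trans hr.r4); have hc := idle k hk
    have sz : ∀ {x}, x ≤ P.X → x.size ≤ 3 * P.L := fun h => (size_le h).trans (by omega)
    refine wp_flat_list (3 * P.L) [4, 52, 54, 56, 57] [3] (by omega) ?_ ?_ fun hF₃ => ?_
    · simp only [List.forall_mem_cons, e4', h52, e54', e56']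
      refine ⟨sz ?_, sz ?_, sz ?_, sz ?_, sz ?_, by simp⟩ <;> unfold X <;> omega
    · rw [ar₂]; simpa using fun i => sz ((hs.ans i).trans one_le_X)
    · have e : (voteBody.eval ω σ₂).reg 57 = σ₂.reg 57 +
          σ.arr 3 ((q / P.a * P.g + k) * P.a + q % P.a) := by
        simp [voteBody, Program.eval, BinOp.eval, e56', e54', e4', h52, ar₂]
      have := hs.ans ((q / P.a * P.g + k) * P.a + q % P.a); refine ⟨⟨by omega, ?_⟩, by omega⟩
      rw [e, h2, Finset.sum_range_succ]
  rintro σ₂ T₂ ⟨h1, h2⟩ hF₂ t₂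
  have fr₂ : ∀ x, x < 45 → σ₂.reg x = σ₁.reg x := fun x hx =>
    hF₂.1 x ((by decide : ∀ x < 45, x ∉ (forLoop 52 3 53 1 voteBody).writes) x hx)
  have ar₂ := hF₂.arr.trans hF.arr; have f24 := (fr₂ 24 (by simp)).trans e24
  have f55 := (hF₂.1 55 (by decide)).trans e55
  have f15 := (fr₂ 15 (by simp)).trans ((fr 15 (by simp)).trans hr.r15)
  have f3 := (fr₂ 3 (by simp)).trans ((fr 3 (by simp)).trans hr.r3)
  have hg : P.guess (q / P.a) ≤ P.NB := (Nat.div_le_self _ _).trans hβ.le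
  refine wp_seq (wp_flat_list P.L [3, 15, 24, 55, 57] [1, 4] hL ?_ ?_ fun hF₃ => ?_)
  · simp only [List.forall_mem_cons, f3, f15, f24, f55]
    refine ⟨size_le ?_, size_le ?_, size_le ?_, size_le ?_, size_le ?_, by simp⟩ <;> unfold X <;> omega
  · rw [ar₂]; simp only [List.forall_mem_cons]
    exact ⟨fun i => size_le ((hout i).trans one_le_X), fun i => size_le ((hs.dead i).trans one_le_X), by simp⟩
  set σ₃ := claimTest.eval ω σ₂ with hσ₃; have h2' : σ₂.reg 57 = P.votes σ q := h2
  have e59 : σ₃.reg 59 ≤ 1 ∧ (σ₃.reg 59 ≠ 0 ↔ P.Claimed σ q) := by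
    unfold Claimed
    by_cases c1 : P.g < 2 * P.votes σ q <;> by_cases c2 : σ.arr 4 (P.guess (q / P.a)) = 0 <;>
      by_cases c3 : P.force = 0 <;> by_cases c4 : σ.arr 1 (P.line q) = 0 <;>
      simp [hσ₃, claimTest, ifLt, Program.eval, BinOp.eval, h2', f24, f55, f15, f3, ar₂, c2, c3, c4,
        Nat.sub_eq_zero_iff_le, ← two_mul, not_le.2, c1, Nat.le_of_not_lt]
  have ar₃ := hF₃.arr.trans ar₂
  have fr₃ : ∀ x < 45, σ₃.reg x = σ₁.reg x := fun x hx =>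
    (hF₃.1 x ((by decide : ∀ x < 45, x ∉ claimTest.writes) x hx)).trans (fr₂ x hx)
  have s₃ : P.Safe A κ σ₃ := hs.of_eq (fun x hx => (fr₃ x (by omega)).trans (fr x hx)) fun v => by rw [ar₃]
  have m1 : P.g * (voteBody.weight * (3 * P.L) + 10 * (P.g.size + 1)) ≤
    P.g * (voteBody.weight * (3 * P.L) + 10 * P.L) := Nat.mul_le_mul_left _ (by omega)
  have e : claimCost * P.L * (P.g + 1) = P.g * (voteBody.weight * (3 * P.L) + 10 * P.L) +
    claimHead.weight * P.L + claimTest.weight * P.L + 40 * P.L + (30 * (P.g * P.L) +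
    claimHead.weight * P.L * P.g + claimTest.weight * P.L * P.g + 3 * (voteBody.weight * P.L)) := by
    unfold claimCost; ring
  have z59 : (σ₃.reg 59).size ≤ 1 := (size_le_of_le e59.1).trans (by simp); unfold verdict
  refine RAM.wp_cond (fun h0 => ?_) (fun h0 => RAM.wp_skip ⟨s₃, ?_, ?_⟩)
  · refine wp_mono (wp_scan s₃ hq ((fr₃ 24 (by simp)).trans e24) ((fr₃ 29 (by simp)).trans e29)
      ((hF₃.1 55 (by decide)).trans f55) ha (by rw [ar₃]; exact hinp)) ?_
    rintro σ₄ T₄ hF₄ ⟨a₄, t₄⟩; have hC := e59.2.1 h0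
    have fr₄ : ∀ x < 23, σ₄.reg x = σ₃.reg x := fun x hx =>
      hF₄.1 x ((by decide : ∀ x < 23, x ∉ scan.writes) x hx)
    have ar₄ : ∀ v, v ≠ 1 ∧ v ≠ 4 → σ₄.arr v = σ₃.arr v := fun v h => hF₄.2 v fun h' => by
      have := (by decide : scan.stores ⊆ {1, 4}) h'; simp at this; omega
    refine ⟨⟨s₃.regs.of_eq fun x hx => fr₄ x (by omega), by rw [fr₄ 22 (by norm_num), s₃.ctr],
      by rw [ar₄ 2 (by simp), s₃.mat], hs.bit,
      by rw [ar₄ 5 (by simp)]; exact s₃.fuel, ?_,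
      by rw [ar₄ 3 (by simp)]; exact s₃.ans,
      fun v hv => by rw [ar₄ v (by omega)]; exact s₃.cells v hv,
      by rw [ar₄ 11 (by simp)]; exact s₃.fresh⟩, ?_, ?_⟩
    · intro i; rw [a₄]; split_ifs
      · rw [State.arr_setArr, if_neg (by norm_num)]; exact s₃.dead i
      · rw [State.arr_setArr_apply]; split_ifs
        · exact le_rfl
        · exact s₃.dead i
    · rw [a₄, if_pos hC, ar₃]; split_ifs <;> simp [State.setArr, ar₃]
    · rw [if_pos hC]; omega
  · rw [if_neg fun hC => e59.2.2 hC h0, ar₃]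
  · rw [if_neg fun hC => e59.2.2 hC h0]; omega

variable {P : Par}

def claimLoop : Program := forLoop 50 10 51 1 claimBody

/-- The number of guesses that are not refuted and of entries of the product that are not found. -/
def opens (P : Par) (σ : State) : ℕ := (∑ γ ∈ Finset.range (P.g ^ 3), if σ.arr 4 γ = 0 then 1 else 0) +
    ∑ j ∈ Finset.range (P.n + P.a), if σ.arr 1 j = 0 then 1 else 0

theorem sum_zero_update (f : ℕ → ℕ) {N : ℕ} (hi : i < N) :
    (∑ j ∈ Finset.range N, if Function.update f i 1 j = 0 then 1 else 0) +
      (if f i = 0 then 1 else 0) = ∑ j ∈ Finset.range N, if f j = 0 then 1 else 0 := by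
  have hm := Finset.mem_range.2 hi
  rw [← Finset.add_sum_erase _ _ hm, ← Finset.add_sum_erase _ (fun j => if f j = 0 then 1 else 0) hm,
    Finset.sum_congr rfl fun j hj => by rw [Function.update_of_ne (Finset.ne_of_mem_erase hj)]]
  rw [Function.update_self, if_neg one_ne_zero, zero_add, add_comm]

open Classical in
-- The amortization of scans: a hit turns an entry of the product from 0 to 1, a miss kills a living
-- guess. Either can happen only once, so there are at most g^3 misses altogether. With `force` the
-- misses are not amortized and are charged directly.
theorem opens_verdict (hq : q < P.NQ) :
    P.opens (P.verdict A σ q) + (if P.Claimed σ q then if P.force = 0 then 1 else 0 else 0) ≤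
      P.opens σ := by
  have h1 := sum_zero_update (σ.arr 1) (line_lt (P := P) (q := q))
  have h4 := sum_zero_update (σ.arr 4) (guess_lt (query_lt hq)); unfold verdict opens
  split_ifs with hC hH hF hF
  · simp only [State.arr_setArr, (by decide : (4 : ℕ) ≠ 1), if_false, if_true]
    rw [if_pos hC.1] at h1; omega
  · simp only [State.arr_setArr, (by decide : (4 : ℕ) ≠ 1), if_false, if_true]
    rw [if_pos hC.1] at h1; omega
  · simp only [State.arr_setArr, (by decide : (1 : ℕ) ≠ 4), if_false, if_true]
    rw [if_pos (hC.2.resolve_left (not_not.2 hF)).1] at h4; omega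
  · simp only [State.arr_setArr, (by decide : (1 : ℕ) ≠ 4), if_false, if_true]; omega
  · omega

/-- The majority of the copies is right about all blocks for the guess `γ`. -/
def Trusted (P : Par) (A : ℕ → ℕ) (σ : State) (γ : ℕ) : Prop :=
  ∀ q < P.NQ, P.guess (q / P.a) = γ → (P.Hit A (σ.arr 0) q ↔ P.g < 2 * P.votes σ q)

/-- The entry of the product that belongs to query `q` is found if the answers can be trusted. -/
structure Verified (P : Par) (A : ℕ → ℕ) (k : ℕ) (σ σ' : State) : Prop where
  other : ∀ v, v ≠ 1 → v ≠ 4 → σ'.arr v = σ.arr v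
  bit : ∀ j, σ'.arr 1 j ≤ 1
  sound : ∀ j, σ.arr 1 j = 0 → σ'.arr 1 j ≠ 0 → ∃ q < P.NQ, P.line q = j ∧ P.Hit A (σ.arr 0) q
  complete : ∀ γ, P.force ≠ 0 ∨ P.Trusted A σ γ ∧ σ.arr 4 γ = 0 → ∀ q < k, q < P.NQ →
    P.guess (q / P.a) = γ → P.Hit A (σ.arr 0) q → σ'.arr 1 (P.line q) ≠ 0
  alive : P.force = 0 → ∀ γ, P.Trusted A σ γ → σ.arr 4 γ = 0 → σ'.arr 4 γ = 0

/-- Entries are written only after a successful scan, hence soundness. A guess with correct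
majorities never claims a false hit, so it is never killed and all its hits get verified. -/
theorem Verified.step (h : P.Verified A k σ σ') (hk : k < P.NQ) :
    P.Verified A (k + 1) σ (P.verdict A σ' k) := by
  obtain ⟨h1, h2, h3, h4, h5⟩ := h; have e0 : σ'.arr 0 = σ.arr 0 := h1 0 (by norm_num) (by norm_num)
  have ev : P.votes σ' k = P.votes σ k := by unfold votes; rw [h1 3 (by norm_num) (by norm_num)]
  have grow : ∀ j, σ'.arr 1 j ≠ 0 → (P.verdict A σ' k).arr 1 j ≠ 0 := by
    intro j hj; unfold verdict; split_ifs
    · rw [State.arr_setArr_apply]; split_ifs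
      · exact one_ne_zero
      · exact hj
    · rw [State.arr_setArr, if_neg (by norm_num)]; exact hj
    · exact hj
  refine ⟨fun v hv hv' => ?_, fun j => ?_, fun j hj hj' => ?_, fun γ hγ q hq hqN hg hH => ?_,
    fun hF γ hT h0 => ?_⟩
  · unfold verdict; split_ifs
    · rw [State.arr_setArr, if_neg hv, h1 v hv hv']
    · rw [State.arr_setArr, if_neg hv', h1 v hv hv']
    · exact h1 v hv hv'
  · unfold verdict; split_ifs
    · rw [State.arr_setArr_apply]; split_ifs
      · exact le_rfl
      · exact h2 j
    · rw [State.arr_setArr, if_neg (by norm_num)]; exact h2 j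
    · exact h2 j
  · by_cases hc : σ'.arr 1 j = 0
    · unfold verdict at hj'; split_ifs at hj' with hC hH
      · rw [State.arr_setArr_apply] at hj'; split_ifs at hj' with he
        · exact ⟨k, hk, he.2.symm, by rw [← e0]; exact hH⟩
        · exact absurd hc hj'
      · rw [State.arr_setArr, if_neg (by norm_num)] at hj'; exact absurd hc hj'
      · exact absurd hc hj'
    · exact h3 j hj hc
  · rcases Nat.lt_succ_iff_lt_or_eq.1 hq with hq | rfl
    · exact grow _ (h4 γ hγ q hq hqN hg hH)
    · by_cases hc : σ'.arr 1 (P.line q) = 0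
      · have hC : P.Claimed σ' q := by
          refine ⟨hc, ?_⟩
          by_cases hF : P.force = 0
          · obtain ⟨hT, h0⟩ := hγ.resolve_left (not_not.2 hF)
            exact Or.inr ⟨by rw [hg]; exact h5 hF γ hT h0, by rw [ev]; exact (hT q hqN hg).1 hH⟩
          · exact Or.inl hF
        unfold verdict
        rw [if_pos hC, if_pos (by rw [e0]; exact hH), State.arr_setArr_apply, if_pos ⟨rfl, rfl⟩]
        exact one_ne_zero
      · exact grow _ hc
  · unfold verdict; split_ifs with hC hH
    · rw [State.arr_setArr, if_neg (by norm_num)]; exact h5 hF γ hT h0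
    · rw [State.arr_setArr_apply, if_neg]
      · exact h5 hF γ hT h0
      -- Killing a trusted guess would take a majority for a hit that the scan does not find.
      · rintro ⟨-, rfl⟩; refine hH ?_; rw [e0]; have := (hC.2.resolve_left (not_not.2 hF)).2
        rw [ev] at this; exact (hT k hk rfl).2 this
    · exact h5 hF γ hT h0

def claimLoopCost (P : Par) : ℕ := (P.NQ + 1) * (claimCost * P.L * (P.g + 1) + 10 * P.L +
    if P.force = 0 then 0 else scanCost * P.L * (P.b + 1))

theorem opens_congr (h : ∀ v, σ'.arr v = σ.arr v) : P.opens σ' = P.opens σ := by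
  unfold opens; rw [h, h]

theorem wp_claimLoop (hs : P.Safe A κ σ)
    (ha : P.a ≤ P.n) (hinp : ∀ i, σ.arr 0 i ≤ 1) (hout : ∀ i, σ.arr 1 i ≤ 1) :
    wp ω claimLoop (fun σ' T' => P.Safe A κ σ' ∧ P.Verified A P.NQ σ σ' ∧ σ'.reg 21 = σ.reg 21 ∧
      T' + scanCost * P.L * (P.b + 1) * P.opens σ' ≤
        T + scanCost * P.L * (P.b + 1) * P.opens σ + P.claimLoopCost) σ T := by
  classical
  have wB : claimBody.writes ⊆ {23, 24, 25, 26, 27, 28, 29, 45, 52, 53, 54, 55, 56, 57, 58, 59, 60, 61} := by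
    decide
  have hw : ∀ x, x = 1 ∨ x = 10 ∨ x = 21 ∨ x = 50 → x ∉ claimBody.writes := by
    rintro x hx h; have := wB h; simp only [Finset.mem_insert, Finset.mem_singleton] at this; omega
  refine wp_for_cost P.NQ (claimCost * P.L * (P.g + 1) +
      if P.force = 0 then 0 else scanCost * P.L * (P.b + 1))
    (fun k σ' => P.Safe A κ σ' ∧ P.Verified A k σ σ') (fun σ' => scanCost * P.L * (P.b + 1) * P.opens σ')
    (hw _ (by simp)) (hw _ (by simp)) (hw _ (by simp)) (by norm_num) hs.regs.r10 hs.regs.r1 ?_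
    (fun _ _ _ => rfl) ⟨hs, fun _ _ _ => rfl, hout, fun j h h' => absurd h h', fun _ _ _ h => absurd h (Nat.not_lt_zero _),
      fun _ _ _ h => h⟩ ?_ ?_
  · rintro k σ' x y ⟨h1, h2⟩
    refine ⟨h1.of_eq (fun z hz => ?_) fun _ => rfl, ⟨h2.1, h2.2, h2.3, h2.4, h2.5⟩⟩
    rw [State.reg_setReg, if_neg (by omega), State.reg_setReg, if_neg (by omega)]
  · rintro k hk σ₁ T₁ ⟨h1, h2⟩ hF h50
    refine wp_mono (wp_claimBody h1 hk h50 ha (by rw [h2.other 0 (by norm_num) (by norm_num)]; exact hinp)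
      h2.bit) ?_
    rintro σ₂ T₂ - ⟨s₂, a₂, t₂⟩; have hv := h2.step hk
    refine ⟨⟨s₂, ⟨by rw [a₂]; exact hv.1, by rw [a₂]; exact hv.2, by rw [a₂]; exact hv.3,
      by rw [a₂]; exact hv.4, by rw [a₂]; exact hv.5⟩⟩, ?_⟩
    have ho := opens_verdict (P := P) (A := A) (σ := σ₁) hk
    rw [← opens_congr (fun v => congrFun a₂ v)] at ho
    have hm := Nat.mul_le_mul_left (scanCost * P.L * (P.b + 1)) ho; rw [mul_add] at hm
    split_ifs at hm t₂ ⊢ <;> omega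
  · rintro σ' T' ⟨h1, h2⟩ hF hT
    have hz : P.NQ.size + 1 ≤ P.L := by
      have := size_le_L (P := P) (x := P.NQ) (by unfold X; omega); omega
    refine ⟨h1, h2, hF.1 21 ?_, hT.trans ?_⟩
    · simp only [forLoop, Program.writes, Finset.mem_union, Finset.mem_singleton, not_or]
      exact ⟨by norm_num, by norm_num, hw _ (by simp), by norm_num, by norm_num⟩
    · unfold claimLoopCost
      generalize (if P.force = 0 then 0 else scanCost * P.L * (P.b + 1)) = f
      have m1 : P.NQ * ((claimCost * P.L * (P.g + 1) + f) + 10 * (P.NQ.size + 1)) ≤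
          P.NQ * (claimCost * P.L * (P.g + 1) + 10 * P.L + f) := Nat.mul_le_mul_left _ (by omega)
      rw [add_mul, one_mul]; omega

variable {P : Par}

/-! ### Multiplications -/

/-- The run (`46`), the phase (`47`) and its position (`48`). -/
def mulHead : Mode → Program
  | .incremental => .arith .quot 46 21 4 ;; .arith .times 47 46 4 ;; .arith .minus 47 21 47 ;;
      .arith .minus 48 4 1 ;; .arith .minus 48 48 47
  | .decremental => .arith .quot 46 21 4 ;; .arith .times 47 46 4 ;; .arith .minus 47 21 47 ;;
      .arith .plus 48 47 0

def mulAll (D : DataStructure) (N : ℕ) (mode : Mode) : Program :=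
  mulHead mode ;; forLoop 50 2 51 1 (.store 1 50 0) ;; vmLoop D N mode ;; claimLoop ;;
    .arith .plus 21 21 1

/-- The majority of the copies is right about all blocks for the guess `γ`, in all multiplications. -/
def Reliable (P : Par) (D : DataStructure) (A : ℕ → ℕ) (vec : ℕ → ℕ → ℕ) (ω : ℕ → Bool) (γ : ℕ) : Prop :=
  ∀ t < P.n, ∀ σ : State, σ.arr 0 = vec t → (∀ i, σ.arr 3 i ≤ 1) →
    (∀ id < P.NV, P.Voted D A vec ω t σ id) → P.Trusted A σ γ

/-- The state before multiplication number `t`. -/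
structure Between (P : Par) (D : DataStructure) (A : ℕ → ℕ) (vec : ℕ → ℕ → ℕ) (ω : ℕ → Bool) (t : ℕ)
    (σ : State) : Prop where
  safe : P.Safe A (1 + P.NV + t * (P.NV * P.E)) σ
  count : σ.reg 21 = t
  out : ∀ j, σ.arr 1 j ≤ 1
  ready : ∀ id < P.NV, P.Ready D A vec ω t σ id
  alive : P.force = 0 → ∀ γ, P.Reliable D A vec ω γ → σ.arr 4 γ = 0

/-- What is known of the result of a multiplication by the vector `v`. -/
structure Product (P : Par) (D : DataStructure) (A : ℕ → ℕ) (vec : ℕ → ℕ → ℕ) (ω : ℕ → Bool)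
    (v out : ℕ → ℕ) : Prop where
  bit : ∀ j, out j ≤ 1
  sound : ∀ j < P.n, out j ≠ 0 → ∃ q < P.NQ, P.line q = j ∧ P.Hit A v q
  complete : ∀ γ, P.force ≠ 0 ∨ P.Reliable D A vec ω γ → ∀ q < P.NQ, P.guess (q / P.a) = γ →
    P.Hit A v q → out (P.line q) ≠ 0

/-- The cost that is still to be paid. -/
def reserve (P : Par) (σ : State) : ℕ := P.totalPot σ +
  scanCost * P.L * (P.b + 1) * ∑ γ ∈ Finset.range (P.g ^ 3), if σ.arr 4 γ = 0 then 1 else 0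

def mulCost (P : Par) (s : ℕ) : ℕ := 3000 * P.L * (P.n + 1) + P.vmLoopCost s +
  scanCost * P.L * (P.b + 1) * (P.n + P.a) + P.claimLoopCost

theorem wp_mulHead (hs : P.Safe A κ σ) (h21 : σ.reg 21 = t) (ht : t < P.n) :
    wp ω (mulHead P.mode) (fun σ' T' => (∀ x, x ≠ 46 ∧ x ≠ 47 ∧ x ≠ 48 → σ'.reg x = σ.reg x) ∧
      σ'.arr = σ.arr ∧ σ'.reg 46 = t / P.a ∧ σ'.reg 47 = t % P.a ∧
      σ'.reg 48 = position P.mode P.a (t % P.a) ∧ T' ≤ T + 2000 * P.L) σ T := by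
  have hL := one_le_L (P := P); have hr := hs.regs; have h0 := hr.r0; have h1 := hr.r1; have h4 := hr.r4
  have z21 : ∀ x ∈ [21], σ.reg x ≤ P.X := by simp [h21, X]; omega
  generalize P.mode = mode
  have hm : (mulHead mode).weight ≤ 2000 ∧ (mulHead mode).writes = {46, 47, 48} := by
    cases mode <;> decide
  refine hr.wp [21] [] z21 (by simp) (fun hF => ⟨fun x h => hF.1 x (by simp [hm.2, h]), ?_⟩)
    (by cases mode <;> decide)
  have := Nat.mul_le_mul_right P.L hm.1
  refine ⟨?_, ?_, ?_, ?_, by omega⟩ <;> cases mode <;>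
    simp [mulHead, Program.eval, BinOp.eval, h21, h4, h1, h0, sub_div_mul, position]

theorem Ready.congr (h : P.Ready D A vec ω t σ id) (hid : id < P.NV) (ht : t ≤ P.n)
    (h5 : ∀ v, v ≠ 0 ∧ v ≠ 1 ∧ v ≠ 4 → σ'.arr v = σ.arr v) : P.Ready D A vec ω t σ' id :=
  h.of_eq hid ht (fun v hv _ i y _ _ => by rw [h5 v (by omega)])
    (by rw [h5 5 (by simp)])

theorem wp_clear (h : P.Regs σ) :
    wp ω (forLoop 50 2 51 1 (.store 1 50 0)) (fun σ' T' => (∀ x < 50, σ'.reg x = σ.reg x) ∧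
      (∀ v, v ≠ 1 → σ'.arr v = σ.arr v) ∧ (∀ j < P.n, σ'.arr 1 j = 0) ∧
      (∀ j, P.n ≤ j → σ'.arr 1 j = σ.arr 1 j) ∧ T' ≤ T + 30 * P.L * (P.n + 1)) σ T := by
  have hL := one_le_L (P := P)
  have zn : P.n.size + 1 ≤ P.L := by
    have := size_le_L (P := P) (x := P.n) (by unfold X; omega); omega
  refine wp_for_const P.n (1 + P.L) (fun k σ' => (∀ j < k, σ'.arr 1 j = 0) ∧
    ∀ j, k ≤ j → σ'.arr 1 j = σ.arr 1 j) h.r2 h.r1 (fun _ _ _ _ h => h)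
    ⟨fun _ h => absurd h (Nat.not_lt_zero _), fun _ _ => rfl⟩ ?_ ?_
  · rintro k hk σ₁ T₁ ⟨h1, h2⟩ hF h50; have e0 : σ₁.reg 0 = 0 := by rw [hF.1 0 (by decide), h.r0]
    refine RAM.wp_store ⟨⟨fun j hj => ?_, fun j hj => ?_⟩, ?_⟩
    · rw [State.arr_setArr_apply, e0, h50]; split_ifs with he
      · rfl
      · exact h1 j (by simp at he; omega)
    · rw [State.arr_setArr_apply, h50, if_neg (by omega)]; exact h2 j (by omega)
    · rw [e0, h50, Nat.size_zero]; have : k.size ≤ P.L := size_le (by unfold X; omega); omega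
  · rintro σ' T' ⟨h1, h2⟩ hF hT; refine ⟨fun x hx => hF.1 x ?_, fun v hv => hF.2 v ?_, h1, h2, ?_⟩
    · simp [(by decide : (forLoop 50 2 51 1 (.store 1 50 0)).writes = {50, 51})]; omega
    · simpa [(by decide : (forLoop 50 2 51 1 (.store 1 50 0)).stores = {1})] using hv
    · have m1 : P.n * (1 + P.L + 10 * (P.n.size + 1)) ≤ P.n * (12 * P.L) :=
        Nat.mul_le_mul_left _ (by omega)
      have e : 30 * P.L * (P.n + 1) = P.n * (12 * P.L) + 18 * (P.n * P.L) + 30 * P.L := by ring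
      omega

/-- The output is cleared for each vector but refuted guesses stay refuted. So `reserve` keeps only
the guesses, while the at most n + a entries of the output are charged to the single multiplication.
-/
theorem wp_mulAll (hD : P.D = D.watched) (ha : P.a ≤ P.n) (hvec : ∀ t i, vec t i ≤ 1) (ht : t < P.n)
    (hs : P.Between D A vec ω t σ) :
    wp ω (mulAll P.D D.bound P.mode) (fun σ' T' => P.Between D A vec ω (t + 1) σ' ∧
      P.Product D A vec ω (vec t) σ'.output ∧ T' + P.reserve σ' ≤ T + P.reserve σ + P.mulCost (t % P.a))
      (σ.withInput (vec t)) T := by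
  obtain ⟨h1, h2, h3, h4, h5⟩ := hs; have hL := one_le_L (P := P)
  obtain ⟨σ₀, hσ₀⟩ : ∃ σ₀, σ₀ = σ.withInput (vec t) := ⟨_, rfl⟩; rw [← hσ₀]
  have a00 : σ₀.arr 0 = vec t := by simp [hσ₀, State.withInput]
  have a0 : ∀ v, v ≠ 0 → σ₀.arr v = σ.arr v := fun v hv => by simp [hσ₀, State.withInput, hv]
  have r0 : σ₀.reg = σ.reg := by rw [hσ₀]; rfl
  have safe_of : ∀ {κ} {σ₁ σ₂ : State}, P.Safe A κ σ₁ → (∀ x < 23, x ≠ 21 → σ₂.reg x = σ₁.reg x) →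
      (∀ v, v ≠ 0 → v ≠ 1 → σ₂.arr v = σ₁.arr v) → P.Safe A κ σ₂ := by
    intro κ σ₁ σ₂ h hr ha
    exact ⟨h.regs.of_eq fun x hx => hr x (by omega) (by omega), by rw [hr 22 (by simp) (by simp), h.ctr],
      by rw [ha 2 (by simp) (by simp), h.mat], h.bit,
      by rw [ha 5 (by simp) (by simp)]; exact h.fuel,
      by rw [ha 4 (by simp) (by simp)]; exact h.dead,
      by rw [ha 3 (by simp) (by simp)]; exact h.ans,
      fun v hv => by rw [ha v (by omega) (by omega)]; exact h.cells v hv,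
      by rw [ha 11 (by simp) (by simp)]; exact h.fresh⟩
  have s₀ : P.Safe A (1 + P.NV + t * (P.NV * P.E)) σ₀ :=
    safe_of h1 (fun x _ _ => by rw [r0]) fun v hv _ => a0 v hv
  refine wp_seq (wp_mono (wp_mulHead s₀ (by rw [r0, h2]) ht) ?_)
  rintro σ₁ T₁ - ⟨r₁, a₁, e46, e47, e48, t₁⟩
  have s₁ := safe_of s₀ (fun x hx _ => r₁ x (by omega)) fun v _ _ => by rw [a₁]
  refine wp_seq (wp_mono (wp_clear s₁.regs) ?_); rintro σ₂ T₂ - ⟨r₂, a₂, z₂, k₂, t₂⟩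
  have s₂ := safe_of s₁ (fun x hx _ => r₂ x (by omega)) fun v _ hv => a₂ v hv
  have a20 : σ₂.arr 0 = vec t := by rw [a₂ 0 (by simp), a₁, a00]
  have a2v : ∀ v, v ≠ 0 → v ≠ 1 → σ₂.arr v = σ.arr v := fun v hv hv' => by rw [a₂ v hv', a₁, a0 v hv]
  have hκ : 1 + P.NV + t * (P.NV * P.E) + P.NV * P.E < P.S :=
    ctr_lt (t := t + 1) ht (by rw [add_mul, one_mul]; omega)
  refine wp_seq (wp_mono (wp_vmLoop (D := D) (vec := vec) hD s₂ (by rw [r₂ 46 (by simp), e46])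
    (by rw [r₂ 47 (by simp), e47]) (by rw [r₂ 48 (by simp), e48]) ht a20
    (by rw [a20]; exact hvec t) hκ.le (by omega)
    fun id hid => (h4 id hid).congr hid ht.le fun v h => a2v v h.1 h.2.1) ?_)
  rintro σ₃ T₃ - ⟨s₃, a₃, e21, v₃, t₃⟩
  have a30 : σ₃.arr 0 = vec t := by rw [a₃ 0 (by simp) (by simp) (by simp), a20]
  have a31 : σ₃.arr 1 = σ₂.arr 1 := a₃ 1 (by simp) (by simp) (by simp)
  have a34 : σ₃.arr 4 = σ.arr 4 := by
    rw [a₃ 4 (by simp) (by simp) (by simp), a2v 4 (by simp) (by simp)]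
  have o₃ : ∀ j, σ₃.arr 1 j ≤ 1 := fun j => by
    rw [a31]
    by_cases hj : j < P.n
    · rw [z₂ j hj]; omega
    · rw [k₂ j (by omega), a₁, a0 1 (by simp)]; exact h3 j
  have tr₃ : ∀ γ, P.Reliable D A vec ω γ → P.Trusted A σ₃ γ := fun γ hγ =>
    hγ t ht σ₃ a30 s₃.ans fun id hid => (v₃ id hid).2
  refine wp_seq (wp_mono (wp_claimLoop s₃ ha (by rw [a30]; exact hvec t) o₃) ?_)
  rintro σ₄ T₄ - ⟨s₄, v₄, f21, t₄⟩
  have e4 : σ₄.reg 21 = t := by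
    rw [f21, e21, r₂ 21 (by simp), r₁ 21 (by simp), r0, h2]
  have e1 := s₄.regs.r1
  refine RAM.wp_arith ⟨⟨?_, ?_, v₄.bit, fun id hid => ?_, fun hF γ hγ => ?_⟩, ⟨v₄.bit, fun j hj hne => ?_,
    fun γ hγ q hq hg hH => ?_⟩, ?_⟩
  · have := safe_of (σ₂ := σ₄.setReg 21 (BinOp.eval .plus (σ₄.reg 21) (σ₄.reg 1))) s₄
      (fun x hx hx' => by rw [State.reg_setReg, if_neg hx']) fun _ _ _ => rfl
    rwa [show 1 + P.NV + (t + 1) * (P.NV * P.E) = 1 + P.NV + t * (P.NV * P.E) + P.NV * P.E by ring]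
  · rw [State.reg_setReg, if_pos rfl, e4, e1]; rfl
  · exact (v₃ id hid).1.congr hid ht fun v h => v₄.other v h.2.1 h.2.2
  · exact v₄.alive hF γ (tr₃ γ hγ) (by rw [a34]; exact h5 hF γ hγ)
  · rw [← a30]; exact v₄.sound j (by rw [a31, z₂ j hj]) hne
  · rw [← a30] at hH; refine v₄.complete γ ?_ q hq hq hg hH
    by_cases hF : P.force = 0
    · have hγ' := hγ.resolve_left (not_not.2 hF)
      exact Or.inr ⟨tr₃ γ hγ', by rw [a34]; exact h5 hF γ hγ'⟩
    · exact Or.inl hF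
  · have p1 : P.totalPot σ₂ = P.totalPot σ := by
      unfold totalPot; rw [a2v 5 (by simp) (by simp)]
    have p2 : P.totalPot (σ₄.setReg 21 (BinOp.eval .plus (σ₄.reg 21) (σ₄.reg 1))) = P.totalPot σ₃ := by
      unfold totalPot; rw [State.arr_setReg, v₄.other 5 (by simp) (by simp)]
    have p3 : P.opens σ₃ ≤ (∑ γ ∈ Finset.range (P.g ^ 3), if σ.arr 4 γ = 0 then 1 else 0) +
        (P.n + P.a) := by
      unfold opens; rw [a34]; refine Nat.add_le_add_left ?_ _
      refine (Finset.sum_le_card_nsmul _ _ 1 fun j _ => ?_).trans (by simp); split_ifs <;> omega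
    have p4 : (∑ γ ∈ Finset.range (P.g ^ 3), if σ₄.arr 4 γ = 0 then 1 else 0) ≤ P.opens σ₄ :=
      Nat.le_add_right _ _
    have m3 := Nat.mul_le_mul_left (scanCost * P.L * (P.b + 1)) p3
    have m4 := Nat.mul_le_mul_left (scanCost * P.L * (P.b + 1)) p4
    have z21 : (σ₄.reg 21).size ≤ P.L := by rw [e4]; exact size_le (by unfold X; omega)
    have z1 : (σ₄.reg 1).size = 1 := by rw [e1]; simp
    have e : 3000 * P.L * (P.n + 1) = 30 * P.L * (P.n + 1) + 2970 * P.L + 2970 * (P.L * P.n) := by ring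
    rw [Nat.mul_add (scanCost * P.L * (P.b + 1))] at m3; unfold reserve mulCost
    rw [p2, State.arr_setReg]; omega

/-! ### The session of all multiplications and its total cost -/

variable {P : Par} {D : DataStructure} {A : ℕ → ℕ} {vec : ℕ → ℕ → ℕ} {ω : ℕ → Bool}

theorem session_mulAll (hD : P.D = D.watched) (ha : P.a ≤ P.n) (hvec : ∀ t i, vec t i ≤ 1) :
    ∀ d k, k + d = P.n → ∀ σ, P.Between D A vec ω k σ → ∃ res, Session ω σ
      ((List.range' k d).map fun t => (mulAll P.D D.bound P.mode, vec t)) res ∧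
      (res.map Result.time).sum ≤ P.reserve σ + ∑ t ∈ Finset.Ico k P.n, P.mulCost (t % P.a) ∧
      ∀ i < d, ∃ r, res[i]? = some r ∧ P.Product D A vec ω (vec (k + i)) r.out
  | 0, k, hk, σ, h => ⟨[], .nil σ, by simp, fun i hi => absurd hi (Nat.not_lt_zero _)⟩
  | d + 1, k, hk, σ, h => by
    obtain ⟨σ', t, T', he, hT, hB, hP, hc⟩ := wp_mulAll (T := 0) hD ha hvec (t := k) (by omega) h
    obtain ⟨res, hs, ht, hr⟩ := session_mulAll hD ha hvec d (k + 1) (by omega) σ' hB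
    refine ⟨⟨t, σ'.output⟩ :: res, ?_, ?_, fun i hi => ?_⟩
    · rw [List.range'_succ, List.map_cons]; exact .cons he hs
    · rw [Finset.sum_eq_sum_Ico_succ_bot (by omega), List.map_cons, List.sum_cons]; show t + _ ≤ _; omega
    · cases i with
      | zero => exact ⟨_, rfl, hP⟩
      | succ i =>
        obtain ⟨r, h1, h2⟩ := hr i (by omega)
        exact ⟨r, by simpa using h1, by rwa [show k + (i + 1) = k + 1 + i by omega]⟩

theorem zRun_ne_zBase {id' ρ : ℕ} (hρ : ρ ≤ P.n) : P.zRun id ρ ≠ P.zBase id' := by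
  intro h; have h1 := zRun_div id hρ; rw [h, zBase_div] at h1; subst h1; unfold zRun zBase at h; omega

theorem between_zero (hD : P.D = D.watched) (hs : P.Safe A (1 + P.NV) σ)
    (h21 : σ.reg 21 = 0) (h1 : ∀ j, σ.arr 1 j = 0) (h4 : ∀ j, σ.arr 4 j = 0)
    (hz : ∀ v, 10 ≤ v → v ≠ 11 → ∀ i y, y < P.S → (∀ id, y ≠ P.zBase id) → σ.arr v (i * P.S + y) = 0)
    (hb : ∀ id < P.NV, ∀ t τ, Exec (tape P.g (id % P.g) ω) P.D.preprocess
      (State.blank.withInput (P.preInput A (id / P.g))) t τ → 4 * t < P.Fpre →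
      P.MemRep σ (P.zBase id) (P.zBase id) τ ∧ σ.arr 5 id ≠ 0) : P.Between D A vec ω 0 σ where
  safe := by simpa using hs
  count := h21
  out j := by rw [h1]; omega
  alive _ γ _ := h4 γ
  ready id hid := by
    refine ⟨fun ρ hρ _ v hv hv' i => hz v hv hv' i _ (zRun_lt hid hρ) fun _ => zRun_ne_zBase hρ,
      fun τ₀ hL => ?_⟩
    obtain ⟨t, he, ht⟩ := hL.boot
    obtain ⟨τ₁, t₁, he₁, ht₁, hW⟩ := Watched.exec he (N := D.bound) (by unfold DataStructure.bound; omega)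
      ((Watched.blank _).withInput _)
    obtain ⟨g1, g2⟩ := hb id hid t₁ τ₁ (by rw [hD]; exact he₁) (by omega)
    exact ⟨⟨τ₁, hW, g1⟩, fun _ => g2, fun h => absurd (Nat.zero_mod _) h⟩

theorem reserve_le (hs : ∀ i, σ.arr 5 i ≤ P.Fm) : P.reserve σ ≤
    rate P.D * P.L * (P.NV * (P.Fm + P.B)) + scanCost * P.L * (P.b + 1) * P.g ^ 3 := by
  refine Nat.add_le_add (Nat.mul_le_mul_left _ ?_) (Nat.mul_le_mul_left _ ?_)
  · simpa using Finset.sum_le_card_nsmul (Finset.range P.NV) _ _ fun i _ => potential_le _ (hs i)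
  · refine (Finset.sum_le_card_nsmul _ _ 1 fun j _ => ?_).trans (by simp); split_ifs <;> omega

/-- A bound for the cost of the algorithm, if the setup costs at most `w * L * (n + 1) ^ 2`. -/
def totalCost (P : Par) (w : ℕ) : ℕ := w * P.L * ((P.n + 1) * (P.n + 1)) +
  (P.NV + 1) * (preCost P.D P.mode * P.L * (2 * P.B) + 10 * P.L) +
  (rate P.D * P.L * (P.NV * (P.Fm + P.B)) + scanCost * P.L * (P.b + 1) * P.g ^ 3) +
  ∑ t ∈ Finset.range P.n, P.mulCost (t % P.a)

end Par

namespace Consts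
variable (c : Consts)

/-- The algorithm for online matrix-vector multiplication. -/
def algorithm (N : ℕ) : OMv.Algorithm := ⟨c.setup ;; Par.preAll c.D c.mode, Par.mulAll c.D N c.mode⟩

def setupCost : ℕ := c.paramsCost + (powProg 53 52 c.K).weight + 10 * c.K + copyBody.weight + 100

theorem stores_powProg (d x : ℕ) : ∀ k, (powProg d x k).stores = ∅
  | 0 => rfl
  | k + 1 => by simp [powProg, Program.stores, stores_powProg d x k]

/-- The vectors, numbered by natural numbers. -/
def vecs {n : ℕ} (v : Fin n → Fin n → Bool) (t : ℕ) : ℕ → ℕ :=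
  if h : t < n then ofList ((List.finRange n).map fun j => (v ⟨t, h⟩ j).toNat) else 0

theorem vecs_le (v : Fin n → Fin n → Bool) (t i : ℕ) : vecs v t i ≤ 1 := by
  unfold vecs; split_ifs with h
  · unfold ofList
    by_cases hi : i < ((List.finRange n).map fun j => (v ⟨t, h⟩ j).toNat).length
    · rw [List.getD_eq_getElem _ _ hi, List.getElem_map]; exact Bool.toNat_le _
    · rw [List.getD_eq_default _ _ (by omega)]; omega
  · exact Nat.zero_le _

/-- Holds for every outcome of the random bits and every data structure: halting, the cost bound and
soundness of the outputs are unconditional. Probability enters only through `Reliable` in the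
completeness of `Product`. -/
theorem exists_session (hD : c.D = D.watched) (hn : 1 ≤ n)
    (ha : (c.par n hn).a ≤ n) (M v : Fin n → Fin n → Bool) (ω : ℕ → Bool) :
    ∃ res, Session ω State.blank ((c.algorithm D.bound).calls M v) res ∧
      (res.map Result.time).sum ≤ (c.par n hn).totalCost c.setupCost ∧
      ∀ t : Fin n, ∃ r, res[t.val + 1]? = some r ∧ (c.par n hn).Product D
        ((c.par n hn).copy (ofList (n :: rows M))) (vecs v) ω (vecs v t) r.out := by
  set P := c.par n hn with hP; set A := P.copy (ofList (n :: rows M))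
  have key := c.wp_setup (ω := ω) hn (inp := ofList (n :: rows M)) rfl (fun i => getD_rows_le M i) (T := 0)
  have hsto : ∀ b < 10, b ≠ 2 → b ∉ c.setup.stores := by
    intro b _ hb
    simp [setup, Program.stores, forLoop, copyBody, rootBody, params, ifLt, stores_powProg, hb]
  have hpre : ∀ b < 10, b ≠ 5 → b ∉ (Par.preAll c.D c.mode).stores := by
    intro b hb hb5 h
    have h1 : (Par.preHead ;; forLoop 52 17 53 1 (Par.edgeBody c.mode) ;; Par.preTail).stores ⊆ {11} := by
      cases c.mode <;> decide
    simp only [Par.preAll, forLoop, Par.preMachine] at h h1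
    simp only [Program.stores, Finset.mem_union, Finset.notMem_empty, false_or, or_false,
      Finset.mem_singleton] at h h1
    have h2 : b = 11 ∨ b ∈ (simulate c.D.preprocess).stores ∨ b = 5 := by
      rcases h with h | h
      · exact Or.inl (by simpa using h1 (by simpa [Program.stores] using h))
      · exact Or.inr h
    rcases h2 with h | h | h
    · omega
    · have := stores_simulate _ _ h; omega
    · omega
  have hwp : wp ω (c.algorithm D.bound).preprocess (fun σ T => P.Between D A (vecs v) ω 0 σ ∧
      T ≤ c.setupCost * P.L * ((n + 1) * (n + 1)) + (P.NV + 1) * (Par.preCost c.D c.mode * P.L *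
        (2 * P.B) + 10 * P.L)) (State.blank.withInput (ofList (n :: rows M))) 0 := by
    refine wp_seq (wp_mono key ?_); rintro σ₁ T₁ hF₁ ⟨s₁, k₁, z₁, d₁, t₁⟩
    refine wp_mono (Par.wp_preAll s₁ z₁) ?_; rintro σ₂ T₂ hF₂ ⟨s₂, k₂, t₂, z₂, b₂⟩
    have h1 : ∀ j, σ₂.arr 1 j = 0 := fun j => by
      rw [hF₂.2 1 (hpre 1 (by norm_num) (by norm_num)), hF₁.2 1 (hsto 1 (by norm_num) (by norm_num))]
      simp [State.withInput, State.blank]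
    have h4 : ∀ j, σ₂.arr 4 j = 0 := fun j => by
      rw [hF₂.2 4 (hpre 4 (by norm_num) (by norm_num)), d₁]
    refine ⟨Par.between_zero hD s₂ (by rw [k₂, k₁]) h1 h4 z₂ b₂, t₂.trans ?_⟩
    exact Nat.add_le_add_right (t₁.trans (by simp [setupCost, hP])) _
  obtain ⟨σ, t, T', he, hT, hB, hc⟩ := hwp
  obtain ⟨res, hs, ht, hr⟩ := Par.session_mulAll hD ha (vecs_le v) n 0 (Nat.zero_add _) σ hB
  refine ⟨⟨t, σ.output⟩ :: res, .cons he ?_, ?_, fun i => ?_⟩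
  · convert hs using 1
    rw [← List.range_eq_range', ← List.map_coe_finRange_eq_range, List.map_map]
    refine List.map_congr_left fun i _ => ?_; simp [vecs, algorithm, hP]; rfl
  · have h3 := Par.reserve_le hB.safe.fuel; rw [List.map_cons, List.sum_cons]; unfold Par.totalCost
    rw [Finset.range_eq_Ico]; have e1 : P.D = c.D := rfl; have e2 : P.n = n := rfl
    have e3 : P.mode = c.mode := rfl; rw [e1] at h3; rw [e2] at ht; rw [e1, e2, e3]
    show t + (res.map Result.time).sum ≤ _; omega
  · obtain ⟨r, h1, h2⟩ := hr i i.2; exact ⟨r, by simpa using h1, by rwa [Nat.zero_add] at h2⟩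

end Consts
namespace Block
variable (K : Block)

/-! ### The number of edges -/

theorem card_diag (l m k : ℕ) (h : l + m ≤ k) : ((Finset.Ico l (l + m) ×ˢ Finset.Ico l k).filter
    fun e => e.1 ≠ e.2).card = m * (k - l - 1) := by
  have h1 := Finset.card_filter_add_card_filter_not (s := Finset.Ico l (l + m) ×ˢ Finset.Ico l k)
    (fun e => e.1 = e.2)
  have h2 : ((Finset.Ico l (l + m) ×ˢ Finset.Ico l k).filter fun e => e.1 = e.2).card = m := by
    rw [show (Finset.Ico l (l + m) ×ˢ Finset.Ico l k).filter (fun e => e.1 = e.2) =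
      (Finset.Ico l (l + m)).image fun x => (x, x) from ?_, Finset.card_image_of_injective _
        fun x y h => by simpa using h, Nat.card_Ico, Nat.add_sub_cancel_left]
    ext ⟨x, y⟩
    simp only [Finset.mem_filter, Finset.mem_product, Finset.mem_Ico, Finset.mem_image, Prod.mk.injEq]
    constructor
    · rintro ⟨_, rfl⟩; exact ⟨x, by omega, rfl, rfl⟩
    · rintro ⟨z, hz, rfl, rfl⟩; omega
  rw [h2, Finset.card_product, Nat.card_Ico, Nat.card_Ico, Nat.add_sub_cancel_left] at h1
  rw [Nat.mul_sub, mul_one]; exact (Nat.sub_eq_of_eq_add (by rw [add_comm]; exact h1.symm)).symm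

/-- The lower bound counts the padding. The gadget adds at most a * b dynamic edges, a * b edges for
the block, a path edges and a edges back to 0. -/
theorem card_full (hw : 2 * K.a + K.b + 1 + K.w ≤ K.n) :
    K.w * (K.n - (2 * K.a + K.b + 1) - 1) ≤ K.full.card ∧
    K.full.card ≤ K.w * (K.n - (2 * K.a + K.b + 1) - 1) + (2 * (K.a * K.b) + 2 * K.a) := by
  rw [← card_diag _ _ _ hw, ← Finset.card_image_of_injective K.full
    (f := fun e => ((e.1 : ℕ), (e.2 : ℕ))) fun x y h => by simpa [Prod.ext_iff, Fin.ext_iff] using h]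
  constructor
  · refine Finset.card_le_card fun ⟨x, y⟩ h => ?_
    simp only [Finset.mem_filter, Finset.mem_product, Finset.mem_Ico] at h
    refine Finset.mem_image.2 ⟨(⟨x, by omega⟩, ⟨y, by omega⟩), (K.mem_full _ _).2 (Or.inl ?_), rfl⟩
    unfold staticEdge; simp only; omega
  · have h : K.full.image (fun e => ((e.1 : ℕ), (e.2 : ℕ))) ⊆
        ((Finset.Ico (2 * K.a + K.b + 1) (2 * K.a + K.b + 1 + K.w) ×ˢ
          Finset.Ico (2 * K.a + K.b + 1) K.n).filter fun e => e.1 ≠ e.2) ∪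
        ((Finset.range K.a ×ˢ Finset.Ioc K.a (K.a + K.b) ∪
          Finset.Ioc K.a (K.a + K.b) ×ˢ Finset.Ioc (K.a + K.b) (K.a + K.b + K.a)) ∪
        ((Finset.range K.a).image (fun x => (x, x + 1)) ∪
          Finset.Ioc (K.a + K.b) (K.a + K.b + K.a) ×ˢ {0})) := by
      rintro ⟨x, y⟩ hxy; obtain ⟨⟨u, v⟩, hm, he⟩ := Finset.mem_image.1 hxy
      simp only [Prod.mk.injEq] at he; obtain ⟨rfl, rfl⟩ := he; have hu := u.2; have hv := v.2
      rw [mem_full] at hm; unfold staticEdge dynEdge at hm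
      simp only [Finset.mem_union, Finset.mem_filter, Finset.mem_product, Finset.mem_Ico,
        Finset.mem_Ioc, Finset.mem_range, Finset.mem_image, Prod.mk.injEq, Finset.mem_singleton]
      rcases hm with (⟨h1, h2⟩ | ⟨h1, h2, h3, h4, -⟩ | h | h) | h
      · exact Or.inr (Or.inr (Or.inl ⟨u, h1, rfl, h2.symm⟩))
      all_goals omega
    refine (Finset.card_le_card h).trans ((Finset.card_union_le _ _).trans (Nat.add_le_add_left ?_ _))
    refine (Finset.card_union_le _ _).trans (Nat.add_le_add ((Finset.card_union_le _ _).trans ?_)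
      ((Finset.card_union_le _ _).trans (Nat.add_le_add Finset.card_image_le le_rfl |>.trans ?_)))
    · simp only [Finset.card_product, Finset.card_range, Nat.card_Ioc, Nat.add_sub_cancel_left]
      rw [mul_comm K.b, two_mul]
    · simp only [Finset.card_product, Finset.card_range, Nat.card_Ioc, Nat.add_sub_cancel_left,
        Finset.card_singleton]
      omega

end Block

/-! ### The simulated preprocessing receives the input of the instance -/

namespace Par
variable {P : Par} {D : DataStructure} {A : ℕ → ℕ} {vec : ℕ → ℕ → ℕ}

theorem sum_fullBit (h : 2 * P.a + P.b + 1 ≤ P.nG) (id ρ : ℕ) :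
    ∑ e ∈ Finset.range P.nGG, P.fullBit A (id / P.g) e = (P.runBlock h A vec id ρ).full.card := by
  rw [DynSC.Block.full, Finset.card_filter, Finset.sum_range]
  refine (Fintype.sum_equiv (finProdFinEquiv (m := P.nG) (n := P.nG)) _ _ fun ⟨x, y⟩ => ?_).symm
  have hx : (y.val + P.nG * x.val) / P.nG = x := by
    rw [Nat.add_mul_div_left _ _ P.hnG, Nat.div_eq_of_lt y.2, zero_add]
  have hy : (y.val + P.nG * x.val) % P.nG = y := by
    rw [Nat.add_mul_mod_self_left, Nat.mod_eq_of_lt y.2]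
  simp only [fullBit, finProdFinEquiv_apply_val, hx, hy]; rfl

theorem preInput_eq (h : 2 * P.a + P.b + 1 ≤ P.nG) (id ρ : ℕ) : P.preInput A (id / P.g) =
    ofList ((P.runBlock h A vec id ρ).n :: (P.runBlock h A vec id ρ).toInstance.numEdges ::
      rows fun x y => decide ((x, y) ∈ (P.runBlock h A vec id ρ).toInstance.start)) := by
  have hn : (P.runBlock h A vec id ρ).n = P.nG := rfl; funext i; rcases i with _ | _ | i
  · rfl
  · rw [DynSC.Block.numEdges_toInstance, preInput, if_neg (by omega), if_pos rfl, sum_fullBit h]; rfl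
  · rw [preInput, if_neg (by omega), if_neg (by omega)]; show _ = (rows _).getD i 0
    by_cases hi : i < P.nGG
    · have hd : i / P.nG < P.nG := Nat.div_lt_of_lt_mul hi
      have hm : i % P.nG < P.nG := Nat.mod_lt _ P.hnG
      have e := getD_rows (fun x y => decide ((x, y) ∈ (P.runBlock h A vec id ρ).toInstance.start))
        ⟨_, hd⟩ ⟨_, hm⟩
      simp only [hn, Nat.div_add_mod'] at e
      rw [if_pos (by omega), e, show i + 1 + 1 - 2 = i by omega, startBit]
      have := (P.runBlock h A vec id ρ).mem_start ⟨_, hd⟩ ⟨_, hm⟩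
      by_cases hs : (⟨_, hd⟩, ⟨_, hm⟩) ∈ (P.runBlock h A vec id ρ).start
      · exact (if_pos (this.1 hs)).trans (congrArg Bool.toNat (decide_eq_true hs)).symm
      · exact (if_neg fun hc => hs (this.2 hc)).trans (congrArg Bool.toNat (decide_eq_false hs)).symm
    · rw [if_neg (by omega), List.getD_eq_default _ _ (by rw [length_rows, hn]; unfold nGG at hi; omega)]

end Par
open MeasureTheory

namespace Par
variable {P : Par} {D : DataStructure} {A : ℕ → ℕ} {vec : ℕ → ℕ → ℕ} {ω : ℕ → Bool}

/-! ### Majorities -/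

/-- The data structure is correct and fast in all runs for the block `β`. -/
structure Suitable (P : Par) (D : DataStructure) (A : ℕ → ℕ) (vec : ℕ → ℕ → ℕ) (β : ℕ) : Prop where
  large : 2 * P.a + P.b + 1 ≤ P.nG
  correct : ∀ id, id / P.g = β → ∀ ρ, D.Correct (P.runBlock large A vec id ρ).toInstance
  run : ∀ id, id / P.g = β → ∀ ρ ω, ∃ r₀ rs,
    Session ω State.blank (D.calls (P.runBlock large A vec id ρ).toInstance) (r₀ :: rs) ∧
      40 * r₀.time < P.Fpre ∧ 40 * (rs.map Result.time).sum + 8 * (P.a * P.E) < P.Frun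

theorem runBlock_congr {h : 2 * P.a + P.b + 1 ≤ P.nG} {id' ρ : ℕ} (e : id / P.g = id' / P.g) :
    P.runBlock h A vec id ρ = P.runBlock h A vec id' ρ := by
  simp only [runBlock, e]

/-- The input of the preprocessing depends on the matrix and the guess but not on the run, so all
instances of a machine share the state `τ₀` after their first call, and their sessions can be
continued from there. -/
theorem Suitable.legit {β : ℕ} (h : P.Suitable D A vec β) (hid : id / P.g = β) (ω : ℕ → Bool) :
    ∃ τ₀, P.Legit D A vec ω id τ₀ ∧ ∀ ρ r₀ rs, Session (tape P.g (id % P.g) ω) State.blank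
      (D.calls (P.runBlock h.large A vec id ρ).toInstance) (r₀ :: rs) →
      Session (tape P.g (id % P.g) ω) τ₀ (P.runCalls h.large D A vec id ρ (P.a * P.E)) rs := by
  obtain ⟨r₀, rs, hs, hr, -⟩ := h.run id hid 0 (tape P.g (id % P.g) ω)
  cases hs with
  | cons he hs =>
    rename_i τ₀ t
    have key : ∀ ρ r₀ rs, Session (tape P.g (id % P.g) ω) State.blank
        (D.calls (P.runBlock h.large A vec id ρ).toInstance) (r₀ :: rs) →
        Session (tape P.g (id % P.g) ω) τ₀ (P.runCalls h.large D A vec id ρ (P.a * P.E)) rs := by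
      intro ρ r rs' hs'
      cases hs' with
      | cons he' hs' =>
        rw [← preInput_eq h.large id ρ] at he'; rw [← preInput_eq h.large id 0] at he
        obtain ⟨-, rfl⟩ := he.det he'; exact hs'
    refine ⟨τ₀, ⟨h.large, ⟨t, ?_, hr⟩, fun ρ _ => ?_⟩, key⟩
    · rw [preInput_eq h.large id 0]; exact he
    · obtain ⟨r₀', rs', hs', -, ht'⟩ := h.run id hid ρ (tape P.g (id % P.g) ω)
      exact ⟨rs', key ρ r₀' rs' hs', ht'⟩

/-- The data structure answers query `q` in multiplication number `t` correctly. -/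
def rightSet (h : 2 * P.a + P.b + 1 ≤ P.nG) (D : DataStructure) (A : ℕ → ℕ) (vec : ℕ → ℕ → ℕ)
    (q t : ℕ) : Set (ℕ → Bool) :=
  {ω | ∃ res, Session ω State.blank (D.calls (P.runBlock h A vec (q / P.a * P.g) (t / P.a)).toInstance)
    res ∧ ∃ r, res[((P.runBlock h A vec (q / P.a * P.g) (t / P.a)).opsTo
      (t % P.a * P.E + P.b + q % P.a)).length + 1]? = some r ∧
      (P.Hit A (vec t) q ∧ r.out 0 = 1 ∨ ¬ P.Hit A (vec t) q ∧ r.out 0 = 0)}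

/-- The instance depends on the block only; copy number 0 of the machine, with index `q / P.a *
P.g`, stands for all copies. The operations do not depend on the random bits, since matrix and
vectors are fixed in advance. -/
theorem coin_rightSet (h : P.Suitable D A vec (q / P.a)) :
    2 / 3 ≤ coin (rightSet h.large D A vec q t) := by
  have hi := Nat.mod_lt q P.ha; have hs := Nat.mod_lt t P.ha
  have hq := (P.runBlock h.large A vec (q / P.a * P.g) (t / P.a)).opAt_query' hs hi
  have ht := (P.runBlock h.large A vec (q / P.a * P.g) (t / P.a)).query_iff hs hi
  obtain ⟨h1, h2⟩ := DynSC.Block.getElem?_ops _ hq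
  have hid : q / P.a * P.g / P.g = q / P.a := Nat.mul_div_cancel _ P.hg
  refine (h.correct _ hid (t / P.a) _ _ _ _ _ h1).trans (measure_mono ?_)
  have e : (∃ c < P.b, P.blockMat A (q / P.a * P.g / P.g) (q % P.a) c = true ∧
      P.blockVec (vec (t / P.a * P.a + t % P.a)) (q / P.a * P.g / P.g) c = true) ↔
      P.Hit A (vec t) q := by rw [hid, Nat.div_add_mod']; rfl
  rintro ω ⟨r₀, rs, r, hse, hr, hc⟩
  refine ⟨r₀ :: rs, hse, r, by rw [List.getElem?_cons_succ]; exact hr, ?_⟩; rw [h2] at hc; rw [← e]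
  exact hc.imp (fun hc => ⟨ht.1 hc.1, hc.2⟩) fun hc => ⟨fun hh => hc.1 (ht.2 hh), hc.2⟩

theorem vote_eq {c : ℕ} (h : P.Suitable D A vec (q / P.a)) (hc : c < P.g)
    (hv : P.Voted D A vec ω t σ (q / P.a * P.g + c)) (hr : tape P.g c ω ∈ rightSet h.large D A vec q t) :
    (P.Hit A (vec t) q → σ.arr 3 ((q / P.a * P.g + c) * P.a + q % P.a) = 1) ∧
    (¬ P.Hit A (vec t) q → σ.arr 3 ((q / P.a * P.g + c) * P.a + q % P.a) = 0) := by
  have hd : (q / P.a * P.g + c) / P.g = q / P.a := by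
    rw [mul_comm, Nat.mul_add_div P.hg, Nat.div_eq_of_lt hc, add_zero]
  have hm : (q / P.a * P.g + c) % P.g = c := by
    rw [mul_comm, Nat.mul_add_mod, Nat.mod_eq_of_lt hc]
  obtain ⟨τ₀, hL, hses⟩ := h.legit hd ω; obtain ⟨res, hs, r, hres, hcor⟩ := hr
  rw [runBlock_congr (id' := q / P.a * P.g + c) (by rw [hd, Nat.mul_div_cancel _ P.hg])] at hs hres
  cases hs with
  | cons he hs' =>
    rename_i τ₁ t₁ rs
    have := hv τ₀ hL (q % P.a) (Nat.mod_lt _ P.ha) rs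
      (hses _ _ _ (by rw [hm]; exact Session.cons he hs')) r (by simpa using hres)
    rw [this]; refine ⟨fun hH => if_pos ?_, fun hH => if_neg ?_⟩
    · exact (hcor.resolve_right fun h => h.1 hH).2
    · rw [(hcor.resolve_left fun h => hH h.1).2]; norm_num

open Classical in
/-- Half of the copies are wrong about query `q` in multiplication number `t`. -/
def badSet (P : Par) (D : DataStructure) (A : ℕ → ℕ) (vec : ℕ → ℕ → ℕ) (γ q t : ℕ) : Set (ℕ → Bool) :=
  {ω | ∃ h : P.Suitable D A vec (q / P.a), P.guess (q / P.a) = γ ∧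
    P.g ≤ 2 * ((Finset.range P.g).filter fun c => tape P.g c ω ∉ rightSet h.large D A vec q t).card}

/-- For blocks that are not suitable the set is empty by definition, so nothing has to be known of
wrong guesses. -/
theorem coin_badSet (γ q t : ℕ) : coin.real (P.badSet D A vec γ q t) ≤ Real.exp (-(P.g : ℝ) / 18) := by
  classical
  by_cases h : P.Suitable D A vec (q / P.a)
  · have hm : MeasurableSet (rightSet h.large D A vec q t) := measurableSet_session _ _ _
    refine le_trans ?_ (coin_majority hm (coin_rightSet (t := t) h) P.hg); refine measureReal_mono ?_
    rintro ω ⟨_, _, h3⟩; exact h3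
  · have : P.badSet D A vec γ q t = ∅ := by
      ext ω; simp [badSet, h]
    rw [this]; simp; positivity

/-- Outside the bad sets fewer than half of the copies err, and only these can make the number of
votes differ from `g` (hit) or `0` (no hit). -/
theorem reliable_of {γ : ℕ} (h : ∀ β < P.NB, P.guess β = γ → P.Suitable D A vec β)
    (hω : ∀ q < P.NQ, ∀ t < P.n, ω ∉ P.badSet D A vec γ q t) : P.Reliable D A vec ω γ := by
  classical
  intro t ht σ h0 h3 hV q hq hg; have hβ := query_lt hq; have hS := h _ hβ hg; have hb := hω q hq t ht
  simp only [badSet, Set.mem_ofPred_eq, not_exists, not_and, not_le] at hb; have hb := hb hS hg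
  set B := (Finset.range P.g).filter fun c => tape P.g c ω ∉ rightSet hS.large D A vec q t
  have hv : ∀ c < P.g, c ∉ B → _ := fun c hc hcB => vote_eq hS hc (hV _ (by
      have h1 : (q / P.a + 1) * P.g ≤ P.NB * P.g := Nat.mul_le_mul_right _ hβ; rw [add_mul] at h1
      unfold NV; omega)) (by
        by_contra hn; exact hcB (Finset.mem_filter.2 ⟨Finset.mem_range.2 hc, hn⟩))
  rw [h0]
  have hcard : ∑ c ∈ Finset.range P.g, (if c ∈ B then 1 else 0) = B.card := by
    rw [← Finset.card_filter]; congr 1; ext c; simp [B]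
  by_cases hH : P.Hit A (vec t) q
  · simp only [hH, true_iff]
    have : P.g ≤ P.votes σ q + B.card := by
      rw [← hcard, votes, ← Finset.sum_add_distrib]
      calc P.g = ∑ c ∈ Finset.range P.g, 1 := by simp
        _ ≤ _ := Finset.sum_le_sum fun c hc => by
          by_cases hcB : c ∈ B
          · rw [if_pos hcB]; omega
          · rw [(hv c (Finset.mem_range.1 hc) hcB).1 hH]; omega
    omega
  · simp only [hH, false_iff, not_lt]
    have : P.votes σ q ≤ B.card := by
      rw [← hcard, votes]; refine Finset.sum_le_sum fun c hc => ?_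
      by_cases hcB : c ∈ B
      · rw [if_pos hcB]; exact h3 _
      · rw [(hv c (Finset.mem_range.1 hc) hcB).2 hH]; omega
    omega

/-- Union bound over all queries and all multiplications. Only the one guess `γ` has to be reliable,
and measurability of `G` is not needed since `G` and the bad sets together cover everything. -/
theorem coin_reliable {γ : ℕ} (h : ∀ β < P.NB, P.guess β = γ → P.Suitable D A vec β)
    (hsmall : (P.NQ * P.n : ℕ) * Real.exp (-(P.g : ℝ) / 18) ≤ 1 / 3) {G : Set (ℕ → Bool)}
    (hG : ∀ ω, P.Reliable D A vec ω γ → ω ∈ G) : 2 / 3 ≤ coin G := by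
  set U : Set (ℕ → Bool) := ⋃ q ∈ Finset.range P.NQ, ⋃ t ∈ Finset.range P.n, P.badSet D A vec γ q t
  have hU : coin.real U ≤ 1 / 3 := by
    refine le_trans ((measureReal_biUnion_finset_le _ _).trans (Finset.sum_le_sum fun q _ =>
      (measureReal_biUnion_finset_le _ _).trans (Finset.sum_le_sum fun t _ => coin_badSet γ q t))) ?_
    simp only [Finset.sum_const, Finset.card_range, nsmul_eq_mul]
    rw [← mul_assoc]; exact_mod_cast hsmall
  have h1 : coin.real (Set.univ : Set (ℕ → Bool)) ≤ coin.real (G ∪ U) := by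
    refine measureReal_mono fun ω _ => ?_
    by_cases hω : ω ∈ U
    · exact Or.inr hω
    · refine Or.inl (hG ω (reliable_of h fun q hq t ht hb => hω ?_))
      simp only [U, Set.mem_iUnion, Finset.mem_range]; exact ⟨q, hq, t, ht, hb⟩
  have h2 := measureReal_union_le (μ := coin) G U; rw [probReal_univ] at h1
  have h3 : (2 / 3 : ℝ) ≤ coin.real G := by linarith
  rw [Measure.real, ← ENNReal.ofReal_le_iff_le_toReal (measure_ne_top _ _)] at h3
  refine le_trans (le_of_eq ?_) h3; rw [ENNReal.ofReal_div_of_pos (by norm_num)]; norm_num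

end Par

/-- The number of edges can be brought into the admissible range. -/
theorem exists_guess {c₁ c₂ c₃ q : ℝ} (hc₁ : 0 < c₁) {g a b r : ℕ} (ha : a = g ^ s)
    (hb : b = g ^ r) (hrs : r ≤ s) (hg : 12 ≤ g) (hq₁ : (g : ℝ) ^ (r + s + 2) ≤ q)
    (hq₂ : q ≤ (g : ℝ) ^ (r + s + 3)) (hq₃ : c₁ * q ≤ c₃ * ((g : ℝ) ^ 2 * a ^ 2))
    (h₁ : 11 ≤ (1 - c₃) * g) (h₂ : 5 ≤ (c₂ - c₁) * g) (h₃ : 2 * c₁ + 7 ≤ g) :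
    ∃ γ < g ^ 3, 2 * a + b + 1 + γ * b ≤ g * a ∧ c₁ * q ≤ (γ * b * (g * a - (2 * a + b + 1) - 1) : ℕ) ∧
      ((γ * b * (g * a - (2 * a + b + 1) - 1) + (2 * (a * b) + 2 * a) : ℕ) : ℝ) ≤ c₂ * q := by
  have hg0 : 0 < g := by omega
  have hb1 : 1 ≤ b := hb ▸ Nat.one_le_pow _ _ hg0
  have hba : b ≤ a := by rw [ha, hb]; exact Nat.pow_le_pow_right hg0 hrs
  have hga : 12 * a ≤ g * a := Nat.mul_le_mul_right _ hg
  obtain ⟨Z, hZ⟩ : ∃ Z, g * a = 2 * a + b + 1 + (Z + 1) := ⟨g * a - (2 * a + b + 1) - 1, by omega⟩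
  have e : g * a - (2 * a + b + 1) - 1 = Z := by omega
  rw [e]
  have hZr : (g : ℝ) * a = 2 * a + b + 2 + Z := by
    have : ((g * a : ℕ) : ℝ) = ((2 * a + b + 1 + (Z + 1) : ℕ) : ℝ) := by rw [hZ]
    push_cast at this; linarith
  have xa : (1 : ℝ) ≤ a := by exact_mod_cast hb1.trans hba
  have xb : (1 : ℝ) ≤ b := by exact_mod_cast hb1
  have xba : (b : ℝ) ≤ a := by exact_mod_cast hba
  have xg : (12 : ℝ) ≤ g := by exact_mod_cast hg
  have ea : (a : ℝ) = (g : ℝ) ^ s := by rw [ha]; push_cast; rfl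
  have eb : (b : ℝ) = (g : ℝ) ^ r := by rw [hb]; push_cast; rfl
  have q1 : (g : ℝ) ^ 2 * (a * b) ≤ q := by rw [ea, eb]; refine le_trans (le_of_eq ?_) hq₁; ring
  have q2 : q ≤ (g : ℝ) ^ 3 * (a * b) := by rw [ea, eb]; refine hq₂.trans (le_of_eq ?_); ring
  have eZ : 2 * a + b + 1 + (Z + 1) = g * a := hZ.symm; have ha1 : 1 ≤ a := hb1.trans hba
  clear e hZ ha hb hga hba; have hZ5 : ((g : ℝ) - 5) * a ≤ Z := by linarith
  have hZ0 : (0 : ℝ) < Z := by nlinarith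
  have hbZ : 0 < (b : ℝ) * Z := by positivity
  have hq0 : 0 < q := lt_of_lt_of_le (by positivity) q1; have k1 := Nat.le_ceil (c₁ * q / (b * Z))
  -- Each of the first padding vertices emits `Z` edges, so one unit of the guess is worth `b * Z`
  -- edges; γ is the least number of units that reaches the lower end of the window.
  have k2 := Nat.ceil_lt_add_one (a := c₁ * q / (b * Z)) (by positivity); set γ := ⌈c₁ * q / (b * Z)⌉₊
  rw [div_le_iff₀ hbZ] at k1; rw [← sub_lt_iff_lt_add, lt_div_iff₀ hbZ] at k2
  have x5 : (0 : ℝ) < (g : ℝ) - 5 := by linarith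
  have k3 : ((γ : ℝ) - 1) * b * ((g - 5) * a) ≤ c₁ * q := by
    rcases le_total (γ : ℝ) 1 with h | h
    · have : ((γ : ℝ) - 1) * (b * ((g - 5) * a)) ≤ 0 :=
        mul_nonpos_of_nonpos_of_nonneg (by linarith) (by positivity)
      nlinarith
    · have : ((γ : ℝ) - 1) * b * ((g - 5) * a) ≤ ((γ : ℝ) - 1) * b * Z :=
        mul_le_mul_of_nonneg_left hZ5 (mul_nonneg (by linarith) (by linarith))
      linarith
  refine ⟨γ, ?_, ?_, ?_, ?_⟩
  -- From (γ - 1) * b * (g - 5) * a ≤ c₁ * q ≤ c₁ * g^3 * a * b, as 2 * c₁ < g - 5.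
  · have h3 : ((γ : ℝ) - 1) * 2 < (g : ℝ) ^ 3 := by
      refine lt_of_mul_lt_mul_right (a := (b : ℝ) * ((g - 5) * a)) ?_ (by positivity)
      calc ((γ : ℝ) - 1) * 2 * (b * ((g - 5) * a)) ≤ 2 * (c₁ * q) := by linarith
        _ ≤ 2 * c₁ * ((g : ℝ) ^ 3 * (a * b)) := by
          linarith [mul_le_mul_of_nonneg_left q2 hc₁.le]
        _ < (g - 5) * ((g : ℝ) ^ 3 * (a * b)) := mul_lt_mul_of_pos_right (by linarith) (by positivity)
        _ = _ := by ring
    have h4 : (2 : ℝ) ≤ (g : ℝ) ^ 3 := by nlinarith [pow_le_pow_left₀ (by norm_num) xg 3]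
    have : (γ : ℝ) < (g : ℝ) ^ 3 := by linarith
    exact_mod_cast this
  -- The `γ * b` emitting vertices must fit into the padding. Here the density matters: c₁ * q is at
  -- most c₃ times the square of the number of vertices with c₃ < 1, and the difference makes room
  -- for the gadget when g is large.
  · have h3 : ((γ : ℝ) - 1) * b ≤ (g - 6) * a := by
      refine le_of_mul_le_mul_right (a := ((g : ℝ) - 5) * a) ?_ (by positivity)
      calc ((γ : ℝ) - 1) * b * ((g - 5) * a) ≤ c₃ * g * (g * (a : ℝ) ^ 2) := by linarith
        _ ≤ (g - 11) * (g * (a : ℝ) ^ 2) := mul_le_mul_of_nonneg_right (by linarith) (by positivity)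
        _ ≤ _ := by linarith [sq_nonneg (a : ℝ)]
    have : (γ : ℝ) * b ≤ Z := by linarith
    have : γ * b ≤ Z := by exact_mod_cast this
    omega
  · push_cast; linarith
  -- Rounding up costs at most `b * Z ≤ g * a * b` edges and the gadget at most 4 * a * b; both
  -- together fit into (c₂ - c₁) * q because q ≥ g² * a * b.
  · push_cast; have h5 : (b : ℝ) * Z ≤ g * (a * b) := by nlinarith
    have h6 : 5 * (g * (a * b : ℝ)) ≤ (c₂ - c₁) * q := by
      have := mul_le_mul_of_nonneg_right h₂ (show (0 : ℝ) ≤ g * (a * b) by positivity)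
      have := mul_le_mul_of_nonneg_left q1 (show (0 : ℝ) ≤ c₂ - c₁ by nlinarith); linarith
    have h7 : (a : ℝ) ≤ a * b := by nlinarith
    have h8 : 12 * (a * b : ℝ) ≤ g * (a * b) := mul_le_mul_of_nonneg_right xg (by positivity); linarith

/-! ### Choice of the exponents and cost of a run for the right guess -/

open Filter

theorem eventually_le_mul {k : ℝ} (hk : 0 < k) (c : ℝ) : ∀ᶠ g : ℕ in atTop, c ≤ k * g :=
  (tendsto_natCast_atTop_atTop.const_mul_atTop hk).eventually_ge_atTop c

/-- For δ = 1/2 the window is quadratic in the number of vertices and c₃ = c₁ < 1 works. For δ < 1/2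
the exponent 1/(1-δ) is below 2, and the left side is eventually negligible. -/
theorem exists_density {δ c₁ : ℝ} (hδ : 0 < δ) (hδ' : δ ≤ 1 / 2) (hf : δ = 1 / 2 → c₁ < 1) (s : ℕ) :
    ∃ c₃ < 1, ∀ᶠ g : ℕ in atTop,
      c₁ * ((g : ℝ) ^ (s + 1)) ^ (1 / (1 - δ)) ≤ c₃ * ((g : ℝ) ^ 2 * ((g : ℝ) ^ s) ^ 2) := by
  rcases eq_or_lt_of_le hδ' with rfl | h
  · refine ⟨c₁, hf rfl, Eventually.of_forall fun g => le_of_eq ?_⟩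
    rw [show (1 : ℝ) / (1 - 1 / 2) = (2 : ℕ) by norm_num, Real.rpow_natCast]; ring
  · refine ⟨1 / 2, by norm_num, ?_⟩; have hp : 1 / (1 - δ) < 2 := by rw [div_lt_iff₀] <;> linarith
    have hpos : 0 < (s + 1 : ℝ) * (2 - 1 / (1 - δ)) := mul_pos (by positivity) (by linarith)
    have := ((tendsto_rpow_atTop hpos).comp tendsto_natCast_atTop_atTop).eventually_ge_atTop (2 * c₁)
    filter_upwards [this, eventually_gt_atTop 0] with g hg h0
    have hx : (0 : ℝ) < g := by exact_mod_cast h0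
    have e : (g : ℝ) ^ 2 * ((g : ℝ) ^ s) ^ 2 = (g : ℝ) ^ ((s + 1 : ℝ) * (2 - 1 / (1 - δ))) *
        ((g : ℝ) ^ (s + 1)) ^ (1 / (1 - δ)) := by
      rw [← Real.rpow_natCast _ (s + 1), ← Real.rpow_mul hx.le, ← Real.rpow_add hx, ← pow_mul, ← pow_add,
        ← Real.rpow_natCast]
      congr 1; push_cast; ring
    rw [e]
    have := mul_le_mul_of_nonneg_right hg
      (show (0 : ℝ) ≤ ((g : ℝ) ^ (s + 1)) ^ (1 / (1 - δ)) by positivity)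
    simp only [Function.comp] at this; linarith

theorem sum_time_le {Q : ℝ} (hQ : 0 ≤ Q) : ∀ (ops : List (Operation n)) (rs : List Result),
    rs.length = ops.length → (∀ (i : ℕ) (u v a b : Fin n) (r : Result),
      ops[i]? = some (.query u v a b) → rs[i]? = some r → (r.time : ℝ) ≤ Q) →
    ((rs.map Result.time).sum : ℝ) ≤ updateTime ops rs + ops.length * Q
  | [], [], _, _ => by simp [updateTime]
  | [], _ :: _, h, _ => by simp at h
  | _ :: _, [], h, _ => by simp at h
  | op :: ops, r :: rs, h, hq => by
    have ih := sum_time_le hQ ops rs (by simpa using h) fun i u v a b r' h1 h2 =>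
      hq (i + 1) u v a b r' (by simpa using h1) (by simpa using h2)
    cases op with
    | update a b => simp only [updateTime, List.zipWith_cons_cons, List.sum_cons, List.map_cons,
        List.length_cons] at ih ⊢; push_cast at ih ⊢; linarith
    | query u v a b =>
      have := hq 0 u v a b r rfl rfl
      simp only [updateTime, List.zipWith_cons_cons, List.sum_cons, List.map_cons,
        List.length_cons] at ih ⊢; push_cast at ih ⊢; linarith

/-- A saving of m^ε in a bound is a saving by any factor z ≤ m^ε', if ε' ≤ ε. This replaces real
exponents by the integral power g^50. -/
theorem rpow_sub_mul_le {C m y q z e ε ε' : ℝ} (hm : 1 ≤ m) (he : ε' ≤ ε) (hz : 0 < z) (hy : m ^ e ≤ y)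
    (hzm : z ≤ m ^ ε') (hq : q ≤ C * m ^ (e - ε)) : q * z ≤ |C| * y := by
  have hm0 : 0 < m := by linarith
  have h1 : q ≤ |C| * m ^ (e - ε') := hq.trans (mul_le_mul (le_abs_self C)
    (Real.rpow_le_rpow_of_exponent_le hm (by linarith)) (by positivity) (abs_nonneg C))
  calc q * z ≤ |C| * m ^ (e - ε') * z := mul_le_mul_of_nonneg_right h1 hz.le
    _ ≤ |C| * m ^ (e - ε') * m ^ ε' := mul_le_mul_of_nonneg_left hzm (by positivity)
    _ = |C| * m ^ e := by rw [mul_assoc, ← Real.rpow_add hm0]; congr 2; ring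
    _ ≤ _ := mul_le_mul_of_nonneg_left hy (abs_nonneg C)

/-- After multiplication by x^50 the updates and the at most 3 * x^(2s) operations cost
O(x^(r+2s+4)), while the target becomes x^(r+2s+32). One of the spare factors x absorbs the
constants. -/
theorem lt_pow_of_le {x C c T U l Q z : ℝ} {r : ℕ} (hr : 30 ≤ r) (x1 : 1 ≤ x) (hC : 0 ≤ C) (hc : 0 < c)
    (hU : U * x ^ 50 ≤ C * (c * x ^ (r + 2 * s + 4))) (hQ : Q * x ^ 50 = C * ((c + 1) * x ^ (r + 2)))
    (hl : l ≤ 3 * x ^ (2 * s)) (hT : T ≤ U + l * Q) (hz : z ≤ 3 * x ^ (2 * s))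
    (hx : 160 * (C * (c + 1)) + 25 ≤ 1 * x) : 40 * T + 8 * z < x ^ (2 * s + r - 18) := by
  have x0 : 0 < x := by linarith
  have z0 : 0 < x ^ 50 := by positivity
  have hS : T * x ^ 50 ≤ 4 * (C * (c + 1)) * x ^ (r + 2 * s + 4) := by
    have l1 : l * (Q * x ^ 50) ≤ 3 * (C * (c + 1)) * x ^ (r + 2 * s + 4) := by
      rw [hQ]
      calc _ ≤ 3 * x ^ (2 * s) * (C * ((c + 1) * x ^ (r + 2))) :=
            mul_le_mul_of_nonneg_right hl (by positivity)
        _ = 3 * (C * (c + 1)) * x ^ (r + 2 * s + 2) := by ring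
        _ ≤ _ := mul_le_mul_of_nonneg_left (pow_le_pow_right₀ x1 (by omega)) (by positivity)
    have l2 := mul_le_mul_of_nonneg_right hT z0.le
    have l3 := mul_nonneg hC (show 0 ≤ x ^ (r + 2 * s + 4) by positivity); linarith
  have hkr : x ^ (2 * s + r - 18) * x ^ 50 = x ^ (r + 2 * s + 31) * x := by
    rw [← pow_add, ← pow_succ]; congr 1; omega
  have l4 : x ^ (r + 2 * s + 4) ≤ x ^ (r + 2 * s + 31) := pow_le_pow_right₀ x1 (by omega)
  have l5 : x ^ (2 * s) * x ^ 50 ≤ x ^ (r + 2 * s + 31) := by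
    rw [← pow_add]; exact pow_le_pow_right₀ x1 (by omega)
  have l6 : 0 < x ^ (r + 2 * s + 31) := by positivity
  refine lt_of_mul_lt_mul_right (a := x ^ 50) ?_ z0.le; rw [hkr]
  have l7 := mul_le_mul_of_nonneg_right hz z0.le
  have l8 := mul_le_mul_of_nonneg_left l4 (show 0 ≤ 160 * (C * (c + 1)) by positivity)
  have l9 := mul_le_mul_of_nonneg_left hx l6.le; linarith

/-- If the data structure exists, then for one guess the number of edges is admissible, and then the
data structure is fast enough. -/
theorem DataStructure.Achieves.exists_suitable {mode : Mode} {δ c₁ c₂ ε : ℝ}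
    (hD : D.Achieves mode δ c₁ c₂ ε) (hδ : 0 < δ) (hδ' : δ ≤ 1 / 2) (hc₁ : 0 < c₁) (hc : c₁ < c₂)
    (hf : δ = 1 / 2 → c₁ < 1) (hε : 0 < ε) :
    ∃ s r kp kr g₁ : ℕ, 30 ≤ r ∧ r ≤ s ∧ kr + 18 = 2 * s + r ∧ ∀ P : Par, P.mode = mode → g₁ ≤ P.g →
      P.a = P.g ^ s → P.b = P.g ^ r → P.nG = P.g ^ (s + 1) → P.Fpre = P.g ^ kp → P.Frun = P.g ^ kr →
      ∃ γ < P.g ^ 3, ∀ A vec β, P.guess β = γ → P.Suitable D A vec β := by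
  obtain ⟨C, k, hD⟩ := hD; have hδ1 : 0 < 1 - δ := by linarith
  set p := 1 / (1 - δ) with hp; set η := δ / (1 - δ) with hη
  have hpη : p = 1 + η := by rw [hp, hη]; field_simp; ring
  have hpδ : p * δ = η := by rw [hp, hη]; ring
  have hη1 : η ≤ 1 := by rw [hη, div_le_one hδ1]; linarith
  have hηδ : δ ≤ η := by rw [hη, le_div_iff₀ hδ1]; nlinarith
  -- `ε' ≤ δ ≤ η` makes (s + 1) * η at least 50 below, so that r becomes large; also ε itself might
  -- exceed δ.
  obtain ⟨ε', hε', h1ε, h2⟩ : ∃ ε' > 0, ε' ≤ ε ∧ ε' ≤ δ :=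
    ⟨min ε δ, lt_min hε hδ, min_le_left _ _, min_le_right _ _⟩
  -- So that the saving nG^ε' is at least g^50.
  obtain ⟨s, hs⟩ : ∃ s : ℕ, 50 ≤ ((s : ℝ) + 1) * ε' := by
    obtain ⟨s, hs⟩ := exists_nat_ge (50 / ε'); rw [div_le_iff₀ hε'] at hs; exact ⟨s, by linarith⟩
  have hs1 : (0 : ℝ) < s + 1 := by positivity
  -- b = g^r is nG^η divided by a factor between g and g^2. Then q = nG^(1+η) lies between g^(r+s+2)
  -- and g^(r+s+3), and q^δ = nG^η is at most g^(r+2).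
  obtain ⟨r, hr1, hr2⟩ : ∃ r : ℕ, (r : ℝ) + 1 ≤ (s + 1) * η ∧ (s + 1) * η ≤ r + 2 := by
    have h50 : 50 ≤ (s + 1) * η := hs.trans (mul_le_mul_of_nonneg_left (h2.trans hηδ) hs1.le)
    have h3 : 50 ≤ ⌊(s + 1) * η⌋₊ := Nat.le_floor (by exact_mod_cast h50)
    refine ⟨⌊(s + 1) * η⌋₊ - 1, ?_, ?_⟩ <;> rw [Nat.cast_sub (by omega)] <;> push_cast
    · linarith [Nat.floor_le (show 0 ≤ (s + 1) * η by linarith)]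
    · linarith [Nat.lt_floor_add_one ((s + 1) * η)]
  have hrs : r ≤ s := by
    have : (s + 1) * η ≤ s + 1 := mul_le_of_le_one_right hs1.le hη1; have : (r : ℝ) ≤ s := by linarith
    exact_mod_cast this
  have hr30 : 30 ≤ r := by
    have : 50 ≤ (s + 1) * η := hs.trans (mul_le_mul_of_nonneg_left (h2.trans hηδ) hs1.le)
    have : (30 : ℝ) ≤ r := by linarith
    exact_mod_cast this
  obtain ⟨c₃, hc₃, hev⟩ := exists_density hδ hδ' hf s
  obtain ⟨g₁, hg₁⟩ := eventually_atTop.1 <| hev.and <|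
    (eventually_le_mul (sub_pos.2 hc₃) 11).and <| (eventually_le_mul (sub_pos.2 hc) 5).and <|
    (eventually_le_mul one_pos (2 * c₁ + 7)).and <| (eventually_le_mul hc₁ 1).and <|
    (eventually_le_mul one_pos (40 * (|C| * 2 ^ k) + 1)).and <|
    (eventually_le_mul one_pos (160 * (|C| * (c₂ + 1)) + 25)).and (eventually_ge_atTop 12)
  refine ⟨s, r, (s + 1) * k + 1, 2 * s + r - 18, g₁, hr30, hrs, by omega, ?_⟩
  rintro P rfl hg ha hb hnG hFp hFr; obtain ⟨e1, e2, e3, e4, e5, e6, e7, e8⟩ := hg₁ P.g hg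
  have x12 : (12 : ℝ) ≤ P.g := by exact_mod_cast e8
  have x1 : (1 : ℝ) ≤ P.g := by linarith
  have x0 : (0 : ℝ) < P.g := by linarith
  have hN : ((P.nG : ℕ) : ℝ) = (P.g : ℝ) ^ (s + 1) := by rw [hnG]; push_cast; rfl
  have hpw : ∀ y : ℝ, ((P.g : ℝ) ^ (s + 1)) ^ y = (P.g : ℝ) ^ ((s + 1) * y) := fun y => by
    rw [← Real.rpow_natCast, ← Real.rpow_mul x0.le]; push_cast; rfl
  set q : ℝ := ((P.g : ℝ) ^ (s + 1)) ^ p with hq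
  have hq₁ : (P.g : ℝ) ^ (r + s + 2) ≤ q := by
    rw [hq, hpw, ← Real.rpow_natCast]
    exact Real.rpow_le_rpow_of_exponent_le x1 (by rw [hpη]; push_cast; linarith)
  have hq₂ : q ≤ (P.g : ℝ) ^ (r + s + 3) := by
    rw [hq, hpw, ← Real.rpow_natCast]
    exact Real.rpow_le_rpow_of_exponent_le x1 (by rw [hpη]; push_cast; linarith)
  obtain ⟨γ, hγ, hw, hm₁, hm₂⟩ := exists_guess (q := q) (c₂ := c₂) hc₁ ha hb hrs e8 hq₁ hq₂
    (by rw [ha]; push_cast; exact e1) e2 e3 (by linarith)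
  have hga : P.g * P.a = P.nG := by rw [ha, hnG, pow_succ']
  rw [hga] at hw hm₁ hm₂; have hlarge : 2 * P.a + P.b + 1 ≤ P.nG := by omega
  refine ⟨γ, hγ, fun A vec β hβ => ?_⟩
  have main : ∀ id, id / P.g = β → ∀ ρ, c₁ * q ≤ (P.runBlock hlarge A vec id ρ).toInstance.numEdges ∧
      ((P.runBlock hlarge A vec id ρ).toInstance.numEdges : ℝ) ≤ c₂ * q := by
    rintro id rfl ρ; have hwd : (P.runBlock hlarge A vec id ρ).w = γ * P.b := by rw [← hβ]; rfl
    obtain ⟨h1, h2⟩ := (P.runBlock hlarge A vec id ρ).card_full (by rw [hwd]; exact hw)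
    rw [hwd] at h1 h2; rw [Block.numEdges_toInstance]
    exact ⟨hm₁.trans (Nat.cast_le.2 h1), (Nat.cast_le.2 h2).trans hm₂⟩
  -- The number of edges is at least that of vertices, so m^ε' and (m * nG)^ε' are at least nG^ε'
  -- and hence at least g^50.
  have hqN : (P.nG : ℝ) ≤ c₁ * q := by
    have : (P.g : ℝ) ^ (s + 1) * P.g ≤ q := by
      rw [← pow_succ]; exact (pow_le_pow_right₀ x1 (by omega)).trans hq₁
    have := mul_le_mul_of_nonneg_left this hc₁.le
    have := mul_le_mul_of_nonneg_left e5 (show (0 : ℝ) ≤ (P.g : ℝ) ^ (s + 1) by positivity)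
    rw [hN]; linarith
  have hN1 : (1 : ℝ) ≤ P.nG := by rw [hN]; exact one_le_pow₀ x1
  refine ⟨hlarge, fun id hid ρ => ?_, fun id hid ρ ω => ?_⟩
  · obtain ⟨h1, h2⟩ := main id hid ρ; rw [hq, ← hN] at h1 h2; exact (hD P.nG _ h1 h2).1
  · obtain ⟨h1, h2⟩ := main id hid ρ; set I := (P.runBlock hlarge A vec id ρ).toInstance with hI
    have h1' := h1; have h2' := h2; rw [hq, ← hN] at h1' h2'
    obtain ⟨r₀, rs, hs', ht₀, htU, htQ⟩ := (hD P.nG I h1' h2').2 ω; refine ⟨r₀, rs, hs', ?_, ?_⟩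
    · have : (r₀.time : ℝ) ≤ |C| * 2 ^ k * (P.g : ℝ) ^ ((s + 1) * k) := by
        refine ht₀.trans ((mul_le_mul_of_nonneg_right (le_abs_self C) (by positivity)).trans ?_)
        rw [mul_assoc, pow_mul, ← hN, ← mul_pow]; gcongr; linarith
      have h3 : (0 : ℝ) < (P.g : ℝ) ^ ((s + 1) * k) := by positivity
      have h4 : (40 * r₀.time : ℝ) < (P.g : ℝ) ^ ((s + 1) * k) * P.g := by
        nlinarith [mul_le_mul_of_nonneg_left e6 h3.le]
      rw [hFp, pow_succ]; exact_mod_cast h4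
    · set m : ℝ := ((I.numEdges : ℕ) : ℝ) with hm; have hmN : (P.nG : ℝ) ≤ m := hqN.trans h1
      have hm1 : 1 ≤ m := hN1.trans hmN; have z0 : (0 : ℝ) < (P.g : ℝ) ^ 50 := by positivity
      have hz : (P.g : ℝ) ^ 50 ≤ (P.nG : ℝ) ^ ε' := by
        rw [hN, hpw, ← Real.rpow_natCast]
        exact Real.rpow_le_rpow_of_exponent_le x1 (by push_cast; exact hs)
      have hc₂ : 0 < c₂ := hc₁.trans hc
      have hU : (updateTime I.ops rs : ℝ) * (P.g : ℝ) ^ 50 ≤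
          |C| * (c₂ * (P.g : ℝ) ^ (r + 2 * s + 4)) := by
        refine rpow_sub_mul_le (e := 1) (m := m * P.nG) ?_ h1ε z0 ?_ ?_ htU
        · exact one_le_mul_of_one_le_of_one_le hm1 hN1
        · rw [Real.rpow_one, hN]
          calc m * (P.g : ℝ) ^ (s + 1) ≤ c₂ * (P.g : ℝ) ^ (r + s + 3) * (P.g : ℝ) ^ (s + 1) := by
                gcongr; exact h2.trans (by gcongr)
            _ = _ := by ring
        · refine hz.trans (Real.rpow_le_rpow (by linarith)
            (le_mul_of_one_le_left (by linarith) hm1) hε'.le)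
      have hq0 : 0 ≤ q := by positivity
      have hQ : ∀ Q : ℝ, Q ≤ C * m ^ (δ - ε) → Q * (P.g : ℝ) ^ 50 ≤
          |C| * ((c₂ + 1) * (P.g : ℝ) ^ (r + 2)) := by
        intro Q hQ
        refine rpow_sub_mul_le (e := δ) hm1 h1ε z0 ?_
          (hz.trans (Real.rpow_le_rpow (by linarith) hmN hε'.le)) hQ
        calc m ^ δ ≤ ((c₂ + 1) * q) ^ δ :=
              Real.rpow_le_rpow (by linarith) (h2.trans (by linarith)) hδ.le
          _ = (c₂ + 1) ^ δ * q ^ δ := Real.mul_rpow (by linarith) (by positivity)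
          _ ≤ _ := by
            refine mul_le_mul ?_ ?_ (by positivity) (by linarith)
            · exact (Real.rpow_le_rpow_of_exponent_le (by linarith) (by linarith)).trans
                (Real.rpow_one _).le
            · rw [hq, ← Real.rpow_mul (by positivity), hpδ, hpw, ← Real.rpow_natCast]
              exact Real.rpow_le_rpow_of_exponent_le x1 (by push_cast; linarith)
      have hE : P.a * P.E ≤ 3 * P.g ^ (2 * s) := by
        have : P.b ≤ P.a := by rw [ha, hb]; exact Nat.pow_le_pow_right P.hg hrs
        calc P.a * P.E ≤ P.a * (3 * P.a) := Nat.mul_le_mul_left _ (by unfold Par.E; omega)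
          _ = _ := by rw [ha]; ring
      have hlen : rs.length = I.ops.length := by
        have := hs'.length; simp only [DataStructure.calls, List.length_cons, List.length_map] at this
        exact Nat.succ.inj this
      have hops : I.ops.length ≤ 3 * P.g ^ (2 * s) := by
        refine le_trans ?_ hE; refine (List.length_filterMap_le _ _).trans ?_; simp; rfl
      set Q : ℝ := |C| * ((c₂ + 1) * (P.g : ℝ) ^ (r + 2)) / (P.g : ℝ) ^ 50 with hQd
      have hsum := sum_time_le (Q := Q) (by positivity) I.ops rs hlen fun i u v a b r h h' => by
        rw [hQd, le_div_iff₀ z0]; exact hQ _ (htQ i u v a b r h h')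
      have hopsR : (I.ops.length : ℝ) ≤ 3 * (P.g : ℝ) ^ (2 * s) := by exact_mod_cast hops
      have hER : (P.a * P.E : ℝ) ≤ 3 * (P.g : ℝ) ^ (2 * s) := by exact_mod_cast hE
      have hQz : Q * (P.g : ℝ) ^ 50 = |C| * ((c₂ + 1) * (P.g : ℝ) ^ (r + 2)) := by
        rw [hQd]; field_simp
      have hfin := lt_pow_of_le hr30 x1 (abs_nonneg C) hc₂ hU hQz hopsR hsum hER e7; rw [hFr]
      exact_mod_cast hfin

/-! ### The order of the total cost -/

theorem card_multiples_le {a : ℕ} (ha : 1 ≤ a) :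
    ((Finset.range n).filter fun t => t % a = 0).card ≤ n / a + 1 := by
  rw [← Finset.card_range (n / a + 1)]
  refine Finset.card_le_card_of_injOn (· / a) (fun t ht => ?_) fun t ht t' ht' h => ?_
  · simp only [Finset.coe_filter, Finset.mem_range, Set.mem_ofPred_eq] at ht
    simpa using Nat.lt_succ_of_le (Nat.div_le_div_right ht.1.le)
  · simp only [Finset.coe_filter, Set.mem_ofPred_eq] at ht ht'; have h1 := Nat.div_add_mod t a
    have h2 := Nat.div_add_mod t' a; simp only at h; rw [← h1, ← h2, h, ht.2, ht'.2]

/-- The constant parts of the programs. -/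
def DataStructure.constSizes (D : DataStructure) : ℕ :=
  D.preprocess.constSize + D.update.constSize + D.query.constSize

namespace Par

theorem NV_le {P : Par} : P.NV + 1 ≤ 2 * P.g ^ 4 * P.BB := by
  have : 1 ≤ P.g ^ 4 * P.BB := Nat.mul_pos (pow_pos P.hg 4) BB_pos
  have e : P.NV = P.g ^ 4 * P.BB := by unfold NV NB; ring
  rw [e, mul_assoc]; omega

theorem NQ_le {P : Par} : P.NQ + 1 ≤ 2 * P.g ^ 3 * (P.BB * P.a) := by
  have : 1 ≤ P.g ^ 3 * (P.BB * P.a) := Nat.mul_pos (pow_pos P.hg 3) (Nat.mul_pos BB_pos P.ha)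
  have e : P.NQ = P.g ^ 3 * (P.BB * P.a) := by unfold NQ NB; ring
  rw [e, mul_assoc]; omega

/-- The factor in the bound for the cost. -/
def totalFactor (D : DataStructure) (mode : Mode) (w : ℕ) : ℕ :=
  4 * w + 8 * (2 * preCost D mode + 10 + 2 * rate D) * (D.constSizes + 21) + 2 * scanCost +
    (6000 + 32 * (vmCost D mode + 10) + 4 * scanCost + 8 * (2 * claimCost + 10) + 16 * rate D)

/-- The relations between the parameters that determine the order of the cost. -/
structure Balanced (P : Par) (B₀ : ℕ) : Prop where
  force : P.force = 0
  two : 2 ≤ P.g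
  hab : P.b ≤ P.a
  gb : P.g ^ 6 ≤ P.b
  run : P.g ^ 6 * P.Frun ≤ P.a * (P.a * P.b)
  small : ∀ x ∈ [P.a, P.nG, P.nG * P.nG, P.Fpre, P.Frun, 1], x * P.g ^ 6 ≤ B₀
  le : B₀ ≤ P.n

namespace Balanced
variable {P : Par} {B₀ : ℕ}

theorem an (h : P.Balanced B₀) : P.a ≤ P.n :=
  (Nat.le_mul_of_pos_right _ (pow_pos P.hg 6)).trans ((h.small _ (by simp)).trans h.le)

theorem Br_mul (h : P.Balanced B₀) : P.Br * P.a ≤ 2 * P.n := by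
  have := Nat.div_mul_le_self P.n P.a; have := h.an; unfold Br; rw [add_mul]; omega

theorem BB_mul (h : P.Balanced B₀) : P.BB * (P.a * P.b) ≤ 4 * P.n ^ 2 := by
  have h2 : P.Bc * P.b ≤ 2 * P.n := by
    have := Nat.div_mul_le_self P.n P.b; have := P.hbn; unfold Bc; rw [add_mul]; omega
  calc P.BB * (P.a * P.b) = P.Br * P.a * (P.Bc * P.b) := by unfold BB; ring
    _ ≤ 2 * P.n * (2 * P.n) := Nat.mul_le_mul h.Br_mul h2
    _ = _ := by ring

theorem g_mul (h : P.Balanced B₀) : P.g ^ 6 * (P.BB * P.a) ≤ 4 * P.n ^ 2 :=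
  calc _ ≤ P.b * (P.BB * P.a) := Nat.mul_le_mul_right _ h.gb
    _ = P.BB * (P.a * P.b) := by ring
    _ ≤ _ := h.BB_mul

theorem NV_mul (h : P.Balanced B₀) : (P.NV + 1) * P.g ^ 2 ≤ 8 * P.n ^ 2 :=
  calc _ ≤ 2 * P.g ^ 4 * P.BB * P.g ^ 2 := Nat.mul_le_mul_right _ NV_le
    _ = 2 * (P.g ^ 6 * (P.BB * 1)) := by ring
    _ ≤ 2 * (P.g ^ 6 * (P.BB * P.a)) := by gcongr; exact P.ha
    _ ≤ 2 * (4 * P.n ^ 2) := Nat.mul_le_mul_left _ h.g_mul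
    _ = _ := by ring

theorem B_mul (h : P.Balanced B₀) : P.B * P.g ^ 6 ≤ (P.D.constSizes + 21) * B₀ := by
  have h1 := h.small P.a (by simp); have h2 := h.small P.nG (by simp)
  have h3 := h.small _ (show P.nG * P.nG ∈ _ by simp); have h4 := h.small P.Fpre (by simp)
  have h5 := h.small P.Frun (by simp); have h6 := h.small 1 (by simp)
  have h7 := Nat.mul_le_mul_right (P.g ^ 6) h.hab; have h8 := Nat.mul_le_mul_left P.D.constSizes h6
  unfold B Fm nGG; rw [← DataStructure.constSizes]; linarith

theorem B_le (h : P.Balanced B₀) : P.B ≤ (P.D.constSizes + 21) * P.n :=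
  (Nat.le_mul_of_pos_right _ (pow_pos P.hg 6)).trans (h.B_mul.trans (Nat.mul_le_mul_left _ h.le))

/-- Five contributions, each at most a multiple of L * n^3 / g^2: linear overhead, the steps of the
machines, scans for entries of the outputs, the votes of all copies on all queries, and the fuel of
the runs. The fuel is charged once in `a` multiplications. -/
theorem mulCost_sum (h : P.Balanced B₀) : (∑ t ∈ Finset.range P.n, P.mulCost (t % P.a)) * P.g ^ 2 ≤
    (6000 + 32 * (vmCost P.D P.mode + 10) + 4 * scanCost + 8 * (2 * claimCost + 10) + 16 * rate P.D) *
      (P.L * P.n ^ 3) := by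
  set V := vmCost P.D P.mode with hV
  have hsum : ∑ t ∈ Finset.range P.n, P.mulCost (t % P.a) ≤
      P.n * (3000 * P.L * (P.n + 1) + (P.NV + 1) * (V * P.L * (P.E + 1) + 10 * P.L) +
        scanCost * P.L * (P.b + 1) * (P.n + P.a) + (P.NQ + 1) * (claimCost * P.L * (P.g + 1) + 10 * P.L)) +
      P.Br * ((P.NV + 1) * (rate P.D * P.L * P.Frun)) := by
    have e : ∀ t, P.mulCost (t % P.a) =
        (3000 * P.L * (P.n + 1) + (P.NV + 1) * (V * P.L * (P.E + 1) + 10 * P.L) +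
        scanCost * P.L * (P.b + 1) * (P.n + P.a) + (P.NQ + 1) * (claimCost * P.L * (P.g + 1) + 10 * P.L)) +
        if t % P.a = 0 then (P.NV + 1) * (rate P.D * P.L * P.Frun) else 0 := fun t => by
      simp only [mulCost, vmLoopCost, claimLoopCost, h.force, if_true, ← hV]; split_ifs <;> ring
    rw [Finset.sum_congr rfl fun t _ => e t, Finset.sum_add_distrib, ← Finset.sum_filter, Finset.sum_const,
      Finset.sum_const, Finset.card_range, smul_eq_mul, smul_eq_mul]
    have := Nat.mul_le_mul_right ((P.NV + 1) * (rate P.D * P.L * P.Frun)) (card_multiples_le (n := P.n) P.ha)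
    unfold Br; linarith
  refine (Nat.mul_le_mul_right _ hsum).trans ?_
  have hg2 : P.b * P.g ^ 2 ≤ P.n := by
    refine le_trans ?_ ((h.small P.a (by simp)).trans h.le)
    exact Nat.mul_le_mul h.hab (Nat.pow_le_pow_right P.hg (by norm_num))
  have hb := P.hb; have hn := P.hn; have ha := P.ha; have hg := P.hg
  have i1 : P.n * (3000 * P.L * (P.n + 1)) * P.g ^ 2 ≤ 6000 * (P.L * P.n ^ 3) :=
    calc _ ≤ P.n * (3000 * P.L * (P.n + P.n)) * (P.b * P.g ^ 2) := by
          gcongr; exact Nat.le_mul_of_pos_left _ hb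
      _ ≤ P.n * (3000 * P.L * (P.n + P.n)) * P.n := Nat.mul_le_mul_left _ hg2
      _ = _ := by ring
  -- Per multiplication g^4 machines for each block make O(a) steps. As there are about n^2 / (a *
  -- b) blocks, b ≥ g^6 yields the factor g^2.
  have i2 : P.n * ((P.NV + 1) * (V * P.L * (P.E + 1) + 10 * P.L)) * P.g ^ 2 ≤
      32 * (V + 10) * (P.L * P.n ^ 3) := by
    have hE : P.E + 1 ≤ 4 * P.a := by have := h.hab; unfold E; omega
    calc _ ≤ P.n * (2 * P.g ^ 4 * P.BB * (V * P.L * (4 * P.a) + 10 * P.L * (4 * P.a))) * P.g ^ 2 := by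
          refine Nat.mul_le_mul_right _ (Nat.mul_le_mul_left _ (Nat.mul_le_mul NV_le (Nat.add_le_add
            (Nat.mul_le_mul_left _ hE) (Nat.le_mul_of_pos_right _ (by omega)))))
      _ = 8 * (V + 10) * P.L * P.n * (P.g ^ 6 * (P.BB * P.a)) := by ring
      _ ≤ 8 * (V + 10) * P.L * P.n * (4 * P.n ^ 2) := Nat.mul_le_mul_left _ h.g_mul
      _ = _ := by ring
  have i3 : P.n * (scanCost * P.L * (P.b + 1) * (P.n + P.a)) * P.g ^ 2 ≤ 4 * scanCost * (P.L * P.n ^ 3) := by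
    have := h.an
    calc _ ≤ P.n * (scanCost * P.L * (P.b + P.b) * (P.n + P.n)) * P.g ^ 2 := by gcongr
      _ = 4 * scanCost * P.L * P.n ^ 2 * (P.b * P.g ^ 2) := by ring
      _ ≤ 4 * scanCost * P.L * P.n ^ 2 * P.n := Nat.mul_le_mul_left _ hg2
      _ = _ := by ring
  have i4 : P.n * ((P.NQ + 1) * (claimCost * P.L * (P.g + 1) + 10 * P.L)) * P.g ^ 2 ≤
      8 * (2 * claimCost + 10) * (P.L * P.n ^ 3) := by
    calc _ ≤ P.n * (2 * P.g ^ 3 * (P.BB * P.a) * (claimCost * P.L * (P.g + P.g) + 10 * P.L * P.g)) *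
          P.g ^ 2 := by
          refine Nat.mul_le_mul_right _ (Nat.mul_le_mul_left _ (Nat.mul_le_mul NQ_le (Nat.add_le_add
            (Nat.mul_le_mul_left _ (by omega)) (Nat.le_mul_of_pos_right _ (by omega)))))
      _ = 2 * (2 * claimCost + 10) * P.L * P.n * (P.g ^ 6 * (P.BB * P.a)) := by ring
      _ ≤ 2 * (2 * claimCost + 10) * P.L * P.n * (4 * P.n ^ 2) := Nat.mul_le_mul_left _ h.g_mul
      _ = _ := by ring
  -- The main term, and the only place where the speed of the data structure is used: about n/a runs
  -- of g^4 * n^2/(a * b) machines, each with fuel `Frun`, where g^6 * Frun ≤ a² * b.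
  have i5 : P.Br * ((P.NV + 1) * (rate P.D * P.L * P.Frun)) * P.g ^ 2 ≤ 16 * rate P.D * (P.L * P.n ^ 3) :=
    calc _ ≤ P.Br * (2 * P.g ^ 4 * P.BB * (rate P.D * P.L * P.Frun)) * P.g ^ 2 :=
          Nat.mul_le_mul_right _ (Nat.mul_le_mul_left _ (Nat.mul_le_mul_right _ NV_le))
      _ = 2 * rate P.D * P.L * (P.Br * P.BB) * (P.g ^ 6 * P.Frun) := by ring
      _ ≤ 2 * rate P.D * P.L * (P.Br * P.BB) * (P.a * (P.a * P.b)) := Nat.mul_le_mul_left _ h.run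
      _ = 2 * rate P.D * P.L * (P.Br * P.a * (P.BB * (P.a * P.b))) := by ring
      _ ≤ 2 * rate P.D * P.L * (2 * P.n * (4 * P.n ^ 2)) :=
          Nat.mul_le_mul_left _ (Nat.mul_le_mul h.Br_mul h.BB_mul)
      _ = _ := by ring
  linarith

theorem totalCost_mul (h : P.Balanced B₀) (w : ℕ) : P.totalCost w * P.g ^ 2 ≤ totalFactor P.D P.mode w *
      (P.L * P.n ^ 3) := by
  have hb := P.hb; have hn := P.hn; have hg := P.hg
  have hg6 : P.b * P.g ^ 6 ≤ P.n := (Nat.mul_le_mul_right _ h.hab).trans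
    ((h.small P.a (by simp)).trans h.le)
  have hg2 : P.g ^ 2 ≤ P.n := le_trans (le_trans (Nat.pow_le_pow_right hg (by norm_num))
    (Nat.le_mul_of_pos_left _ hb)) hg6
  have hB := h.B_le; have hB1 : 1 ≤ P.B := by unfold B; omega
  have hFB : P.Fm ≤ P.B := by unfold B; omega
  have i1 : w * P.L * ((P.n + 1) * (P.n + 1)) * P.g ^ 2 ≤ 4 * w * (P.L * P.n ^ 3) :=
    calc _ ≤ w * P.L * ((P.n + P.n) * (P.n + P.n)) * P.n := by gcongr
      _ = _ := by ring
  have i2 : ((P.NV + 1) * (preCost P.D P.mode * P.L * (2 * P.B) + 10 * P.L) +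
      rate P.D * P.L * (P.NV * (P.Fm + P.B))) * P.g ^ 2 ≤
      8 * (2 * preCost P.D P.mode + 10 + 2 * rate P.D) * (P.D.constSizes + 21) * (P.L * P.n ^ 3) :=
    calc _ ≤ ((P.NV + 1) * (preCost P.D P.mode * P.L * (2 * P.B) + 10 * P.L * P.B) +
          rate P.D * P.L * ((P.NV + 1) * (P.B + P.B))) * P.g ^ 2 := by
          exact Nat.mul_le_mul_right _ (Nat.add_le_add (Nat.mul_le_mul_left _ (Nat.add_le_add_left
            (Nat.le_mul_of_pos_right _ hB1) _)) (Nat.mul_le_mul_left _ (Nat.mul_le_mul (Nat.le_succ _)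
            (Nat.add_le_add_right hFB _))))
      _ = (2 * preCost P.D P.mode + 10 + 2 * rate P.D) * P.L * P.B * ((P.NV + 1) * P.g ^ 2) := by ring
      _ ≤ (2 * preCost P.D P.mode + 10 + 2 * rate P.D) * P.L * ((P.D.constSizes + 21) * P.n) *
          (8 * P.n ^ 2) := Nat.mul_le_mul (Nat.mul_le_mul_left _ hB) h.NV_mul
      _ = _ := by ring
  have i3 : scanCost * P.L * (P.b + 1) * P.g ^ 3 * P.g ^ 2 ≤ 2 * scanCost * (P.L * P.n ^ 3) :=
    calc _ ≤ scanCost * P.L * (P.b + P.b) * P.g ^ 3 * P.g ^ 3 := by gcongr; norm_num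
      _ = 2 * scanCost * P.L * (P.b * P.g ^ 6) := by ring
      _ ≤ 2 * scanCost * P.L * P.n ^ 3 := Nat.mul_le_mul_left _ (hg6.trans (Nat.le_self_pow (by norm_num) _))
      _ = _ := by ring
  have i4 := h.mulCost_sum; unfold totalCost totalFactor; linarith

theorem NQ_mul (h : P.Balanced B₀) : P.NQ ≤ 8 * P.n ^ 3 := by
  have h1 : P.g ^ 3 * (P.BB * P.a) ≤ 4 * P.n ^ 2 :=
    (Nat.mul_le_mul_right _ (Nat.pow_le_pow_right P.hg (by norm_num))).trans h.g_mul
  have h2 : P.n ^ 2 ≤ P.n ^ 3 := Nat.pow_le_pow_right P.hn (by norm_num); have := NQ_le (P := P)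
  rw [mul_assoc] at this; omega

theorem X_le (h : P.Balanced B₀) : P.X ≤ (P.D.constSizes + 205) * P.n ^ 5 := by
  have hs : ∀ x ∈ [P.a, P.nG, P.nG * P.nG, P.Fpre, P.Frun, 1], x ≤ P.n := fun x hx =>
    (Nat.le_mul_of_pos_right _ (pow_pos P.hg 6)).trans ((h.small x hx).trans h.le)
  have h1 := h.an; have h2 := hs P.nG (by simp); have h3 := hs (P.nG * P.nG) (by simp)
  have h4 := hs P.Fpre (by simp); have h5 := hs P.Frun (by simp); have hn := P.hn; have hbn := P.hbn
  have hgn : P.g ≤ P.n := by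
    have := h.small 1 (by simp); have := h.le; have : P.g ≤ P.g ^ 6 := Nat.le_self_pow (by norm_num) _
    omega
  have hp : ∀ k, k ≤ 5 → P.n ^ k ≤ P.n ^ 5 := fun k hk => Nat.pow_le_pow_right hn hk
  have p1 := hp 1 (by norm_num); have p2 := hp 2 (by norm_num); have p3 := hp 3 (by norm_num)
  rw [pow_one] at p1
  have hNV : P.NV + 1 ≤ 8 * P.n ^ 2 := (Nat.le_mul_of_pos_right _ (pow_pos P.hg 2)).trans h.NV_mul
  have hNB : P.NB ≤ P.NV := Nat.le_mul_of_pos_right _ P.hg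
  have hBB : P.BB ≤ P.NB := Nat.le_mul_of_pos_left _ (pow_pos P.hg 3)
  have hBc : P.Bc ≤ P.BB := Nat.le_mul_of_pos_left _ Br_pos
  have hE : P.E ≤ 3 * P.n := by unfold E; omega
  have hS : P.S ≤ 120 * P.n ^ 5 := calc
    P.S ≤ (3 * P.n) * (8 * P.n ^ 2 * (5 * P.n)) :=
      Nat.mul_le_mul (by omega) (Nat.mul_le_mul hNV (by omega))
    _ = 120 * P.n ^ 4 := by ring
    _ ≤ _ := Nat.mul_le_mul_left _ (hp 4 (by norm_num))
  have hB := h.B_le.trans (Nat.mul_le_mul_left _ p1); have hNQ := h.NQ_mul; have hf := h.force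
  have e : (P.D.constSizes + 205) * P.n ^ 5 = (P.D.constSizes + 21) * P.n ^ 5 + 184 * P.n ^ 5 := by ring
  rw [e]; unfold X W nGG; omega

/-- `X` is polynomial in n and n is polynomial in g, so `L` is O(log g). The crude bound O(g) is
enough, because a factor g^2 has been gained. -/
theorem L_le (h : P.Balanced B₀) {K : ℕ} (hc : P.D.constSizes + 205 ≤ P.n) (hn : P.n < (P.g + 1) ^ K) :
    P.L ≤ (12 * K + 10) * P.g := by
  have hg := P.hg
  have h1 : P.X ≤ P.n ^ 6 := h.X_le.trans (by rw [pow_succ' P.n 5]; exact Nat.mul_le_mul_right _ hc)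
  have h2 : P.n ≤ P.g ^ (2 * K) := hn.le.trans (by
    rw [pow_mul]; exact Nat.pow_le_pow_left (by have := h.two; nlinarith) _)
  have h3 := (size_le_of_le h1).trans (Consts.size_pow_le _ _)
  have h4 := (size_le_of_le h2).trans (Consts.size_pow_le _ _)
  have h5 : P.g.size ≤ P.g := Nat.size_le.2 Nat.lt_two_pow_self
  have h6 := Nat.mul_le_mul_left (2 * K) h5
  have e : (12 * K + 10) * P.g = 6 * (2 * K * P.g) + 10 * P.g := by ring
  rw [e]; unfold L; omega

end Balanced
end Par

/-! ### From verified queries to the Boolean product -/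

namespace Par
variable {P : Par} {D : DataStructure} {ω : ℕ → Bool}

theorem copy_ne_zero (hP : P.n = n) (M : Fin n → Fin n → Bool) (hj : j < P.W) :
    P.copy (ofList (n :: rows M)) (i * P.W + j) ≠ 0 ↔
      ∃ (h : i < n) (h' : j < n), M ⟨i, h⟩ ⟨j, h'⟩ = true := by
  have h1 : (i * P.W + j) / P.W = i := by
    rw [mul_comm, Nat.mul_add_div (by omega), Nat.div_eq_of_lt hj, add_zero]
  have h2 : (i * P.W + j) % P.W = j := by rw [mul_comm, Nat.mul_add_mod, Nat.mod_eq_of_lt hj]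
  rw [copy, h1, h2, hP]
  by_cases h : i < n ∧ j < n
  · have := getD_rows M ⟨i, h.1⟩ ⟨j, h.2⟩; rw [if_pos h]
    simp only [ofList, List.getD_cons_succ] at this ⊢; rw [this]; simp [h.1, h.2]
  · rw [if_neg h]; exact ⟨fun h' => absurd rfl h', fun ⟨h1, h2, _⟩ => absurd ⟨h1, h2⟩ h⟩

theorem vecs_ne_zero (v : Fin n → Fin n → Bool) (t : Fin n) :
    Consts.vecs v t j ≠ 0 ↔ ∃ h : j < n, v t ⟨j, h⟩ = true := by
  rw [Consts.vecs, dif_pos t.2, ofList]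
  by_cases h : j < n
  · rw [List.getD_eq_getElem _ _ (by simpa using h)]; simp [h]
  · rw [List.getD_eq_default _ _ (by simpa using h)]; simp [h]

theorem hit_iff (hP : P.n = n) (M v : Fin n → Fin n → Bool) (t : Fin n) (q : ℕ) :
    P.Hit (P.copy (ofList (n :: rows M))) (Consts.vecs v t) q ↔
      ∃ h : P.line q < n, ∃ j : Fin n, j.val / P.b = P.col (q / P.a) ∧
        M ⟨P.line q, h⟩ j = true ∧ v t j = true := by
  have key : ∀ c < P.b, c + P.col (q / P.a) * P.b < P.W := fun c hc => by
    have h1 : P.col (q / P.a) < P.Bc := Nat.mod_lt _ Bc_pos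
    have h2 : P.col (q / P.a) * P.b ≤ P.n :=
      (Nat.mul_le_mul_right _ (Nat.lt_succ_iff.1 h1)).trans (Nat.div_mul_le_self _ _)
    have := P.hbn; unfold W; omega
  have hl : q % P.a + P.row (q / P.a) * P.a = P.line q := add_comm _ _; constructor
  · rintro ⟨c, hc, h1, h2⟩; rw [blockMat, decide_eq_true_iff, copy_ne_zero hP M (key c hc), hl] at h1
    rw [blockVec, decide_eq_true_iff, vecs_ne_zero] at h2; obtain ⟨h, h', h1⟩ := h1
    refine ⟨h, ⟨_, h'⟩, ?_, h1, h2.2⟩; show (c + P.col (q / P.a) * P.b) / P.b = _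
    rw [Nat.add_mul_div_right _ _ P.hb, Nat.div_eq_of_lt hc, zero_add]
  · rintro ⟨h, j, hj, h1, h2⟩; have hc := Nat.mod_lt j.val P.hb
    have e : j.val % P.b + P.col (q / P.a) * P.b = j := by rw [← hj]; exact Nat.mod_add_div' _ _
    refine ⟨j.val % P.b, hc, ?_, ?_⟩
    · rw [blockMat, decide_eq_true_iff, copy_ne_zero hP M (key _ hc), hl, e]; exact ⟨h, j.2, h1⟩
    · rw [blockVec, decide_eq_true_iff, vecs_ne_zero, e]; exact ⟨j.2, h2⟩

/-- The query that asks for row `i` and the block of column `j` with the guess `γ`. -/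
theorem exists_query {γ : ℕ} (hγ : γ < P.g ^ 3) (hi : i < P.n) (hj : j < P.n) :
    ∃ q < P.NQ, P.guess (q / P.a) = γ ∧ P.line q = i ∧ P.col (q / P.a) = j / P.b := by
  have h1 : i / P.a < P.Br := Nat.lt_succ_of_le (Nat.div_le_div_right hi.le)
  have h2 : j / P.b < P.Bc := Nat.lt_succ_of_le (Nat.div_le_div_right hj.le)
  have h3 := Nat.mod_lt i P.ha
  have h4 : i / P.a * P.Bc + j / P.b < P.BB := by
    have := Nat.mul_le_mul_right P.Bc h1; rw [Nat.succ_mul] at this; unfold BB; omega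
  have dm : ∀ {x y z : ℕ}, y < z → (x * z + y) / z = x ∧ (x * z + y) % z = y := fun {x y z} h => by
    rw [mul_comm, Nat.mul_add_div (by omega), Nat.div_eq_of_lt h, Nat.mul_add_mod, Nat.mod_eq_of_lt h]
    exact ⟨rfl, rfl⟩
  have h5 : γ * P.BB + (i / P.a * P.Bc + j / P.b) < P.NB := by
    have := Nat.mul_le_mul_right P.BB hγ; rw [Nat.succ_mul] at this; unfold NB; omega
  refine ⟨(γ * P.BB + (i / P.a * P.Bc + j / P.b)) * P.a + i % P.a, ?_, ?_, ?_, ?_⟩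
  · have := Nat.mul_le_mul_right P.a h5; rw [Nat.succ_mul] at this; unfold NQ; omega
  · rw [(dm h3).1, guess, (dm h4).1]
  · rw [line, (dm h3).1, (dm h3).2, row, (dm h4).2, (dm h2).1, Nat.div_add_mod']
  · rw [(dm h3).1, col, (dm h4).2, (dm h2).2]

/-- An entry 1 is always justified by a scan. Conversely a common 1 in column j belongs to the query
for its row, its block and the guess `γ`, which is answered correctly or, under `force`, verified
anyway. -/
theorem Product.eq_boolMulVec (hP : P.n = n) {M v : Fin n → Fin n → Bool} {t : Fin n}
    {out : ℕ → ℕ} {γ : ℕ} (hγ : γ < P.g ^ 3)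
    (h : P.Product D (P.copy (ofList (n :: rows M))) vec ω (Consts.vecs v t) out)
    (hr : P.force ≠ 0 ∨ P.Reliable D (P.copy (ofList (n :: rows M))) vec ω γ) (i : Fin n) :
    out i = (OMv.boolMulVec M (v t) i).toNat := by
  subst hP
  by_cases hM : ∃ j, M i j = true ∧ v t j = true
  · obtain ⟨j, h1, h2⟩ := hM; obtain ⟨q, hq, hg, hl, hc⟩ := exists_query (j := j) hγ i.2 j.2
    have h3 := h.complete γ hr q hq hg ((hit_iff rfl M v t q).2
      ⟨by rw [hl]; exact i.2, j, hc.symm, by simp only [hl]; exact h1, h2⟩)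
    rw [hl] at h3; have : OMv.boolMulVec M (v t) i = true := decide_eq_true ⟨j, h1, h2⟩; rw [this]
    exact le_antisymm (h.bit _) (Nat.one_le_iff_ne_zero.2 h3)
  · have : OMv.boolMulVec M (v t) i = false := decide_eq_false hM; rw [this]; by_contra h0
    obtain ⟨q, hq, hl, hh⟩ := h.sound i i.2 h0; obtain ⟨h', j, -, h1, h2⟩ := (hit_iff rfl M v t q).1 hh
    exact hM ⟨j, by rw [← h1]; congr 1; exact Fin.ext hl.symm, h2⟩

end Par

/-! ### Error probability, exponent and conclusion -/

theorem exists_exp_le (K : ℕ) : ∃ g₂ : ℕ, ∀ g ≥ g₂, 8 * (g : ℝ) ^ K * Real.exp (-(g : ℝ) / 18) ≤ 1 / 3 := by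
  have h := ((Real.tendsto_pow_mul_exp_neg_atTop_nhds_zero K).comp
    (tendsto_natCast_atTop_atTop.atTop_mul_const (show (0 : ℝ) < 1 / 18 by norm_num)))
  have hp : (0 : ℝ) < 1 / (24 * 18 ^ K) := by positivity
  obtain ⟨g₂, hg⟩ := eventually_atTop.1 (h.eventually_le_const hp); refine ⟨g₂, fun g hgg => ?_⟩
  have := hg g hgg; simp only [Function.comp, mul_pow] at this; rw [le_div_iff₀ (by positivity)] at this
  rw [show -(g : ℝ) / 18 = -((g : ℝ) * (1 / 18)) by ring]
  have e : (1 / 18 : ℝ) ^ K * 18 ^ K = 1 := by rw [← mul_pow]; norm_num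
  have : 24 * ((g : ℝ) ^ K * Real.exp (-((g : ℝ) * (1 / 18)))) * ((1 / 18 : ℝ) ^ K * 18 ^ K) ≤ 1 := by
    linarith
  rw [e] at this; linarith

/-- n < (g + 1)^K gives n^(1/K) ≤ 2 * g, so a factor g gained is a factor n^(1/K) / 2. -/
theorem le_rpow_of_mul_le {K g W : ℕ} (hK : 1 ≤ K) (hn : 1 ≤ n) (hg : 1 ≤ g) (h : n < (g + 1) ^ K)
    (hT : T * g ≤ W * n ^ 3) : (T : ℝ) ≤ 2 * W * (n : ℝ) ^ (3 - 1 / (K : ℝ)) := by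
  have n0 : (0 : ℝ) < n := by exact_mod_cast hn
  have h1 : (n : ℝ) ^ (1 / (K : ℝ)) ≤ 2 * g := by
    have h2 : (n : ℝ) ≤ ((g : ℝ) + 1) ^ K := by exact_mod_cast h.le
    have h3 := Real.rpow_le_rpow n0.le h2 (show 0 ≤ ((K : ℝ))⁻¹ by positivity)
    rw [Real.pow_rpow_inv_natCast (by positivity) (by omega)] at h3
    have : (1 : ℝ) ≤ g := by exact_mod_cast hg
    rw [one_div]; linarith
  have hp : (0 : ℝ) < (n : ℝ) ^ (1 / (K : ℝ)) := by positivity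
  rw [Real.rpow_sub n0, mul_div_assoc', le_div_iff₀ hp]
  have e : (n : ℝ) ^ (3 : ℝ) = (n : ℝ) ^ 3 := by exact_mod_cast Real.rpow_natCast (n : ℝ) 3
  rw [e]; have h4 : (T : ℝ) * g ≤ W * (n : ℝ) ^ 3 := by exact_mod_cast hT
  have h5 := mul_le_mul_of_nonneg_left h1 (Nat.cast_nonneg (α := ℝ) T); linarith

/-- A data structure for the dynamic problem yields an algorithm for matrix-vector multiplication. -/
theorem DataStructure.Achieves.exists_solvesIn {mode : Mode} {δ c₁ c₂ ε : ℝ}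
    (hD : D.Achieves mode δ c₁ c₂ ε) (hδ : 0 < δ) (hδ' : δ ≤ 1 / 2) (hc₁ : 0 < c₁) (hc : c₁ < c₂)
    (hf : δ = 1 / 2 → c₁ < 1) (hε : 0 < ε) :
    ∃ ε' : ℝ, 0 < ε' ∧ ∃ (A : OMv.Algorithm) (C : ℝ), A.SolvesIn fun n => C * (n : ℝ) ^ (3 - ε') := by
  obtain ⟨s, r, kp, kr, g₁, hr, hrs, hkr, hS⟩ := hD.exists_suitable hδ hδ' hc₁ hc hf hε
  -- `K` is so large that each of the quantities in `Balanced.small`, times g^6, is at most g^K and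
  -- hence at most n.
  obtain ⟨K, hK⟩ : ∃ K, K = kp + kr + 2 * (s + 1) + 6 := ⟨_, rfl⟩
  -- The union bound has at most 8 * n^4 terms, and n ≤ g^(2K).
  obtain ⟨g₂, hg₂⟩ := exists_exp_le (2 * K * 4)
  -- From `g₀` on the right guess is suitable, the union bound is below 1/3, and the estimates of
  -- the cost hold.
  obtain ⟨g₀, l1, l2, l3, l4⟩ : ∃ g₀, g₁ ≤ g₀ ∧ g₂ ≤ g₀ ∧ 2 ≤ g₀ ∧ D.watched.constSizes + 205 ≤ g₀ :=
    ⟨g₁ + g₂ + 2 + (D.watched.constSizes + 205), by omega, by omega, by omega, by omega⟩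
  let c : Consts := ⟨D.watched, mode, s + 1, r, K, kp, kr, g₀, by omega, by omega⟩
  have hpw : ∀ n (hn : 1 ≤ n) k, k ≤ K → (c.par n hn).g ^ k ≤ n := fun n hn k hk =>
    (Nat.pow_le_pow_right (c.par n hn).hg hk).trans (c.root_pow_le hn)
  have hbal : ∀ n (hn : 1 ≤ n), (c.par n hn).force = 0 → (c.par n hn).Balanced ((c.par n hn).g ^ K) := by
    intro n hn h0; set P := c.par n hn with hP; have hg : g₀ ≤ P.g := Nat.sub_eq_zero_iff_le.1 h0
    have hm : ∀ {i j}, i ≤ j → P.g ^ i ≤ P.g ^ j := fun h => Nat.pow_le_pow_right P.hg h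
    refine ⟨h0, l3.trans hg, hm hrs, hm (by omega : 6 ≤ r), ?_, ?_, c.root_pow_le hn⟩
    · show P.g ^ 6 * P.g ^ kr ≤ P.g ^ s * (P.g ^ s * P.g ^ r)
      rw [← pow_add, ← pow_add, ← pow_add]; exact hm (by omega)
    · intro x hx; simp only [List.mem_cons, List.not_mem_nil, or_false] at hx
      rcases hx with rfl | rfl | rfl | rfl | rfl | rfl
      · show P.g ^ s * _ ≤ _; rw [← pow_add]; exact hm (by omega)
      · show P.g ^ (s + 1) * _ ≤ _; rw [← pow_add]; exact hm (by omega)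
      · show P.g ^ (s + 1) * P.g ^ (s + 1) * _ ≤ _; rw [← pow_add, ← pow_add]; exact hm (by omega)
      · show P.g ^ kp * _ ≤ _; rw [← pow_add]; exact hm (by omega)
      · show P.g ^ kr * _ ≤ _; rw [← pow_add]; exact hm (by omega)
      · rw [one_mul]; exact hm (by omega)
  set W := Par.totalFactor D.watched mode c.setupCost * (12 * K + 10)
  set F : ℕ → ℕ := fun n => if hn : 1 ≤ n then (c.par n hn).totalCost c.setupCost else 0
  have hK1 : 1 ≤ K := by omega
  have hK0 : (0 : ℝ) < 1 / K := by have : (0 : ℝ) < K := by exact_mod_cast hK1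
                                   positivity
  -- `2 * W` serves the orders with root at least `g₀`. The others are below g₀^K, finitely many,
  -- and the sum of their costs goes into the constant.
  refine ⟨1 / K, hK0, c.algorithm D.bound, 2 * W + ∑ n ∈ Finset.range (g₀ ^ K), F n, fun n hn M v => ?_⟩
  set P := c.par n hn with hP; have hses := c.exists_session (D := D) rfl hn (hpw n hn s (by omega)) M v
  have hlt : n < (P.g + 1) ^ K := c.lt_root_succ_pow hn; refine ⟨fun ω => ?_, ?_⟩
  · obtain ⟨res, h1, h2, -⟩ := hses ω; refine ⟨res, h1, (Nat.cast_le.2 h2).trans ?_⟩; simp only [add_mul]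
    have n1 : (1 : ℝ) ≤ n := by exact_mod_cast hn
    by_cases h0 : P.force = 0
    · have hb := hbal n hn h0; have hg : g₀ ≤ P.g := Nat.sub_eq_zero_iff_le.1 h0
      have hL := hb.L_le (K := K) (l4.trans (hg.trans (show P.g ≤ n by simpa using hpw n hn 1 hK1))) hlt
      have hT := hb.totalCost_mul c.setupCost
      have : P.totalCost c.setupCost * P.g ≤ W * n ^ 3 := by
        refine Nat.le_of_mul_le_mul_right ?_ P.hg
        calc _ = P.totalCost c.setupCost * P.g ^ 2 := by ring
          _ ≤ _ := hT
          _ ≤ Par.totalFactor P.D P.mode c.setupCost * ((12 * K + 10) * P.g * P.n ^ 3) :=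
            Nat.mul_le_mul_left _ (Nat.mul_le_mul_right _ hL)
          _ = Par.totalFactor P.D P.mode c.setupCost * (12 * K + 10) * P.n ^ 3 * P.g := by ring
      refine (le_rpow_of_mul_le hK1 hn P.hg hlt this).trans (le_add_of_nonneg_right ?_); positivity
    · have hg : P.g + 1 ≤ g₀ := by
        by_contra hh; exact h0 (Nat.sub_eq_zero_iff_le.2 (show g₀ ≤ P.g by omega))
      have hmem : n ∈ Finset.range (g₀ ^ K) :=
        Finset.mem_range.2 (hlt.trans_le (Nat.pow_le_pow_left hg K))
      have hF : P.totalCost c.setupCost ≤ ∑ n ∈ Finset.range (g₀ ^ K), F n := by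
        refine le_trans (le_of_eq ?_) (Finset.single_le_sum (fun _ _ => Nat.zero_le _) hmem)
        simp [F, hn, hP]
      have h1K : 1 / (K : ℝ) ≤ 1 := by
        rw [div_le_one (by exact_mod_cast hK1)]; exact_mod_cast hK1
      have h3 : (1 : ℝ) ≤ (n : ℝ) ^ (3 - 1 / (K : ℝ)) := Real.one_le_rpow n1 (by linarith)
      have hF' : ((P.totalCost c.setupCost : ℕ) : ℝ) ≤ (∑ n ∈ Finset.range (g₀ ^ K), F n : ℕ) :=
        Nat.cast_le.2 hF
      refine (hF'.trans (le_mul_of_one_le_right (by positivity) h3)).trans (le_add_of_nonneg_left ?_)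
      exact mul_nonneg (mul_nonneg zero_le_two (Nat.cast_nonneg _)) (zero_le_one.trans h3)
  · set A := P.copy (ofList (n :: rows M))
    have key : ∀ ω, ∀ γ < P.g ^ 3, (P.force ≠ 0 ∨ P.Reliable D A (Consts.vecs v) ω γ) →
        ω ∈ {ω | ∃ res, Session ω State.blank ((c.algorithm D.bound).calls M v) res ∧ OMv.Correct M v res} := by
      intro ω γ hγ hrel; obtain ⟨res, h1, -, h3⟩ := hses ω; refine ⟨res, h1, fun t => ?_⟩
      obtain ⟨r, hr, hp⟩ := h3 t; exact ⟨r, hr, fun i => hp.eq_boolMulVec rfl hγ hrel i⟩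
    by_cases h0 : P.force = 0
    · have hb := hbal n hn h0; have hg : g₀ ≤ P.g := Nat.sub_eq_zero_iff_le.1 h0
      obtain ⟨γ, hγ, hsuit⟩ := hS P rfl (l1.trans hg) rfl rfl rfl rfl rfl
      refine Par.coin_reliable (fun β _ hβ => hsuit A (Consts.vecs v) β hβ) ?_
        fun ω hω => key ω γ hγ (Or.inr hω)
      have h1 : P.NQ * P.n ≤ 8 * P.g ^ (2 * K * 4) :=
        calc P.NQ * P.n ≤ 8 * P.n ^ 3 * P.n := Nat.mul_le_mul_right _ hb.NQ_mul
          _ = 8 * P.n ^ 4 := by ring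
          _ ≤ 8 * (P.g ^ (2 * K)) ^ 4 := by
            refine Nat.mul_le_mul_left _ (Nat.pow_le_pow_left (hlt.le.trans ?_) _)
            rw [pow_mul]; exact Nat.pow_le_pow_left (by have := hb.two; nlinarith) _
          _ = _ := by rw [← pow_mul]
      refine le_trans (mul_le_mul_of_nonneg_right ?_ (Real.exp_pos _).le) (hg₂ P.g (l2.trans hg))
      exact_mod_cast h1
    -- For small orders the exhaustive verification is correct with certainty; any guess will do.
    · rw [Set.eq_univ_of_forall fun ω => key ω 0 (pow_pos P.hg 3) (Or.inl h0), measure_univ]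
      exact ENNReal.div_le_of_le_mul (by norm_num)

end DynSC

theorem mainTheorem6 (hOMv : OMv.Conjecture) (δ : ℝ) (hδ : 0 < δ) (hδ' : δ ≤ 1 / 2)
    (c₁ c₂ : ℝ) (hc₁ : 0 < c₁) (hc : c₁ < c₂) (hfeas : δ = 1 / 2 → c₁ < 1)
    (mode : DynSC.Mode) :
    ¬ ∃ (D : DynSC.DataStructure) (ε : ℝ), 0 < ε ∧ D.Achieves mode δ c₁ c₂ ε := by
  rintro ⟨D, ε, hε, hD⟩; obtain ⟨ε', hε', h⟩ := hD.exists_solvesIn hδ hδ' hc₁ hc hfeas hε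
  exact hOMv ε' hε' h
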